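/- Let $d\ge 2$, $T>0$, $\mathbb T^d=(\mathbb R/2\pi\mathbb Z)^d$ and $e_k(x)=e^{\sqrt{-1}\,k\cdot x}$. Let $\{\chi_n\}_{n\ge -1}$ be smooth functions $\mathbb R^d\to[0,1]$ with $\sum_{n\ge-1}\chi_n=1$, $\chi_n=\chi_0(2^{-n}\cdot)$ for $n\ge 0$, $\chi_{-1}$ supported in $\{|x|\le \frac43\}$ and $\chi_0$ supported in $\{\frac34\le|x|\le\frac83\}$. For $s\in\mathbb R$ and $p,q\in[1,\infty]$, $B^{s}_{p,q}$ is the completion of $C^\infty(\mathbb T^d)$ in $\mathcal S'(\mathbb T^d)$ for the norm $\|f\|_{B^s_{p,q}}=\big\|\big(2^{ns}\|\Delta_nf\|_{L^p(\mathbb T^d)}\big)_{n\ge-1}\big\|_{\ell^q}$, where $\Delta_n f=\sum_k\chi_n(k)\hat f(k)e_k$. Write $C^{-\alpha}=B^{-\alpha}_{\infty,\infty}$ for $\alpha>0$; for $\beta>0$, $C^\beta$ is the space of continuous functions on $\mathbb T^d$ with finite $\|\cdot\|_{B^\beta_{\infty,\infty}}$. Assume $\sigma>0$ and, for some $\beta>d/2$,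 $F\in C^\beta(\mathbb T^d;\mathbb R^d)$; let $K\in L^1(\mathbb T^d;\mathbb R^d)$, and let $\bar\rho\in C([0,T],C^\beta)$, where each $\bar\rho_t$ is a probability density, solve in the weak sense $$\partial_t\bar\rho=\sigma\Delta\bar\rho-\nabla\cdot\big([F+K*\bar\rho]\bar\rho\big).$$ Let $\xi$ be an $\mathbb R^d$-valued space-time white noise on $\mathbb R^+\times\mathbb T^d$ over a probability space $(\Omega,\mathcal F,\mathbb P)$, i.e. a centered Gaussian family indexed by $L^2(\mathbb R^+\times\mathbb T^d;\mathbb R^d)$ whose covariance is the inner product. With $\Gamma$ the heat kernel of $\sigma\Delta$ on $\mathbb T^d$, let $$Z_t=\int_0^t\!\int_{\mathbb T^d}\nabla\Gamma_{t-s}(\cdot-y)\sqrt{\bar\rho_s(y)}\,\xi(ds,dy).$$ Let $\eta_0$ be a random distribution on $\mathbb T^d$ and let $\eta$ be a mild solution with initial condition $\eta_0$ of $$\partial_t\eta=\sigma\Delta\eta-\nabla\cdot(\bar\rho\,K*\eta)-\nabla\cdot(\eta\,K*\bar\rho)-\nabla\cdot(F\eta)-\sqrt{2\sigma}\,\nabla\cdot(\sqrt{\bar\rho}\,\xi).$$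 This means: $\eta$ is a process such that almost surely $\eta\in C([0,T],\mathcal S'(\mathbb T^d))\cap L^2([0,T],B^{-\alpha'}_{p',q'})$ for some $\alpha'<\beta$ and $p',q'\in[1,\infty]$ (not depending on $\omega$), and for all $\varphi\in C^\infty(\mathbb T^d)$ and $t\in[0,T]$, almost surely, $$\langle\eta_t,\varphi\rangle=\langle\Gamma_t*\eta_0,\varphi\rangle-\int_0^t\big\langle\nabla\Gamma_{t-s}*(\bar\rho_s\,K*\eta_s+\eta_s\,K*\bar\rho_s+F\eta_s),\varphi\big\rangle\,ds-\sqrt{2\sigma}\,\langle Z_t,\varphi\rangle .$$ 1. Let $r>2$, $\alpha\in(d/2,\beta)$ and $p,q\in[1,\infty]$. If $\eta_0\in L^r(\Omega,B^{-\alpha}_{p,q})$, then $\eta\in C([0,T],B^{-\alpha}_{p,q})$ almost surely, and $\mathbb E\sup_{t\in[0,T]}\|\eta_t\|^r_{B^{-\alpha}_{p,q}}<\infty$. 2. In particular, if for every $\alpha>d/2$ there is $r>2$ with $\eta_0\in L^r(\Omega,C^{-\alpha})$, then almost surely $\eta\in C([0,T],C^{-\alpha})$ for every $\alpha>d/2$.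 3. This range of $\alpha$ is optimal: almost surely, $\eta\notin C([0,T],B^{-\alpha}_{\infty,\infty})$ for every $\alpha\le d/2$. -/

import Mathlib

open MeasureTheory ProbabilityTheory Filter Topology Set
open scoped ENNReal InnerProductSpace

noncomputable section

namespace FluctuationSPDE

/-! ### The torus `𝕋^d = (ℝ / 2πℤ)^d`

Functions on the torus are functions on `ℝ^d` that are `2π`-periodic in every coordinate;
integrals and `L^p` norms over the torus are taken over the fundamental domain `[0, 2π)^d`. -/

/-- `ℝ^d` with the Euclidean norm. -/
abbrev E (d : ℕ) : Type := EuclideanSpace ℝ (Fin d)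

/-- The frequency `k ∈ ℤ^d`, as a vector of `ℝ^d`. -/
def freq {d : ℕ} (k : Fin d → ℤ) : E d := WithLp.toLp 2 (fun i => (k i : ℝ))

/-- `2π`-periodicity in every coordinate. -/
def Periodic {d : ℕ} {X : Type*} (f : E d → X) : Prop :=
  ∀ (k : Fin d → ℤ) (x : E d), f (x + (2 * Real.pi) • freq k) = f x

/-- The fundamental domain `[0, 2π)^d`. -/
def cube (d : ℕ) : Set (E d) := {x | ∀ i, x i ∈ Ico (0 : ℝ) (2 * Real.pi)}

/-- Lebesgue measure on the torus (total mass `(2π)^d`). -/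
def torusMeasure (d : ℕ) : Measure (E d) := volume.restrict (cube d)

/-- The partial derivative `∂_i f`. -/
def pderiv {d : ℕ} (i : Fin d) (f : E d → ℂ) (x : E d) : ℂ :=
  fderiv ℝ f x (EuclideanSpace.single i (1 : ℝ))

/-- The Fourier basis `e_k(x) = exp(i k·x)`. -/
def fourierE {d : ℕ} (k : Fin d → ℤ) (x : E d) : ℂ :=
  Complex.exp (Complex.I * ((∑ i, (k i : ℝ) * x i : ℝ) : ℂ))

/-- Fourier coefficients, normalised so that `f = ∑ₖ f̂(k) e_k`. -/
def fcoef {d : ℕ} (f : E d → ℂ) (k : Fin d → ℤ) : ℂ :=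
  (((2 * Real.pi) ^ d : ℝ) : ℂ)⁻¹ * ∫ x, f x * fourierE (-k) x ∂(torusMeasure d)

/-! ### Test functions and distributions on the torus -/

/-- `C^∞(𝕋^d)`, complex valued. -/
def TestFun (d : ℕ) : Submodule ℂ (E d → ℂ) where
  carrier := {φ | ContDiff ℝ (⊤ : ℕ∞) φ ∧ Periodic φ}
  add_mem' := by
    rintro f g ⟨hf, hf'⟩ ⟨hg, hg'⟩
    exact ⟨hf.add hg, fun k x => by simp [hf' k x, hg' k x]⟩
  zero_mem' := ⟨contDiff_const, fun _ _ => rfl⟩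
  smul_mem' := by
    rintro c f ⟨hf, hf'⟩
    exact ⟨contDiff_const.smul hf, fun k x => by simp [hf' k x]⟩

theorem fourierE_mem {d : ℕ} (k : Fin d → ℤ) : fourierE k ∈ TestFun d := by
  constructor
  · unfold fourierE
    have h : ∀ i : Fin d, ContDiff ℝ (⊤ : ℕ∞) (fun x : E d => x i) :=
      fun i => (EuclideanSpace.proj (𝕜 := ℝ) i).contDiff
    have h' : ContDiff ℝ (⊤ : ℕ∞) (fun x : E d => ∑ i, (k i : ℝ) * x i) :=
      ContDiff.sum fun i _ => contDiff_const.mul (h i)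
    exact ContDiff.cexp (contDiff_const.mul (Complex.ofRealCLM.contDiff.comp h'))
  · intro m x
    unfold fourierE
    rw [Complex.exp_eq_exp_iff_exists_int]
    refine ⟨∑ i, k i * m i, ?_⟩
    simp only [freq, PiLp.add_apply, PiLp.smul_apply, smul_eq_mul]
    push_cast
    rw [Finset.sum_mul, Finset.mul_sum, Finset.mul_sum, ← Finset.sum_add_distrib]
    refine Finset.sum_congr rfl fun i _ => ?_
    ring

/-- The Fourier basis function as a test function. -/
def fourierTest {d : ℕ} (k : Fin d → ℤ) : TestFun d := ⟨fourierE k, fourierE_mem k⟩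

/-- `𝒮'(𝕋^d)`: linear functionals on `C^∞(𝕋^d)` that are continuous, i.e. dominated by
finitely many of the seminorms `sup_x ‖D^j φ(x)‖`. -/
structure Dist (d : ℕ) where
  toFun : TestFun d →ₗ[ℂ] ℂ
  continuous' : ∃ (C : ℝ) (m : ℕ), ∀ (φ : TestFun d) (M : ℝ),
    (∀ j ≤ m, ∀ x, ‖iteratedFDeriv ℝ j (φ : E d → ℂ) x‖ ≤ M) → ‖toFun φ‖ ≤ C * M

/-- Fourier coefficients of a distribution. -/
def Dist.coef {d : ℕ} (u : Dist d) (k : Fin d → ℤ) : ℂ :=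
  (((2 * Real.pi) ^ d : ℝ) : ℂ)⁻¹ * u.toFun (fourierTest (-k))

/-- The pairing `⟨a, φ⟩ = (2π)^d ∑ₖ a(k) φ̂(-k)` of the distribution with Fourier coefficients `a`
with a test function `φ`. -/
def pairing {d : ℕ} (a : (Fin d → ℤ) → ℂ) (φ : TestFun d) : ℂ :=
  (((2 * Real.pi) ^ d : ℝ) : ℂ) * ∑' k, a k * fcoef (φ : E d → ℂ) (-k)

/-! ### Besov spaces -/

/-- A Littlewood–Paley (dyadic) partition of unity; `chi j` is `χ_{j-1}`, so that `j = 0` is the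
low-frequency block `χ_{-1}`. -/
structure DyadicPartition (d : ℕ) where
  chi : ℕ → E d → ℝ
  smooth : ∀ j, ContDiff ℝ (⊤ : ℕ∞) (chi j)
  mem_Icc : ∀ j x, chi j x ∈ Icc (0 : ℝ) 1
  supp_low : ∀ x, chi 0 x ≠ 0 → ‖x‖ ≤ 4 / 3
  supp_annulus : ∀ x, chi 1 x ≠ 0 → 3 / 4 ≤ ‖x‖ ∧ ‖x‖ ≤ 8 / 3
  scaling : ∀ (n : ℕ) x, chi (n + 1) x = chi 1 (((2 : ℝ) ^ n)⁻¹ • x)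
  sum_one : ∀ x, HasSum (fun j => chi j x) 1

/-- The Littlewood–Paley block of the distribution with Fourier coefficients `a`
(a trigonometric polynomial: the sum has finitely many nonzero terms). -/
def lpBlock {d : ℕ} (χ : DyadicPartition d) (j : ℕ) (a : (Fin d → ℤ) → ℂ) (x : E d) : ℂ :=
  ∑' k, (χ.chi j (freq k) : ℂ) * a k * fourierE k x

/-- The `B^s_{p,q}` norm (possibly `∞`) of the distribution with Fourier coefficients `a`: the
`ℓ^q` norm over `n ≥ -1` of `2^{ns} ‖Δ_n a‖_{L^p(𝕋^d)}`, with `n = j - 1`. -/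
def besovNorm {d : ℕ} (χ : DyadicPartition d) (s : ℝ) (p q : ℝ≥0∞)
    (a : (Fin d → ℤ) → ℂ) : ℝ≥0∞ :=
  eLpNorm (fun j : ℕ => ENNReal.ofReal ((2 : ℝ) ^ (((j : ℝ) - 1) * s)) *
    eLpNorm (lpBlock χ j a) p (torusMeasure d)) q Measure.count

/-- Membership of a distribution in `B^s_{p,q}(𝕋^d)`, the completion of `C^∞(𝕋^d)` with respect to
the Besov norm: `u` is approximated by smooth functions in this norm. -/
def MemBesov {d : ℕ} (χ : DyadicPartition d) (s : ℝ) (p q : ℝ≥0∞) (u : Dist d) : Prop :=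
  ∀ ε : ℝ≥0∞, 0 < ε → ∃ f : TestFun d,
    besovNorm χ s p q (u.coef - fcoef (f : E d → ℂ)) < ε

/-- `u ∈ C([0,T], B^s_{p,q})`. -/
def ContinuousBesov {d : ℕ} (χ : DyadicPartition d) (T s : ℝ) (p q : ℝ≥0∞)
    (u : ℝ → Dist d) : Prop :=
  (∀ t ∈ Icc 0 T, MemBesov χ s p q (u t)) ∧
  ∀ t₀ ∈ Icc 0 T, Tendsto (fun t => besovNorm χ s p q ((u t).coef - (u t₀).coef))
    (𝓝[Icc 0 T] t₀) (𝓝 0)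

/-- `u ∈ L²([0,T], B^s_{p,q})`, for a path that is weakly measurable. -/
def L2Besov {d : ℕ} (χ : DyadicPartition d) (T s : ℝ) (p q : ℝ≥0∞) (u : ℝ → Dist d) : Prop :=
  (∀ᵐ t ∂(volume.restrict (Icc 0 T)), MemBesov χ s p q (u t)) ∧
  ∫⁻ t in Icc 0 T, besovNorm χ s p q (u t).coef ^ (2 : ℝ) < ∞

/-- `f ∈ C^β(𝕋^d)`, `β > 0`: a continuous function with finite `B^β_{∞,∞}` norm (for
`β ∉ ℕ` the usual Hölder space; for `β ∈ ℕ` the Zygmund class, which contains the `β` times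
continuously differentiable functions). -/
def MemHolder {d : ℕ} (χ : DyadicPartition d) (β : ℝ) (f : E d → ℝ) : Prop :=
  Continuous f ∧ Periodic f ∧ besovNorm χ β ∞ ∞ (fcoef fun x => (f x : ℂ)) < ∞

/-- `f ∈ C([0,T], C^β(𝕋^d))`. -/
def ContinuousHolder {d : ℕ} (χ : DyadicPartition d) (T β : ℝ) (f : ℝ → E d → ℝ) : Prop :=
  (∀ t ∈ Icc 0 T, MemHolder χ β (f t)) ∧
  ∀ t₀ ∈ Icc 0 T, Tendsto (fun t => besovNorm χ β ∞ ∞ (fcoef fun x => ((f t x - f t₀ x : ℝ) : ℂ)))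
    (𝓝[Icc 0 T] t₀) (𝓝 0)

/-! ### Products, convolutions, heat semigroup -/

/-- The partial sum `S_N a = ∑_{j ≤ N} Δ_j a`. -/
def lpPartial {d : ℕ} (χ : DyadicPartition d) (N : ℕ) (a : (Fin d → ℤ) → ℂ) (x : E d) : ℂ :=
  ∑ j ∈ Finset.range (N + 1), lpBlock χ j a x

/-- Fourier coefficients of the product of two distributions, `lim_N (S_N a)(S_N b)`. For
`a ∈ C^β`, `b ∈ B^{-α}_{p,q}` with `α < β` this is the continuous extension of the product of smooth
functions. -/
def prodCoef {d : ℕ} (χ : DyadicPartition d) (a b : (Fin d → ℤ) → ℂ) (k : Fin d → ℤ) : ℂ :=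
  limUnder atTop fun N : ℕ => fcoef (fun x => lpPartial χ N a x * lpPartial χ N b x) k

/-- Fourier coefficients of the convolution `f * u` over the torus of an integrable function `f`
with the distribution with Fourier coefficients `a`. -/
def convCoef {d : ℕ} (f : E d → ℂ) (a : (Fin d → ℤ) → ℂ) (k : Fin d → ℤ) : ℂ :=
  (((2 * Real.pi) ^ d : ℝ) : ℂ) * fcoef f k * a k

/-- The vector field `K * f` for a vector field `K` and a function `f` on the torus. -/
def convFun {d : ℕ} (K : E d → E d) (f : E d → ℝ) (x : E d) : E d :=
  WithLp.toLp 2 fun i => ∫ y, K (x - y) i * f y ∂(torusMeasure d)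

/-- The symbol `exp(-σ t |k|²)` of convolution with the heat kernel `Γ_t` of `σΔ`. -/
def heatSymbol {d : ℕ} (σ t : ℝ) (k : Fin d → ℤ) : ℂ :=
  (Real.exp (-(σ * t * ‖freq k‖ ^ 2)) : ℂ)

/-- The heat kernel `Γ_t` of `σΔ` on the torus, `t > 0`. -/
def heatKernel {d : ℕ} (σ t : ℝ) (x : E d) : ℂ :=
  (((2 * Real.pi) ^ d : ℝ) : ℂ)⁻¹ * ∑' k : Fin d → ℤ, heatSymbol σ t k * fourierE k x

/-! ### The mean-field equation -/

/-- `ρ` is a weak solution on `[0,T]` of `∂ₜρ = σΔρ - div([F + K * ρ] ρ)`. -/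
def IsMeanFieldSolution {d : ℕ} (T σ : ℝ) (K F : E d → E d) (ρ : ℝ → E d → ℝ) : Prop :=
  ∀ (φ : TestFun d), ∀ t ∈ Icc 0 T,
    ∫ x, (ρ t x : ℂ) * (φ : E d → ℂ) x ∂(torusMeasure d) =
      ∫ x, (ρ 0 x : ℂ) * (φ : E d → ℂ) x ∂(torusMeasure d) +
      ∫ s in (0 : ℝ)..t, ∫ x, (ρ s x : ℂ) *
        ((σ : ℂ) * ∑ i, pderiv i (pderiv i (φ : E d → ℂ)) x +
          ∑ i, ((F x i + convFun K (ρ s) x i : ℝ) : ℂ) * pderiv i (φ : E d → ℂ) x)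
        ∂(torusMeasure d)

/-- The standing assumption on the limit objects in the case of non-vanishing diffusion, with
parameter `β`: positive diffusion coefficient, `F ∈ C^β`, and `ρ ∈ C([0,T], C^β)` a weak solution of
the mean-field equation consisting of probability densities. -/
structure NonvanishingDiffusion {d : ℕ} (χ : DyadicPartition d) (T σ β : ℝ) (K F : E d → E d)
    (ρ : ℝ → E d → ℝ) : Prop where
  sigma_pos : 0 < σ
  beta_gt : (d : ℝ) / 2 < β
  rho_holder : ContinuousHolder χ T β ρ
  F_holder : ∀ i, MemHolder χ β (fun x => F x i)
  rho_nonneg : ∀ t ∈ Icc 0 T, ∀ x, 0 ≤ ρ t x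
  rho_mass : ∀ t ∈ Icc 0 T, ∫ x, ρ t x ∂(torusMeasure d) = 1
  mean_field : IsMeanFieldSolution T σ K F ρ

/-! ### White noise and the stochastic convolution -/

/-- The measure of `ℝ⁺ × 𝕋^d`. -/
def spaceTime (d : ℕ) : Measure (ℝ × E d) := (volume.restrict (Ici 0)).prod (torusMeasure d)

/-- `L²(ℝ⁺ × 𝕋^d; ℝ^d)`. -/
abbrev NoiseSpace (d : ℕ) : Type := Lp (E d) 2 (spaceTime d)

/-- `ξ` is an `ℝ^d`-valued space-time white noise on `ℝ⁺ × 𝕋^d`: a centered Gaussian family indexed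
by `L²(ℝ⁺ × 𝕋^d; ℝ^d)` whose covariance is the inner product. -/
structure IsWhiteNoise {d : ℕ} {Ω : Type*} [MeasurableSpace Ω] (P : Measure Ω)
    (ξ : NoiseSpace d → Ω → ℝ) : Prop where
  gaussian : IsGaussianProcess ξ P
  centered : ∀ h, ∫ ω, ξ h ω ∂P = 0
  covariance : ∀ h g, ∫ ω, ξ h ω * ξ g ω ∂P = ⟪h, g⟫_ℝ

open Classical in
/-- The stochastic integral `∫∫ g · ξ(ds, dy)` of a deterministic square-integrable `g`. -/
def noiseIntegral {d : ℕ} {Ω : Type*} (ξ : NoiseSpace d → Ω → ℝ) (g : ℝ × E d → E d) (ω : Ω) : ℝ :=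
  if h : MemLp g 2 (spaceTime d) then ξ (h.toLp g) ω else 0

/-- The `i`-th component at `(s, y)` of the integrand of `⟨Z_t, φ⟩`, that is
`1_{s < t} √ρ_s(y) ∫ ∂_iΓ_{t-s}(x - y) φ(x) dx`. -/
def noiseKernel {d : ℕ} (σ : ℝ) (ρ : ℝ → E d → ℝ) (t : ℝ) (φ : TestFun d) (z : ℝ × E d)
    (i : Fin d) : ℂ :=
  (Ico 0 t).indicator (fun s => (Real.sqrt (ρ s z.2) : ℂ) *
    ∫ x, pderiv i (heatKernel σ (t - s)) (x - z.2) * (φ : E d → ℂ) x ∂(torusMeasure d)) z.1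

/-- The random variable `⟨Z_t, φ⟩` for the stochastic convolution
`Z_t = ∫₀ᵗ ∫ ∇Γ_{t-s}(· - y) √ρ_s(y) ξ(ds, dy)`; real and imaginary parts are integrated
separately. -/
def stochConv {d : ℕ} {Ω : Type*} (ξ : NoiseSpace d → Ω → ℝ) (σ : ℝ) (ρ : ℝ → E d → ℝ) (t : ℝ)
    (φ : TestFun d) (ω : Ω) : ℂ :=
  (noiseIntegral ξ (fun z => WithLp.toLp 2 fun i => (noiseKernel σ ρ t φ z i).re) ω : ℂ) +
  Complex.I *
    (noiseIntegral ξ (fun z => WithLp.toLp 2 fun i => (noiseKernel σ ρ t φ z i).im) ω : ℂ)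

/-! ### Mild solutions -/

/-- Fourier coefficients of the `i`-th component of
`ρ_s (K * η) + η (K * ρ_s) + F η`, where `a` are the Fourier coefficients of `η`. -/
def driftCoef {d : ℕ} (χ : DyadicPartition d) (K F : E d → E d) (ρs : E d → ℝ)
    (a : (Fin d → ℤ) → ℂ) (i : Fin d) (k : Fin d → ℤ) : ℂ :=
  prodCoef χ (fcoef fun x => (ρs x : ℂ)) (convCoef (fun x => (K x i : ℂ)) a) k +
  prodCoef χ (fcoef fun x => (convFun K ρs x i : ℂ)) a k +
  prodCoef χ (fcoef fun x => (F x i : ℂ)) a k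

/-- Fourier coefficients of `∇Γ_τ * V = ∑ᵢ ∂ᵢ(Γ_τ * Vᵢ)`. -/
def gradHeatCoef {d : ℕ} (σ τ : ℝ) (V : Fin d → (Fin d → ℤ) → ℂ) (k : Fin d → ℤ) : ℂ :=
  ∑ i, Complex.I * (k i : ℂ) * heatSymbol σ τ k * V i k

/-- `η` is a mild solution on `[0,T]`, driven by `ξ` and with initial condition `η₀`, of
`∂ₜη = σΔη - ∇·(ρ K*η) - ∇·(η K*ρ) - ∇·(F η) - √(2σ) ∇·(√ρ ξ)`. -/
structure IsMildSolution {d : ℕ} {Ω : Type*} [MeasurableSpace Ω] (χ : DyadicPartition d)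
    (P : Measure Ω) (T σ β : ℝ) (K F : E d → E d) (ρ : ℝ → E d → ℝ) (ξ : NoiseSpace d → Ω → ℝ)
    (η₀ : Ω → Dist d) (η : ℝ → Ω → Dist d) : Prop where
  /-- `η` is a process: every `⟨η_t, φ⟩` is a random variable. -/
  measurable : ∀ t ∈ Icc 0 T, ∀ φ, AEMeasurable (fun ω => (η t ω).toFun φ) P
  /-- `η ∈ C([0,T], 𝒮'(𝕋^d))` almost surely. -/
  continuous : ∀ᵐ ω ∂P, ∀ φ, ContinuousOn (fun t => (η t ω).toFun φ) (Icc 0 T)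
  /-- `η ∈ L²([0,T], B^{-α}_{p,q})` almost surely for some `α < β` and `p, q ∈ [1,∞]`. -/
  regular : ∃ (α : ℝ) (p q : ℝ≥0∞), α < β ∧ 1 ≤ p ∧ 1 ≤ q ∧
    ∀ᵐ ω ∂P, L2Besov χ T (-α) p q (fun t => η t ω)
  /-- The mild equation, tested against every `φ`. -/
  mild : ∀ φ : TestFun d, ∀ t ∈ Icc 0 T, ∀ᵐ ω ∂P,
    (η t ω).toFun φ =
      pairing (fun k => heatSymbol σ t k * (η₀ ω).coef k) φ
      - (∫ s in (0 : ℝ)..t,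
          pairing (gradHeatCoef σ (t - s) (driftCoef χ K F (ρ s) (η s ω).coef)) φ)
      - (Real.sqrt (2 * σ) : ℂ) * stochConv ξ σ ρ t φ ω

/-- `u ∈ L^r(Ω, B^s_{p,q})`. -/
def MemLrBesov {d : ℕ} {Ω : Type*} [MeasurableSpace Ω] (χ : DyadicPartition d) (P : Measure Ω)
    (r s : ℝ) (p q : ℝ≥0∞) (u : Ω → Dist d) : Prop :=
  (∀ φ, AEMeasurable (fun ω => (u ω).toFun φ) P) ∧
  (∀ᵐ ω ∂P, MemBesov χ s p q (u ω)) ∧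
  ∫⁻ ω, besovNorm χ s p q (u ω).coef ^ r ∂P < ∞

end FluctuationSPDE

end

/-! Taking Fourier coefficients turns the mild equation into a linear Volterra equation `c = W - L
c`. The free part is `W_t = Γ_t * η₀ - √(2σ) Z_t`, and `L` integrates in time the heat-smoothed
divergence of the drift. Three facts carry the proof: the drift is a perturbation of lower order,
the noise is exactly as rough as spatial white noise, and the norm of a block is continuous in the
coefficients.

Drift. The coefficients `ρ`, `K * ρ` and `F` lie in `C^β`, so multiplying them with a distribution
of regularity `-α`, `0 < α < β`, is a convergent sum over pairs of Littlewood-Paley blocks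
(`exists_prodCoef_bound`). The gradient of the heat kernel has multiplier norm `τ^{-1/2}`.
Interpolating this with a bound that carries two more derivatives gains a factor `2^{-j/2}` on block
`j` at the price of the integrable singularity `τ^{-3/4}` (`exists_gradHeat_drift_bound`). Hence an
exponential weight in time makes `L` a contraction, and the Picard iterates inherit the bound of
`W`. The solution itself is a priori known only in a weak space `L¹([0,T], B^{-a}_{1,∞})`. The
contraction there identifies it with the limit of the iterates, and lower semicontinuity transfers
the bound (`exists_volterra_bound`). Going through the equation once more, block by block, the gain
`2^{-j/2}` dominates the blocks by a fixed sequence whose `ℓ^q` tails vanish. This gives membership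
in the closure of the smooth functions and continuity in time at once (`MildPath.exists_bound`).

Noise. The factor `|k|²` produced by the gradient cancels the smoothing of the heat semigroup, so
the variance of every coefficient of `Z_t` is bounded uniformly in `k`. A block with about `2^{dj}`
frequencies then has size `2^{dj/2}`. Gaussian moments of high order `2m`, Bernstein's inequality
and chaining over dyadic times bound the supremum in time. Their polynomial losses in `2^j` do not
depend on `m`, up to constants, so they become negligible after the `2m`-th root. This leaves any
regularity below `-d/2` (`lintegral_noise_tsum_lt_top`).

Optimality. Suppose the path is continuous in the closure of the smooth functions at regularity
`-d/2`. Then the blocks of `η_T` and of `Γ_T * η_0` are `o(2^{dj/2})` in `L²`, and the drift is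
smoother still, so the same holds for `Z_T` (`MildPath.tendsto_noise`). Consequently the sum of
`|Z_T(k)|²` over a box of side `2^J` is `o(2^{dJ})`. But its mean is at least a multiple of
`2^{dJ}`, since `ρ_s` has mass one, and its variance is at most a constant times its mean, since `ρ`
is bounded. Chebyshev's inequality excludes the decay almost surely
(`ae_not_tendsto_sum_noiseCoef`). -/

noncomputable section

namespace FluctuationSPDE

/-! ### The lattice and its fundamental domains -/

variable {d : ℕ}

/-- The basis `2π e_i` of the lattice of periods. -/
def periodBasis (d : ℕ) : Module.Basis (Fin d) ℝ (E d) :=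
  (EuclideanSpace.basisFun (Fin d) ℝ).toBasis.isUnitSMul (w := fun _ => 2 * Real.pi)
    (fun _ => (by positivity : (2 * Real.pi : ℝ) ≠ 0).isUnit)

/-- The lattice of periods. -/
abbrev periodLattice (d : ℕ) : AddSubgroup (E d) :=
  (Submodule.span ℤ (Set.range (periodBasis d))).toAddSubgroup

theorem periodBasis_apply (i : Fin d) :
    periodBasis d i = (2 * Real.pi) • EuclideanSpace.single i (1 : ℝ) := by
  simp [periodBasis, Module.Basis.isUnitSMul_apply]

theorem exists_freq_of_mem_periodLattice (g : periodLattice d) :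
    ∃ k : Fin d → ℤ, (g : E d) = (2 * Real.pi) • freq k := by
  obtain ⟨g, hg⟩ := g
  rw [Submodule.mem_toAddSubgroup, Submodule.mem_span_range_iff_exists_fun] at hg
  obtain ⟨c, rfl⟩ := hg
  refine ⟨c, ?_⟩
  ext i
  simp [periodBasis_apply, freq, Finset.sum_apply, mul_comm, Pi.single_apply]

theorem fundamentalDomain_eq_cube : ZSpan.fundamentalDomain (periodBasis d) = cube d := by
  have h2 : (0:ℝ) < 2 * Real.pi := by positivity
  ext x
  rw [ZSpan.mem_fundamentalDomain]
  have : ∀ i, (periodBasis d).repr x i = (2 * Real.pi)⁻¹ * x i := by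
    intro i
    simp [periodBasis, Module.Basis.repr_isUnitSMul, Units.smul_def]
  refine forall_congr' fun i => ?_
  rw [this, mem_Ico, mem_Ico]
  constructor
  · rintro ⟨h, h'⟩
    rw [inv_mul_lt_iff₀ h2, mul_one] at h'
    exact ⟨by simpa using (le_inv_mul_iff₀ h2).1 h, h'⟩
  · rintro ⟨h, h'⟩
    rw [inv_mul_lt_iff₀ h2, mul_one]
    exact ⟨by positivity, h'⟩

theorem isAddFundamentalDomain_cube :
    IsAddFundamentalDomain (periodLattice d) (cube d) volume := by
  rw [← fundamentalDomain_eq_cube]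
  exact ZSpan.isAddFundamentalDomain' _ _

instance : Countable (periodLattice d) :=
  inferInstanceAs (Countable (Submodule.span ℤ (Set.range (periodBasis d))))

theorem Periodic.vadd {X : Type*} {f : E d → X} (hf : Periodic f) (g : periodLattice d) (x : E d) :
    f (g +ᵥ x) = f x := by
  obtain ⟨k, hk⟩ := exists_freq_of_mem_periodLattice g
  rw [AddSubgroup.vadd_def, hk, vadd_eq_add, add_comm]
  exact hf k x

/-- A periodic function has the same integral over any two fundamental domains. Translates and
reflections of the cube are again fundamental domains, so the torus integral inherits its
invariances from Lebesgue measure. -/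
theorem isAddFundamentalDomain_translate (a : E d) :
    IsAddFundamentalDomain (periodLattice d) ((fun x => x - a) ⁻¹' cube d) volume := by
  refine isAddFundamentalDomain_cube.preimage_of_equiv
    (measurePreserving_sub_right volume a).quasiMeasurePreserving (e := id) Function.bijective_id ?_
  intro g x
  simp only [AddSubgroup.vadd_def, vadd_eq_add, id]
  abel

theorem isAddFundamentalDomain_reflect (a : E d) :
    IsAddFundamentalDomain (periodLattice d) ((fun x => a - x) ⁻¹' cube d) volume := by
  refine isAddFundamentalDomain_cube.preimage_of_equiv
    (volume.measurePreserving_sub_left a).quasiMeasurePreserving (e := fun g => -g)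
    neg_involutive.bijective ?_
  intro g x
  simp only [AddSubgroup.vadd_def, vadd_eq_add, AddSubgroup.coe_neg]
  abel

theorem measurableSet_cube : MeasurableSet (cube d) := by
  rw [← fundamentalDomain_eq_cube]
  exact ZSpan.fundamentalDomain_measurableSet _

theorem lintegral_torus_translate {f : E d → ℝ≥0∞} (hf : Periodic f) (a : E d) :
    ∫⁻ x, f (x + a) ∂torusMeasure d = ∫⁻ x, f x ∂torusMeasure d := by
  have h := isAddFundamentalDomain_cube.setLIntegral_eq (isAddFundamentalDomain_translate a) f
    (fun g x => hf.vadd g x)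
  rw [torusMeasure, h]
  have := (measurePreserving_add_right (volume : Measure (E d)) a).setLIntegral_comp_preimage_emb
    (measurableEmbedding_addRight a) f ((fun x => x - a) ⁻¹' cube d)
  rw [← this]
  congr 2
  ext x; simp

theorem integral_torus_translate {X : Type*} [NormedAddCommGroup X] [NormedSpace ℝ X]
    {f : E d → X} (hf : Periodic f) (a : E d) :
    ∫ x, f (x + a) ∂torusMeasure d = ∫ x, f x ∂torusMeasure d := by
  have h := isAddFundamentalDomain_cube.setIntegral_eq (isAddFundamentalDomain_translate a)
    (fun g x => hf.vadd g x)
  rw [torusMeasure, h]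
  have := (measurePreserving_add_right (volume : Measure (E d)) a).setIntegral_preimage_emb
    (measurableEmbedding_addRight a) f ((fun x => x - a) ⁻¹' cube d)
  rw [← this]
  congr 2
  ext x; simp

theorem integral_torus_reflect {X : Type*} [NormedAddCommGroup X] [NormedSpace ℝ X]
    {f : E d → X} (hf : Periodic f) (a : E d) :
    ∫ x, f (a - x) ∂torusMeasure d = ∫ x, f x ∂torusMeasure d := by
  have h := isAddFundamentalDomain_cube.setIntegral_eq (isAddFundamentalDomain_reflect a)
    (fun g x => hf.vadd g x)
  rw [torusMeasure, h]
  have := ((volume : Measure (E d)).measurePreserving_sub_left a).setIntegral_preimage_emb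
    ((Homeomorph.subLeft a).measurableEmbedding) f ((fun x => a - x) ⁻¹' cube d)
  rw [← this]
  congr 2
  ext x; simp

theorem volume_cube : volume (cube d) = ENNReal.ofReal ((2 * Real.pi) ^ d) := by
  have := (EuclideanSpace.volume_preserving_symm_measurableEquiv_toLp (Fin d)).measure_preimage_equiv
    (Set.univ.pi fun _ : Fin d => Ico (0:ℝ) (2 * Real.pi))
  have h2 : (MeasurableEquiv.toLp 2 (Fin d → ℝ)).symm ⁻¹'
      (Set.univ.pi fun _ : Fin d => Ico (0:ℝ) (2 * Real.pi)) = cube d := by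
    ext x; simp [cube]
  rw [h2] at this
  rw [this, volume_pi_pi]
  simp only [Real.volume_Ico, sub_zero, Finset.prod_const, Finset.card_univ, Fintype.card_fin]
  rw [ENNReal.ofReal_pow (by positivity)]

theorem torusMeasure_univ : torusMeasure d univ = ENNReal.ofReal ((2 * Real.pi) ^ d) := by
  rw [torusMeasure, Measure.restrict_apply_univ, volume_cube]

instance : IsFiniteMeasure (torusMeasure d) := ⟨by rw [torusMeasure_univ]; exact ENNReal.ofReal_lt_top⟩

/-! ### The Fourier basis -/

theorem fourierE_zero (x : E d) : fourierE (0 : Fin d → ℤ) x = 1 := by simp [fourierE]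

theorem fourierE_add (k l : Fin d → ℤ) (x : E d) :
    fourierE (k + l) x = fourierE k x * fourierE l x := by
  simp only [fourierE, ← Complex.exp_add]
  congr 1
  simp only [Pi.add_apply]
  push_cast
  rw [← mul_add, ← Finset.sum_add_distrib]
  congr 2; ext i; ring

theorem fourierE_add_right (k : Fin d → ℤ) (x y : E d) :
    fourierE k (x + y) = fourierE k x * fourierE k y := by
  simp only [fourierE, ← Complex.exp_add]
  congr 1
  simp only [PiLp.add_apply]
  push_cast
  rw [← mul_add, ← Finset.sum_add_distrib]
  congr 2; ext i; ring

theorem fourierE_neg_right (k : Fin d → ℤ) (x : E d) : fourierE k (-x) = fourierE (-k) x := by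
  simp [fourierE]

theorem norm_fourierE (k : Fin d → ℤ) (x : E d) : ‖fourierE k x‖ = 1 := by
  rw [fourierE, mul_comm, Complex.norm_exp_ofReal_mul_I]

theorem conj_fourierE (k : Fin d → ℤ) (x : E d) :
    (starRingEnd ℂ) (fourierE k x) = fourierE (-k) x := by
  rw [fourierE, fourierE, ← Complex.exp_conj]
  congr 1
  simp

theorem continuous_fourierE (k : Fin d → ℤ) : Continuous (fourierE k : E d → ℂ) :=
  (fourierE_mem k).1.continuous

theorem periodic_fourierE (k : Fin d → ℤ) : Periodic (fourierE k : E d → ℂ) := (fourierE_mem k).2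

theorem fourierE_neg_mul (k : Fin d → ℤ) (x : E d) : fourierE (-k) x * fourierE k x = 1 := by
  rw [← fourierE_add, neg_add_cancel, fourierE_zero]

theorem integrable_torus_of_continuous {X : Type*} [NormedAddCommGroup X] {f : E d → X}
    (hf : Continuous f) : Integrable f (torusMeasure d) := by
  have hb : Bornology.IsBounded (cube d) := by
    rw [← fundamentalDomain_eq_cube]; exact ZSpan.fundamentalDomain_isBounded _
  exact (hf.continuousOn.integrableOn_compact hb.isCompact_closure).mono_set subset_closure

theorem integral_fourierE (k : Fin d → ℤ) :
    ∫ x, fourierE k x ∂torusMeasure d = if k = 0 then (((2 * Real.pi) ^ d : ℝ) : ℂ) else 0 := by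
  split_ifs with h
  · subst h
    simp only [fourierE_zero, integral_const, Measure.real, torusMeasure_univ]
    rw [ENNReal.toReal_ofReal (by positivity)]
    simp
  · obtain ⟨i, hi⟩ : ∃ i, k i ≠ 0 := by
      by_contra hh; push Not at hh; exact h (funext hh)
    -- Translation by `π / k i` in direction `i` multiplies `e_k` by `-1`, so the integral equals
    -- its own opposite.
    have key := integral_torus_translate (periodic_fourierE k)
      (EuclideanSpace.single i (Real.pi / k i))
    simp only [fourierE_add_right] at key
    rw [integral_mul_const] at key
    have h1 : fourierE k (EuclideanSpace.single i (Real.pi / k i)) = -1 := by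
      rw [fourierE, ← Complex.exp_pi_mul_I]
      congr 1
      have : (∑ j, (k j : ℝ) * (EuclideanSpace.single i (Real.pi / (k i : ℝ)) : E d) j) = Real.pi := by
        rw [Finset.sum_eq_single i]
        · simp only [PiLp.single_apply, if_true]
          field_simp
        · intro j _ hj; simp [hj]
        · simp
      rw [this, mul_comm]
    rw [h1] at key
    linear_combination (-1/2 : ℂ) * key

/-! ### Trigonometric polynomials -/

/-- The trigonometric polynomial `∑_{k ∈ S} c_k e_k`. -/
def trig (S : Finset (Fin d → ℤ)) (c : (Fin d → ℤ) → ℂ) (x : E d) : ℂ :=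
  ∑ k ∈ S, c k * fourierE k x

theorem continuous_trig (S : Finset (Fin d → ℤ)) (c : (Fin d → ℤ) → ℂ) : Continuous (trig S c) :=
  continuous_finsetSum _ fun k _ => continuous_const.mul (continuous_fourierE k)

theorem periodic_trig (S : Finset (Fin d → ℤ)) (c : (Fin d → ℤ) → ℂ) : Periodic (trig S c) := by
  intro k x
  exact Finset.sum_congr rfl fun l _ => by rw [periodic_fourierE l k x]

theorem fcoef_fourierE (k l : Fin d → ℤ) :
    fcoef (fourierE k : E d → ℂ) l = if k = l then 1 else 0 := by
  have : (((2 * Real.pi) ^ d : ℝ) : ℂ) ≠ 0 := by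
    exact_mod_cast (by positivity : ((2 * Real.pi) ^ d : ℝ) ≠ 0)
  simp only [fcoef, ← fourierE_add, integral_fourierE, ← sub_eq_add_neg, sub_eq_zero]
  split_ifs <;> simp

theorem integrable_mul_fourierE {f : E d → ℂ} (hf : Integrable f (torusMeasure d))
    (k : Fin d → ℤ) : Integrable (fun x => f x * fourierE k x) (torusMeasure d) :=
  hf.mul_bdd (c := 1) (continuous_fourierE k).aestronglyMeasurable
    (Eventually.of_forall fun x => (norm_fourierE k x).le)

theorem fcoef_sub {f g : E d → ℂ} (hf : Integrable f (torusMeasure d))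
    (hg : Integrable g (torusMeasure d)) (k : Fin d → ℤ) :
    fcoef (fun x => f x - g x) k = fcoef f k - fcoef g k := by
  simp only [fcoef, sub_mul]
  rw [integral_sub (integrable_mul_fourierE hf _) (integrable_mul_fourierE hg _), mul_sub]

theorem fcoef_const_mul (c : ℂ) (f : E d → ℂ) (k : Fin d → ℤ) :
    fcoef (fun x => c * f x) k = c * fcoef f k := by
  simp only [fcoef, mul_assoc, integral_const_mul]
  ring

theorem fcoef_sum {ι : Type*} (S : Finset ι) {f : ι → E d → ℂ}
    (hf : ∀ i ∈ S, Integrable (f i) (torusMeasure d)) (k : Fin d → ℤ) :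
    fcoef (fun x => ∑ i ∈ S, f i x) k = ∑ i ∈ S, fcoef (f i) k := by
  simp only [fcoef, Finset.sum_mul]
  rw [integral_finsetSum _ fun i hi => integrable_mul_fourierE (hf i hi) _, Finset.mul_sum]

theorem fcoef_trig (S : Finset (Fin d → ℤ)) (c : (Fin d → ℤ) → ℂ) (k : Fin d → ℤ) :
    fcoef (trig S c) k = if k ∈ S then c k else 0 := by
  have : trig S c = fun x => ∑ l ∈ S, c l * fourierE l x := rfl
  rw [this, fcoef_sum (f := fun l x => c l * fourierE l x) _ fun l _ =>
    integrable_torus_of_continuous (continuous_const.mul (continuous_fourierE l))]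
  simp only [fcoef_const_mul, fcoef_fourierE, mul_ite, mul_one, mul_zero, Finset.sum_ite_eq']

theorem fcoef_trig_mul_trig (S S' : Finset (Fin d → ℤ)) (c c' : (Fin d → ℤ) → ℂ) (k : Fin d → ℤ) :
    fcoef (fun x => trig S c x * trig S' c' x) k =
      ∑ l ∈ S, ∑ l' ∈ S', if l + l' = k then c l * c' l' else 0 := by
  have : (fun x : E d => trig S c x * trig S' c' x) =
      fun x => ∑ l ∈ S, ∑ l' ∈ S', (c l * c' l') * fourierE (l + l') x := by
    ext x
    simp only [trig, Finset.sum_mul_sum, fourierE_add]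
    exact Finset.sum_congr rfl fun l _ => Finset.sum_congr rfl fun l' _ => by ring
  rw [this, fcoef_sum (f := fun l x => ∑ l' ∈ S', (c l * c' l') * fourierE (l + l') x) _ fun l _ =>
    integrable_torus_of_continuous (continuous_finsetSum _ fun l' _ =>
      continuous_const.mul (continuous_fourierE _))]
  refine Finset.sum_congr rfl fun l _ => ?_
  rw [fcoef_sum (f := fun l' x => (c l * c' l') * fourierE (l + l') x) _ fun l' _ =>
    integrable_torus_of_continuous (continuous_const.mul (continuous_fourierE _))]
  refine Finset.sum_congr rfl fun l' _ => ?_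
  rw [fcoef_const_mul, fcoef_fourierE]
  simp

theorem trig_add (S : Finset (Fin d → ℤ)) (c c' : (Fin d → ℤ) → ℂ) (x : E d) :
    trig S (c + c') x = trig S c x + trig S c' x := by
  simp [trig, add_mul, Finset.sum_add_distrib]

theorem trig_sub (S : Finset (Fin d → ℤ)) (c c' : (Fin d → ℤ) → ℂ) (x : E d) :
    trig S (c - c') x = trig S c x - trig S c' x := by
  simp [trig, sub_mul, Finset.sum_sub_distrib]

theorem norm_trig_le (S : Finset (Fin d → ℤ)) (c : (Fin d → ℤ) → ℂ) (x : E d) :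
    ‖trig S c x‖ ≤ ∑ k ∈ S, ‖c k‖ := by
  refine (norm_sum_le _ _).trans (Finset.sum_le_sum fun k _ => ?_)
  rw [norm_mul, norm_fourierE, mul_one]

theorem parseval_trig (S : Finset (Fin d → ℤ)) (c : (Fin d → ℤ) → ℂ) :
    ∫ x, ‖trig S c x‖ ^ 2 ∂torusMeasure d = (2 * Real.pi) ^ d * ∑ k ∈ S, ‖c k‖ ^ 2 := by
  have h0 : (((2 * Real.pi) ^ d : ℝ) : ℂ) ≠ 0 := by
    exact_mod_cast (by positivity : ((2 * Real.pi) ^ d : ℝ) ≠ 0)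
  have h1 : ∀ x : E d, ((‖trig S c x‖ ^ 2 : ℝ) : ℂ) =
      ∑ k ∈ S, (starRingEnd ℂ) (c k) * (trig S c x * fourierE (-k) x) := by
    intro x
    push_cast
    rw [← Complex.mul_conj']
    conv_lhs => rw [trig.eq_def S c x, map_sum, ← trig.eq_def S c x]
    rw [Finset.mul_sum]
    refine Finset.sum_congr rfl fun k _ => ?_
    rw [map_mul, conj_fourierE]; ring
  have h2 : ((∫ x, ‖trig S c x‖ ^ 2 ∂torusMeasure d : ℝ) : ℂ) =
      ∑ k ∈ S, (starRingEnd ℂ) (c k) * ((((2 * Real.pi) ^ d : ℝ) : ℂ) * fcoef (trig S c) k) := by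
    rw [← integral_complex_ofReal]
    simp_rw [h1]
    rw [integral_finsetSum _ fun k _ => (integrable_mul_fourierE
      (integrable_torus_of_continuous (continuous_trig S c)) _).const_mul _]
    refine Finset.sum_congr rfl fun k _ => ?_
    rw [integral_const_mul, fcoef, mul_inv_cancel_left₀ h0]
  have h3 : ((∫ x, ‖trig S c x‖ ^ 2 ∂torusMeasure d : ℝ) : ℂ) =
      (((2 * Real.pi) ^ d * ∑ k ∈ S, ‖c k‖ ^ 2 : ℝ) : ℂ) := by
    rw [h2, Complex.ofReal_mul, Complex.ofReal_sum, Finset.mul_sum]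
    refine Finset.sum_congr rfl fun k hk => ?_
    rw [fcoef_trig, if_pos hk]
    push_cast
    rw [← Complex.mul_conj']; ring
  exact_mod_cast h3

/-- With `g` the Fourier partial sum over `S`, the cross term of `‖f - g‖²` integrates to the same
sum as `‖g‖²`, so the nonnegative integral of the square is the difference of the two sides. -/
theorem bessel {f : E d → ℂ} (hf : Continuous f) (S : Finset (Fin d → ℤ)) :
    (2 * Real.pi) ^ d * ∑ k ∈ S, ‖fcoef f k‖ ^ 2 ≤ ∫ x, ‖f x‖ ^ 2 ∂torusMeasure d := by
  have h0 : (((2 * Real.pi) ^ d : ℝ) : ℂ) ≠ 0 := by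
    exact_mod_cast (by positivity : ((2 * Real.pi) ^ d : ℝ) ≠ 0)
  set g := trig S (fcoef f) with hg
  have hgc : Continuous g := continuous_trig _ _
  have hpos : 0 ≤ ∫ x, ‖f x - g x‖ ^ 2 ∂torusMeasure d := integral_nonneg fun x => by positivity
  have hexp : ∀ x, ‖f x - g x‖ ^ 2 = ‖f x‖ ^ 2 - 2 * (f x * (starRingEnd ℂ) (g x)).re + ‖g x‖ ^ 2 := by
    intro x
    rw [← Complex.normSq_eq_norm_sq, ← Complex.normSq_eq_norm_sq, ← Complex.normSq_eq_norm_sq,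
      Complex.normSq_sub]; ring
  have hcross : ∫ x, f x * (starRingEnd ℂ) (g x) ∂torusMeasure d =
      (((2 * Real.pi) ^ d * ∑ k ∈ S, ‖fcoef f k‖ ^ 2 : ℝ) : ℂ) := by
    have : ∀ x, f x * (starRingEnd ℂ) (g x) =
        ∑ k ∈ S, (starRingEnd ℂ) (fcoef f k) * (f x * fourierE (-k) x) := by
      intro x
      rw [hg, trig, map_sum, Finset.mul_sum]
      refine Finset.sum_congr rfl fun k _ => ?_
      rw [map_mul, conj_fourierE]; ring
    simp_rw [this]
    rw [integral_finsetSum _ fun k _ => (integrable_mul_fourierE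
      (integrable_torus_of_continuous hf) _).const_mul _, Complex.ofReal_mul, Complex.ofReal_sum,
      Finset.mul_sum]
    refine Finset.sum_congr rfl fun k _ => ?_
    rw [integral_const_mul]
    have : ∫ x, f x * fourierE (-k) x ∂torusMeasure d = (((2 * Real.pi) ^ d : ℝ) : ℂ) * fcoef f k := by
      rw [fcoef, mul_inv_cancel_left₀ h0]
    rw [this]
    push_cast
    rw [← Complex.mul_conj']; ring
  have hci : Continuous fun x => f x * (starRingEnd ℂ) (g x) :=
    hf.mul (Complex.continuous_conj.comp hgc)
  simp_rw [hexp] at hpos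
  rw [integral_add, integral_sub, integral_const_mul] at hpos
  · have hre : ∫ x, (f x * (starRingEnd ℂ) (g x)).re ∂torusMeasure d =
        (2 * Real.pi) ^ d * ∑ k ∈ S, ‖fcoef f k‖ ^ 2 := by
      have := integral_re (integrable_torus_of_continuous hci)
      simp only [RCLike.re_to_complex] at this
      rw [this, hcross, Complex.ofReal_re]
    rw [hre, hg, parseval_trig] at hpos
    linarith
  · exact integrable_torus_of_continuous (hf.norm.pow 2)
  · exact (integrable_torus_of_continuous (Complex.continuous_re.comp hci)).const_mul _
  · exact (integrable_torus_of_continuous (hf.norm.pow 2)).sub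
      ((integrable_torus_of_continuous (Complex.continuous_re.comp hci)).const_mul _)
  · exact integrable_torus_of_continuous (hgc.norm.pow 2)

/-! ### Sup norm and completeness -/

/-- The set where `f` exceeds its essential supremum over the cube is open, invariant under the
lattice and null in a fundamental domain. It is therefore null everywhere, hence empty. -/
theorem enorm_le_eLpNorm_top {f : E d → ℂ} (hf : Continuous f) (hp : Periodic f) (x : E d) :
    ‖f x‖ₑ ≤ eLpNorm f ∞ (torusMeasure d) := by
  by_contra! h
  set M := eLpNorm f ∞ (torusMeasure d)
  set t : Set (E d) := {y | M < ‖f y‖ₑ} with ht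
  have hto : IsOpen t := isOpen_lt continuous_const hf.enorm
  have h0 : volume (t ∩ cube d) = 0 := by
    have := ae_le_eLpNormEssSup (f := f) (μ := torusMeasure d)
    rw [torusMeasure, ae_restrict_iff' measurableSet_cube] at this
    refine measure_mono_null ?_ (ae_iff.1 this)
    intro y hy
    simp only [mem_ofPred_eq, Classical.not_imp, not_le]
    refine ⟨hy.2, ?_⟩
    have := hy.1
    simpa only [ht, mem_ofPred_eq, M, eLpNorm_exponent_top, torusMeasure] using this
  have h1 := isAddFundamentalDomain_cube.measure_zero_of_invariant t (fun g => by
    ext y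
    rw [mem_vadd_set_iff_neg_vadd_mem, ht, mem_ofPred_eq, mem_ofPred_eq, hp.vadd]) h0
  exact (hto.measure_pos volume ⟨x, h⟩).ne' h1

theorem eLpNorm_top_le {f : E d → ℂ} {M : ℝ≥0∞} (hM : ∀ x, ‖f x‖ₑ ≤ M) :
    eLpNorm f ∞ (torusMeasure d) ≤ M := by
  rw [eLpNorm_exponent_top]
  exact essSup_le_of_ae_le _ (Eventually.of_forall hM)

theorem eLpNorm_translate {f : E d → ℂ} (hf : Continuous f) (hp : Periodic f) {p : ℝ≥0∞}
    (hp0 : p ≠ 0) (a : E d) :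
    eLpNorm (fun x => f (x + a)) p (torusMeasure d) = eLpNorm f p (torusMeasure d) := by
  rcases eq_or_ne p ∞ with rfl | hpt
  · have hpa : Periodic fun x => f (x + a) := fun k x => by
      simp only [add_right_comm x _ a, hp k _]
    have hca : Continuous fun x => f (x + a) := hf.comp (continuous_add_const a)
    refine le_antisymm (eLpNorm_top_le fun x => enorm_le_eLpNorm_top hf hp _)
      (eLpNorm_top_le fun x => ?_)
    simpa using enorm_le_eLpNorm_top hca hpa (x - a)
  · rw [eLpNorm_eq_lintegral_rpow_enorm_toReal hp0 hpt, eLpNorm_eq_lintegral_rpow_enorm_toReal hp0 hpt]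
    congr 1
    exact lintegral_torus_translate (f := fun x => ‖f x‖ₑ ^ p.toReal) (fun k x => by
      simp only [hp k x]) a

/-- After rescaling by `2π`, a periodic function descends to the unit torus, where the span of the
characters is dense in the uniform norm. -/
theorem exists_trig_approx {f : E d → ℂ} (hf : Continuous f) (hp : Periodic f) {ε : ℝ} (hε : 0 < ε) :
    ∃ (S : Finset (Fin d → ℤ)) (c : (Fin d → ℤ) → ℂ), ∀ x, ‖f x - trig S c x‖ ≤ ε := by
  set q : (Fin d → ℝ) → UnitAddTorus (Fin d) := fun y i => (y i : UnitAddCircle) with hq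
  have hqo : IsOpenQuotientMap q :=
    IsOpenQuotientMap.piMap (f := fun (_ : Fin d) => ((↑) : ℝ → UnitAddCircle))
      (fun _ => QuotientAddGroup.isOpenQuotientMap_mk)
  set F : (Fin d → ℝ) → ℂ := fun y => f ((2 * Real.pi) • WithLp.toLp 2 y) with hF
  have hFc : Continuous F := hf.comp (by fun_prop)
  have hFq : Function.FactorsThrough F q := by
    intro y y' h
    have : ∀ i, ∃ n : ℤ, y i = y' i + n := by
      intro i
      have := congrFun h i
      simp only [hq] at this
      obtain ⟨n, hn⟩ := AddCircle.coe_eq_zero_iff (1 : ℝ) |>.1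
        (show ((y i - y' i : ℝ) : AddCircle (1 : ℝ)) = 0 by
          rw [AddCircle.coe_sub, sub_eq_zero]; exact this)
      refine ⟨n, ?_⟩
      simp at hn
      linarith
    choose n hn using this
    have h2 : (2 * Real.pi) • WithLp.toLp 2 y = (2 * Real.pi) • WithLp.toLp 2 y' +
        (2 * Real.pi) • (freq n : E d) := by
      rw [← smul_add]
      congr 1
      ext i
      simp [freq, hn]
    simp only [hF]
    rw [h2, hp]
  set G : C(UnitAddTorus (Fin d), ℂ) := Topology.IsQuotientMap.lift (f := ⟨q, hqo.continuous⟩) hqo.isQuotientMap ⟨F, hFc⟩ hFq with hG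
  have hGq : ∀ y, G (q y) = F y := fun y =>
    DFunLike.congr_fun (Topology.IsQuotientMap.lift_comp (f := ⟨q, hqo.continuous⟩)
      hqo.isQuotientMap ⟨F, hFc⟩ hFq) y
  have hmem : G ∈ (Submodule.span ℂ (range (UnitAddTorus.mFourier (d := Fin d)))).topologicalClosure := by
    rw [UnitAddTorus.span_mFourier_closure_eq_top]; trivial
  obtain ⟨P, hP, hdist⟩ := Metric.mem_closure_iff.1
    (show G ∈ closure (Submodule.span ℂ (range (UnitAddTorus.mFourier (d := Fin d))) : Set _) from hmem)
    ε hε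
  obtain ⟨c, rfl⟩ := Finsupp.mem_span_range_iff_exists_finsupp.1 hP
  refine ⟨c.support, c, fun x => ?_⟩
  set y : Fin d → ℝ := fun i => (2 * Real.pi)⁻¹ * x i with hy
  have hx : x = (2 * Real.pi) • WithLp.toLp 2 y := by
    ext i
    simp only [PiLp.smul_apply, smul_eq_mul, hy]
    field_simp
  have h1 : f x = G (q y) := by rw [hGq, hF]; simp only [← hx]
  have h2 : trig c.support c x = (c.sum fun i a => a • UnitAddTorus.mFourier i) (q y) := by
    rw [Finsupp.sum, trig, ContinuousMap.sum_apply]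
    refine Finset.sum_congr rfl fun k _ => ?_
    rw [ContinuousMap.smul_apply, smul_eq_mul]
    congr 1
    simp only [UnitAddTorus.mFourier, ContinuousMap.coe_mk, hq, fourier_coe_apply, fourierE, hy]
    rw [← Complex.exp_sum]
    congr 1
    push_cast
    rw [Finset.mul_sum]
    refine Finset.sum_congr rfl fun i _ => ?_
    have : (Real.pi : ℂ) ≠ 0 := by exact_mod_cast Real.pi_ne_zero
    field_simp
  rw [h1, h2, ← ContinuousMap.sub_apply]
  exact ((ContinuousMap.norm_coe_le_norm _ _).trans (dist_eq_norm G _ ▸ hdist.le))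

/-- A continuous periodic function whose Fourier coefficients vanish is zero. -/
theorem eq_zero_of_fcoef_eq_zero {f : E d → ℂ} (hf : Continuous f) (hp : Periodic f)
    (h : ∀ k, fcoef f k = 0) (x : E d) : f x = 0 := by
  have hfi := integrable_torus_of_continuous hf
  -- Vanishing coefficients make `f` orthogonal to every trigonometric polynomial, so one copy of
  -- `f` in `∫ ‖f‖²` may be replaced by an approximation error of size `ε`.
  have hint : ∀ ε > 0, ∫ x, ‖f x‖ ^ 2 ∂torusMeasure d ≤ ε * ∫ x, ‖f x‖ ∂torusMeasure d := by
    intro ε hε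
    obtain ⟨S, c, hc⟩ := exists_trig_approx hf hp hε
    have h0 : ∫ x, (starRingEnd ℂ) (trig S c x) * f x ∂torusMeasure d = 0 := by
      have : ∀ x, (starRingEnd ℂ) (trig S c x) * f x =
          ∑ k ∈ S, (starRingEnd ℂ) (c k) * (f x * fourierE (-k) x) := by
        intro x
        rw [trig, map_sum, Finset.sum_mul]
        refine Finset.sum_congr rfl fun k _ => ?_
        rw [map_mul, conj_fourierE]; ring
      simp_rw [this]
      rw [integral_finsetSum _ fun k _ => (integrable_mul_fourierE hfi _).const_mul _]
      refine Finset.sum_eq_zero fun k _ => ?_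
      have h0 : (((2 * Real.pi) ^ d : ℝ) : ℂ) ≠ 0 := by
        exact_mod_cast (by positivity : ((2 * Real.pi) ^ d : ℝ) ≠ 0)
      rw [integral_const_mul]
      have := h k
      rw [fcoef, mul_eq_zero] at this
      rw [this.resolve_left (inv_ne_zero h0), mul_zero]
    have hc1 : Continuous fun x => (starRingEnd ℂ) (f x) * f x :=
      (Complex.continuous_conj.comp hf).mul hf
    have hc2 : Continuous fun x => (starRingEnd ℂ) (trig S c x) * f x :=
      (Complex.continuous_conj.comp (continuous_trig S c)).mul hf
    have h1 : ((∫ x, ‖f x‖ ^ 2 ∂torusMeasure d : ℝ) : ℂ) =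
        ∫ x, (starRingEnd ℂ) (f x - trig S c x) * f x ∂torusMeasure d := by
      simp_rw [map_sub, sub_mul]
      rw [integral_sub (integrable_torus_of_continuous hc1) (integrable_torus_of_continuous hc2), h0,
        sub_zero, ← integral_complex_ofReal]
      congr 1
      ext x
      push_cast
      rw [Complex.conj_mul']
    have h2 : ‖((∫ x, ‖f x‖ ^ 2 ∂torusMeasure d : ℝ) : ℂ)‖ ≤ ∫ x, ε * ‖f x‖ ∂torusMeasure d := by
      rw [h1]
      refine norm_integral_le_of_norm_le (hfi.norm.const_mul _) (Eventually.of_forall fun x => ?_)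
      rw [norm_mul, RCLike.norm_conj]
      gcongr
      exact hc x
    rw [Complex.norm_real, integral_const_mul] at h2
    exact (le_abs_self _).trans h2
  have hz : ∫ x, ‖f x‖ ^ 2 ∂torusMeasure d = 0 := by
    refine le_antisymm ?_ (integral_nonneg fun x => by positivity)
    by_contra! hpos
    have hA : 0 ≤ ∫ x, ‖f x‖ ∂torusMeasure d := integral_nonneg fun x => norm_nonneg _
    -- This `ε` makes the right-hand side at most half of `∫ ‖f‖²`.
    have := hint ((∫ x, ‖f x‖ ^ 2 ∂torusMeasure d) / (2 * (1 + ∫ x, ‖f x‖ ∂torusMeasure d)))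
      (div_pos hpos (by linarith))
    rw [div_mul_eq_mul_div, le_div_iff₀ (by linarith)] at this
    nlinarith
  have hae : (fun x => ‖f x‖ ^ 2) =ᵐ[torusMeasure d] 0 :=
    (integral_eq_zero_iff_of_nonneg (fun x => sq_nonneg ‖f x‖)
      (integrable_torus_of_continuous (hf.norm.pow 2))).1 hz
  have h3 : eLpNorm f ∞ (torusMeasure d) = 0 := by
    rw [eLpNorm_eq_zero_iff hf.aestronglyMeasurable (by simp)]
    filter_upwards [hae] with x hx
    simpa using hx
  have := enorm_le_eLpNorm_top hf hp x
  rw [h3] at this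
  simpa using this

end FluctuationSPDE

end

/-! ### Fourier multipliers as averages of translations, uniformly in `L^p` -/

noncomputable section

namespace FluctuationSPDE

variable {d : ℕ}

/-! ### `L^p` norms of trigonometric polynomials and Fourier multipliers -/

theorem memLp_of_continuous {f : E d → ℂ} (hf : Continuous f) (p : ℝ≥0∞) :
    MemLp f p (torusMeasure d) := by
  have hb : Bornology.IsBounded (cube d) := by
    rw [← fundamentalDomain_eq_cube]; exact ZSpan.fundamentalDomain_isBounded _
  obtain ⟨C, hC⟩ := hb.isCompact_closure.exists_bound_of_continuousOn hf.continuousOn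
  refine MemLp.of_bound hf.aestronglyMeasurable C ?_
  rw [torusMeasure, ae_restrict_iff' measurableSet_cube]
  exact Eventually.of_forall fun x hx => hC x (subset_closure hx)

theorem memLp_trig (S : Finset (Fin d → ℤ)) (c : (Fin d → ℤ) → ℂ) (p : ℝ≥0∞) :
    MemLp (trig S c) p (torusMeasure d) :=
  memLp_of_continuous (continuous_trig S c) p

theorem toLp_trig (p : ℝ≥0∞) [Fact (1 ≤ p)] (S : Finset (Fin d → ℤ)) (c : (Fin d → ℤ) → ℂ) :
    (memLp_trig S c p).toLp (trig S c) =
      ∑ k ∈ S, c k • (memLp_of_continuous (continuous_fourierE k) p).toLp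
        (fourierE k) := by
  classical
  induction S using Finset.induction_on with
  | empty =>
    rw [Finset.sum_empty]
    exact MemLp.toLp_zero _
  | insert k S hk ih =>
    rw [Finset.sum_insert hk, ← ih, ← MemLp.toLp_const_smul, ← MemLp.toLp_add]
    congr 1
    ext x
    simp [trig, Finset.sum_insert hk]

/-- Minkowski's integral inequality for trigonometric polynomials. -/
theorem eLpNorm_trig_integral_le {Y : Type*} [MeasurableSpace Y] (ν : Measure Y) {p : ℝ≥0∞}
    (hp : 1 ≤ p) (S : Finset (Fin d → ℤ)) (c : Y → (Fin d → ℤ) → ℂ)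
    (hc : ∀ k ∈ S, Integrable (fun y => c y k) ν) :
    eLpNorm (trig S fun k => ∫ y, c y k ∂ν) p (torusMeasure d) ≤
      ∫⁻ y, eLpNorm (trig S (c y)) p (torusMeasure d) ∂ν := by
  have : Fact (1 ≤ p) := ⟨hp⟩
  -- Only finitely many characters occur, so the integral is a Bochner integral in the Banach space
  -- `L^p` and the inequality is that of the norm of an integral. This covers `p = ∞` as well.
  have key : ∀ a, eLpNorm (trig S a) p (torusMeasure d) = ‖∑ k ∈ S, a k •
      (memLp_of_continuous (continuous_fourierE k) p).toLp (fourierE k)‖ₑ :=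
    fun a => by rw [← toLp_trig, Lp.enorm_toLp]
  simp_rw [key, ← integral_smul_const]
  rw [← integral_finsetSum _ fun k hk => (hc k hk).smul_const _]
  exact enorm_integral_le_lintegral_enorm _

/-- The Fourier multiplier with symbol `m` has norm at most `M` on all `L^p` spaces. -/
def MultBound (m : (Fin d → ℤ) → ℂ) (M : ℝ≥0∞) : Prop :=
  ∀ p : ℝ≥0∞, 1 ≤ p → ∀ (S : Finset (Fin d → ℤ)) (c : (Fin d → ℤ) → ℂ),
    eLpNorm (trig S fun k => m k * c k) p (torusMeasure d) ≤ M * eLpNorm (trig S c) p (torusMeasure d)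

theorem MultBound.mono {m : (Fin d → ℤ) → ℂ} {M M' : ℝ≥0∞} (h : MultBound m M) (hM : M ≤ M') :
    MultBound m M' := fun p hp S c => (h p hp S c).trans (by gcongr)

theorem MultBound.mul {m m' : (Fin d → ℤ) → ℂ} {M M' : ℝ≥0∞} (h : MultBound m M)
    (h' : MultBound m' M') : MultBound (fun k => m k * m' k) (M * M') := fun p hp S c => by
  simp_rw [mul_assoc]
  exact (h p hp S _).trans (by gcongr; exact h' p hp S c)

theorem eLpNorm_trig_add_le {p : ℝ≥0∞} (hp : 1 ≤ p) (S : Finset (Fin d → ℤ))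
    (c c' : (Fin d → ℤ) → ℂ) :
    eLpNorm (trig S fun k => c k + c' k) p (torusMeasure d) ≤
      eLpNorm (trig S c) p (torusMeasure d) + eLpNorm (trig S c') p (torusMeasure d) := by
  have : trig S (fun k => c k + c' k) = trig S c + trig S c' := funext fun x => trig_add S c c' x
  rw [this]
  exact eLpNorm_add_le (memLp_trig S c p).1 (memLp_trig S c' p).1 hp

theorem eLpNorm_trig_sum_le {ι : Type*} {p : ℝ≥0∞} (hp : 1 ≤ p) (S : Finset (Fin d → ℤ))
    (I : Finset ι) (c : ι → (Fin d → ℤ) → ℂ) :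
    eLpNorm (trig S fun k => ∑ i ∈ I, c i k) p (torusMeasure d) ≤
      ∑ i ∈ I, eLpNorm (trig S (c i)) p (torusMeasure d) := by
  have : trig S (fun k => ∑ i ∈ I, c i k) = ∑ i ∈ I, trig S (c i) := by
    ext x
    simp only [trig, Finset.sum_apply, Finset.sum_mul]
    exact Finset.sum_comm
  rw [this]
  exact eLpNorm_sum_le (fun i _ => (memLp_trig S (c i) p).1) hp

theorem eLpNorm_trig_const_mul (p : ℝ≥0∞) (S : Finset (Fin d → ℤ)) (a : ℂ)
    (c : (Fin d → ℤ) → ℂ) :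
    eLpNorm (trig S fun k => a * c k) p (torusMeasure d) =
      ‖a‖ₑ * eLpNorm (trig S c) p (torusMeasure d) := by
  have : trig S (fun k => a * c k) = a • trig S c := by
    ext x; simp [trig, Finset.mul_sum, mul_assoc]
  rw [this, eLpNorm_const_smul]

theorem MultBound.const_mul {m : (Fin d → ℤ) → ℂ} {M : ℝ≥0∞} (h : MultBound m M) (a : ℂ) :
    MultBound (fun k => a * m k) (‖a‖ₑ * M) := fun p hp S c => by
  simp_rw [mul_assoc]
  rw [eLpNorm_trig_const_mul]
  gcongr
  exact h p hp S c

theorem MultBound.sum {ι : Type*} (I : Finset ι) {m : ι → (Fin d → ℤ) → ℂ} {M : ι → ℝ≥0∞}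
    (h : ∀ i ∈ I, MultBound (m i) (M i)) :
    MultBound (fun k => ∑ i ∈ I, m i k) (∑ i ∈ I, M i) := fun p hp S c => by
  simp_rw [Finset.sum_mul]
  exact (eLpNorm_trig_sum_le hp S I _).trans (Finset.sum_le_sum fun i hi => h i hi p hp S c)

/-- Superpositions of translations are Fourier multipliers. -/
theorem multBound_integral {Y : Type*} [MeasurableSpace Y] {ν : Measure Y} {g : Y → ℂ}
    (hg : Integrable g ν) {τ : Y → E d} (hτ : Measurable τ) :
    MultBound (fun k => ∫ y, g y * fourierE k (τ y) ∂ν) (∫⁻ y, ‖g y‖ₑ ∂ν) := fun p hp S c => by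
  have hint : ∀ k, Integrable (fun y => g y * fourierE k (τ y)) ν := fun k =>
    hg.mul_bdd (c := 1) ((continuous_fourierE k).measurable.comp hτ).aestronglyMeasurable
      (Eventually.of_forall fun y => (norm_fourierE k _).le)
  simp_rw [← integral_mul_const]
  refine (eLpNorm_trig_integral_le ν hp S _ fun k _ => (hint k).mul_const _).trans ?_
  rw [← lintegral_mul_const'' _ hg.1.enorm]
  refine lintegral_mono fun y => ?_
  have : trig S (fun k => g y * fourierE k (τ y) * c k) = g y • fun x => trig S c (x + τ y) := by
    ext x
    simp only [trig, Pi.smul_apply, smul_eq_mul, Finset.mul_sum, fourierE_add_right]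
    exact Finset.sum_congr rfl fun k _ => by ring
  rw [this, eLpNorm_const_smul, eLpNorm_translate (continuous_trig S c) (periodic_trig S c)
    (zero_lt_one.trans_le hp).ne']

theorem fourierE_eq_exp_inner (k : Fin d → ℤ) (x : E d) :
    fourierE k x = Complex.exp (Complex.I * ((⟪x, freq k⟫_ℝ : ℝ) : ℂ)) := by
  rw [fourierE, PiLp.inner_apply]
  simp [freq]

/-- By Fourier inversion the multiplier with symbol `f(c k)` averages translations by `2πc y` with
weight `g(y)`, `g` the Fourier transform of `f`. The dilation `c` changes only the translations, so
`‖g‖_{L¹}` bounds all dilates at once; this gives one constant for all dyadic blocks. -/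
theorem exists_multBound_schwartz (f : SchwartzMap (E d) ℂ) :
    ∃ M : NNReal, ∀ c : ℝ, MultBound (fun k => f (c • freq k)) M := by
  set g := FourierTransform.fourier f with hg
  have hgi : Integrable g := g.integrable
  refine ⟨(∫⁻ y, ‖g y‖ₑ).toNNReal, fun c => ?_⟩
  rw [ENNReal.coe_toNNReal hgi.2.ne]
  have h := multBound_integral (d := d) hgi (τ := fun y => (2 * Real.pi * c) • y) (by fun_prop)
  convert h using 2 with k
  have h1 : f = FourierTransformInv.fourierInv g := by
    rw [hg, FourierTransform.fourierInv_fourier_eq]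
  conv_lhs => rw [h1, SchwartzMap.fourierInv_coe, Real.fourierInv_eq']
  congr 1
  ext y
  rw [smul_eq_mul, mul_comm, fourierE_eq_exp_inner, inner_smul_left, inner_smul_right]
  congr 2
  simp only [conj_trivial]
  push_cast
  ring

theorem exists_multBound_smooth {f : E d → ℝ} (hf : ContDiff ℝ (⊤ : ℕ∞) f)
    (hs : HasCompactSupport f) :
    ∃ M : NNReal, ∀ c : ℝ, MultBound (fun k => (f (c • freq k) : ℂ)) M := by
  have h1 : ContDiff ℝ (⊤ : ℕ∞) fun x => (f x : ℂ) := Complex.ofRealCLM.contDiff.comp hf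
  have h2 : HasCompactSupport fun x => (f x : ℂ) := hs.comp_left Complex.ofReal_zero
  exact exists_multBound_schwartz (h2.toSchwartzMap h1)

/-! ### The heat semigroup -/

/-- The heat semigroup is the average of translations by a Gaussian vector of covariance `2s`, hence
a contraction on every `L^p`. -/
theorem integral_stdGaussian_fourierE (s : ℝ) (hs : 0 ≤ s) (k : Fin d → ℤ) :
    ∫ y, fourierE k (Real.sqrt (2 * s) • y) ∂(stdGaussian (E d)) =
      (Real.exp (-(s * ‖freq k‖ ^ 2)) : ℂ) := by
  have := charFun_stdGaussian (Real.sqrt (2 * s) • (freq k : E d))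
  rw [charFun_apply] at this
  rw [norm_smul, Real.norm_of_nonneg (Real.sqrt_nonneg _)] at this
  convert this using 1
  · congr 1
    ext y
    rw [fourierE_eq_exp_inner, inner_smul_left, inner_smul_right, mul_comm]
    simp
  · push_cast
    congr 1
    rw [mul_pow, ← Complex.ofReal_pow (Real.sqrt _), Real.sq_sqrt (by positivity)]
    push_cast
    ring

theorem multBound_heatSymbol {σ t : ℝ} (h : 0 ≤ σ * t) :
    MultBound (heatSymbol σ t : (Fin d → ℤ) → ℂ) 1 := by
  have := multBound_integral (d := d) (ν := stdGaussian (E d)) (g := fun _ => (1 : ℂ))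
    (integrable_const _) (τ := fun y => Real.sqrt (2 * (σ * t)) • y) (by fun_prop)
  simp only [one_mul, integral_stdGaussian_fourierE _ h, enorm_one, lintegral_const, measure_univ,
    mul_one] at this
  exact this

/-- Differentiating the Gaussian characteristic function in direction `i` exhibits the symbol of
`∂_i Γ` as an average of translations with weight `y_i / √(2s)`. Its total mass is of order
`s^{-1/2}`, which is the parabolic smoothing rate. -/
theorem integral_stdGaussian_coord_mul_fourierE (s : ℝ) (hs : 0 < s) (i : Fin d) (k : Fin d → ℤ) :
    ∫ y, ((y i : ℝ) : ℂ) * fourierE k (Real.sqrt (2 * s) • y) ∂(stdGaussian (E d)) =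
      Real.sqrt (2 * s) * (Complex.I * (k i : ℂ) * (Real.exp (-(s * ‖freq k‖ ^ 2)) : ℂ)) := by
  set θ : E d := Real.sqrt (2 * s) • freq k with hθ
  have hm : MemLp id ((1 : ℕ) : ℝ≥0∞) (stdGaussian (E d)) := by
    rw [Nat.cast_one, memLp_one_iff_integrable]
    exact IsGaussian.integrable_id
  have h1 := iteratedFDeriv_charFun (t := θ) hm (fun _ => EuclideanSpace.single i (1 : ℝ))
  rw [iteratedFDeriv_one_apply] at h1
  have h2 : charFun (stdGaussian (E d)) = fun t : E d => Complex.exp (((-(‖t‖ ^ 2) / 2 : ℝ) : ℂ)) := by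
    ext t; rw [charFun_stdGaussian]; push_cast; rfl
  have h3 : HasFDerivAt (fun t : E d => -(‖t‖ ^ 2) / 2)
      (-(innerSL ℝ θ)) θ := by
    have := ((hasStrictFDerivAt_norm_sq θ).hasFDerivAt.neg).const_mul (2⁻¹ : ℝ)
    convert! this using 1
    · ext t; simp only [Pi.neg_apply]; ring
    · ext t; simp
  have h4 : HasFDerivAt (charFun (stdGaussian (E d)))
      (Complex.exp (((-(‖θ‖ ^ 2) / 2 : ℝ) : ℂ)) •
        (Complex.ofRealCLM.comp (-(innerSL ℝ θ)))) θ := by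
    rw [h2]
    exact (Complex.ofRealCLM.hasFDerivAt.comp θ h3).cexp
  rw [h4.fderiv] at h1
  have hθn : -(‖θ‖ ^ 2) / 2 = -(s * ‖(freq k : E d)‖ ^ 2) := by
    rw [hθ, norm_smul, Real.norm_of_nonneg (Real.sqrt_nonneg _), mul_pow,
      Real.sq_sqrt (by positivity)]; ring
  have hθi : θ i = Real.sqrt (2 * s) * k i := by simp [hθ, freq]
  have h5 : ∫ y, ((y i : ℝ) : ℂ) * fourierE k (Real.sqrt (2 * s) • y) ∂(stdGaussian (E d)) =
      ∫ y, ((∏ _j : Fin 1, ⟪y, EuclideanSpace.single i (1 : ℝ)⟫_ℝ : ℝ) : ℂ) *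
        Complex.exp (((⟪y, θ⟫_ℝ : ℝ) : ℂ) * Complex.I) ∂(stdGaussian (E d)) := by
    congr 1
    ext y
    rw [fourierE_eq_exp_inner, hθ, inner_smul_left, inner_smul_right, mul_comm Complex.I]
    simp [EuclideanSpace.inner_single_right]
  rw [h5]
  have h6 : ∀ A B : ℂ, A = Complex.I ^ 1 * B → B = -Complex.I * A := by
    rintro A B rfl
    rw [pow_one, ← mul_assoc, neg_mul, Complex.I_mul_I]; ring
  rw [h6 _ _ h1]
  simp only [smul_apply, ContinuousLinearMap.comp_apply,
    neg_apply, innerSL_apply_apply, EuclideanSpace.inner_single_right,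
    Complex.ofRealCLM_apply, hθn, hθi]
  simp only [conj_trivial, smul_eq_mul, one_mul]
  push_cast
  ring

/-- The symbol of `∂_i Γ`, at diffusion time `s`. -/
def derivHeatSymbol (i : Fin d) (s : ℝ) (k : Fin d → ℤ) : ℂ :=
  Complex.I * (k i : ℂ) * (Real.exp (-(s * ‖freq k‖ ^ 2)) : ℂ)

theorem exists_multBound_derivHeatSymbol (d : ℕ) :
    ∃ C : NNReal, ∀ (i : Fin d) (s : ℝ), 0 < s →
      MultBound (derivHeatSymbol i s) (C * ENNReal.ofReal (s ^ (-(1/2) : ℝ))) := by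
  have hi : Integrable (fun y : E d => y) (stdGaussian (E d)) := IsGaussian.integrable_id
  refine ⟨(∫⁻ y, ‖y‖ₑ ∂(stdGaussian (E d))).toNNReal, fun i s hs => ?_⟩
  rw [ENNReal.coe_toNNReal hi.2.ne]
  have hgi : Integrable (fun y : E d => ((y i : ℝ) : ℂ)) (stdGaussian (E d)) :=
    ((EuclideanSpace.proj (𝕜 := ℝ) i).integrable_comp hi).ofReal
  have h := (multBound_integral (d := d) hgi (τ := fun y => Real.sqrt (2 * s) • y)
    (by fun_prop)).const_mul ((Real.sqrt (2 * s) : ℂ)⁻¹)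
  have hs0 : (0 : ℝ) < Real.sqrt (2 * s) := Real.sqrt_pos.2 (by positivity)
  have hs2 : (Real.sqrt (2 * s) : ℂ) ≠ 0 := by exact_mod_cast hs0.ne'
  simp only [integral_stdGaussian_coord_mul_fourierE s hs i, inv_mul_cancel_left₀ hs2] at h
  refine MultBound.mono h ?_
  rw [mul_comm]
  gcongr with y
  · rw [← ofReal_norm, ← ofReal_norm, Complex.norm_real]
    exact ENNReal.ofReal_le_ofReal (PiLp.norm_apply_le y i)
  · rw [← ofReal_norm]
    refine ENNReal.ofReal_le_ofReal ?_
    rw [norm_inv, Complex.norm_real, Real.norm_of_nonneg hs0.le, Real.rpow_neg hs.le,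
      ← Real.sqrt_eq_rpow]
    gcongr
    linarith

end FluctuationSPDE

end

/-! ### Littlewood–Paley symbols and sequence norms -/

noncomputable section

namespace FluctuationSPDE

variable {d : ℕ}

/-! ### Frequency boxes and Littlewood–Paley blocks -/

/-- The frequencies with all components bounded by `n`. -/
def box (d n : ℕ) : Finset (Fin d → ℤ) := Fintype.piFinset fun _ => Finset.Icc (-(n : ℤ)) n

theorem mem_box {n : ℕ} {k : Fin d → ℤ} : k ∈ box d n ↔ ∀ i, |k i| ≤ n := by
  simp [box, abs_le]

theorem card_box (n : ℕ) : (box d n).card = (2 * n + 1) ^ d := by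
  rw [box, Fintype.card_piFinset]
  simp only [Int.card_Icc, Finset.prod_const, Finset.card_univ, Fintype.card_fin]
  congr 1
  omega

theorem box_mono {m n : ℕ} (h : m ≤ n) : box d m ⊆ box d n := fun k hk => by
  rw [mem_box] at hk ⊢
  exact fun i => (hk i).trans (by exact_mod_cast h)

theorem abs_le_norm_freq (k : Fin d → ℤ) (i : Fin d) : |(k i : ℝ)| ≤ ‖freq k‖ :=
  PiLp.norm_apply_le (freq k) i

theorem mem_box_of_norm_le {n : ℕ} {k : Fin d → ℤ} (h : ‖freq k‖ ≤ n) : k ∈ box d n := by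
  rw [mem_box]
  intro i
  have := (abs_le_norm_freq k i).trans h
  exact_mod_cast this

theorem freq_add (k l : Fin d → ℤ) : freq (k + l) = freq k + freq l := by
  ext i; simp [freq]

theorem trig_subset {S S' : Finset (Fin d → ℤ)} (h : S ⊆ S') {c : (Fin d → ℤ) → ℂ}
    (hc : ∀ k ∈ S', k ∉ S → c k = 0) : trig S' c = trig S c := by
  ext x
  refine (Finset.sum_subset h fun k hk hk' => ?_).symm
  rw [hc k hk hk', zero_mul]

variable (χ : DyadicPartition d)

theorem DyadicPartition.norm_le_of_ne_zero {j : ℕ} {x : E d} (h : χ.chi j x ≠ 0) :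
    ‖x‖ ≤ 4 / 3 * 2 ^ j := by
  rcases j with _ | n
  · simpa using χ.supp_low x h
  · rw [χ.scaling] at h
    have := (χ.supp_annulus _ h).2
    rw [norm_smul, norm_inv, norm_pow, Real.norm_ofNat, inv_mul_le_iff₀ (by positivity)] at this
    rw [pow_succ]; linarith

theorem DyadicPartition.le_norm_of_ne_zero {j : ℕ} {x : E d} (hj : 1 ≤ j) (h : χ.chi j x ≠ 0) :
    3 / 8 * 2 ^ j ≤ ‖x‖ := by
  obtain ⟨n, rfl⟩ := Nat.exists_eq_add_of_le' hj
  rw [χ.scaling] at h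
  have := (χ.supp_annulus _ h).1
  rw [norm_smul, norm_inv, norm_pow, Real.norm_ofNat, le_inv_mul_iff₀ (by positivity)] at this
  rw [pow_succ]; linarith

/-- The symbol of the `j`-th Littlewood–Paley block. -/
def chiSymbol (j : ℕ) (k : Fin d → ℤ) : ℂ := (χ.chi j (freq k) : ℂ)

variable {χ}

theorem norm_freq_le_of_chiSymbol {j : ℕ} {k : Fin d → ℤ} (h : chiSymbol χ j k ≠ 0) :
    ‖freq k‖ ≤ 4 / 3 * 2 ^ j :=
  χ.norm_le_of_ne_zero fun h' => h (by simp [chiSymbol, h'])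

theorem le_norm_freq_of_chiSymbol {j : ℕ} (hj : 1 ≤ j) {k : Fin d → ℤ} (h : chiSymbol χ j k ≠ 0) :
    3 / 8 * 2 ^ j ≤ ‖freq k‖ :=
  χ.le_norm_of_ne_zero hj fun h' => h (by simp [chiSymbol, h'])

theorem norm_chiSymbol_le (j : ℕ) (k : Fin d → ℤ) : ‖chiSymbol χ j k‖ ≤ 1 := by
  rw [chiSymbol, Complex.norm_real, Real.norm_of_nonneg (χ.mem_Icc j _).1]
  exact (χ.mem_Icc j _).2

theorem mem_box_of_norm_freq_le {j : ℕ} {k : Fin d → ℤ} (h : ‖freq k‖ ≤ 4 / 3 * 2 ^ j) :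
    k ∈ box d (2 ^ (j + 1)) := by
  refine mem_box_of_norm_le (h.trans ?_)
  push_cast
  rw [pow_succ]
  have : (0:ℝ) < 2 ^ j := by positivity
  linarith

theorem chiSymbol_eq_zero_of_notMem {j : ℕ} {k : Fin d → ℤ} (h : k ∉ box d (2 ^ (j + 1))) :
    chiSymbol χ j k = 0 := by
  by_contra h'
  exact h (mem_box_of_norm_freq_le (norm_freq_le_of_chiSymbol h'))

theorem lpBlock_eq_trig (j : ℕ) (a : (Fin d → ℤ) → ℂ) :
    lpBlock χ j a = trig (box d (2 ^ (j + 1))) fun k => chiSymbol χ j k * a k := by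
  ext x
  refine tsum_eq_sum fun k hk => ?_
  have := chiSymbol_eq_zero_of_notMem (χ := χ) hk
  rw [chiSymbol] at this
  rw [this]; simp

theorem lpBlock_eq_trig_of_le {j N : ℕ} (h : j ≤ N) (a : (Fin d → ℤ) → ℂ) :
    lpBlock χ j a = trig (box d (2 ^ (N + 1))) fun k => chiSymbol χ j k * a k := by
  rw [lpBlock_eq_trig]
  refine (trig_subset (box_mono (Nat.pow_le_pow_right two_pos (Nat.succ_le_succ h)))
    fun k _ hk => ?_).symm
  rw [chiSymbol_eq_zero_of_notMem hk, zero_mul]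

/-! ### The symbols of the partial sums -/

/-- By scaling, the tail of the partition beyond `N` at `x` is the tail beyond the low block at
`2^{-N} x`. Partial sums are thus dilates of one fixed bump, which gives them a uniform multiplier
bound. -/
theorem DyadicPartition.sum_chi_range (N : ℕ) (x : E d) :
    ∑ j ∈ Finset.range (N + 1), χ.chi j x = χ.chi 0 (((2 : ℝ) ^ N)⁻¹ • x) := by
  have h1 := (hasSum_nat_add_iff' (N + 1)).2 (χ.sum_one x)
  have h2 := (hasSum_nat_add_iff' 1).2 (χ.sum_one (((2 : ℝ) ^ N)⁻¹ • x))
  have h3 : (fun n => χ.chi (n + (N + 1)) x) = fun n => χ.chi (n + 1) (((2 : ℝ) ^ N)⁻¹ • x) := by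
    ext n
    rw [← add_assoc, χ.scaling, χ.scaling n, smul_smul, pow_add, mul_inv]
  rw [h3] at h1
  have := h1.unique h2
  simp only [Finset.range_one, Finset.sum_singleton] at this
  linarith

/-- The symbol of the `N`-th partial sum. -/
def lowSymbol (χ : DyadicPartition d) (N : ℕ) (k : Fin d → ℤ) : ℂ :=
  ∑ j ∈ Finset.range (N + 1), chiSymbol χ j k

theorem lowSymbol_eq (N : ℕ) (k : Fin d → ℤ) :
    lowSymbol χ N k = (χ.chi 0 (((2 : ℝ) ^ N)⁻¹ • freq k) : ℂ) := by
  rw [← DyadicPartition.sum_chi_range, lowSymbol]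
  simp [chiSymbol]

theorem lowSymbol_eq_zero_of_notMem {N : ℕ} {k : Fin d → ℤ} (h : k ∉ box d (2 ^ (N + 1))) :
    lowSymbol χ N k = 0 := by
  refine Finset.sum_eq_zero fun j hj => ?_
  exact chiSymbol_eq_zero_of_notMem fun h' => h (box_mono (Nat.pow_le_pow_right two_pos
    (by have := Finset.mem_range.1 hj; omega)) h')

theorem hasSum_chiSymbol (k : Fin d → ℤ) : HasSum (fun j => chiSymbol χ j k) 1 := by
  have := Complex.hasSum_ofReal.2 (χ.sum_one (freq k))
  rwa [Complex.ofReal_one] at this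

theorem lowSymbol_eq_one {N : ℕ} {k : Fin d → ℤ} (h : ‖freq k‖ < 3 / 8 * 2 ^ (N + 1)) :
    lowSymbol χ N k = 1 := by
  refine (hasSum_sum_of_ne_finset_zero (f := fun j => chiSymbol χ j k) fun j hj => ?_).unique
    (hasSum_chiSymbol k)
  by_contra h'
  have h1 : N + 1 ≤ j := by simpa using hj
  have h2 := le_norm_freq_of_chiSymbol (by omega) h'
  have h3 : (2 : ℝ) ^ (N + 1) ≤ 2 ^ j := pow_le_pow_right₀ (by norm_num) h1
  linarith

theorem lpPartial_eq_trig (N : ℕ) (a : (Fin d → ℤ) → ℂ) :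
    lpPartial χ N a = trig (box d (2 ^ (N + 1))) fun k => lowSymbol χ N k * a k := by
  ext x
  rw [lpPartial, Finset.sum_congr rfl fun j hj => by
    rw [lpBlock_eq_trig_of_le (N := N) (by have := Finset.mem_range.1 hj; omega)]]
  simp only [trig, lowSymbol, Finset.sum_mul]
  exact Finset.sum_comm

variable (χ) in
theorem hasCompactSupport_chi_zero : HasCompactSupport (χ.chi 0) :=
  HasCompactSupport.of_support_subset_isCompact (isCompact_closedBall (0 : E d) (4 / 3)) fun x hx =>
    mem_closedBall_zero_iff.2 (χ.supp_low x hx)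

variable (χ) in
theorem hasCompactSupport_chi_one : HasCompactSupport (χ.chi 1) :=
  HasCompactSupport.of_support_subset_isCompact (isCompact_closedBall (0 : E d) (8 / 3)) fun x hx =>
    mem_closedBall_zero_iff.2 (χ.supp_annulus x hx).2

variable (χ) in
theorem exists_multBound_chi :
    ∃ M : NNReal, (∀ j, MultBound (chiSymbol χ j) M) ∧ ∀ N, MultBound (lowSymbol χ N) M := by
  obtain ⟨M₀, h₀⟩ := exists_multBound_smooth (χ.smooth 0) (hasCompactSupport_chi_zero χ)
  obtain ⟨M₁, h₁⟩ := exists_multBound_smooth (χ.smooth 1) (hasCompactSupport_chi_one χ)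
  refine ⟨M₀ + M₁, ?_, ?_⟩
  · rintro (_ | n)
    · refine MultBound.mono (M := M₀) ?_ (by simp)
      have := h₀ 1
      simp only [one_smul] at this
      exact this
    · refine MultBound.mono (M := M₁) ?_ (by simp)
      have := h₁ (((2 : ℝ) ^ n)⁻¹)
      simp only [← χ.scaling] at this
      exact this
  · intro N
    refine MultBound.mono (M := M₀) ?_ (by simp)
    have := h₀ (((2 : ℝ) ^ N)⁻¹)
    simp only [← lowSymbol_eq] at this
    exact this

/-- The function `χ₀ / |·|²`. -/
def invLaplacianBump (χ : DyadicPartition d) (x : E d) : ℝ := χ.chi 1 x * (‖x‖ ^ 2)⁻¹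

theorem contDiff_invLaplacianBump : ContDiff ℝ (⊤ : ℕ∞) (invLaplacianBump χ) := by
  rw [contDiff_iff_contDiffAt]
  intro x
  by_cases hx : x = 0
  · subst hx
    have : invLaplacianBump χ =ᶠ[𝓝 0] fun _ => 0 := by
      filter_upwards [Metric.ball_mem_nhds (0 : E d) (ε := 3 / 4) (by norm_num)] with y hy
      have : χ.chi 1 y = 0 := by
        by_contra h
        have := (χ.supp_annulus y h).1
        rw [mem_ball_zero_iff] at hy
        linarith
      simp [invLaplacianBump, this]
    exact contDiffAt_const.congr_of_eventuallyEq this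
  · exact (χ.smooth 1).contDiffAt.mul
      ((contDiff_norm_sq ℝ).contDiffAt.inv (by positivity))

theorem hasCompactSupport_invLaplacianBump : HasCompactSupport (invLaplacianBump χ) :=
  (hasCompactSupport_chi_one χ).mul_right

/-- The symbol `2^{-2n} χ_{n+1}(k) / |k|²` (up to scaling). -/
def invLaplacianSymbol (χ : DyadicPartition d) (n : ℕ) (k : Fin d → ℤ) : ℂ :=
  (invLaplacianBump χ (((2 : ℝ) ^ n)⁻¹ • freq k) : ℂ)

/-- On an annulus `χ` is `2^{-2n} |k|²` times another uniformly bounded multiplier. The factor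
`|k|²` will be absorbed by the heat kernel, and `2^{-2n}` is the gain of two derivatives. -/
theorem chiSymbol_succ_eq (n : ℕ) (k : Fin d → ℤ) :
    chiSymbol χ (n + 1) k =
      ((((2 : ℝ) ^ n)⁻¹ ^ 2 : ℝ) : ℂ) * ((‖freq k‖ ^ 2 : ℝ) : ℂ) * invLaplacianSymbol χ n k := by
  rw [chiSymbol, invLaplacianSymbol, invLaplacianBump, χ.scaling]
  by_cases h : χ.chi 1 (((2 : ℝ) ^ n)⁻¹ • freq k) = 0
  · simp [h]
  · have h1 := (χ.supp_annulus _ h).1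
    rw [norm_smul, norm_inv, norm_pow, Real.norm_ofNat] at h1 ⊢
    have h2 : ‖freq k‖ ≠ 0 := by
      intro h0; rw [h0] at h1; norm_num at h1
    rw [← Complex.ofReal_mul, ← Complex.ofReal_mul]
    congr 1
    field_simp

theorem invLaplacianSymbol_ne_zero {n : ℕ} {k : Fin d → ℤ} (h : invLaplacianSymbol χ n k ≠ 0) :
    ‖freq k‖ ≤ 4 / 3 * 2 ^ (n + 1) := by
  refine χ.norm_le_of_ne_zero (j := n + 1) fun h' => h ?_
  rw [χ.scaling] at h'
  simp [invLaplacianSymbol, invLaplacianBump, h']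

variable (χ) in
theorem exists_multBound_invLaplacian :
    ∃ M : NNReal, ∀ n, MultBound (invLaplacianSymbol χ n) M := by
  obtain ⟨M, h⟩ := exists_multBound_smooth (contDiff_invLaplacianBump (χ := χ))
    hasCompactSupport_invLaplacianBump
  exact ⟨M, fun n => h _⟩

/-! ### Sequence norms -/

theorem eLpNorm_count_top (f : ℕ → ℝ≥0∞) : eLpNorm f ∞ Measure.count = ⨆ j, f j := by
  rw [eLpNorm_exponent_top, eLpNormEssSup]
  simp only [enorm_eq_self]
  refine le_antisymm (essSup_le_of_ae_le _ (Eventually.of_forall fun j => le_iSup f j)) ?_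
  refine iSup_le fun j => ?_
  have := ENNReal.ae_le_essSup (μ := Measure.count) f
  rw [Measure.ae_count_iff] at this
  exact this j

theorem eLpNorm_count_rpow {q : ℝ≥0∞} (hq : q ≠ 0) (hq' : q ≠ ∞) (f : ℕ → ℝ≥0∞) :
    eLpNorm f q Measure.count = (∑' j, f j ^ q.toReal) ^ (1 / q.toReal) := by
  rw [eLpNorm_eq_lintegral_rpow_enorm_toReal hq hq', lintegral_count]
  simp

theorem le_eLpNorm_count {q : ℝ≥0∞} (hq : q ≠ 0) (f : ℕ → ℝ≥0∞) (j : ℕ) :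
    f j ≤ eLpNorm f q Measure.count := by
  rcases eq_or_ne q ∞ with rfl | hq'
  · rw [eLpNorm_count_top]; exact le_iSup f j
  · have h0 : 0 < q.toReal := ENNReal.toReal_pos hq hq'
    rw [eLpNorm_count_rpow hq hq']
    calc f j = (f j ^ q.toReal) ^ (1 / q.toReal) := by
          rw [← ENNReal.rpow_mul, mul_one_div_cancel h0.ne', ENNReal.rpow_one]
      _ ≤ _ := ENNReal.rpow_le_rpow (ENNReal.le_tsum j) (by positivity)

theorem eLpNorm_count_le_tsum {q : ℝ≥0∞} (hq : 1 ≤ q) (f : ℕ → ℝ≥0∞) :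
    eLpNorm f q Measure.count ≤ ∑' j, f j := by
  rcases eq_or_ne q ∞ with rfl | hq'
  · rw [eLpNorm_count_top]; exact iSup_le fun j => ENNReal.le_tsum j
  · have hq0 : q ≠ 0 := (zero_lt_one.trans_le hq).ne'
    have h1 : 1 ≤ q.toReal := by
      rw [← ENNReal.toReal_one]; exact ENNReal.toReal_mono hq' hq
    rw [eLpNorm_count_rpow hq0 hq']
    set A := ∑' j, f j with hA
    -- One factor is kept and the remaining power is bounded by the whole sum, which gives the
    -- embedding of `ℓ¹` into `ℓ^q`.
    have h2 : ∀ j, f j ^ q.toReal ≤ f j * A ^ (q.toReal - 1) := by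
      intro j
      rcases eq_or_ne (f j) 0 with h | h
      · rw [h, ENNReal.zero_rpow_of_pos (by linarith)]; simp
      · calc f j ^ q.toReal = f j ^ (1 + (q.toReal - 1)) := by ring_nf
          _ = f j * f j ^ (q.toReal - 1) := by
            rw [ENNReal.rpow_add_of_nonneg _ _ zero_le_one (by linarith), ENNReal.rpow_one]
          _ ≤ _ := by
            exact mul_le_mul_right (ENNReal.rpow_le_rpow (ENNReal.le_tsum j) (sub_nonneg.2 h1)) _
    calc (∑' j, f j ^ q.toReal) ^ (1 / q.toReal)
        ≤ (∑' j, f j * A ^ (q.toReal - 1)) ^ (1 / q.toReal) :=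
          ENNReal.rpow_le_rpow (ENNReal.tsum_le_tsum h2) (by positivity)
      _ = (A ^ q.toReal) ^ (1 / q.toReal) := by
          rw [ENNReal.tsum_mul_right, ← hA]
          congr 1
          nth_rewrite 1 [← ENNReal.rpow_one A]
          rw [← ENNReal.rpow_add_of_nonneg _ _ zero_le_one (by linarith)]
          ring_nf
      _ = A := by
          rw [← ENNReal.rpow_mul, mul_one_div_cancel (by linarith), ENNReal.rpow_one]

theorem eLpNorm_count_mono {q : ℝ≥0∞} {f g : ℕ → ℝ≥0∞} (h : ∀ j, f j ≤ g j) :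
    eLpNorm f q Measure.count ≤ eLpNorm g q Measure.count :=
  eLpNorm_mono_enorm fun j => by simpa using h j

theorem eLpNorm_count_add_le {q : ℝ≥0∞} (hq : 1 ≤ q) (f g : ℕ → ℝ≥0∞) :
    eLpNorm (fun j => f j + g j) q Measure.count ≤
      eLpNorm f q Measure.count + eLpNorm g q Measure.count :=
  eLpNorm_add_le (Measurable.of_discrete.aestronglyMeasurable)
    (Measurable.of_discrete.aestronglyMeasurable) hq

theorem eLpNorm_count_const_mul {q : ℝ≥0∞} (hq : 1 ≤ q) (a : ℝ≥0∞) (f : ℕ → ℝ≥0∞) :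
    eLpNorm (fun j => a * f j) q Measure.count = a * eLpNorm f q Measure.count := by
  rcases eq_or_ne q ∞ with rfl | hq'
  · rw [eLpNorm_count_top, eLpNorm_count_top, ENNReal.mul_iSup]
  · have hq0 : q ≠ 0 := (zero_lt_one.trans_le hq).ne'
    have h0 : 0 < q.toReal := ENNReal.toReal_pos hq0 hq'
    rw [eLpNorm_count_rpow hq0 hq', eLpNorm_count_rpow hq0 hq']
    simp_rw [ENNReal.mul_rpow_of_nonneg _ _ h0.le]
    rw [ENNReal.tsum_mul_left, ENNReal.mul_rpow_of_nonneg _ _ (by positivity), ← ENNReal.rpow_mul,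
      mul_one_div_cancel h0.ne', ENNReal.rpow_one]

/-- The `ℓ^q` norms of the tails of `c` vanish. -/
def TailVanish (q : ℝ≥0∞) (c : ℕ → ℝ≥0∞) : Prop :=
  Tendsto (fun N => eLpNorm (fun j => if N ≤ j then c j else 0) q Measure.count) atTop (𝓝 0)

theorem TailVanish.mono {q : ℝ≥0∞} {c c' : ℕ → ℝ≥0∞} (h : TailVanish q c') (hc : ∀ j, c j ≤ c' j) :
    TailVanish q c :=
  tendsto_of_tendsto_of_tendsto_of_le_of_le tendsto_const_nhds h (fun _ => zero_le)
    fun N => eLpNorm_count_mono fun j => by split_ifs; exacts [hc j, le_rfl]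

theorem TailVanish.add {q : ℝ≥0∞} (hq : 1 ≤ q) {c c' : ℕ → ℝ≥0∞} (h : TailVanish q c)
    (h' : TailVanish q c') : TailVanish q fun j => c j + c' j := by
  have := Tendsto.add h h'
  rw [add_zero] at this
  refine tendsto_of_tendsto_of_tendsto_of_le_of_le tendsto_const_nhds this (fun _ => zero_le)
    fun N => ?_
  refine le_trans (le_of_eq ?_) (eLpNorm_count_add_le hq _ _)
  congr 1; ext j; split_ifs <;> simp

theorem TailVanish.const_mul {q : ℝ≥0∞} (hq : 1 ≤ q) {c : ℕ → ℝ≥0∞} (h : TailVanish q c)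
    {a : ℝ≥0∞} (ha : a ≠ ∞) : TailVanish q fun j => a * c j := by
  have := ENNReal.Tendsto.const_mul h (Or.inr ha)
  rw [mul_zero] at this
  refine this.congr fun N => ?_
  rw [← eLpNorm_count_const_mul hq]
  congr 1; ext j; split_ifs <;> simp

theorem tailVanish_of_tsum {q : ℝ≥0∞} (hq : 1 ≤ q) {c : ℕ → ℝ≥0∞} (h : ∑' j, c j ≠ ∞) :
    TailVanish q c := by
  refine tendsto_of_tendsto_of_tendsto_of_le_of_le tendsto_const_nhds
    (ENNReal.tendsto_sum_nat_add c h) (fun _ => zero_le) fun N => ?_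
  refine (eLpNorm_count_le_tsum hq _).trans ?_
  have hs : ∑' j, (if N ≤ j then c j else 0) = ∑ j ∈ Finset.range N, (if N ≤ j then c j else 0) +
      ∑' j, (if N ≤ j + N then c (j + N) else 0) :=
    (Summable.sum_add_tsum_nat_add' ENNReal.summable).symm
  rw [hs, Finset.sum_eq_zero fun j hj => if_neg (by simpa using hj), zero_add]
  simp

end FluctuationSPDE

end

/-! ### Besov norms, the closure of the smooth functions and continuity in time -/

noncomputable section

namespace FluctuationSPDE

variable {d : ℕ} {χ : DyadicPartition d}

/-! ### Besov norms -/

/-- The `L^p` norm of the `j`-th block. -/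
def blockNorm (χ : DyadicPartition d) (p : ℝ≥0∞) (j : ℕ) (a : (Fin d → ℤ) → ℂ) : ℝ≥0∞ :=
  eLpNorm (lpBlock χ j a) p (torusMeasure d)

/-- The weight `2^{(j-1)s}`. -/
def weight (s : ℝ) (j : ℕ) : ℝ≥0∞ := ENNReal.ofReal ((2 : ℝ) ^ (((j : ℝ) - 1) * s))

theorem besovNorm_eq (s : ℝ) (p q : ℝ≥0∞) (a : (Fin d → ℤ) → ℂ) :
    besovNorm χ s p q a = eLpNorm (fun j => weight s j * blockNorm χ p j a) q Measure.count := rfl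

theorem weight_ne_top (s : ℝ) (j : ℕ) : weight s j ≠ ∞ := ENNReal.ofReal_ne_top

theorem weight_mul_weight_neg (s : ℝ) (j : ℕ) : weight s j * weight (-s) j = 1 := by
  rw [weight, weight, ← ENNReal.ofReal_mul (by positivity), ← Real.rpow_add two_pos]
  simp

theorem weight_mul_blockNorm_le {q : ℝ≥0∞} (hq : q ≠ 0) (s : ℝ) (p : ℝ≥0∞) (j : ℕ)
    (a : (Fin d → ℤ) → ℂ) : weight s j * blockNorm χ p j a ≤ besovNorm χ s p q a :=
  le_eLpNorm_count hq (fun j => weight s j * blockNorm χ p j a) j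

theorem blockNorm_le {q : ℝ≥0∞} (hq : q ≠ 0) (s : ℝ) (p : ℝ≥0∞) (j : ℕ)
    (a : (Fin d → ℤ) → ℂ) : blockNorm χ p j a ≤ weight (-s) j * besovNorm χ s p q a := by
  calc blockNorm χ p j a = weight (-s) j * (weight s j * blockNorm χ p j a) := by
        rw [← mul_assoc, mul_comm (weight (-s) j), weight_mul_weight_neg, one_mul]
    _ ≤ _ := by gcongr; exact weight_mul_blockNorm_le hq s p j a

theorem besovNorm_top_le {s : ℝ} {p : ℝ≥0∞} {a : (Fin d → ℤ) → ℂ} {B : ℝ≥0∞}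
    (h : ∀ j, weight s j * blockNorm χ p j a ≤ B) : besovNorm χ s p ∞ a ≤ B := by
  rw [besovNorm_eq, eLpNorm_count_top]
  exact iSup_le h

theorem blockNorm_eq (p : ℝ≥0∞) (j : ℕ) (a : (Fin d → ℤ) → ℂ) : blockNorm χ p j a =
    eLpNorm (trig (box d (2 ^ (j + 1))) fun k => chiSymbol χ j k * a k) p (torusMeasure d) := by
  rw [blockNorm, lpBlock_eq_trig]

theorem continuous_lpBlock (j : ℕ) (a : (Fin d → ℤ) → ℂ) : Continuous (lpBlock χ j a) := by
  rw [lpBlock_eq_trig]; exact continuous_trig _ _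

theorem periodic_lpBlock (j : ℕ) (a : (Fin d → ℤ) → ℂ) : Periodic (lpBlock χ j a) := by
  rw [lpBlock_eq_trig]; exact periodic_trig _ _

theorem blockNorm_add_le {p : ℝ≥0∞} (hp : 1 ≤ p) (j : ℕ) (a b : (Fin d → ℤ) → ℂ) :
    blockNorm χ p j (a + b) ≤ blockNorm χ p j a + blockNorm χ p j b := by
  simp only [blockNorm_eq, Pi.add_apply, mul_add]
  exact eLpNorm_trig_add_le hp _ _ _

theorem blockNorm_const_mul (p : ℝ≥0∞) (j : ℕ) (z : ℂ) (a : (Fin d → ℤ) → ℂ) :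
    blockNorm χ p j (fun k => z * a k) = ‖z‖ₑ * blockNorm χ p j a := by
  simp only [blockNorm_eq, mul_left_comm _ z]
  exact eLpNorm_trig_const_mul p _ z _

theorem blockNorm_neg (p : ℝ≥0∞) (j : ℕ) (a : (Fin d → ℤ) → ℂ) :
    blockNorm χ p j (-a) = blockNorm χ p j a := by
  have : -a = fun k => (-1 : ℂ) * a k := by ext k; simp
  rw [this, blockNorm_const_mul]; simp

theorem blockNorm_sub_le {p : ℝ≥0∞} (hp : 1 ≤ p) (j : ℕ) (a b : (Fin d → ℤ) → ℂ) :
    blockNorm χ p j (a - b) ≤ blockNorm χ p j a + blockNorm χ p j b := by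
  rw [sub_eq_add_neg, ← blockNorm_neg p j b]
  exact blockNorm_add_le hp j a (-b)

theorem MultBound.blockNorm_le {m : (Fin d → ℤ) → ℂ} {M : ℝ≥0∞} (h : MultBound m M) {p : ℝ≥0∞}
    (hp : 1 ≤ p) (j : ℕ) (a : (Fin d → ℤ) → ℂ) :
    blockNorm χ p j (fun k => m k * a k) ≤ M * blockNorm χ p j a := by
  simp only [blockNorm_eq, mul_left_comm _ (m _)]
  exact h p hp _ _

theorem besovNorm_add_le {p q : ℝ≥0∞} (hp : 1 ≤ p) (hq : 1 ≤ q) (s : ℝ) (a b : (Fin d → ℤ) → ℂ) :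
    besovNorm χ s p q (a + b) ≤ besovNorm χ s p q a + besovNorm χ s p q b := by
  refine le_trans (eLpNorm_count_mono fun j => ?_) (eLpNorm_count_add_le hq _ _)
  rw [← mul_add]
  exact mul_le_mul_right (blockNorm_add_le hp j a b) _

theorem besovNorm_neg (s : ℝ) (p q : ℝ≥0∞) (a : (Fin d → ℤ) → ℂ) :
    besovNorm χ s p q (-a) = besovNorm χ s p q a := by
  simp only [besovNorm_eq, blockNorm_neg]

theorem besovNorm_sub_le {p q : ℝ≥0∞} (hp : 1 ≤ p) (hq : 1 ≤ q) (s : ℝ) (a b : (Fin d → ℤ) → ℂ) :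
    besovNorm χ s p q (a - b) ≤ besovNorm χ s p q a + besovNorm χ s p q b := by
  rw [sub_eq_add_neg, ← besovNorm_neg s p q b]
  exact besovNorm_add_le hp hq s a (-b)

theorem eLpNorm_le_of_bound {f : E d → ℂ} {C : ℝ} (hC : ∀ x, ‖f x‖ ≤ C) (p : ℝ≥0∞) :
    eLpNorm f p (torusMeasure d) ≤ torusMeasure d univ ^ p.toReal⁻¹ * ENNReal.ofReal C :=
  eLpNorm_le_of_ae_bound (Eventually.of_forall hC)

theorem torusVol_rpow_ne_top (d : ℕ) (r : ℝ) : torusMeasure d univ ^ r ≠ ∞ := by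
  refine ENNReal.rpow_ne_top_of_ne_zero ?_ (measure_ne_top _ _)
  rw [torusMeasure_univ, Ne, ENNReal.ofReal_eq_zero, not_le]; positivity

theorem blockNorm_le_sum (p : ℝ≥0∞) (j : ℕ) (a : (Fin d → ℤ) → ℂ) :
    blockNorm χ p j a ≤ torusMeasure d univ ^ p.toReal⁻¹ *
      ENNReal.ofReal (∑ k ∈ box d (2 ^ (j + 1)), ‖a k‖) := by
  rw [blockNorm_eq]
  refine eLpNorm_le_of_bound (fun x => (norm_trig_le _ _ x).trans ?_) p
  refine Finset.sum_le_sum fun k _ => ?_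
  rw [norm_mul]
  exact mul_le_of_le_one_left (norm_nonneg _) (norm_chiSymbol_le j k)

theorem blockNorm_ne_top (p : ℝ≥0∞) (j : ℕ) (a : (Fin d → ℤ) → ℂ) : blockNorm χ p j a ≠ ∞ :=
  ne_top_of_le_ne_top (ENNReal.mul_ne_top (torusVol_rpow_ne_top d _) ENNReal.ofReal_ne_top)
    (blockNorm_le_sum p j a)

/-- A block involves finitely many frequencies, so convergence of each coefficient already gives
convergence of the block in every `L^p`. -/
theorem tendsto_blockNorm {ι : Type*} {l : Filter ι} {u : ι → (Fin d → ℤ) → ℂ}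
    {v : (Fin d → ℤ) → ℂ} (h : ∀ k, Tendsto (fun t => u t k) l (𝓝 (v k))) (p : ℝ≥0∞) (j : ℕ) :
    Tendsto (fun t => blockNorm χ p j (u t - v)) l (𝓝 0) := by
  have h1 : Tendsto (fun t => torusMeasure d univ ^ p.toReal⁻¹ *
      ENNReal.ofReal (∑ k ∈ box d (2 ^ (j + 1)), ‖(u t - v) k‖)) l
      (𝓝 (torusMeasure d univ ^ p.toReal⁻¹ * ENNReal.ofReal 0)) := by
    refine ENNReal.Tendsto.const_mul (ENNReal.tendsto_ofReal ?_)
      (Or.inr (torusVol_rpow_ne_top d _))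
    rw [← Finset.sum_const_zero (s := box d (2 ^ (j + 1)))]
    refine tendsto_finsetSum _ fun k _ => ?_
    have := (h k).sub_const (v k)
    rw [sub_self] at this
    simpa using this.norm
  rw [ENNReal.ofReal_zero, mul_zero] at h1
  exact tendsto_of_tendsto_of_tendsto_of_le_of_le tendsto_const_nhds h1 (fun _ => zero_le)
    fun t => blockNorm_le_sum p j _

theorem blockNorm_le_of_tendsto {ι : Type*} {l : Filter ι} [l.NeBot] {u : ι → (Fin d → ℤ) → ℂ}
    {v : (Fin d → ℤ) → ℂ} (h : ∀ k, Tendsto (fun t => u t k) l (𝓝 (v k))) {p : ℝ≥0∞} (hp : 1 ≤ p)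
    (j : ℕ) {B : ℝ≥0∞} (hB : ∃ᶠ t in l, blockNorm χ p j (u t) ≤ B) : blockNorm χ p j v ≤ B := by
  refine ENNReal.le_of_forall_pos_le_add fun ε hε _ => ?_
  have h1 := (ENNReal.tendsto_nhds_zero.1 (tendsto_blockNorm (χ := χ) h p j)) ε (by simpa using hε)
  obtain ⟨t, ht, ht'⟩ := (hB.and_eventually h1).exists
  have h2 := blockNorm_sub_le (χ := χ) hp j (u t) (u t - v)
  rw [sub_sub_cancel] at h2
  exact h2.trans (add_le_add ht ht')

/-- Lower exponents of integrability and regularity. -/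
theorem besovNorm_one_top_le {s s' : ℝ} (hs : s ≤ s') {p q : ℝ≥0∞} (hp : 1 ≤ p) (hq : q ≠ 0)
    (a : (Fin d → ℤ) → ℂ) :
    besovNorm χ s 1 ∞ a ≤ ENNReal.ofReal (2 ^ (s' - s)) *
      torusMeasure d univ ^ (1 / (1 : ℝ≥0∞).toReal - 1 / p.toReal) * besovNorm χ s' p q a := by
  refine besovNorm_top_le fun j => ?_
  -- The constant is needed only for the low block `j = 0`, whose weight has exponent `-s`.
  have h1 : weight s j ≤ ENNReal.ofReal (2 ^ (s' - s)) * weight s' j := by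
    rw [weight, weight, ← ENNReal.ofReal_mul (by positivity), ← Real.rpow_add two_pos]
    refine ENNReal.ofReal_le_ofReal (Real.rpow_le_rpow_of_exponent_le (by norm_num) ?_)
    have : (0 : ℝ) ≤ j := by positivity
    nlinarith
  have h2 : blockNorm χ 1 j a ≤
      blockNorm χ p j a * torusMeasure d univ ^ (1 / (1 : ℝ≥0∞).toReal - 1 / p.toReal) :=
    eLpNorm_le_eLpNorm_mul_rpow_measure_univ hp (continuous_lpBlock j a).aestronglyMeasurable
  calc weight s j * blockNorm χ 1 j a ≤ (ENNReal.ofReal (2 ^ (s' - s)) * weight s' j) *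
        (blockNorm χ p j a * torusMeasure d univ ^ (1 / (1 : ℝ≥0∞).toReal - 1 / p.toReal)) := by
        gcongr
    _ = ENNReal.ofReal (2 ^ (s' - s)) *
      torusMeasure d univ ^ (1 / (1 : ℝ≥0∞).toReal - 1 / p.toReal) *
        (weight s' j * blockNorm χ p j a) := by ring
    _ ≤ _ := by gcongr; exact weight_mul_blockNorm_le hq s' p j a

theorem besovNorm_mono_regularity {s s' : ℝ} (hs : s ≤ s') (p : ℝ≥0∞) {q : ℝ≥0∞} (hq : 1 ≤ q)
    (a : (Fin d → ℤ) → ℂ) :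
    besovNorm χ s p q a ≤ ENNReal.ofReal (2 ^ (s' - s)) * besovNorm χ s' p q a := by
  rw [besovNorm_eq, besovNorm_eq, ← eLpNorm_count_const_mul hq]
  refine eLpNorm_count_mono fun j => ?_
  rw [← mul_assoc]
  gcongr
  rw [weight, weight, ← ENNReal.ofReal_mul (by positivity), ← Real.rpow_add two_pos]
  refine ENNReal.ofReal_le_ofReal (Real.rpow_le_rpow_of_exponent_le (by norm_num) ?_)
  have : (0 : ℝ) ≤ j := by positivity
  nlinarith

theorem memBesov_mono {s s' : ℝ} (hs : s ≤ s') {p q : ℝ≥0∞} (hq : 1 ≤ q) {u : Dist d}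
    (h : MemBesov χ s' p q u) : MemBesov χ s p q u := by
  have hC : ENNReal.ofReal (2 ^ (s' - s)) ≠ 0 := by
    rw [Ne, ENNReal.ofReal_eq_zero, not_le]; positivity
  intro ε hε
  obtain ⟨f, hf⟩ := h (ε / ENNReal.ofReal (2 ^ (s' - s)))
    (ENNReal.div_pos hε.ne' ENNReal.ofReal_ne_top)
  refine ⟨f, (besovNorm_mono_regularity hs p hq _).trans_lt ?_⟩
  rw [mul_comm]
  exact (ENNReal.lt_div_iff_mul_lt (Or.inl hC) (Or.inl ENNReal.ofReal_ne_top)).1 hf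

theorem continuousBesov_mono {s s' : ℝ} (hs : s ≤ s') {p q : ℝ≥0∞} (hq : 1 ≤ q) {T : ℝ}
    {u : ℝ → Dist d} (h : ContinuousBesov χ T s' p q u) : ContinuousBesov χ T s p q u := by
  refine ⟨fun t ht => memBesov_mono hs hq (h.1 t ht), fun t₀ ht₀ => ?_⟩
  have := ENNReal.Tendsto.const_mul (a := ENNReal.ofReal (2 ^ (s' - s))) (h.2 t₀ ht₀)
    (Or.inr ENNReal.ofReal_ne_top)
  rw [mul_zero] at this
  exact tendsto_of_tendsto_of_tendsto_of_le_of_le tendsto_const_nhds this (fun _ => zero_le)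
    fun t => besovNorm_mono_regularity hs p hq _

/-- Continuous paths in Besov spaces are bounded. -/
theorem exists_bound_of_continuous {T s : ℝ} {p q : ℝ≥0∞} (hp : 1 ≤ p) (hq : 1 ≤ q)
    {u : ℝ → (Fin d → ℤ) → ℂ} (hfin : ∀ t ∈ Icc 0 T, besovNorm χ s p q (u t) < ∞)
    (hc : ∀ t₀ ∈ Icc 0 T, Tendsto (fun t => besovNorm χ s p q (u t - u t₀)) (𝓝[Icc 0 T] t₀) (𝓝 0)) :
    ∃ C : NNReal, ∀ t ∈ Icc 0 T, besovNorm χ s p q (u t) ≤ C := by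
  refine (isCompact_Icc (a := (0:ℝ)) (b := T)).induction_on
    (p := fun A => ∃ C : NNReal, ∀ t ∈ A, besovNorm χ s p q (u t) ≤ C) ⟨0, by simp⟩ ?_ ?_ ?_
  · rintro A B hAB ⟨C, hC⟩
    exact ⟨C, fun t ht => hC t (hAB ht)⟩
  · rintro A B ⟨C, hC⟩ ⟨C', hC'⟩
    refine ⟨max C C', ?_⟩
    rintro t (ht | ht)
    · exact (hC t ht).trans (by exact_mod_cast le_max_left _ _)
    · exact (hC' t ht).trans (by exact_mod_cast le_max_right _ _)
  · intro t₀ ht₀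
    refine ⟨_, ENNReal.tendsto_nhds_zero.1 (hc t₀ ht₀) 1 one_pos,
      1 + (besovNorm χ s p q (u t₀)).toNNReal, fun t ht => ?_⟩
    have h1 := besovNorm_add_le (χ := χ) hp hq s (u t - u t₀) (u t₀)
    rw [sub_add_cancel] at h1
    refine h1.trans ?_
    rw [ENNReal.coe_add, ENNReal.coe_one, ENNReal.coe_toNNReal (hfin t₀ ht₀).ne]
    exact add_le_add_left ht _

/-! ### Continuity and tails -/

/-- Trigonometric polynomials as test functions. -/
def trigTest (S : Finset (Fin d → ℤ)) (c : (Fin d → ℤ) → ℂ) : TestFun d :=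
  ∑ k ∈ S, c k • fourierTest k

theorem coe_trigTest (S : Finset (Fin d → ℤ)) (c : (Fin d → ℤ) → ℂ) :
    ((trigTest S c : TestFun d) : E d → ℂ) = trig S c := by
  ext x
  rw [trigTest, Submodule.coe_sum, Finset.sum_apply]
  rfl

theorem fcoef_partial (N : ℕ) (a : (Fin d → ℤ) → ℂ) :
    fcoef (trig (box d (2 ^ (N + 1))) fun k => lowSymbol χ N k * a k) =
      fun k => lowSymbol χ N k * a k := by
  ext k
  rw [fcoef_trig]
  split_ifs with h
  · rfl
  · rw [lowSymbol_eq_zero_of_notMem h, zero_mul]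

/-- The partial sum has symbol one below `3/8 · 2^{N+1}`. Block `j` reaches up to `4/3 · 2^j`, which
stays below that radius exactly when `j < N`. -/
theorem chiSymbol_mul_one_sub_lowSymbol {j N : ℕ} (h : j < N) (k : Fin d → ℤ) :
    chiSymbol χ j k * (1 - lowSymbol χ N k) = 0 := by
  by_cases hk : chiSymbol χ j k = 0
  · rw [hk, zero_mul]
  · rw [lowSymbol_eq_one, sub_self, mul_zero]
    have h1 := norm_freq_le_of_chiSymbol hk
    have h2 : (2 : ℝ) ^ (j + 1) ≤ 2 ^ N := pow_le_pow_right₀ (by norm_num) h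
    rw [pow_succ] at h2 ⊢
    have : (0 : ℝ) < 2 ^ j := by positivity
    linarith

/-- The partial sums `S_N u` are smooth. The difference `u - S_N u` has no blocks below `N`, and its
other blocks are bounded by those of `u`, so the error is a tail. -/
theorem memBesov_of_tailVanish {s : ℝ} {p q : ℝ≥0∞} (hp : 1 ≤ p) (hq : 1 ≤ q) {u : Dist d}
    (h : TailVanish q fun j => weight s j * blockNorm χ p j u.coef) : MemBesov χ s p q u := by
  obtain ⟨M, -, hM⟩ := exists_multBound_chi χ
  have h1 : ∀ N, besovNorm χ s p q (u.coef - fun k => lowSymbol χ N k * u.coef k) ≤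
      (1 + M) * eLpNorm (fun j => if N ≤ j then weight s j * blockNorm χ p j u.coef else 0) q
        Measure.count := by
    intro N
    rw [besovNorm_eq, ← eLpNorm_count_const_mul hq]
    refine eLpNorm_count_mono fun j => ?_
    split_ifs with hj
    · rw [mul_left_comm]
      gcongr
      rw [add_mul, one_mul]
      refine (blockNorm_sub_le hp _ _ _).trans ?_
      gcongr
      exact (hM N).blockNorm_le hp j _
    · rw [mul_zero, nonpos_iff_eq_zero, mul_eq_zero]
      right
      rw [blockNorm_eq]
      have : (trig (box d (2 ^ (j + 1))) fun k => chiSymbol χ j k *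
          (u.coef - fun k => lowSymbol χ N k * u.coef k) k) = fun _ => 0 := by
        ext x
        refine Finset.sum_eq_zero fun k _ => ?_
        have := chiSymbol_mul_one_sub_lowSymbol (χ := χ) (not_le.1 hj) k
        simp only [Pi.sub_apply]
        linear_combination (u.coef k * fourierE k x) * this
      rw [this]
      simp
  have h2 := ENNReal.Tendsto.const_mul (a := (1 + M : ℝ≥0∞)) h (Or.inr (by simp))
  rw [mul_zero] at h2
  intro ε hε
  obtain ⟨N, hN⟩ := (h2.eventually (gt_mem_nhds hε)).exists
  refine ⟨trigTest (box d (2 ^ (N + 1))) fun k => lowSymbol χ N k * u.coef k, ?_⟩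
  rw [coe_trigTest, fcoef_partial]
  exact (h1 N).trans_lt hN

/-- A path whose Fourier coefficients are continuous and whose blocks are dominated by a sequence
with vanishing tails is continuous in the Besov space. -/
theorem continuousBesov_of_tailVanish {T s : ℝ} {p q : ℝ≥0∞} (hp : 1 ≤ p) (hq : 1 ≤ q)
    {u : ℝ → Dist d} (hu : ∀ k, ContinuousOn (fun t => (u t).coef k) (Icc 0 T)) {c : ℕ → ℝ≥0∞}
    (hc : TailVanish q c)
    (h : ∀ t ∈ Icc 0 T, ∀ j, weight s j * blockNorm χ p j (u t).coef ≤ c j) :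
    ContinuousBesov χ T s p q u := by
  refine ⟨fun t ht => memBesov_of_tailVanish hp hq (hc.mono (h t ht)), fun t₀ ht₀ => ?_⟩
  rw [ENNReal.tendsto_nhds_zero]
  intro ε hε
  have hε2 : 0 < ε / 2 := ENNReal.half_pos hε.ne'
  obtain ⟨N, hN⟩ := (ENNReal.tendsto_nhds_zero.1 (hc.const_mul hq (a := 2) (by simp)) _ hε2).exists
  -- The finitely many blocks below `N` converge because the coefficients do; the others are small
  -- uniformly in `t` by domination.
  have hhead : Tendsto (fun t => ∑ j ∈ Finset.range N,
      weight s j * blockNorm χ p j ((u t).coef - (u t₀).coef)) (𝓝[Icc 0 T] t₀) (𝓝 0) := by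
    rw [← Finset.sum_const_zero (ι := ℕ) (M := ℝ≥0∞) (s := Finset.range N)]
    refine tendsto_finsetSum _ fun j _ => ?_
    have := ENNReal.Tendsto.const_mul (a := weight s j)
      (tendsto_blockNorm (χ := χ) (u := fun t => (u t).coef) (v := (u t₀).coef)
        (fun k => hu k t₀ ht₀) p j) (Or.inr (weight_ne_top s j))
    rwa [mul_zero] at this
  filter_upwards [ENNReal.tendsto_nhds_zero.1 hhead _ hε2, self_mem_nhdsWithin] with t ht htT
  set a := (u t).coef - (u t₀).coef with ha
  have hsplit : ∀ j, weight s j * blockNorm χ p j a ≤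
      (if j < N then weight s j * blockNorm χ p j a else 0) + if N ≤ j then 2 * c j else 0 := by
    intro j
    by_cases hj : j < N
    · simp [hj]
    · rw [if_neg hj, if_pos (not_lt.1 hj), zero_add, two_mul]
      calc weight s j * blockNorm χ p j a
          ≤ weight s j * (blockNorm χ p j (u t).coef + blockNorm χ p j (u t₀).coef) := by
            gcongr; exact blockNorm_sub_le hp j _ _
        _ ≤ _ := by rw [mul_add]; exact add_le_add (h t htT j) (h t₀ ht₀ j)
  calc besovNorm χ s p q a ≤ _ := eLpNorm_count_mono hsplit
    _ ≤ _ := eLpNorm_count_add_le hq _ _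
    _ ≤ ε / 2 + ε / 2 := by
        gcongr
        refine (eLpNorm_count_le_tsum hq _).trans ?_
        rw [tsum_eq_sum (s := Finset.range N) fun j hj => if_neg (by simpa using hj)]
        refine le_trans (Finset.sum_le_sum fun j hj => ?_) ht
        split_ifs <;> simp
    _ = ε := ENNReal.add_halves ε

theorem tsum_ofReal_geometric_ne_top (C : ℝ) {θ : ℝ} (hθ : 0 < θ) :
    ∑' j : ℕ, ENNReal.ofReal (C * (2 : ℝ) ^ (-(θ * j))) ≠ ∞ := by
  refine Summable.tsum_ofReal_ne_top (Summable.mul_left _ ?_)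
  have : ∀ j : ℕ, (2 : ℝ) ^ (-(θ * j)) = ((2 : ℝ) ^ (-θ)) ^ j := by
    intro j
    rw [← Real.rpow_natCast, ← Real.rpow_mul (by norm_num)]
    ring_nf
  simp_rw [this]
  refine summable_geometric_of_lt_one (by positivity) ?_
  exact Real.rpow_lt_one_of_one_lt_of_neg (by norm_num) (by linarith)

theorem card_box_two_pow_le (j : ℕ) :
    ((box d (2 ^ (j + 1))).card : ℝ) ≤ (8 : ℝ) ^ d * (2 : ℝ) ^ ((d : ℝ) * j) := by
  rw [card_box, mul_comm (d : ℝ), Real.rpow_mul (by norm_num), Real.rpow_natCast, Real.rpow_natCast,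
    ← mul_pow]
  push_cast
  refine pow_le_pow_left₀ (by positivity) ?_ d
  have : (1 : ℝ) ≤ 2 ^ j := one_le_pow₀ (by norm_num)
  rw [pow_succ]; linarith

/-- Blocks of bounded functions, by the Cauchy–Schwarz inequality. -/
theorem exists_blockNorm_fcoef_le {f : E d → ℂ} (hf : Continuous f) (p : ℝ≥0∞) :
    ∃ C : ℝ, 0 ≤ C ∧ ∀ j, blockNorm χ p j (fcoef f) ≤ ENNReal.ofReal (C * 2 ^ ((d : ℝ) / 2 * j)) := by
  set V := torusMeasure d univ ^ p.toReal⁻¹ with hV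
  set B := ∫ x, ‖f x‖ ^ 2 ∂torusMeasure d with hB
  have hB0 : 0 ≤ B := integral_nonneg fun x => sq_nonneg _
  have hpi : 0 < (2 * Real.pi) ^ d := by positivity
  refine ⟨V.toReal * (Real.sqrt (8 ^ d) * Real.sqrt (B / (2 * Real.pi) ^ d)), by positivity,
    fun j => ?_⟩
  refine (blockNorm_le_sum p j _).trans ?_
  rw [← ENNReal.ofReal_toReal (torusVol_rpow_ne_top d _ : V ≠ ∞),
    ← ENNReal.ofReal_mul ENNReal.toReal_nonneg, mul_assoc]
  refine ENNReal.ofReal_le_ofReal (mul_le_mul_of_nonneg_left ?_ ENNReal.toReal_nonneg)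
  have h1 := sq_sum_le_card_mul_sum_sq (s := box d (2 ^ (j + 1))) (f := fun k => ‖fcoef f k‖)
  have h2 := bessel hf (box d (2 ^ (j + 1)))
  have h3 : ∑ k ∈ box d (2 ^ (j + 1)), ‖fcoef f k‖ ^ 2 ≤ B / (2 * Real.pi) ^ d := by
    rw [le_div_iff₀ hpi]; linarith
  have h4 : (2 : ℝ) ^ ((d : ℝ) / 2 * j) = Real.sqrt (2 ^ ((d : ℝ) * j)) := by
    rw [Real.sqrt_eq_rpow, ← Real.rpow_mul (by norm_num)]; ring_nf
  rw [h4, mul_right_comm, ← Real.sqrt_mul (by positivity), ← Real.sqrt_mul (by positivity)]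
  refine Real.le_sqrt_of_sq_le (h1.trans ?_)
  exact mul_le_mul (card_box_two_pow_le j) h3 (Finset.sum_nonneg fun k _ => sq_nonneg _)
    (by positivity)

/-- Up to a small error `u` is a smooth function. Bessel and Cauchy–Schwarz bound the blocks of the
latter by `2^{dj/2}`, which is crude but summable against `2^{-αj}` because `α > d/2`. -/
theorem tailVanish_of_memBesov {α : ℝ} (hα : (d : ℝ) / 2 < α) {p q : ℝ≥0∞} (hp : 1 ≤ p)
    (hq : 1 ≤ q) {u : Dist d} (h : MemBesov χ (-α) p q u) :
    TailVanish q fun j => weight (-α) j * blockNorm χ p j u.coef := by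
  unfold TailVanish
  rw [ENNReal.tendsto_nhds_zero]
  intro ε hε
  have hε2 : 0 < ε / 2 := ENNReal.half_pos hε.ne'
  obtain ⟨f, hf⟩ := h _ hε2
  obtain ⟨C, hC0, hC⟩ := exists_blockNorm_fcoef_le (χ := χ) f.2.1.continuous p
  have htail : TailVanish q fun j => weight (-α) j * blockNorm χ p j (fcoef (f : E d → ℂ)) := by
    refine tailVanish_of_tsum hq (ne_top_of_le_ne_top (tsum_ofReal_geometric_ne_top (C * 2 ^ α)
      (sub_pos.2 hα)) (ENNReal.tsum_le_tsum fun j => ?_))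
    refine (mul_le_mul_right (hC j) _).trans (le_of_eq ?_)
    rw [weight, ← ENNReal.ofReal_mul (by positivity)]
    congr 1
    rw [mul_left_comm, mul_assoc, ← Real.rpow_add two_pos, ← Real.rpow_add two_pos]
    congr 2
    ring
  filter_upwards [ENNReal.tendsto_nhds_zero.1 htail _ hε2] with N hN
  have h1 : ∀ j, (if N ≤ j then weight (-α) j * blockNorm χ p j u.coef else 0) ≤
      weight (-α) j * blockNorm χ p j (u.coef - fcoef (f : E d → ℂ)) +
      if N ≤ j then weight (-α) j * blockNorm χ p j (fcoef (f : E d → ℂ)) else 0 := by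
    intro j
    split_ifs
    · rw [← mul_add]
      gcongr
      have := blockNorm_add_le (χ := χ) hp j (u.coef - fcoef (f : E d → ℂ)) (fcoef (f : E d → ℂ))
      rwa [sub_add_cancel] at this
    · simp
  calc _ ≤ _ := eLpNorm_count_mono h1
    _ ≤ _ := eLpNorm_count_add_le hq _ _
    _ ≤ ε / 2 + ε / 2 := add_le_add hf.le hN
    _ = ε := ENNReal.add_halves ε

theorem besovNorm_fcoef_lt_top {f : E d → ℂ} (hf : Continuous f) :
    besovNorm χ (-((d : ℝ) / 2)) ∞ ∞ (fcoef f) < ∞ := by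
  obtain ⟨C, hC0, hC⟩ := exists_blockNorm_fcoef_le (χ := χ) hf ∞
  refine (besovNorm_top_le (B := ENNReal.ofReal (C * 2 ^ ((d : ℝ) / 2))) fun j => ?_).trans_lt
    ENNReal.ofReal_lt_top
  refine (mul_le_mul_right (hC j) _).trans (le_of_eq ?_)
  rw [weight, ← ENNReal.ofReal_mul (by positivity)]
  congr 1
  rw [mul_left_comm, ← Real.rpow_add two_pos]
  congr 2
  ring

theorem eLpNorm_two_trig (S : Finset (Fin d → ℤ)) (c : (Fin d → ℤ) → ℂ) :
    eLpNorm (trig S c) 2 (torusMeasure d) =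
      ENNReal.ofReal (Real.sqrt ((2 * Real.pi) ^ d * ∑ k ∈ S, ‖c k‖ ^ 2)) := by
  rw [← parseval_trig, (memLp_trig S c 2).eLpNorm_eq_integral_rpow_norm (by simp) (by simp)]
  congr 1
  rw [Real.sqrt_eq_rpow]
  simp

/-- At the critical regularity `-d/2` the blocks of an element of the closure of the smooth
functions vanish in `L²`. -/
theorem tendsto_blockNorm_of_memBesov (hd : 0 < d) {u : Dist d}
    (h : MemBesov χ (-((d : ℝ) / 2)) ∞ ∞ u) :
    Tendsto (fun j => weight (-((d : ℝ) / 2)) j * blockNorm χ 2 j u.coef) atTop (𝓝 0) := by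
  set V := torusMeasure d univ ^ (2 : ℝ≥0∞).toReal⁻¹ with hV
  have hVt : V ≠ ∞ := torusVol_rpow_ne_top d _
  have hinf : ∀ j (a : (Fin d → ℤ) → ℂ), blockNorm χ 2 j a ≤ V * blockNorm χ ∞ j a := by
    intro j a
    have := eLpNorm_le_eLpNorm_mul_rpow_measure_univ (μ := torusMeasure d) (p := 2) (q := ∞) le_top
      (continuous_lpBlock (χ := χ) j a).aestronglyMeasurable
    rw [mul_comm]
    simpa [V, blockNorm] using this
  rw [ENNReal.tendsto_nhds_zero]
  intro ε hε
  have hε2 : 0 < ε / 2 := ENNReal.half_pos hε.ne'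
  obtain ⟨f, hf⟩ := h (ε / 2 / (V + 1)) (ENNReal.div_pos hε2.ne' (by simp [hVt]))
  have hf' : V * besovNorm χ (-((d : ℝ) / 2)) ∞ ∞ (u.coef - fcoef (f : E d → ℂ)) ≤ ε / 2 := by
    calc _ ≤ (V + 1) * (ε / 2 / (V + 1)) := by gcongr; exact le_self_add
      _ ≤ _ := ENNReal.mul_div_le
  set B := Real.sqrt (∫ x, ‖(f : E d → ℂ) x‖ ^ 2 ∂torusMeasure d) with hB
  have hfb : ∀ j, blockNorm χ 2 j (fcoef (f : E d → ℂ)) ≤ ENNReal.ofReal B := by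
    intro j
    rw [blockNorm_eq, eLpNorm_two_trig]
    refine ENNReal.ofReal_le_ofReal (Real.sqrt_le_sqrt (le_trans ?_
      (bessel f.2.1.continuous (box d (2 ^ (j + 1))))))
    gcongr with k hk
    rw [norm_mul]
    exact mul_le_of_le_one_left (norm_nonneg _) (norm_chiSymbol_le j k)
  have hd' : (0 : ℝ) < (d : ℝ) / 2 := by positivity
  have h0 : Tendsto (fun j => weight (-((d : ℝ) / 2)) j * ENNReal.ofReal B) atTop (𝓝 0) := by
    refine ENNReal.tendsto_atTop_zero_of_tsum_ne_top (ne_top_of_le_ne_top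
      (tsum_ofReal_geometric_ne_top (2 ^ ((d : ℝ) / 2) * B) hd')
      (ENNReal.tsum_le_tsum fun j => le_of_eq ?_))
    rw [weight, ← ENNReal.ofReal_mul (by positivity)]
    congr 1
    rw [mul_right_comm, ← Real.rpow_add two_pos]
    congr 2
    ring
  filter_upwards [ENNReal.tendsto_nhds_zero.1 h0 _ hε2] with j hj
  have h1 := blockNorm_add_le (χ := χ) (p := 2) (by norm_num) j (u.coef - fcoef (f : E d → ℂ))
    (fcoef (f : E d → ℂ))
  rw [sub_add_cancel] at h1
  calc weight (-((d : ℝ) / 2)) j * blockNorm χ 2 j u.coef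
      ≤ weight (-((d : ℝ) / 2)) j * (V * blockNorm χ ∞ j (u.coef - fcoef (f : E d → ℂ)) +
          ENNReal.ofReal B) := by
        gcongr
        exact h1.trans (add_le_add (hinf j _) (hfb j))
    _ = V * (weight (-((d : ℝ) / 2)) j * blockNorm χ ∞ j (u.coef - fcoef (f : E d → ℂ))) +
        weight (-((d : ℝ) / 2)) j * ENNReal.ofReal B := by ring
    _ ≤ ε / 2 + ε / 2 := by
        refine add_le_add (le_trans ?_ hf') hj
        gcongr
        exact weight_mul_blockNorm_le (by simp) _ _ j _
    _ = ε := ENNReal.add_halves ε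

end FluctuationSPDE

end

noncomputable section

namespace FluctuationSPDE

variable {d : ℕ} {χ : DyadicPartition d}

/-! ### Products -/

theorem sum_range_rpow_le {α : ℝ} (hα : 0 < α) (m : ℕ) :
    ∑ j ∈ Finset.range (m + 1), (2 : ℝ) ^ (α * j) ≤ (2 ^ α / (2 ^ α - 1)) * 2 ^ (α * m) := by
  have h1 : (1 : ℝ) < 2 ^ α := Real.one_lt_rpow (by norm_num) hα
  have h2 : ∀ j : ℕ, (2 : ℝ) ^ (α * j) = (2 ^ α) ^ j := fun j => by
    rw [Real.rpow_mul (by norm_num), Real.rpow_natCast]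
  simp_rw [h2]
  rw [geom_sum_eq h1.ne', div_mul_eq_mul_div]
  gcongr
  rw [pow_succ]; linarith

/-- The pairs of blocks whose product contributes to the `n`-th block. -/
def Interacts (n j j' : ℕ) : Prop := (j ≤ j' + 2 ∧ j' ≤ j + 2) ∨ (j ≤ n + 2 ∧ j' ≤ n + 2)

instance (n j j' : ℕ) : Decidable (Interacts n j j') := by unfold Interacts; infer_instance

/-- The size of the product of the blocks `j` and `j'`, if they contribute to the `n`-th block. -/
def pairWeight (α β : ℝ) (n j j' : ℕ) : ℝ :=
  if Interacts n j j' then (2 : ℝ) ^ (-(β * j)) * 2 ^ (α * j') else 0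

theorem pairWeight_nonneg (α β : ℝ) (n j j' : ℕ) : 0 ≤ pairWeight α β n j j' := by
  unfold pairWeight; split_ifs <;> positivity

/-- For fixed `j`, interaction forces `j' ≤ j + 2` or `j' ≤ n + 2`, and a growing geometric sum is
comparable to its last term. What remains in `j` is `2^{-(β-α)j}`, summable precisely because `α <
β`, and `2^{αn} 2^{-βj}`. -/
theorem exists_sum_pairWeight_le {α β : ℝ} (hα : 0 < α) (hαβ : α < β) :
    ∃ C : ℝ, 0 ≤ C ∧ ∀ n N : ℕ, ∑ j ∈ Finset.range (N + 1), ∑ j' ∈ Finset.range (N + 1),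
      pairWeight α β n j j' ≤ C * 2 ^ (α * n) := by
  have h1 : (1 : ℝ) < 2 ^ α := Real.one_lt_rpow (by norm_num) hα
  set D : ℝ := 2 ^ α / (2 ^ α - 1) with hD
  have hD0 : 0 ≤ D := div_nonneg (by positivity) (by linarith)
  have hsum : ∀ θ : ℝ, 0 < θ → Summable fun j : ℕ => (2 : ℝ) ^ (-(θ * j)) := by
    intro θ hθ
    have : ∀ j : ℕ, (2 : ℝ) ^ (-(θ * j)) = ((2 : ℝ) ^ (-θ)) ^ j := by
      intro j
      rw [← Real.rpow_natCast, ← Real.rpow_mul (by norm_num)]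
      ring_nf
    simp_rw [this]
    exact summable_geometric_of_lt_one (by positivity)
      (Real.rpow_lt_one_of_one_lt_of_neg (by norm_num) (by linarith))
  set S₁ := ∑' j : ℕ, (2 : ℝ) ^ (-((β - α) * j)) with hS₁
  set S₂ := ∑' j : ℕ, (2 : ℝ) ^ (-(β * j)) with hS₂
  have hS₁0 : 0 ≤ S₁ := tsum_nonneg fun j => by positivity
  have hS₂0 : 0 ≤ S₂ := tsum_nonneg fun j => by positivity
  refine ⟨D * 2 ^ (α * 2) * (S₁ + S₂), by positivity, fun n N => ?_⟩
  have hrow : ∀ j, ∑ j' ∈ Finset.range (N + 1), pairWeight α β n j j' ≤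
      D * 2 ^ (α * 2) * (2 ^ (-((β - α) * j)) + 2 ^ (-(β * j)) * 2 ^ (α * n)) := by
    intro j
    have h2 : ∀ j' ∈ Finset.range (N + 1), pairWeight α β n j j' ≤
        2 ^ (-(β * j)) * ((if j' ∈ Finset.range (j + 2 + 1) then (2 : ℝ) ^ (α * j') else 0) +
          if j' ∈ Finset.range (n + 2 + 1) then (2 : ℝ) ^ (α * j') else 0) := by
      intro j' _
      have hp : (0 : ℝ) < 2 ^ (α * j') := by positivity
      have hp' : (0 : ℝ) < 2 ^ (-(β * j)) := by positivity
      unfold pairWeight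
      split_ifs with hI h1 h2 h2 h1 h2 h2
      · nlinarith
      · simp
      · simp
      · simp only [Interacts, Finset.mem_range] at *; omega
      all_goals positivity
    have h3 : ∀ m : ℕ, ∑ j' ∈ Finset.range (N + 1),
        (if j' ∈ Finset.range (m + 2 + 1) then (2 : ℝ) ^ (α * j') else 0) ≤
        D * (2 ^ (α * m) * 2 ^ (α * 2)) := by
      intro m
      rw [← Finset.sum_filter]
      calc _ ≤ ∑ j' ∈ Finset.range (m + 2 + 1), (2 : ℝ) ^ (α * j') :=
            Finset.sum_le_sum_of_subset_of_nonneg (fun x hx => (Finset.mem_filter.1 hx).2)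
              fun _ _ _ => by positivity
        _ ≤ _ := sum_range_rpow_le hα (m + 2)
        _ = _ := by rw [← Real.rpow_add two_pos]; congr 2; push_cast; ring
    calc _ ≤ _ := Finset.sum_le_sum h2
      _ = 2 ^ (-(β * j)) * (∑ j' ∈ Finset.range (N + 1),
            (if j' ∈ Finset.range (j + 2 + 1) then (2 : ℝ) ^ (α * j') else 0) +
          ∑ j' ∈ Finset.range (N + 1),
            if j' ∈ Finset.range (n + 2 + 1) then (2 : ℝ) ^ (α * j') else 0) := by
          rw [← Finset.mul_sum, Finset.sum_add_distrib]
      _ ≤ 2 ^ (-(β * j)) * (D * (2 ^ (α * j) * 2 ^ (α * 2)) + D * (2 ^ (α * n) * 2 ^ (α * 2))) := by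
          gcongr
          · exact h3 j
          · exact h3 n
      _ = _ := by
          have : (2 : ℝ) ^ (-((β - α) * j)) = 2 ^ (-(β * j)) * 2 ^ (α * j) := by
            rw [← Real.rpow_add two_pos]; ring_nf
          rw [this]; ring
  have hn : (1 : ℝ) ≤ 2 ^ (α * n) := Real.one_le_rpow (by norm_num) (by positivity)
  calc _ ≤ ∑ j ∈ Finset.range (N + 1),
        D * 2 ^ (α * 2) * (2 ^ (-((β - α) * j)) + 2 ^ (-(β * j)) * 2 ^ (α * n)) :=
        Finset.sum_le_sum fun j _ => hrow j
    _ = D * 2 ^ (α * 2) * (∑ j ∈ Finset.range (N + 1), (2 : ℝ) ^ (-((β - α) * j)) +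
        (∑ j ∈ Finset.range (N + 1), (2 : ℝ) ^ (-(β * j))) * 2 ^ (α * n)) := by
        rw [← Finset.mul_sum, Finset.sum_add_distrib, Finset.sum_mul]
    _ ≤ D * 2 ^ (α * 2) * (S₁ * 2 ^ (α * n) + S₂ * 2 ^ (α * n)) := by
        gcongr
        · refine ((hsum _ (sub_pos.2 hαβ)).sum_le_tsum _ fun j _ => by positivity).trans ?_
          exact le_mul_of_one_le_right hS₁0 hn
        · exact (hsum β (hα.trans hαβ)).sum_le_tsum _ fun j _ => by positivity
    _ = _ := by ring

/-- Fourier coefficients of the product of two blocks. -/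
def pairCoef (χ : DyadicPartition d) (a b : (Fin d → ℤ) → ℂ) (j j' : ℕ) (k : Fin d → ℤ) : ℂ :=
  fcoef (fun x => lpBlock χ j a x * lpBlock χ j' b x) k

theorem fcoef_lpPartial_mul (a b : (Fin d → ℤ) → ℂ) (N : ℕ) (k : Fin d → ℤ) :
    fcoef (fun x => lpPartial χ N a x * lpPartial χ N b x) k =
      ∑ j ∈ Finset.range (N + 1), ∑ j' ∈ Finset.range (N + 1), pairCoef χ a b j j' k := by
  have hc : ∀ j j', Continuous fun x => lpBlock χ j a x * lpBlock χ j' b x := fun j j' =>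
    (continuous_lpBlock j a).mul (continuous_lpBlock j' b)
  simp only [lpPartial, Finset.sum_mul_sum]
  rw [fcoef_sum (f := fun j x => ∑ j' ∈ Finset.range (N + 1), lpBlock χ j a x * lpBlock χ j' b x) _
    fun j _ => integrable_torus_of_continuous (continuous_finsetSum _ fun j' _ => hc j j')]
  refine Finset.sum_congr rfl fun j _ => ?_
  rw [fcoef_sum (f := fun j' x => lpBlock χ j a x * lpBlock χ j' b x) _
    fun j' _ => integrable_torus_of_continuous (hc j j')]
  rfl

theorem exists_of_pairCoef_ne_zero {a b : (Fin d → ℤ) → ℂ} {j j' : ℕ} {k : Fin d → ℤ}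
    (h : pairCoef χ a b j j' k ≠ 0) :
    ∃ l l' : Fin d → ℤ, l + l' = k ∧ chiSymbol χ j l ≠ 0 ∧ chiSymbol χ j' l' ≠ 0 := by
  rw [pairCoef, lpBlock_eq_trig, lpBlock_eq_trig, fcoef_trig_mul_trig] at h
  obtain ⟨l, -, h⟩ := Finset.exists_ne_zero_of_sum_ne_zero h
  obtain ⟨l', -, h⟩ := Finset.exists_ne_zero_of_sum_ne_zero h
  split_ifs at h with h'
  · refine ⟨l, l', h', ?_, ?_⟩ <;> rintro h0 <;> simp [h0] at h
  · exact absurd rfl h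

/-- If the indices differ by at least three, the lower frequency is at most `1/6 · 2^{i'}` and the
higher one at least `3/8 · 2^{i'}`. Their sum then has size at least `5/24 · 2^{i'}`, too large for
the `n`-th ball unless `i' ≤ n + 2`. -/
theorem interacts_of_pairCoef_ne_zero {a b : (Fin d → ℤ) → ℂ} {n j j' : ℕ} {k : Fin d → ℤ}
    (hk : ‖freq k‖ ≤ 4 / 3 * 2 ^ n) (h : pairCoef χ a b j j' k ≠ 0) : Interacts n j j' := by
  obtain ⟨l, l', rfl, hl, hl'⟩ := exists_of_pairCoef_ne_zero h
  have key : ∀ (i i' : ℕ) (u v : E d), i + 3 ≤ i' → ‖u‖ ≤ 4 / 3 * 2 ^ i → 3 / 8 * 2 ^ i' ≤ ‖v‖ →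
      ‖u + v‖ ≤ 4 / 3 * 2 ^ n → i' ≤ n + 2 := by
    intro i i' u v hi hu hv huv
    by_contra! hn
    have h1 : (2 : ℝ) ^ (i + 3) ≤ 2 ^ i' := pow_le_pow_right₀ (by norm_num) hi
    have h2 : (2 : ℝ) ^ (n + 3) ≤ 2 ^ i' := pow_le_pow_right₀ (by norm_num) (by omega)
    have h3 : ‖v‖ ≤ ‖u + v‖ + ‖u‖ := by
      have := norm_sub_le (u + v) u
      rwa [add_sub_cancel_left] at this
    rw [pow_add] at h1 h2
    have : (0 : ℝ) < 2 ^ n := by positivity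
    linarith
  rw [freq_add] at hk
  unfold Interacts
  by_cases h1 : j + 3 ≤ j'
  · have := key j j' _ _ h1 (norm_freq_le_of_chiSymbol hl)
      (le_norm_freq_of_chiSymbol (by omega) hl') hk
    omega
  · by_cases h2 : j' + 3 ≤ j
    · rw [add_comm] at hk
      have := key j' j _ _ h2 (norm_freq_le_of_chiSymbol hl')
        (le_norm_freq_of_chiSymbol (by omega) hl) hk
      omega
    · omega

/-- Multiplier bounds apply to trigonometric polynomials only. The product is put in that form by
uniqueness of Fourier coefficients. -/
theorem lpBlock_mul_eq_trig (a b : (Fin d → ℤ) → ℂ) (j j' : ℕ) :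
    ∃ S : Finset (Fin d → ℤ), (∀ k ∉ S, pairCoef χ a b j j' k = 0) ∧
      (fun x => lpBlock χ j a x * lpBlock χ j' b x) = trig S (pairCoef χ a b j j') := by
  classical
  set S := Finset.image₂ (· + ·) (box d (2 ^ (j + 1))) (box d (2 ^ (j' + 1))) with hS
  have hz : ∀ k ∉ S, pairCoef χ a b j j' k = 0 := by
    intro k hk
    by_contra h
    obtain ⟨l, l', rfl, hl, hl'⟩ := exists_of_pairCoef_ne_zero h
    exact hk (Finset.mem_image₂_of_mem (mem_box_of_norm_freq_le (norm_freq_le_of_chiSymbol hl))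
      (mem_box_of_norm_freq_le (norm_freq_le_of_chiSymbol hl')))
  refine ⟨S, hz, ?_⟩
  have hc : Continuous fun x => lpBlock χ j a x * lpBlock χ j' b x :=
    (continuous_lpBlock j a).mul (continuous_lpBlock j' b)
  have hp : Periodic fun x => lpBlock χ j a x * lpBlock χ j' b x := fun k x => by
    simp only [periodic_lpBlock j a k x, periodic_lpBlock j' b k x]
  ext x
  rw [← sub_eq_zero]
  refine eq_zero_of_fcoef_eq_zero (f := fun x => lpBlock χ j a x * lpBlock χ j' b x -
    trig S (pairCoef χ a b j j') x) (hc.sub (continuous_trig _ _))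
    (fun k x => by simp only [hp k x, periodic_trig S _ k x]) (fun k => ?_) x
  rw [fcoef_sub (integrable_torus_of_continuous hc)
    (integrable_torus_of_continuous (continuous_trig _ _)), fcoef_trig]
  split_ifs with h
  · exact sub_self _
  · rw [sub_zero]; exact hz k h

theorem eLpNorm_lpBlock_mul_le {p : ℝ≥0∞} (a b : (Fin d → ℤ) → ℂ) (j j' : ℕ) :
    eLpNorm (fun x => lpBlock χ j a x * lpBlock χ j' b x) p (torusMeasure d) ≤
      blockNorm χ ∞ j a * blockNorm χ p j' b := by
  have := eLpNorm_smul_le_mul_eLpNorm (p := ∞) (q := p) (r := p) (μ := torusMeasure d)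
    (continuous_lpBlock (χ := χ) j' b).aestronglyMeasurable
    (continuous_lpBlock (χ := χ) j a).aestronglyMeasurable
  exact this

theorem enorm_fcoef_le (f : E d → ℂ) (k : Fin d → ℤ) :
    ‖fcoef f k‖ₑ ≤ ENNReal.ofReal (((2 * Real.pi) ^ d)⁻¹) * eLpNorm f 1 (torusMeasure d) := by
  rw [fcoef, enorm_mul]
  gcongr
  · rw [← ofReal_norm, norm_inv, Complex.norm_real, Real.norm_of_nonneg (by positivity)]
  · rw [eLpNorm_one_eq_lintegral_enorm]
    refine (enorm_integral_le_lintegral_enorm _).trans (lintegral_mono fun x => ?_)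
    rw [enorm_mul, ← ofReal_norm (fourierE _ _), norm_fourierE, ENNReal.ofReal_one, mul_one]

theorem sum_finset_le_of_sum_range_le {f : ℕ → ℕ → ℝ} (hf : ∀ j j', 0 ≤ f j j') {C : ℝ}
    (h : ∀ N, ∑ j ∈ Finset.range (N + 1), ∑ j' ∈ Finset.range (N + 1), f j j' ≤ C) :
    Summable fun z : ℕ × ℕ => f z.1 z.2 := by
  refine summable_of_sum_le (c := C) (fun z => hf _ _) fun u => ?_
  obtain ⟨N, hN⟩ : ∃ N, u ⊆ Finset.range (N + 1) ×ˢ Finset.range (N + 1) := by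
    refine ⟨u.sup fun z => max z.1 z.2, fun z hz => ?_⟩
    have := Finset.le_sup (f := fun z : ℕ × ℕ => max z.1 z.2) hz
    simp only [Finset.mem_product, Finset.mem_range]
    omega
  calc ∑ z ∈ u, f z.1 z.2 ≤ ∑ z ∈ Finset.range (N + 1) ×ˢ Finset.range (N + 1), f z.1 z.2 :=
        Finset.sum_le_sum_of_subset_of_nonneg hN fun z _ _ => hf _ _
    _ = _ := Finset.sum_product _ _ _
    _ ≤ C := h N

theorem exists_freq_le (k : Fin d → ℤ) : ∃ n : ℕ, ‖freq k‖ ≤ 4 / 3 * 2 ^ n := by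
  obtain ⟨n, hn⟩ := pow_unbounded_of_one_lt ‖freq k‖ (one_lt_two)
  exact ⟨n, by linarith [(by positivity : (0:ℝ) < 2 ^ n)]⟩

section

variable {α β : ℝ} {p : ℝ≥0∞} {a b : (Fin d → ℤ) → ℂ} {A B : ℝ}

/-- The product of a function of class `C^β` and a distribution of class `B^{-α}_{p,∞}`,
`0 < α < β`, is well defined. -/
theorem tendsto_prodCoef (hα : 0 < α) (hαβ : α < β) (hp : 1 ≤ p) (hA0 : 0 ≤ A) (hB0 : 0 ≤ B)
    (hA : ∀ j, blockNorm χ ∞ j a ≤ ENNReal.ofReal (A * 2 ^ (-(β * j))))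
    (hB : ∀ j, blockNorm χ p j b ≤ ENNReal.ofReal (B * 2 ^ (α * j))) (k : Fin d → ℤ) :
    Tendsto (fun N : ℕ => fcoef (fun x => lpPartial χ N a x * lpPartial χ N b x) k) atTop
      (𝓝 (prodCoef χ a b k)) := by
  obtain ⟨n, hn⟩ := exists_freq_le k
  obtain ⟨C, hC0, hC⟩ := exists_sum_pairWeight_le hα hαβ
  set V := (torusMeasure d univ ^ (1 / (1 : ℝ≥0∞).toReal - 1 / p.toReal)).toReal with hV
  set D := ((2 * Real.pi) ^ d)⁻¹ * (A * B) * V with hD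
  have hD0 : 0 ≤ D := by positivity
  have hbound : ∀ j j', ‖pairCoef χ a b j j' k‖ ≤ D * pairWeight α β n j j' := by
    intro j j'
    by_cases h : pairCoef χ a b j j' k = 0
    · rw [h, norm_zero]
      exact mul_nonneg hD0 (pairWeight_nonneg _ _ _ _ _)
    · rw [pairWeight, if_pos (interacts_of_pairCoef_ne_zero hn h)]
      have hVt : torusMeasure d univ ^ (1 / (1 : ℝ≥0∞).toReal - 1 / p.toReal) ≠ ∞ :=
        torusVol_rpow_ne_top d _
      have h1 : blockNorm χ 1 j' b ≤ ENNReal.ofReal (B * 2 ^ (α * j') * V) := by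
        refine (eLpNorm_le_eLpNorm_mul_rpow_measure_univ hp
          (continuous_lpBlock j' b).aestronglyMeasurable).trans ?_
        rw [ENNReal.ofReal_mul (by positivity), hV, ENNReal.ofReal_toReal hVt]
        gcongr
        exact hB j'
      have h2 : ‖pairCoef χ a b j j' k‖ₑ ≤ ENNReal.ofReal (((2 * Real.pi) ^ d)⁻¹ *
          ((A * 2 ^ (-(β * j))) * (B * 2 ^ (α * j') * V))) := by
        refine (enorm_fcoef_le _ k).trans ?_
        rw [ENNReal.ofReal_mul (by positivity), ENNReal.ofReal_mul (by positivity)]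
        gcongr
        exact (eLpNorm_lpBlock_mul_le a b j j').trans (mul_le_mul' (hA j) h1)
      rw [← ofReal_norm] at h2
      have h3 := (ENNReal.ofReal_le_ofReal_iff (by positivity)).1 h2
      refine h3.trans (le_of_eq ?_)
      rw [hD]; ring
  -- At a fixed frequency the array of pairs is absolutely summable, so in particular its sums over
  -- squares, which are the products of partial sums, converge.
  have hsum : Summable fun z : ℕ × ℕ => pairCoef χ a b z.1 z.2 k := by
    have h1 := (sum_finset_le_of_sum_range_le (pairWeight_nonneg α β n) (hC n)).mul_left D
    exact Summable.of_norm_bounded h1 fun z => hbound z.1 z.2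
  have hT : Tendsto (fun N : ℕ => Finset.range (N + 1) ×ˢ Finset.range (N + 1)) atTop atTop := by
    refine tendsto_atTop_finset_of_monotone (fun m n h => ?_) fun z => ⟨max z.1 z.2, ?_⟩
    · exact Finset.product_subset_product (Finset.range_mono (by omega))
        (Finset.range_mono (by omega))
    · simp only [Finset.mem_product, Finset.mem_range]; omega
  have hlim := hsum.hasSum.comp hT
  have heq : (fun N : ℕ => fcoef (fun x => lpPartial χ N a x * lpPartial χ N b x) k) =
      (fun u : Finset (ℕ × ℕ) => ∑ z ∈ u, pairCoef χ a b z.1 z.2 k) ∘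
        fun N : ℕ => Finset.range (N + 1) ×ˢ Finset.range (N + 1) := by
    ext N
    rw [fcoef_lpPartial_mul, Function.comp_apply, Finset.sum_product]
  rw [← heq] at hlim
  rw [prodCoef, hlim.limUnder_eq]
  exact hlim

end

theorem eLpNorm_trig_le_of_tendsto {S : Finset (Fin d → ℤ)} {p : ℝ≥0∞}
    {u : ℕ → (Fin d → ℤ) → ℂ} {v : (Fin d → ℤ) → ℂ}
    (h : ∀ k ∈ S, Tendsto (fun N => u N k) atTop (𝓝 (v k))) {B : ℝ≥0∞}
    (hB : ∀ N, eLpNorm (trig S (u N)) p (torusMeasure d) ≤ B) :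
    eLpNorm (trig S v) p (torusMeasure d) ≤ B := by
  refine Lp.eLpNorm_le_of_ae_tendsto (u := atTop) (f := fun N => trig S (u N))
    (Eventually.of_forall hB) (fun N => (memLp_trig S (u N) p).1) (Eventually.of_forall fun x => ?_)
  exact tendsto_finsetSum _ fun k hk => (h k hk).mul_const _

/-- The product estimate, after localization by a Fourier multiplier. -/
theorem exists_prodCoef_bound {α β : ℝ} (hα : 0 < α) (hαβ : α < β) (χ : DyadicPartition d) :
    ∃ C : ℝ, 0 ≤ C ∧ ∀ (p : ℝ≥0∞), 1 ≤ p → ∀ (a b : (Fin d → ℤ) → ℂ) (A B : ℝ), 0 ≤ A → 0 ≤ B →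
      (∀ j, blockNorm χ ∞ j a ≤ ENNReal.ofReal (A * 2 ^ (-(β * j)))) →
      (∀ j, blockNorm χ p j b ≤ ENNReal.ofReal (B * 2 ^ (α * j))) →
      ∀ (m : (Fin d → ℤ) → ℂ) (M : ℝ≥0∞) (n : ℕ), (∀ k, m k ≠ 0 → ‖freq k‖ ≤ 4 / 3 * 2 ^ n) →
      MultBound m M →
      eLpNorm (trig (box d (2 ^ (n + 1))) fun k => m k * prodCoef χ a b k) p (torusMeasure d) ≤
        M * ENNReal.ofReal (C * (A * B) * 2 ^ (α * n)) := by
  obtain ⟨C, hC0, hC⟩ := exists_sum_pairWeight_le hα hαβ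
  refine ⟨C, hC0, fun p hp a b A B hA0 hB0 hA hB m M n hm hM => ?_⟩
  have hmz : ∀ k ∉ box d (2 ^ (n + 1)), m k = 0 := by
    intro k hk
    by_contra h
    exact hk (mem_box_of_norm_freq_le (hm k h))
  refine eLpNorm_trig_le_of_tendsto
    (fun k _ => (tendsto_prodCoef hα hαβ hp hA0 hB0 hA hB k).const_mul (m k)) fun N => ?_
  simp only [fcoef_lpPartial_mul, Finset.mul_sum]
  -- For an interacting pair this is Hölder's inequality after the multiplier bound. For any other
  -- pair the multiplier vanishes wherever the product has a frequency.
  have hpair : ∀ j j', eLpNorm (trig (box d (2 ^ (n + 1))) fun k => m k * pairCoef χ a b j j' k) p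
      (torusMeasure d) ≤ M * ENNReal.ofReal (A * B * pairWeight α β n j j') := by
    intro j j'
    rw [pairWeight]
    split_ifs with hI
    · classical
      obtain ⟨S, hS, hSeq⟩ := lpBlock_mul_eq_trig (χ := χ) a b j j'
      have h1 : (trig (box d (2 ^ (n + 1))) fun k => m k * pairCoef χ a b j j' k) =
          trig S fun k => m k * pairCoef χ a b j j' k := by
        rw [← trig_subset (S := box d (2 ^ (n + 1))) (S' := box d (2 ^ (n + 1)) ∪ S)
          Finset.subset_union_left fun k _ hk => by rw [hmz k hk, zero_mul]]
        exact trig_subset Finset.subset_union_right fun k _ hk => by rw [hS k hk, mul_zero]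
      rw [h1]
      refine (hM p hp S _).trans ?_
      rw [← hSeq]
      gcongr
      refine (eLpNorm_lpBlock_mul_le a b j j').trans ((mul_le_mul' (hA j) (hB j')).trans ?_)
      rw [← ENNReal.ofReal_mul (by positivity)]
      exact ENNReal.ofReal_le_ofReal (le_of_eq (by ring))
    · have : (trig (box d (2 ^ (n + 1))) fun k => m k * pairCoef χ a b j j' k) = fun _ => 0 := by
        ext x
        refine Finset.sum_eq_zero fun k _ => ?_
        by_cases h : m k = 0
        · simp [h]
        · have : pairCoef χ a b j j' k = 0 := by
            by_contra h'
            exact hI (interacts_of_pairCoef_ne_zero (hm k h) h')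
          simp [this]
      rw [this]
      simp
  refine (eLpNorm_trig_sum_le hp _ _ _).trans ?_
  calc _ ≤ ∑ j ∈ Finset.range (N + 1), ∑ j' ∈ Finset.range (N + 1),
        M * ENNReal.ofReal (A * B * pairWeight α β n j j') :=
        Finset.sum_le_sum fun j _ => (eLpNorm_trig_sum_le hp _ _ _).trans
          (Finset.sum_le_sum fun j' _ => hpair j j')
    _ = M * ENNReal.ofReal (A * B * ∑ j ∈ Finset.range (N + 1), ∑ j' ∈ Finset.range (N + 1),
          pairWeight α β n j j') := by
        have hnn : ∀ j j', 0 ≤ A * B * pairWeight α β n j j' := fun j j' =>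
          mul_nonneg (mul_nonneg hA0 hB0) (pairWeight_nonneg _ _ _ _ _)
        simp_rw [Finset.mul_sum]
        rw [ENNReal.ofReal_sum_of_nonneg fun j _ => Finset.sum_nonneg fun j' _ => hnn j j',
          Finset.mul_sum]
        refine Finset.sum_congr rfl fun j _ => ?_
        rw [ENNReal.ofReal_sum_of_nonneg fun j' _ => hnn j j', Finset.mul_sum]
    _ ≤ _ := by
        refine mul_le_mul_right (ENNReal.ofReal_le_ofReal ?_) _
        calc _ ≤ A * B * (C * 2 ^ (α * n)) :=
              mul_le_mul_of_nonneg_left (hC n N) (mul_nonneg hA0 hB0)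
          _ = _ := by ring

end FluctuationSPDE

end

/-! ### The linear drift and its smoothing by the heat semigroup -/

noncomputable section

namespace FluctuationSPDE

variable {d : ℕ} {χ : DyadicPartition d}

/-! ### Measurability of Besov norms -/

theorem aemeasurable_eLpNorm_trig {Y : Type*} [MeasurableSpace Y] {ν : Measure Y} {p : ℝ≥0∞}
    (hp : 1 ≤ p) (S : Finset (Fin d → ℤ)) {c : Y → (Fin d → ℤ) → ℂ}
    (hc : ∀ k, AEMeasurable (fun y => c y k) ν) :
    AEMeasurable (fun y => eLpNorm (trig S (c y)) p (torusMeasure d)) ν := by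
  have : Fact (1 ≤ p) := ⟨hp⟩
  have key : ∀ a, eLpNorm (trig S a) p (torusMeasure d) = ‖∑ k ∈ S, a k •
      (memLp_of_continuous (continuous_fourierE k) p).toLp (fourierE k)‖ₑ :=
    fun a => by rw [← toLp_trig, Lp.enorm_toLp]
  simp_rw [key]
  refine AEStronglyMeasurable.enorm ?_
  exact Finset.aestronglyMeasurable_fun_sum _ fun k _ => (hc k).aestronglyMeasurable.smul_const _

theorem aemeasurable_blockNorm {Y : Type*} [MeasurableSpace Y] {ν : Measure Y} {p : ℝ≥0∞}
    (hp : 1 ≤ p) (j : ℕ) {c : Y → (Fin d → ℤ) → ℂ} (hc : ∀ k, AEMeasurable (fun y => c y k) ν) :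
    AEMeasurable (fun y => blockNorm χ p j (c y)) ν := by
  simp_rw [blockNorm_eq]
  exact aemeasurable_eLpNorm_trig hp _ fun k => (hc k).const_mul _

theorem aemeasurable_besovNorm {Y : Type*} [MeasurableSpace Y] {ν : Measure Y} {s : ℝ}
    {p q : ℝ≥0∞} (hp : 1 ≤ p) (hq : 1 ≤ q) {c : Y → (Fin d → ℤ) → ℂ}
    (hc : ∀ k, AEMeasurable (fun y => c y k) ν) :
    AEMeasurable (fun y => besovNorm χ s p q (c y)) ν := by
  simp_rw [besovNorm_eq]
  have h1 : ∀ j, AEMeasurable (fun y => weight s j * blockNorm χ p j (c y)) ν := fun j =>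
    (aemeasurable_blockNorm hp j hc).const_mul _
  rcases eq_or_ne q ∞ with rfl | hq'
  · simp_rw [eLpNorm_count_top]
    exact AEMeasurable.iSup h1
  · simp_rw [eLpNorm_count_rpow (zero_lt_one.trans_le hq).ne' hq']
    exact (AEMeasurable.tsum fun j => (h1 j).pow_const _).pow_const _

/-! ### Convolutions -/

theorem exists_bound_of_periodic {f : E d → ℂ} (hf : Continuous f) (hp : Periodic f) :
    ∃ C : ℝ, ∀ x, ‖f x‖ ≤ C := by
  have hfin := (memLp_of_continuous hf ∞).2
  refine ⟨(eLpNorm f ∞ (torusMeasure d)).toReal, fun x => ?_⟩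
  have := ENNReal.toReal_mono hfin.ne (enorm_le_eLpNorm_top hf hp x)
  simpa using this

theorem integrable_coord {K : E d → E d} (hK : Integrable K (torusMeasure d)) (i : Fin d) :
    Integrable (fun x => ((K x i : ℝ) : ℂ)) (torusMeasure d) :=
  ((EuclideanSpace.proj (𝕜 := ℝ) i).integrable_comp hK).ofReal

theorem two_pi_pow_mul_fcoef (f : E d → ℂ) (k : Fin d → ℤ) :
    (((2 * Real.pi) ^ d : ℝ) : ℂ) * fcoef f k = ∫ x, f x * fourierE (-k) x ∂torusMeasure d := by
  have h0 : (((2 * Real.pi) ^ d : ℝ) : ℂ) ≠ 0 := by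
    exact_mod_cast (by positivity : ((2 * Real.pi) ^ d : ℝ) ≠ 0)
  rw [fcoef, mul_inv_cancel_left₀ h0]

theorem multBound_convolution {f : E d → ℂ} (hf : Integrable f (torusMeasure d)) :
    MultBound (fun k => (((2 * Real.pi) ^ d : ℝ) : ℂ) * fcoef f k)
      (∫⁻ x, ‖f x‖ₑ ∂torusMeasure d) := by
  have := multBound_integral hf (τ := fun x : E d => -x) measurable_neg
  simp_rw [fourierE_neg_right] at this
  simp_rw [two_pi_pow_mul_fcoef]
  exact this

/-- Fubini is available since `K` is integrable and `f` bounded. The identity lets `K * ρ` inherit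
the `C^β` bound of `ρ` through the multiplier of `K`. -/
theorem fcoef_convFun {K : E d → E d} (hK : Periodic K) (hK1 : Integrable K (torusMeasure d))
    {f : E d → ℝ} (hf : Continuous f) (hfp : Periodic f) (i : Fin d) (k : Fin d → ℤ) :
    fcoef (fun x => (convFun K f x i : ℂ)) k =
      convCoef (fun x => (K x i : ℂ)) (fcoef fun x => (f x : ℂ)) k := by
  have h1 : ∀ x, (convFun K f x i : ℂ) =
      ∫ y, ((K y i : ℝ) : ℂ) * (f (x - y) : ℂ) ∂torusMeasure d := by
    intro x
    have hper : Periodic fun y => K y i * f (x - y) := by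
      intro l y
      have h := hfp (-l) (x - y)
      have h2 : x - y + (2 * Real.pi) • freq (-l) = x - (y + (2 * Real.pi) • freq l) := by
        have : freq (-l) = -(freq l : E d) := by ext i; simp [freq]
        rw [this, smul_neg]; abel
      rw [h2] at h
      simp only [hK l y, h]
    have := integral_torus_reflect hper x
    simp only [sub_sub_cancel] at this
    simp only [convFun]
    rw [this, ← integral_complex_ofReal]
    simp
  have hint := integrable_coord hK1 i
  have hfc : Continuous fun x => (f x : ℂ) := Complex.continuous_ofReal.comp hf
  obtain ⟨C, hC⟩ := exists_bound_of_periodic hfc (fun l x => by simp only [hfp l x])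
  have hC' : ∀ x, ‖(f x : ℂ)‖ ≤ C := hC
  rw [convCoef, two_pi_pow_mul_fcoef, fcoef, fcoef]
  simp_rw [h1, ← integral_mul_const]
  rw [integral_integral_swap]
  · have h2 : ∀ y, ∫ x, ((K y i : ℝ) : ℂ) * (f (x - y) : ℂ) * fourierE (-k) x ∂torusMeasure d =
        ((K y i : ℝ) : ℂ) * fourierE (-k) y * ∫ x, (f x : ℂ) * fourierE (-k) x ∂torusMeasure d := by
      intro y
      have hper : Periodic fun x => (f x : ℂ) * fourierE (-k) x := fun l x => by
        simp only [hfp l x, periodic_fourierE (-k) l x]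
      rw [← integral_torus_translate hper (-y), ← integral_const_mul]
      congr 1
      ext x
      rw [fourierE_add_right, fourierE_neg_right, neg_neg, ← sub_eq_add_neg]
      have := fourierE_neg_mul k y
      linear_combination (-((K y i : ℝ) : ℂ) * (f (x - y) : ℂ) * fourierE (-k) x) * this
    simp_rw [h2]
    rw [← integral_const_mul]
    congr 1
    ext x
    ring
  · have hswap : Integrable (fun z : E d × E d => ((K z.2 i : ℝ) : ℂ))
        ((torusMeasure d).prod (torusMeasure d)) := hint.comp_snd _
    have := hswap.mul_bdd (c := C) (g := fun z : E d × E d => (f (z.1 - z.2) : ℂ) * fourierE (-k) z.1)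
      (Continuous.aestronglyMeasurable ((hfc.comp (continuous_fst.sub continuous_snd)).mul
        ((continuous_fourierE (-k)).comp continuous_fst)))
      (Eventually.of_forall fun z => by
        rw [norm_mul, norm_fourierE, mul_one]; exact hC' _)
    simpa only [Function.uncurry_def, mul_assoc] using this

/-! ### The drift -/

/-- The coefficients of the linear drift are bounded by `R` in `C^β`, and `K` by `κ` in `L^1`. -/
structure CoefBound (χ : DyadicPartition d) (β R : ℝ) (κ : ℝ) (K F : E d → E d) (ρs : E d → ℝ) :
    Prop where
  density : ∀ j, blockNorm χ ∞ j (fcoef fun x => (ρs x : ℂ)) ≤ ENNReal.ofReal (R * 2 ^ (-(β * j)))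
  conv : ∀ i j, blockNorm χ ∞ j (fcoef fun x => (convFun K ρs x i : ℂ)) ≤
    ENNReal.ofReal (R * 2 ^ (-(β * j)))
  force : ∀ i j, blockNorm χ ∞ j (fcoef fun x => (F x i : ℂ)) ≤ ENNReal.ofReal (R * 2 ^ (-(β * j)))
  kernel : ∀ i, MultBound (fun k => (((2 * Real.pi) ^ d : ℝ) : ℂ) * fcoef (fun x => (K x i : ℂ)) k)
    (ENNReal.ofReal κ)

theorem blockNorm_convCoef_le {β R κ : ℝ} {K F : E d → E d} {ρs : E d → ℝ}
    (h : CoefBound χ β R κ K F ρs) (hκ : 0 ≤ κ) {p : ℝ≥0∞} (hp : 1 ≤ p) {u : (Fin d → ℤ) → ℂ}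
    {B α : ℝ} (hB : ∀ j, blockNorm χ p j u ≤ ENNReal.ofReal (B * 2 ^ (α * j))) (i : Fin d) (j : ℕ) :
    blockNorm χ p j (convCoef (fun x => (K x i : ℂ)) u) ≤
      ENNReal.ofReal (κ * B * 2 ^ (α * j)) := by
  refine ((h.kernel i).blockNorm_le hp j u).trans ?_
  rw [mul_assoc, ENNReal.ofReal_mul hκ]
  gcongr
  exact hB j

/-- The localized drift is bounded. -/
theorem exists_drift_bound {α β R κ : ℝ} (hα : 0 < α) (hαβ : α < β) (hR : 0 ≤ R) (hκ : 0 ≤ κ)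
    (χ : DyadicPartition d) :
    ∃ C : ℝ, 0 ≤ C ∧ ∀ (K F : E d → E d) (ρs : E d → ℝ), CoefBound χ β R κ K F ρs →
      ∀ (p : ℝ≥0∞), 1 ≤ p → ∀ (u : (Fin d → ℤ) → ℂ) (B : ℝ), 0 ≤ B →
      (∀ j, blockNorm χ p j u ≤ ENNReal.ofReal (B * 2 ^ (α * j))) →
      ∀ (m : (Fin d → ℤ) → ℂ) (M : ℝ≥0∞) (n : ℕ), (∀ k, m k ≠ 0 → ‖freq k‖ ≤ 4 / 3 * 2 ^ n) →
      MultBound m M → ∀ i,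
      eLpNorm (trig (box d (2 ^ (n + 1))) fun k => m k * driftCoef χ K F ρs u i k) p
        (torusMeasure d) ≤ M * ENNReal.ofReal (C * B * 2 ^ (α * n)) := by
  obtain ⟨C, hC0, hC⟩ := exists_prodCoef_bound hα hαβ χ
  refine ⟨C * (R * κ + R + R), by positivity, fun K F ρs h p hp u B hB0 hB m M n hm hM i => ?_⟩
  have h1 := hC p hp _ _ R (κ * B) hR (by positivity) h.density
    (blockNorm_convCoef_le h hκ hp hB i) m M n hm hM
  have h2 := hC p hp _ _ R B hR hB0 (h.conv i) hB m M n hm hM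
  have h3 := hC p hp _ _ R B hR hB0 (h.force i) hB m M n hm hM
  simp only [driftCoef, mul_add]
  refine (eLpNorm_trig_add_le hp _ _ _).trans
    ((add_le_add ((eLpNorm_trig_add_le hp _ _ _).trans (add_le_add h1 h2)) h3).trans (le_of_eq ?_))
  rw [← mul_add, ← mul_add, ← ENNReal.ofReal_add (by positivity) (by positivity),
    ← ENNReal.ofReal_add (by positivity) (by positivity)]
  congr 2
  ring

/-- A product is defined by `limUnder`, which is additive only where the limits exist; the block
bounds guarantee this for both arguments. The two integrability exponents need not agree. -/
theorem driftCoef_sub {α β R κ : ℝ} (hα : 0 < α) (hαβ : α < β) (hR : 0 ≤ R) (hκ : 0 ≤ κ)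
    {K F : E d → E d} {ρs : E d → ℝ} (h : CoefBound χ β R κ K F ρs) {p p' : ℝ≥0∞} (hp : 1 ≤ p)
    (hp' : 1 ≤ p') {u v : (Fin d → ℤ) → ℂ} {B B' : ℝ} (hB0 : 0 ≤ B) (hB0' : 0 ≤ B')
    (hB : ∀ j, blockNorm χ p j u ≤ ENNReal.ofReal (B * 2 ^ (α * j)))
    (hB' : ∀ j, blockNorm χ p' j v ≤ ENNReal.ofReal (B' * 2 ^ (α * j))) (i : Fin d)
    (k : Fin d → ℤ) :
    driftCoef χ K F ρs (u - v) i k = driftCoef χ K F ρs u i k - driftCoef χ K F ρs v i k := by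
  have key : ∀ (a b b' : (Fin d → ℤ) → ℂ) (A : ℝ), 0 ≤ A →
      (∀ j, blockNorm χ ∞ j a ≤ ENNReal.ofReal (A * 2 ^ (-(β * j)))) → ∀ D D' : ℝ, 0 ≤ D → 0 ≤ D' →
      (∀ j, blockNorm χ p j b ≤ ENNReal.ofReal (D * 2 ^ (α * j))) →
      (∀ j, blockNorm χ p' j b' ≤ ENNReal.ofReal (D' * 2 ^ (α * j))) →
      prodCoef χ a (b - b') k = prodCoef χ a b k - prodCoef χ a b' k := by
    intro a b b' A hA0 hA D D' hD hD' hb hb'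
    have h1 := (tendsto_prodCoef hα hαβ hp hA0 hD hA hb k).sub
      (tendsto_prodCoef hα hαβ hp' hA0 hD' hA hb' k)
    have hc : ∀ N (c : (Fin d → ℤ) → ℂ), Integrable
        (fun x => lpPartial χ N a x * lpPartial χ N c x) (torusMeasure d) := by
      intro N c
      rw [lpPartial_eq_trig, lpPartial_eq_trig]
      exact integrable_torus_of_continuous ((continuous_trig _ _).mul (continuous_trig _ _))
    rw [prodCoef]
    refine Tendsto.limUnder_eq (h1.congr fun N => ?_)
    rw [← fcoef_sub (hc N b) (hc N b')]
    congr 1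
    ext x
    rw [← mul_sub]
    congr 1
    rw [lpPartial_eq_trig, lpPartial_eq_trig, lpPartial_eq_trig, ← trig_sub]
    congr 2
    ext k
    simp [mul_sub]
  have hconv : convCoef (fun x => (K x i : ℂ)) (u - v) =
      convCoef (fun x => (K x i : ℂ)) u - convCoef (fun x => (K x i : ℂ)) v := by
    ext k; simp [convCoef, mul_sub]
  simp only [driftCoef]
  rw [hconv, key _ _ _ R hR h.density (κ * B) (κ * B') (by positivity) (by positivity)
      (blockNorm_convCoef_le h hκ hp hB i) (blockNorm_convCoef_le h hκ hp' hB' i),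
    key _ _ _ R hR (h.conv i) B B' hB0 hB0' hB hB', key _ _ _ R hR (h.force i) B B' hB0 hB0' hB hB']
  ring

/-- The heat semigroup is split into three equal times, one for each derivative, and `|k|²` is minus
the sum of the `(i k_l)²`. The first-order bound used three times then yields the rate `s^{-3/2}`.
-/
theorem freq_sq_mul_derivHeatSymbol (i : Fin d) (s : ℝ) (k : Fin d → ℤ) :
    ((‖freq k‖ ^ 2 : ℝ) : ℂ) * derivHeatSymbol i s k =
      ∑ l : Fin d, (-1 : ℂ) * (derivHeatSymbol l (s / 3) k * derivHeatSymbol l (s / 3) k *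
        derivHeatSymbol i (s / 3) k) := by
  have h1 : ‖freq k‖ ^ 2 = ∑ l, (k l : ℝ) ^ 2 := by
    rw [EuclideanSpace.norm_sq_eq]; simp [freq]
  have h2 : (Real.exp (-(s * ‖freq k‖ ^ 2)) : ℂ) = (Real.exp (-(s / 3 * ‖freq k‖ ^ 2)) : ℂ) ^ 3 := by
    rw [← Complex.ofReal_pow, ← Real.exp_nat_mul]; congr 2; push_cast; ring
  conv_lhs => rw [h1]
  rw [Complex.ofReal_sum, Finset.sum_mul]
  refine Finset.sum_congr rfl fun l _ => ?_
  simp only [derivHeatSymbol, h2]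
  push_cast
  linear_combination (((k l : ℂ) ^ 2 * Complex.I * (k i : ℂ) *
    (Complex.exp (-(s / 3 * ‖freq k‖ ^ 2))) ^ 3)) * Complex.I_sq

/-- These weights interpolate the rates `τ^{-1/2}` and `2^{-2j} τ^{-3/2}` to `2^{-j/2} τ^{-3/4}`: a
gain in `j` with a singularity that is still integrable. -/
theorem ofReal_le_geom_mean {X : ℝ≥0∞} {a b : ℝ} (ha : 0 ≤ a) (hb : 0 ≤ b)
    (h1 : X ≤ ENNReal.ofReal a) (h2 : X ≤ ENNReal.ofReal b) :
    X ≤ ENNReal.ofReal (a ^ (3 / 4 : ℝ) * b ^ (1 / 4 : ℝ)) := by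
  have h3 : X ≤ ENNReal.ofReal (min a b) := by
    rcases min_cases a b with ⟨h, -⟩ | ⟨h, -⟩ <;> rw [h] <;> assumption
  refine h3.trans (ENNReal.ofReal_le_ofReal ?_)
  have hm : 0 ≤ min a b := le_min ha hb
  calc min a b = min a b ^ (3 / 4 : ℝ) * min a b ^ (1 / 4 : ℝ) := by
        rw [← Real.rpow_add_of_nonneg hm (by norm_num) (by norm_num)]; norm_num
    _ ≤ _ := by
        gcongr
        · exact min_le_left _ _
        · exact min_le_right _ _

theorem blockNorm_gradHeat (p : ℝ≥0∞) (σ τ : ℝ) (V : Fin d → (Fin d → ℤ) → ℂ) (j : ℕ) :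
    blockNorm χ p j (gradHeatCoef σ τ V) = eLpNorm (trig (box d (2 ^ (j + 1))) fun k =>
      ∑ i, derivHeatSymbol i (σ * τ) k * (chiSymbol χ j k * V i k)) p (torusMeasure d) := by
  rw [blockNorm_eq]
  congr 2
  ext k
  rw [gradHeatCoef, Finset.mul_sum]
  refine Finset.sum_congr rfl fun i _ => ?_
  rw [derivHeatSymbol, heatSymbol]
  ring

set_option maxHeartbeats 1000000 in
/-- Smoothing of the drift by the heat semigroup: a gain of half a derivative at the price of the
singularity `τ^{-3/4}`. -/
theorem exists_gradHeat_drift_bound {α β R κ σ T : ℝ} (hα : 0 < α) (hαβ : α < β) (hR : 0 ≤ R)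
    (hκ : 0 ≤ κ) (hσ : 0 < σ) (hT : 0 < T) (χ : DyadicPartition d) :
    ∃ C : ℝ, 0 < C ∧ ∀ (K F : E d → E d) (ρs : E d → ℝ), CoefBound χ β R κ K F ρs →
      ∀ (p : ℝ≥0∞), 1 ≤ p → ∀ (u : (Fin d → ℤ) → ℂ) (τ : ℝ), 0 < τ → τ ≤ T → ∀ j : ℕ,
      weight (-α) j * blockNorm χ p j (gradHeatCoef σ τ (driftCoef χ K F ρs u)) ≤
        ENNReal.ofReal (C * 2 ^ (-(1 / 2 * (j : ℝ)))) * ENNReal.ofReal (τ ^ (-(3 / 4) : ℝ)) *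
          besovNorm χ (-α) p ∞ u := by
  obtain ⟨C₁, hC₁0, hC₁⟩ := exists_drift_bound (d := d) hα hαβ hR hκ χ
  obtain ⟨C₀, hC₀⟩ := exists_multBound_derivHeatSymbol d
  obtain ⟨M, hM, -⟩ := exists_multBound_chi χ
  obtain ⟨M', hM'⟩ := exists_multBound_invLaplacian χ
  -- `Q₁` is the constant of the bound with one derivative on the heat kernel, `Q₂` of the one with
  -- three. The outer `d` counts the components of the divergence, the inner one the terms of
  -- `|k|²`.
  set Q₁ : ℝ := d * (C₀ * σ ^ (-(1 / 2) : ℝ) * (M * C₁)) with hQ₁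
  set Q₂ : ℝ := d * (d * ((C₀ * (σ / 3) ^ (-(1 / 2) : ℝ)) ^ 3) * (M' * C₁)) with hQ₂
  have hQ₁0 : 0 ≤ Q₁ := by positivity
  have hQ₂0 : 0 ≤ Q₂ := by positivity
  -- The three summands serve the low block, the interpolated blocks and the strict positivity of
  -- `C`. The factor `2 ^ α` comes from the weight being indexed by `j - 1`.
  set C : ℝ := 2 ^ α * (Q₁ * T ^ (1 / 4 : ℝ) + Q₁ ^ (3 / 4 : ℝ) * Q₂ ^ (1 / 4 : ℝ) * 2 + 1) with hC
  have hCpos : 0 < C := by positivity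
  refine ⟨C, hCpos, fun K F ρs h p hp u τ hτ hτT j => ?_⟩
  rcases eq_or_ne (besovNorm χ (-α) p ∞ u) ∞ with hinf | hfin
  · rw [hinf, ENNReal.mul_top]
    · exact le_top
    · refine mul_ne_zero ?_ ?_ <;> rw [Ne, ENNReal.ofReal_eq_zero, not_le] <;> positivity
  set B := (besovNorm χ (-α) p ∞ u).toReal with hBdef
  have hB0 : 0 ≤ B := ENNReal.toReal_nonneg
  have hB : ∀ j, blockNorm χ p j u ≤ ENNReal.ofReal (B * 2 ^ (α * j)) := by
    intro j
    refine (blockNorm_le (q := ∞) (by simp) (-α) p j u).trans ?_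
    rw [mul_comm, ENNReal.ofReal_mul hB0, hBdef, ENNReal.ofReal_toReal hfin, neg_neg, weight]
    exact mul_le_mul' le_rfl (ENNReal.ofReal_le_ofReal
      (Real.rpow_le_rpow_of_exponent_le (by norm_num) (by nlinarith)))
  have hτ2 : (σ * τ) ^ (-(1 / 2) : ℝ) = σ ^ (-(1 / 2) : ℝ) * τ ^ (-(1 / 2) : ℝ) :=
    Real.mul_rpow hσ.le hτ.le
  have hτ3 : (σ * τ / 3) ^ (-(1 / 2) : ℝ) = (σ / 3) ^ (-(1 / 2) : ℝ) * τ ^ (-(1 / 2) : ℝ) := by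
    rw [← Real.mul_rpow (by positivity) hτ.le]; ring_nf
  -- the crude bound
  have hI : blockNorm χ p j (gradHeatCoef σ τ (driftCoef χ K F ρs u)) ≤
      ENNReal.ofReal (Q₁ * τ ^ (-(1 / 2) : ℝ) * (B * 2 ^ (α * j))) := by
    rw [blockNorm_gradHeat]
    refine (eLpNorm_trig_sum_le hp _ _ _).trans ?_
    have hi : ∀ i, eLpNorm (trig (box d (2 ^ (j + 1))) fun k =>
        derivHeatSymbol i (σ * τ) k * (chiSymbol χ j k * driftCoef χ K F ρs u i k)) p
        (torusMeasure d) ≤ ENNReal.ofReal (C₀ * (σ * τ) ^ (-(1 / 2) : ℝ) *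
          (M * (C₁ * B * 2 ^ (α * j)))) := by
      intro i
      refine (hC₀ i (σ * τ) (by positivity) p hp _ _).trans ?_
      rw [ENNReal.ofReal_mul (by positivity), ENNReal.ofReal_mul (by positivity),
        ENNReal.ofReal_mul (by positivity), ENNReal.ofReal_coe_nnreal, ENNReal.ofReal_coe_nnreal]
      gcongr
      exact hC₁ K F ρs h p hp u B hB0 hB _ M j (fun k hk => norm_freq_le_of_chiSymbol hk) (hM j) i
    refine (Finset.sum_le_sum fun i _ => hi i).trans (le_of_eq ?_)
    rw [Finset.sum_const, Finset.card_univ, Fintype.card_fin, ← ENNReal.ofReal_nsmul, nsmul_eq_mul,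
      hτ2, hQ₁]
    congr 1
    ring
  -- the bound with a gain
  have hII : ∀ n, j = n + 1 → blockNorm χ p j (gradHeatCoef σ τ (driftCoef χ K F ρs u)) ≤
      ENNReal.ofReal (Q₂ * ((((2 : ℝ) ^ n)⁻¹) ^ 2 * (τ ^ (-(1 / 2) : ℝ)) ^ 3) *
        (B * 2 ^ (α * j))) := by
    rintro n rfl
    rw [blockNorm_gradHeat]
    refine (eLpNorm_trig_sum_le hp _ _ _).trans ?_
    have hi : ∀ i, eLpNorm (trig (box d (2 ^ (n + 1 + 1))) fun k =>
        derivHeatSymbol i (σ * τ) k * (chiSymbol χ (n + 1) k * driftCoef χ K F ρs u i k)) p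
        (torusMeasure d) ≤ ENNReal.ofReal ((((2 : ℝ) ^ n)⁻¹) ^ 2 *
          (d * ((C₀ * (σ * τ / 3) ^ (-(1 / 2) : ℝ)) ^ 3) *
          (M' * (C₁ * B * 2 ^ (α * (n + 1 : ℕ)))))) := by
      intro i
      set D : ℝ≥0∞ := C₀ * ENNReal.ofReal ((σ * τ / 3) ^ (-(1 / 2) : ℝ)) with hD
      have h3 := fun l : Fin d => hC₀ l (σ * τ / 3) (by positivity)
      have hmult : MultBound (fun k => ((‖freq k‖ ^ 2 : ℝ) : ℂ) * derivHeatSymbol i (σ * τ) k)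
          (∑ l : Fin d, ‖(-1 : ℂ)‖ₑ * (D * D * D)) := by
        simp_rw [freq_sq_mul_derivHeatSymbol]
        exact MultBound.sum _ fun l _ => (((h3 l).mul (h3 l)).mul (h3 i)).const_mul (-1)
      have heq : (fun k => derivHeatSymbol i (σ * τ) k *
          (chiSymbol χ (n + 1) k * driftCoef χ K F ρs u i k)) = fun k =>
          ((((2 : ℝ) ^ n)⁻¹ ^ 2 : ℝ) : ℂ) * ((((‖freq k‖ ^ 2 : ℝ) : ℂ) *
            derivHeatSymbol i (σ * τ) k) * (invLaplacianSymbol χ n k *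
              driftCoef χ K F ρs u i k)) := by
        ext k
        rw [chiSymbol_succ_eq]; ring
      rw [heq, eLpNorm_trig_const_mul, ENNReal.ofReal_mul (by positivity)]
      refine mul_le_mul' (le_of_eq ?_) ?_
      · rw [← ofReal_norm, Complex.norm_real, Real.norm_of_nonneg (by positivity)]
      refine (hmult p hp _ _).trans ?_
      rw [ENNReal.ofReal_mul (by positivity), ENNReal.ofReal_mul (p := (M' : ℝ)) (by positivity)]
      refine mul_le_mul' (le_of_eq ?_) ?_
      · rw [ENNReal.ofReal_mul (by positivity), ENNReal.ofReal_pow (by positivity),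
          ENNReal.ofReal_mul (by positivity), ENNReal.ofReal_coe_nnreal, ← hD]
        simp
        ring
      · rw [ENNReal.ofReal_coe_nnreal]
        exact hC₁ K F ρs h p hp u B hB0 hB _ M' (n + 1) (fun k hk => invLaplacianSymbol_ne_zero hk)
          (hM' n) i
    refine (Finset.sum_le_sum fun i _ => hi i).trans (le_of_eq ?_)
    rw [Finset.sum_const, Finset.card_univ, Fintype.card_fin, ← ENNReal.ofReal_nsmul, nsmul_eq_mul,
      hτ3, hQ₂]
    congr 1
    ring
  have hw : weight (-α) j * ENNReal.ofReal (2 ^ (α * j)) = ENNReal.ofReal (2 ^ α) := by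
    rw [weight, ← ENNReal.ofReal_mul (by positivity), ← Real.rpow_add two_pos]
    congr 2; ring
  have hBB : besovNorm χ (-α) p ∞ u = ENNReal.ofReal B := by
    rw [hBdef, ENNReal.ofReal_toReal hfin]
  suffices hs : blockNorm χ p j (gradHeatCoef σ τ (driftCoef χ K F ρs u)) ≤
      ENNReal.ofReal ((C / 2 ^ α) * 2 ^ (-(1 / 2 * (j : ℝ))) * τ ^ (-(3 / 4) : ℝ) *
        (B * 2 ^ (α * j))) by
    refine (mul_le_mul_right hs _).trans (le_of_eq ?_)
    rw [← mul_assoc _ B, ENNReal.ofReal_mul (by positivity), mul_left_comm, hw, hBB,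
      ← ENNReal.ofReal_mul (by positivity), ← ENNReal.ofReal_mul (by positivity),
      ← ENNReal.ofReal_mul (by positivity)]
    congr 1
    field_simp
  have hC2 : C / 2 ^ α = Q₁ * T ^ (1 / 4 : ℝ) + Q₁ ^ (3 / 4 : ℝ) * Q₂ ^ (1 / 4 : ℝ) * 2 + 1 := by
    rw [hC]; field_simp
  rw [hC2]
  have hX : 0 ≤ B * (2 : ℝ) ^ (α * j) := by positivity
  have hτ34 : 0 < τ ^ (-(3 / 4) : ℝ) := by positivity
  -- The low block lives on a ball, where nothing is gained from `|k|²`; there `τ ≤ T` converts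
  -- `τ^{-1/2}` into `τ^{-3/4}`.
  rcases j with _ | n
  · refine hI.trans (ENNReal.ofReal_le_ofReal (mul_le_mul_of_nonneg_right ?_ hX))
    have h1 : τ ^ (-(1 / 2) : ℝ) ≤ T ^ (1 / 4 : ℝ) * τ ^ (-(3 / 4) : ℝ) := by
      calc τ ^ (-(1 / 2) : ℝ) = τ ^ (1 / 4 : ℝ) * τ ^ (-(3 / 4) : ℝ) := by
            rw [← Real.rpow_add hτ]; norm_num
        _ ≤ _ := by gcongr
    have h2 : 0 ≤ Q₁ ^ (3 / 4 : ℝ) * Q₂ ^ (1 / 4 : ℝ) * 2 + 1 := by positivity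
    simp only [CharP.cast_eq_zero, mul_zero, neg_zero, Real.rpow_zero, mul_one]
    nlinarith [mul_le_mul_of_nonneg_left h1 hQ₁0]
  · refine (ofReal_le_geom_mean (by positivity) (by positivity) hI (hII n rfl)).trans
      (ENNReal.ofReal_le_ofReal ?_)
    set t := τ ^ (-(1 / 2) : ℝ) with ht
    have ht0 : 0 < t := by positivity
    have e1 : t ^ (3 / 4 : ℝ) * (t ^ 3) ^ (1 / 4 : ℝ) = τ ^ (-(3 / 4) : ℝ) := by
      rw [← Real.rpow_natCast t 3, ← Real.rpow_mul ht0.le, ← Real.rpow_add ht0, ht,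
        ← Real.rpow_mul hτ.le]
      norm_num
    have e2 : ((((2 : ℝ) ^ n)⁻¹) ^ 2) ^ (1 / 4 : ℝ) ≤ 2 * 2 ^ (-(1 / 2 * ((n + 1 : ℕ) : ℝ))) := by
      have : (((2 : ℝ) ^ n)⁻¹) ^ 2 = 2 ^ (-(2 * n) : ℝ) := by
        rw [Real.rpow_neg (by norm_num), inv_pow, ← pow_mul, ← Real.rpow_natCast]
        congr 2; push_cast; ring
      rw [this, ← Real.rpow_mul (by norm_num)]
      calc (2 : ℝ) ^ (-(2 * (n : ℝ)) * (1 / 4)) ≤ 2 ^ (1 + -(1 / 2 * ((n + 1 : ℕ) : ℝ))) :=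
            Real.rpow_le_rpow_of_exponent_le (by norm_num) (by push_cast; linarith)
        _ = _ := by rw [Real.rpow_add two_pos, Real.rpow_one]
    set X := B * (2 : ℝ) ^ (α * ((n + 1 : ℕ) : ℝ)) with hXdef
    have e3 : X ^ (3 / 4 : ℝ) * X ^ (1 / 4 : ℝ) = X := by
      rw [← Real.rpow_add_of_nonneg hX (by norm_num) (by norm_num)]; norm_num
    have hb0 : (0:ℝ) ≤ ((2 : ℝ) ^ n)⁻¹ ^ 2 := by positivity
    rw [Real.mul_rpow (by positivity) hX, Real.mul_rpow hQ₁0 ht0.le,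
      Real.mul_rpow (mul_nonneg hQ₂0 (by positivity)) hX, Real.mul_rpow hQ₂0 (by positivity),
      Real.mul_rpow hb0 (by positivity)]
    set y := ((((2 : ℝ) ^ n)⁻¹) ^ 2) ^ (1 / 4 : ℝ) with hy
    set G := Q₁ ^ (3 / 4 : ℝ) * Q₂ ^ (1 / 4 : ℝ) with hG
    have hG0 : 0 ≤ G := by positivity
    have hy0 : 0 ≤ y := by positivity
    calc _ = G * y * (t ^ (3 / 4 : ℝ) * (t ^ 3) ^ (1 / 4 : ℝ)) *
          (X ^ (3 / 4 : ℝ) * X ^ (1 / 4 : ℝ)) := by rw [hG]; ring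
      _ = G * y * τ ^ (-(3 / 4) : ℝ) * X := by rw [e1, e3]
      _ ≤ G * (2 * 2 ^ (-(1 / 2 * ((n + 1 : ℕ) : ℝ)))) * τ ^ (-(3 / 4) : ℝ) * X := by gcongr
      _ = G * 2 * 2 ^ (-(1 / 2 * ((n + 1 : ℕ) : ℝ))) * τ ^ (-(3 / 4) : ℝ) * X := by ring
      _ ≤ _ := by
          gcongr
          have : 0 ≤ Q₁ * T ^ (1 / 4 : ℝ) := by positivity
          linarith

end FluctuationSPDE

end

noncomputable section

namespace FluctuationSPDE

variable {d : ℕ} {χ : DyadicPartition d}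

/-! ### The drift along a path -/

/-- Uniform bounds and weak continuity in time of the coefficients of the linear drift. -/
structure DriftData (χ : DyadicPartition d) (T σ β R κ : ℝ) (K F : E d → E d)
    (ρ : ℝ → E d → ℝ) : Prop where
  time_pos : 0 < T
  sigma_pos : 0 < σ
  R_nonneg : 0 ≤ R
  kappa_nonneg : 0 ≤ κ
  bound : ∀ s ∈ Icc 0 T, CoefBound χ β R κ K F (ρ s)
  density_cont : ∀ k, ContinuousOn (fun s => fcoef (fun x => (ρ s x : ℂ)) k) (Icc 0 T)
  conv_cont : ∀ i k, ContinuousOn (fun s => fcoef (fun x => (convFun K (ρ s) x i : ℂ)) k) (Icc 0 T)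

/-- Weakly measurable paths in `L^1([0,T], B^{-α}_{p,∞})`. -/
structure AdmPath (χ : DyadicPartition d) (T α : ℝ) (p : ℝ≥0∞) (c : ℝ → (Fin d → ℤ) → ℂ) :
    Prop where
  meas : ∀ k, AEMeasurable (fun s => c s k) (volume.restrict (Icc 0 T))
  finite : ∫⁻ s in Icc 0 T, besovNorm χ (-α) p ∞ (c s) ≠ ∞

/-- The time-integrated drift, `∫₀ᵗ ∇Γ_{t-s} * (drift of c_s) ds`. -/
def driftInt (χ : DyadicPartition d) (σ : ℝ) (K F : E d → E d) (ρ : ℝ → E d → ℝ)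
    (c : ℝ → (Fin d → ℤ) → ℂ) (t : ℝ) (k : Fin d → ℤ) : ℂ :=
  ∫ s in (0 : ℝ)..t, gradHeatCoef σ (t - s) (driftCoef χ K F (ρ s) (c s)) k

theorem norm_freq_le_of_lowSymbol {N : ℕ} {k : Fin d → ℤ} (h : lowSymbol χ N k ≠ 0) :
    ‖freq k‖ ≤ 4 / 3 * 2 ^ N := by
  rw [lowSymbol_eq] at h
  have h1 := χ.supp_low (((2 : ℝ) ^ N)⁻¹ • freq k) (by exact_mod_cast h)
  rw [norm_smul, norm_inv, norm_pow, Real.norm_ofNat, inv_mul_le_iff₀ (by positivity)] at h1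
  linarith

theorem bound_of_besovNorm {α : ℝ} {p : ℝ≥0∞} {u : (Fin d → ℤ) → ℂ}
    (hu : besovNorm χ (-α) p ∞ u ≠ ∞) : ∃ B : ℝ, 0 ≤ B ∧
      ENNReal.ofReal B = 2 ^ |α| * besovNorm χ (-α) p ∞ u ∧
      ∀ j, blockNorm χ p j u ≤ ENNReal.ofReal (B * 2 ^ (α * j)) := by
  set b := (besovNorm χ (-α) p ∞ u).toReal with hb
  have hb0 : 0 ≤ b := ENNReal.toReal_nonneg
  have hbb : besovNorm χ (-α) p ∞ u = ENNReal.ofReal b := (ENNReal.ofReal_toReal hu).symm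
  refine ⟨2 ^ |α| * b, by positivity, ?_, fun j => ?_⟩
  · rw [hbb, ENNReal.ofReal_mul (by positivity), ← ENNReal.ofReal_rpow_of_pos two_pos]
    simp
  · refine (blockNorm_le (q := ∞) (by simp) (-α) p j u).trans ?_
    rw [hbb, neg_neg, weight, ← ENNReal.ofReal_mul (by positivity)]
    refine ENNReal.ofReal_le_ofReal ?_
    rw [mul_right_comm, ← Real.rpow_add two_pos]
    refine mul_le_mul_of_nonneg_right (Real.rpow_le_rpow_of_exponent_le (by norm_num) ?_) hb0
    linarith [neg_abs_le α]

/-- Every Fourier coefficient of the drift is controlled by the Besov norm. -/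
theorem exists_driftCoef_bound {α β R κ : ℝ} (hα : 0 < α) (hαβ : α < β) (hR : 0 ≤ R) (hκ : 0 ≤ κ)
    (χ : DyadicPartition d) (k : Fin d → ℤ) :
    ∃ C : NNReal, ∀ (K F : E d → E d) (ρs : E d → ℝ), CoefBound χ β R κ K F ρs →
      ∀ u i, besovNorm χ (-α) 1 ∞ u ≠ ∞ →
        ‖driftCoef χ K F ρs u i k‖ₑ ≤ C * besovNorm χ (-α) 1 ∞ u := by
  obtain ⟨C, hC0, hC⟩ := exists_drift_bound (d := d) hα hαβ hR hκ χ
  obtain ⟨M, -, hM⟩ := exists_multBound_chi χ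
  -- For such `n` the low-frequency multiplier equals one at `k`, so the localized drift has the
  -- wanted coefficient.
  obtain ⟨n, hn⟩ : ∃ n : ℕ, ‖freq k‖ < 3 / 8 * 2 ^ (n + 1) := by
    obtain ⟨n, hn⟩ := pow_unbounded_of_one_lt (‖freq k‖ * (8 / 3)) (one_lt_two)
    refine ⟨n, ?_⟩
    rw [pow_succ]
    have : (0:ℝ) < 2 ^ n := by positivity
    linarith
  have hlow : lowSymbol χ n k = 1 := lowSymbol_eq_one hn
  have hmem : k ∈ box d (2 ^ (n + 1)) := by
    by_contra hk
    rw [lowSymbol_eq_zero_of_notMem hk] at hlow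
    exact zero_ne_one hlow
  refine ⟨Real.toNNReal (((2 * Real.pi) ^ d)⁻¹) * (M * (Real.toNNReal (C * 2 ^ (α * n)) * 2 ^ |α|)),
    fun K F ρs h u i hu => ?_⟩
  obtain ⟨B, hB0, hBu, hB⟩ := bound_of_besovNorm hu
  have h1 := hC K F ρs h 1 le_rfl u B hB0 hB _ M n (fun k hk => norm_freq_le_of_lowSymbol hk)
    (hM n) i
  have h2 := enorm_fcoef_le (trig (box d (2 ^ (n + 1)))
    fun k => lowSymbol χ n k * driftCoef χ K F ρs u i k) k
  rw [fcoef_trig, if_pos hmem, hlow, one_mul] at h2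
  refine h2.trans ((mul_le_mul_right h1 _).trans (le_of_eq ?_))
  rw [mul_right_comm C, ENNReal.ofReal_mul (by positivity), hBu]
  push_cast
  simp only [ENNReal.ofReal]
  rw [ENNReal.coe_rpow_of_nonneg _ (abs_nonneg α)]
  push_cast
  ring

/-! ### Measurability, integrability and continuity of the drift along admissible paths -/

section Path

variable {T σ β R κ : ℝ} {K F : E d → E d} {ρ : ℝ → E d → ℝ}

theorem AdmPath.ae_finite {α : ℝ} {p : ℝ≥0∞} (hp : 1 ≤ p) {c : ℝ → (Fin d → ℤ) → ℂ}
    (hc : AdmPath χ T α p c) :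
    ∀ᵐ s ∂volume.restrict (Icc 0 T), besovNorm χ (-α) p ∞ (c s) ≠ ∞ := by
  filter_upwards [ae_lt_top' (aemeasurable_besovNorm hp le_top hc.meas) hc.finite] with s hs
  exact hs.ne

/-- The product is an almost everywhere limit of finite bilinear expressions in the coefficients,
which are measurable. -/
theorem aemeasurable_prodCoef {α A : ℝ} (hα : 0 < α) (hαβ : α < β) {p : ℝ≥0∞} (hp : 1 ≤ p)
    (hA0 : 0 ≤ A) {a b : ℝ → (Fin d → ℤ) → ℂ}
    (ha : ∀ k, AEMeasurable (fun s => a s k) (volume.restrict (Icc 0 T)))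
    (hb : ∀ k, AEMeasurable (fun s => b s k) (volume.restrict (Icc 0 T)))
    (hA : ∀ s ∈ Icc 0 T, ∀ j, blockNorm χ ∞ j (a s) ≤ ENNReal.ofReal (A * 2 ^ (-(β * j))))
    (hB : ∀ᵐ s ∂volume.restrict (Icc 0 T), ∃ B : ℝ, 0 ≤ B ∧
      ∀ j, blockNorm χ p j (b s) ≤ ENNReal.ofReal (B * 2 ^ (α * j))) (k : Fin d → ℤ) :
    AEMeasurable (fun s => prodCoef χ (a s) (b s) k) (volume.restrict (Icc 0 T)) := by
  refine aemeasurable_of_tendsto_metrizable_ae atTop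
    (f := fun N s => fcoef (fun x => lpPartial χ N (a s) x * lpPartial χ N (b s) x) k)
    (fun N => ?_) ?_
  · simp_rw [fcoef_lpPartial_mul]
    refine Finset.aemeasurable_fun_sum (M := ℂ) _ fun j _ =>
      Finset.aemeasurable_fun_sum (M := ℂ) _ fun j' _ => ?_
    simp only [pairCoef, lpBlock_eq_trig, fcoef_trig_mul_trig]
    refine Finset.aemeasurable_fun_sum (M := ℂ) _ fun l _ =>
      Finset.aemeasurable_fun_sum (M := ℂ) _ fun l' _ => ?_
    split_ifs
    · exact ((ha l).const_mul _).mul ((hb l').const_mul _)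
    · exact aemeasurable_const
  · filter_upwards [hB, ae_restrict_mem measurableSet_Icc] with s ⟨B, hB0, hB⟩ hs
    exact tendsto_prodCoef hα hαβ hp hA0 hB0 (hA s hs) hB k

theorem aemeasurable_driftCoef (h : DriftData χ T σ β R κ K F ρ) {α : ℝ} (hα : 0 < α)
    (hαβ : α < β) {p : ℝ≥0∞} (hp : 1 ≤ p) {c : ℝ → (Fin d → ℤ) → ℂ} (hc : AdmPath χ T α p c)
    (i : Fin d) (k : Fin d → ℤ) :
    AEMeasurable (fun s => driftCoef χ K F (ρ s) (c s) i k) (volume.restrict (Icc 0 T)) := by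
  have hB : ∀ᵐ s ∂volume.restrict (Icc 0 T), ∃ B : ℝ, 0 ≤ B ∧
      ∀ j, blockNorm χ p j (c s) ≤ ENNReal.ofReal (B * 2 ^ (α * j)) := by
    filter_upwards [hc.ae_finite hp] with s hs
    obtain ⟨B, hB0, -, hB⟩ := bound_of_besovNorm hs
    exact ⟨B, hB0, hB⟩
  have hcont : ∀ {f : ℝ → ℂ}, ContinuousOn f (Icc 0 T) →
      AEMeasurable f (volume.restrict (Icc 0 T)) := fun hf => hf.aemeasurable measurableSet_Icc
  have h2 := aemeasurable_prodCoef hα hαβ hp h.R_nonneg (fun k => hcont (h.conv_cont i k)) hc.meas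
    (fun s hs => (h.bound s hs).conv i) hB k
  have h3 := aemeasurable_prodCoef (a := fun _ => fcoef fun x => (F x i : ℂ)) hα hαβ hp h.R_nonneg
    (fun k => aemeasurable_const) hc.meas (fun s hs => (h.bound s hs).force i) hB k
  refine AEMeasurable.add (AEMeasurable.add ?_ h2) h3
  refine aemeasurable_prodCoef hα hαβ hp h.R_nonneg (fun k => hcont (h.density_cont k))
    (fun k => ?_) (fun s hs => (h.bound s hs).density) ?_ k
  · exact (hc.meas k).const_mul _
  · filter_upwards [hB, ae_restrict_mem measurableSet_Icc] with s ⟨B, hB0, hB⟩ hs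
    exact ⟨κ * B, mul_nonneg h.kappa_nonneg hB0,
      blockNorm_convCoef_le (h.bound s hs) h.kappa_nonneg hp hB i⟩

/-- Admissible paths stay admissible with lower integrability and regularity. -/
theorem AdmPath.mono {α α' : ℝ} (hα : α ≤ α') {p : ℝ≥0∞} (hp : 1 ≤ p) {c : ℝ → (Fin d → ℤ) → ℂ}
    (hc : AdmPath χ T α p c) : AdmPath χ T α' 1 c := by
  refine ⟨hc.meas, ?_⟩
  refine ne_top_of_le_ne_top ?_ (lintegral_mono fun s =>
    besovNorm_one_top_le (neg_le_neg hα) hp (q := ∞) (by simp) (c s))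
  rw [lintegral_const_mul' _ _ (ENNReal.mul_ne_top ENNReal.ofReal_ne_top (torusVol_rpow_ne_top d _))]
  exact ENNReal.mul_ne_top (ENNReal.mul_ne_top ENNReal.ofReal_ne_top (torusVol_rpow_ne_top d _))
    hc.finite

theorem exists_driftCoef_integral_bound (h : DriftData χ T σ β R κ K F ρ) {α : ℝ} (hα : 0 < α)
    (hαβ : α < β) (k : Fin d → ℤ) : ∃ C : NNReal, ∀ c, AdmPath χ T α 1 c → ∀ i,
      Integrable (fun s => driftCoef χ K F (ρ s) (c s) i k) (volume.restrict (Icc 0 T)) ∧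
      ∫⁻ s in Icc 0 T, ‖driftCoef χ K F (ρ s) (c s) i k‖ₑ ≤
        C * ∫⁻ s in Icc 0 T, besovNorm χ (-α) 1 ∞ (c s) := by
  obtain ⟨C, hC⟩ := exists_driftCoef_bound hα hαβ h.R_nonneg h.kappa_nonneg χ k
  refine ⟨C, fun c hc i => ?_⟩
  have hle : ∫⁻ s in Icc 0 T, ‖driftCoef χ K F (ρ s) (c s) i k‖ₑ ≤
        C * ∫⁻ s in Icc 0 T, besovNorm χ (-α) 1 ∞ (c s) := by
    rw [← lintegral_const_mul' _ _ ENNReal.coe_ne_top]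
    refine lintegral_mono_ae ?_
    filter_upwards [hc.ae_finite le_rfl, ae_restrict_mem measurableSet_Icc] with s hs hs'
    exact hC K F (ρ s) (h.bound s hs') (c s) i hs
  exact ⟨⟨(aemeasurable_driftCoef h hα hαβ le_rfl hc i k).aestronglyMeasurable,
    hle.trans_lt (ENNReal.mul_lt_top ENNReal.coe_lt_top hc.finite.lt_top)⟩, hle⟩

/-- At a fixed frequency the heat factor splits into a function of `t` and one of `s`. The
integrated drift becomes a smooth factor times a primitive, whence its continuity in time. -/
theorem gradHeatCoef_eq (σ t s : ℝ) (V : Fin d → (Fin d → ℤ) → ℂ) (k : Fin d → ℤ) :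
    gradHeatCoef σ (t - s) V k = (Real.exp (-(σ * t * ‖freq k‖ ^ 2)) : ℂ) *
      ((Real.exp (σ * s * ‖freq k‖ ^ 2) : ℂ) * ∑ i, Complex.I * (k i : ℂ) * V i k) := by
  rw [gradHeatCoef, ← mul_assoc, ← Complex.ofReal_mul, ← Real.exp_add, Finset.mul_sum]
  refine Finset.sum_congr rfl fun i _ => ?_
  rw [heatSymbol, show -(σ * t * ‖freq k‖ ^ 2) + σ * s * ‖freq k‖ ^ 2 =
    -(σ * (t - s) * ‖freq k‖ ^ 2) by ring]
  ring

theorem integrable_exp_mul_driftCoef (h : DriftData χ T σ β R κ K F ρ) {α : ℝ} (hα : 0 < α)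
    (hαβ : α < β) {c : ℝ → (Fin d → ℤ) → ℂ} (hc : AdmPath χ T α 1 c) (k : Fin d → ℤ) :
    IntegrableOn (fun s => (Real.exp (σ * s * ‖freq k‖ ^ 2) : ℂ) *
      ∑ i, Complex.I * (k i : ℂ) * driftCoef χ K F (ρ s) (c s) i k) (Icc 0 T) := by
  obtain ⟨C, hC⟩ := exists_driftCoef_integral_bound h hα hαβ k
  have h1 : Integrable (fun s => ∑ i, Complex.I * (k i : ℂ) * driftCoef χ K F (ρ s) (c s) i k)
      (volume.restrict (Icc 0 T)) := integrable_finsetSum _ fun i _ => (hC c hc i).1.const_mul _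
  refine h1.bdd_mul (c := Real.exp (σ * T * ‖freq k‖ ^ 2)) ?_ ?_
  · exact Continuous.aestronglyMeasurable (by fun_prop)
  · filter_upwards [ae_restrict_mem measurableSet_Icc] with s hs
    rw [Complex.norm_real, Real.norm_of_nonneg (Real.exp_pos _).le]
    refine Real.exp_le_exp.2 ?_
    have := h.sigma_pos
    gcongr
    exact hs.2

theorem driftInt_eq (c : ℝ → (Fin d → ℤ) → ℂ) (t : ℝ) (k : Fin d → ℤ) :
    driftInt χ σ K F ρ c t k = (Real.exp (-(σ * t * ‖freq k‖ ^ 2)) : ℂ) *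
      ∫ s in (0 : ℝ)..t, (Real.exp (σ * s * ‖freq k‖ ^ 2) : ℂ) *
        ∑ i, Complex.I * (k i : ℂ) * driftCoef χ K F (ρ s) (c s) i k := by
  simp only [driftInt, gradHeatCoef_eq]
  rw [intervalIntegral.integral_const_mul]

theorem continuousOn_driftInt (h : DriftData χ T σ β R κ K F ρ) {α : ℝ} (hα : 0 < α)
    (hαβ : α < β) {c : ℝ → (Fin d → ℤ) → ℂ} (hc : AdmPath χ T α 1 c) (k : Fin d → ℤ) :
    ContinuousOn (fun t => driftInt χ σ K F ρ c t k) (Icc 0 T) := by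
  simp only [driftInt_eq]
  refine ContinuousOn.mul (Continuous.continuousOn (by fun_prop)) ?_
  have := intervalIntegral.continuousOn_primitive_interval
    (μ := volume) (a := 0) (b := T) (by
      rw [uIcc_of_le h.time_pos.le]
      exact integrable_exp_mul_driftCoef h hα hαβ hc k)
  rwa [uIcc_of_le h.time_pos.le] at this

theorem intervalIntegrable_gradHeat (h : DriftData χ T σ β R κ K F ρ) {α : ℝ} (hα : 0 < α)
    (hαβ : α < β) {c : ℝ → (Fin d → ℤ) → ℂ} (hc : AdmPath χ T α 1 c) {t : ℝ} (ht : t ∈ Icc 0 T)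
    (k : Fin d → ℤ) : IntegrableOn
      (fun s => gradHeatCoef σ (t - s) (driftCoef χ K F (ρ s) (c s)) k) (Ioo 0 t) := by
  simp only [gradHeatCoef_eq]
  exact ((integrable_exp_mul_driftCoef h hα hαβ hc k).mono_set
    (Ioo_subset_Icc_self.trans (Icc_subset_Icc_right ht.2))).const_mul _

theorem driftInt_eq_Ioo (c : ℝ → (Fin d → ℤ) → ℂ) {t : ℝ} (ht : 0 ≤ t) (k : Fin d → ℤ) :
    driftInt χ σ K F ρ c t k =
      ∫ s in Ioo 0 t, gradHeatCoef σ (t - s) (driftCoef χ K F (ρ s) (c s)) k := by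
  rw [driftInt, intervalIntegral.integral_of_le ht, integral_Ioc_eq_integral_Ioo]

theorem driftInt_sub (h : DriftData χ T σ β R κ K F ρ) {α : ℝ} (hα : 0 < α)
    (hαβ : α < β) {c c' : ℝ → (Fin d → ℤ) → ℂ} (hc : AdmPath χ T α 1 c) (hc' : AdmPath χ T α 1 c')
    {t : ℝ} (ht : t ∈ Icc 0 T) :
    driftInt χ σ K F ρ (c - c') t = driftInt χ σ K F ρ c t - driftInt χ σ K F ρ c' t := by
  ext k
  rw [Pi.sub_apply, driftInt_eq_Ioo _ ht.1, driftInt_eq_Ioo _ ht.1, driftInt_eq_Ioo _ ht.1,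
    ← integral_sub (intervalIntegrable_gradHeat h hα hαβ hc ht k)
      (intervalIntegrable_gradHeat h hα hαβ hc' ht k)]
  have hsub : Ioo 0 t ⊆ Icc 0 T := Ioo_subset_Icc_self.trans (Icc_subset_Icc_right ht.2)
  refine integral_congr_ae ?_
  filter_upwards [ae_mono (Measure.restrict_mono hsub le_rfl) (hc.ae_finite le_rfl),
    ae_mono (Measure.restrict_mono hsub le_rfl) (hc'.ae_finite le_rfl),
    ae_restrict_mem measurableSet_Ioo] with s h1 h2 hs
  obtain ⟨B, hB0, -, hB⟩ := bound_of_besovNorm h1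
  obtain ⟨B', hB0', -, hB'⟩ := bound_of_besovNorm h2
  simp only [gradHeatCoef, Pi.sub_apply]
  rw [← Finset.sum_sub_distrib]
  refine Finset.sum_congr rfl fun i _ => ?_
  rw [driftCoef_sub hα hαβ h.R_nonneg h.kappa_nonneg (h.bound s (hsub hs)) le_rfl le_rfl hB0 hB0'
    hB hB']
  ring

/-- Coefficients of the integrated drift are controlled by the `L^1` norm of the path. -/
theorem exists_driftInt_coef_bound (h : DriftData χ T σ β R κ K F ρ) {α : ℝ} (hα : 0 < α)
    (hαβ : α < β) (k : Fin d → ℤ) : ∃ C : NNReal, ∀ c, AdmPath χ T α 1 c → ∀ t ∈ Icc 0 T,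
      ‖driftInt χ σ K F ρ c t k‖ₑ ≤ C * ∫⁻ s in Icc 0 T, besovNorm χ (-α) 1 ∞ (c s) := by
  obtain ⟨C, hC⟩ := exists_driftCoef_integral_bound h hα hαβ k
  refine ⟨∑ i, ‖(k i : ℂ)‖₊ * C, fun c hc t ht => ?_⟩
  rw [driftInt_eq_Ioo _ ht.1]
  refine (enorm_integral_le_lintegral_enorm _).trans ?_
  have hsub : Ioo 0 t ⊆ Icc 0 T := Ioo_subset_Icc_self.trans (Icc_subset_Icc_right ht.2)
  have h1 : ∀ s ∈ Ioo 0 t, ‖gradHeatCoef σ (t - s) (driftCoef χ K F (ρ s) (c s)) k‖ₑ ≤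
      ∑ i, ‖(k i : ℂ)‖ₑ * ‖driftCoef χ K F (ρ s) (c s) i k‖ₑ := by
    intro s hs
    refine (enorm_sum_le _ _).trans (Finset.sum_le_sum fun i _ => ?_)
    have h2 : ‖heatSymbol σ (t - s) k‖ₑ ≤ 1 := by
      rw [heatSymbol, ← ofReal_norm, Complex.norm_real, Real.norm_of_nonneg (Real.exp_pos _).le,
        ENNReal.ofReal_le_one, Real.exp_le_one_iff, neg_nonpos]
      have := h.sigma_pos
      have := sub_nonneg.2 hs.2.le
      positivity
    rw [enorm_mul, enorm_mul, enorm_mul]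
    have h3 : ‖Complex.I‖ₑ = 1 := by rw [← ofReal_norm]; simp
    rw [h3, one_mul]
    gcongr
    exact mul_le_of_le_one_right' h2
  refine (lintegral_mono_ae (by
    filter_upwards [ae_restrict_mem measurableSet_Ioo] with s hs using h1 s hs)).trans ?_
  refine (lintegral_mono_set hsub).trans ?_
  rw [lintegral_finsetSum' _ fun i _ =>
    ((aemeasurable_driftCoef h hα hαβ le_rfl hc i k).enorm.const_mul _)]
  push_cast
  rw [Finset.sum_mul]
  refine Finset.sum_le_sum fun i _ => ?_
  rw [lintegral_const_mul' _ _ (by simp), mul_assoc]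
  exact mul_le_mul' le_rfl (hC c hc i).2

end Path

end FluctuationSPDE

end

noncomputable section

namespace FluctuationSPDE

variable {d : ℕ} {χ : DyadicPartition d}

/-! ### The Volterra equation -/

/-- The weakly singular kernel `τ^{-3/4} e^{-lτ}` on `τ > 0`. -/
def singularKernel (l τ : ℝ) : ℝ≥0∞ :=
  (Ioi (0 : ℝ)).indicator (fun τ => ENNReal.ofReal (τ ^ (-(3 / 4) : ℝ) * Real.exp (-(l * τ)))) τ

theorem measurable_singularKernel (l : ℝ) : Measurable (singularKernel l) := by
  refine Measurable.indicator ?_ measurableSet_Ioi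
  fun_prop

theorem lintegral_singularKernel {l : ℝ} (hl : 0 < l) :
    ∫⁻ τ, singularKernel l τ =
      ENNReal.ofReal ((1 / l) ^ (1 / 4 : ℝ) * Real.Gamma (1 / 4)) := by
  have h1 : ∀ τ : ℝ, τ ^ (-(3 / 4) : ℝ) = τ ^ ((1 / 4 : ℝ) - 1) := fun τ => by norm_num
  have h2 := Real.integral_rpow_mul_exp_neg_mul_Ioi (a := 1 / 4) (by norm_num) hl
  have hpos : 0 < (1 / l) ^ (1 / 4 : ℝ) * Real.Gamma (1 / 4) :=
    mul_pos (by positivity) (Real.Gamma_pos_of_pos (by norm_num))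
  simp only [singularKernel]
  rw [lintegral_indicator measurableSet_Ioi]
  simp_rw [h1]
  rw [← h2, ofReal_integral_eq_lintegral_ofReal]
  · by_contra hcon
    rw [integral_undef hcon] at h2
    exact hpos.ne h2
  · filter_upwards [ae_restrict_mem measurableSet_Ioi] with τ hτ
    have : (0:ℝ) < τ := hτ
    positivity

/-- The kernel has mass `l^{-1/4} Γ(1/4)`, so a fast exponential weight makes the Volterra operator
small whatever its constant. -/
theorem exists_singularKernel_small (C : ℝ) :
    ∃ l : ℝ, 0 < l ∧ ENNReal.ofReal C * ∫⁻ τ, singularKernel l τ ≤ 2⁻¹ := by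
  set G := |C| * Real.Gamma (1 / 4) with hG
  have hG0 : 0 ≤ G := mul_nonneg (abs_nonneg _) (Real.Gamma_pos_of_pos (by norm_num)).le
  -- Then `l^{-1/4} G = G / (2G + 1)`, which is below one half.
  set l : ℝ := (2 * G + 1) ^ 4 with hl
  have hl0 : 0 < l := by positivity
  refine ⟨l, hl0, ?_⟩
  have h1 : (1 / l) ^ (1 / 4 : ℝ) = (2 * G + 1)⁻¹ := by
    rw [one_div, Real.inv_rpow hl0.le, hl, ← Real.rpow_natCast, ← Real.rpow_mul (by positivity)]
    norm_num
  have h2 : (2⁻¹ : ℝ≥0∞) = ENNReal.ofReal (2⁻¹ : ℝ) := by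
    rw [ENNReal.ofReal_inv_of_pos two_pos]; simp
  rw [lintegral_singularKernel hl0, h1, h2]
  refine (mul_le_mul_left (ENNReal.ofReal_le_ofReal (le_abs_self C)) _).trans ?_
  rw [← ENNReal.ofReal_mul (abs_nonneg _)]
  refine ENNReal.ofReal_le_ofReal ?_
  rw [mul_left_comm, ← hG, inv_mul_le_iff₀ (by positivity)]
  linarith

/-- Splitting `e^{-lt} = e^{-l(t-s)} e^{-ls}` moves the weight into the kernel. Smallness of the
kernel's mass then bounds the operator in the weighted supremum norm and, by Tonelli, in the
weighted `L¹` norm. -/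
theorem exp_mul_lintegral_eq (l t : ℝ) (g : ℝ → ℝ≥0∞) :
    ENNReal.ofReal (Real.exp (-(l * t))) *
      ∫⁻ s in Ioo 0 t, ENNReal.ofReal ((t - s) ^ (-(3 / 4) : ℝ)) * g s =
    ∫⁻ s in Ioo 0 t, singularKernel l (t - s) * (ENNReal.ofReal (Real.exp (-(l * s))) * g s) := by
  rw [← lintegral_const_mul' _ _ ENNReal.ofReal_ne_top]
  refine setLIntegral_congr_fun measurableSet_Ioo fun s hs => ?_
  have hpos : 0 < t - s := sub_pos.2 hs.2
  rw [singularKernel, indicator_of_mem (by exact hpos), ← mul_assoc, ← mul_assoc]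
  congr 1
  rw [← ENNReal.ofReal_mul (Real.exp_pos _).le, ← ENNReal.ofReal_mul (by positivity), mul_assoc,
    ← Real.exp_add, mul_comm]
  congr 3
  ring

theorem exp_mul_lintegral_le_sup {l t : ℝ} {g : ℝ → ℝ≥0∞} {G : ℝ≥0∞}
    (hg : ∀ s ∈ Ioo 0 t, ENNReal.ofReal (Real.exp (-(l * s))) * g s ≤ G) :
    ENNReal.ofReal (Real.exp (-(l * t))) *
      ∫⁻ s in Ioo 0 t, ENNReal.ofReal ((t - s) ^ (-(3 / 4) : ℝ)) * g s ≤
    (∫⁻ τ, singularKernel l τ) * G := by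
  rw [exp_mul_lintegral_eq]
  calc _ ≤ ∫⁻ s in Ioo 0 t, singularKernel l (t - s) * G :=
        setLIntegral_mono' measurableSet_Ioo fun s hs => mul_le_mul' le_rfl (hg s hs)
    _ ≤ ∫⁻ s, singularKernel l (t - s) * G := setLIntegral_le_lintegral _ _
    _ = _ := by
        have hm : Measurable fun s => singularKernel l (t - s) :=
          (measurable_singularKernel l).comp (measurable_id.const_sub t)
        rw [lintegral_mul_const _ hm, lintegral_sub_left_eq_self (fun τ => singularKernel l τ) t]

theorem lintegral_exp_mul_lintegral_le {l T : ℝ} {g : ℝ → ℝ≥0∞}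
    (hg : AEMeasurable g (volume.restrict (Icc 0 T))) :
    ∫⁻ t in Icc 0 T, ENNReal.ofReal (Real.exp (-(l * t))) *
      ∫⁻ s in Ioo 0 t, ENNReal.ofReal ((t - s) ^ (-(3 / 4) : ℝ)) * g s ≤
    (∫⁻ τ, singularKernel l τ) * ∫⁻ s in Icc 0 T, ENNReal.ofReal (Real.exp (-(l * s))) * g s := by
  simp_rw [exp_mul_lintegral_eq]
  set G : ℝ → ℝ≥0∞ := fun s => ENNReal.ofReal (Real.exp (-(l * s))) * g s with hG
  have hGm : AEMeasurable G (volume.restrict (Icc 0 T)) :=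
    AEMeasurable.mul (by fun_prop) hg
  calc _ ≤ ∫⁻ t in Icc 0 T, ∫⁻ s in Icc 0 T, singularKernel l (t - s) * G s :=
        setLIntegral_mono' measurableSet_Icc fun t ht => lintegral_mono_set
          (Ioo_subset_Icc_self.trans (Icc_subset_Icc_right ht.2))
    _ = ∫⁻ s in Icc 0 T, ∫⁻ t in Icc 0 T, singularKernel l (t - s) * G s := by
        refine lintegral_lintegral_swap ?_
        refine AEMeasurable.mul ?_ hGm.comp_snd
        exact ((measurable_singularKernel l).comp (measurable_fst.sub measurable_snd)).aemeasurable
    _ ≤ ∫⁻ s in Icc 0 T, (∫⁻ τ, singularKernel l τ) * G s := by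
        refine lintegral_mono fun s => ?_
        refine (setLIntegral_le_lintegral _ _).trans (le_of_eq ?_)
        have hm : Measurable fun t => singularKernel l (t - s) :=
          (measurable_singularKernel l).comp (measurable_id.sub_const s)
        rw [lintegral_mul_const _ hm, lintegral_sub_right_eq_self (fun τ => singularKernel l τ) s]
    _ = _ := lintegral_const_mul'' _ hGm

/-! ### The integrated drift as a weakly singular Volterra operator -/

section Path

variable {T σ β R κ : ℝ} {K F : E d → E d} {ρ : ℝ → E d → ℝ}

/-- The integrated drift gains half a derivative. -/
theorem exists_driftInt_block_bound (h : DriftData χ T σ β R κ K F ρ) {α : ℝ} (hα : 0 < α)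
    (hαβ : α < β) : ∃ C : ℝ, 0 < C ∧ ∀ p : ℝ≥0∞, 1 ≤ p → ∀ c, AdmPath χ T α p c →
      ∀ t ∈ Icc 0 T, ∀ j : ℕ, weight (-α) j * blockNorm χ p j (driftInt χ σ K F ρ c t) ≤
        ENNReal.ofReal (C * 2 ^ (-(1 / 2 * (j : ℝ)))) *
          ∫⁻ s in Ioo 0 t, ENNReal.ofReal ((t - s) ^ (-(3 / 4) : ℝ)) *
            besovNorm χ (-α) p ∞ (c s) := by
  obtain ⟨C, hC0, hC⟩ := exists_gradHeat_drift_bound hα hαβ h.R_nonneg h.kappa_nonneg h.sigma_pos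
    h.time_pos χ
  refine ⟨C, hC0, fun p hp c hc t ht j => ?_⟩
  have hint := fun k => intervalIntegrable_gradHeat h hα hαβ (hc.mono le_rfl hp) ht k
  have hsub : Ioo 0 t ⊆ Icc 0 T := Ioo_subset_Icc_self.trans (Icc_subset_Icc_right ht.2)
  have h1 : blockNorm χ p j (driftInt χ σ K F ρ c t) ≤ ∫⁻ s in Ioo 0 t,
      blockNorm χ p j (gradHeatCoef σ (t - s) (driftCoef χ K F (ρ s) (c s))) := by
    simp_rw [blockNorm_eq, driftInt_eq_Ioo _ ht.1, ← integral_const_mul]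
    exact eLpNorm_trig_integral_le _ hp _ _ fun k _ => (hint k).const_mul _
  refine (mul_le_mul_right h1 _).trans ?_
  rw [← lintegral_const_mul' _ _ (weight_ne_top _ _), ← lintegral_const_mul' _ _
    ENNReal.ofReal_ne_top]
  refine setLIntegral_mono' measurableSet_Ioo fun s hs => ?_
  rw [← mul_assoc]
  exact hC K F (ρ s) (h.bound s (hsub hs)) p hp (c s) (t - s) (sub_pos.2 hs.2)
    (by linarith [hs.1, ht.2]) j

theorem exists_driftInt_besov_bound (h : DriftData χ T σ β R κ K F ρ) {α : ℝ} (hα : 0 < α)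
    (hαβ : α < β) : ∃ C : ℝ, 0 < C ∧ ∀ p : ℝ≥0∞, 1 ≤ p → ∀ c, AdmPath χ T α p c →
      ∀ t ∈ Icc 0 T, besovNorm χ (-α) p ∞ (driftInt χ σ K F ρ c t) ≤ ENNReal.ofReal C *
          ∫⁻ s in Ioo 0 t, ENNReal.ofReal ((t - s) ^ (-(3 / 4) : ℝ)) *
            besovNorm χ (-α) p ∞ (c s) := by
  obtain ⟨C, hC0, hC⟩ := exists_driftInt_block_bound h hα hαβ
  refine ⟨C, hC0, fun p hp c hc t ht => besovNorm_top_le fun j => (hC p hp c hc t ht j).trans ?_⟩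
  refine mul_le_mul' (ENNReal.ofReal_le_ofReal ?_) le_rfl
  refine mul_le_of_le_one_right hC0.le (Real.rpow_le_one_of_one_le_of_nonpos (by norm_num) ?_)
  have : (0 : ℝ) ≤ j := Nat.cast_nonneg j
  linarith

/-- Picard iterates for `c = W - L c`. -/
def picard (χ : DyadicPartition d) (σ : ℝ) (K F : E d → E d) (ρ : ℝ → E d → ℝ)
    (W : ℝ → (Fin d → ℤ) → ℂ) : ℕ → ℝ → (Fin d → ℤ) → ℂ
  | 0 => 0
  | n + 1 => fun t => W t - driftInt χ σ K F ρ (picard χ σ K F ρ W n) t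

theorem besovNorm_zero (s : ℝ) (p q : ℝ≥0∞) :
    besovNorm χ s p q (0 : (Fin d → ℤ) → ℂ) = 0 := by
  have : ∀ j, blockNorm χ p j (0 : (Fin d → ℤ) → ℂ) = 0 := by
    intro j
    have := blockNorm_const_mul (χ := χ) p j 0 (0 : (Fin d → ℤ) → ℂ)
    simpa [← Pi.zero_def] using this
  rw [besovNorm_eq]
  simp [this, ← Pi.zero_def]

theorem AdmPath.sub {α : ℝ} {p : ℝ≥0∞} (hp : 1 ≤ p) {c c' : ℝ → (Fin d → ℤ) → ℂ}
    (hc : AdmPath χ T α p c) (hc' : AdmPath χ T α p c') : AdmPath χ T α p (c - c') := by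
  refine ⟨fun k => (hc.meas k).sub (hc'.meas k), ?_⟩
  refine ne_top_of_le_ne_top (ENNReal.add_ne_top.2 ⟨hc.finite, hc'.finite⟩) ?_
  rw [← lintegral_add_left' (aemeasurable_besovNorm hp le_top hc.meas)]
  exact lintegral_mono fun s => besovNorm_sub_le hp le_top _ _ _

theorem admPath_of_bound {α : ℝ} {p : ℝ≥0∞} {c : ℝ → (Fin d → ℤ) → ℂ}
    (hc : ∀ k, AEMeasurable (fun s => c s k) (volume.restrict (Icc 0 T))) {B : ℝ≥0∞} (hB : B ≠ ∞)
    (h : ∀ t ∈ Icc 0 T, besovNorm χ (-α) p ∞ (c t) ≤ B) : AdmPath χ T α p c := by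
  refine ⟨hc, ne_top_of_le_ne_top ?_ (setLIntegral_mono' measurableSet_Icc h)⟩
  rw [lintegral_const, Measure.restrict_apply_univ]
  exact ENNReal.mul_ne_top hB (by simp)

/-- A solution of `c = W - L c` inherits the bounds of `W`. -/
theorem exists_volterra_bound (h : DriftData χ T σ β R κ K F ρ) {α a : ℝ} (hα : 0 < α)
    (hαa : α ≤ a) (haβ : a < β) : ∃ A : NNReal, ∀ p : ℝ≥0∞, 1 ≤ p →
      ∀ c W : ℝ → (Fin d → ℤ) → ℂ, AdmPath χ T a 1 c →
      (∀ k, AEMeasurable (fun t => W t k) (volume.restrict (Icc 0 T))) →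
      (∀ t ∈ Icc 0 T, c t = W t - driftInt χ σ K F ρ c t) → ∀ w : ℝ≥0∞, w ≠ ∞ →
      (∀ t ∈ Icc 0 T, besovNorm χ (-α) p ∞ (W t) ≤ w) →
      ∀ t ∈ Icc 0 T, besovNorm χ (-α) p ∞ (c t) ≤ A * w := by
  have hαβ := hαa.trans_lt haβ
  have ha := hα.trans_le hαa
  obtain ⟨C₁, hC₁0, hC₁⟩ := exists_driftInt_besov_bound h hα hαβ
  obtain ⟨C₂, hC₂0, hC₂⟩ := exists_driftInt_besov_bound h ha haβ
  -- A single rate makes the operator halve weighted norms both in the target space `(α, p)` and in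
  -- the weak space `(a, 1)` where the solution is known to lie.
  obtain ⟨l, hl0, hl⟩ := exists_singularKernel_small (max C₁ C₂)
  have hl₁ : ENNReal.ofReal C₁ * ∫⁻ τ, singularKernel l τ ≤ 2⁻¹ :=
    (mul_le_mul' (ENNReal.ofReal_le_ofReal (le_max_left _ _)) le_rfl).trans hl
  have hl₂ : ENNReal.ofReal C₂ * ∫⁻ τ, singularKernel l τ ≤ 2⁻¹ :=
    (mul_le_mul' (ENNReal.ofReal_le_ofReal (le_max_right _ _)) le_rfl).trans hl
  set e : ℝ → ℝ≥0∞ := fun t => ENNReal.ofReal (Real.exp (-(l * t))) with he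
  set eT : ℝ≥0∞ := ENNReal.ofReal (Real.exp (l * T)) with heT
  have heT_top : eT ≠ ∞ := ENNReal.ofReal_ne_top
  have hunit : ∀ t ∈ Icc 0 T, 1 ≤ eT * e t := by
    intro t ht
    rw [heT, he, ← ENNReal.ofReal_mul (Real.exp_pos _).le, ← Real.exp_add, ← ENNReal.ofReal_one]
    refine ENNReal.ofReal_le_ofReal (Real.one_le_exp ?_)
    nlinarith [ht.2]
  have hunit' : ∀ t ∈ Icc 0 T, ∀ x : ℝ≥0∞, x ≤ eT * (e t * x) := by
    intro t ht x
    rw [← mul_assoc]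
    exact le_mul_of_one_le_left' (hunit t ht)
  have he1 : ∀ t ∈ Icc 0 T, e t ≤ 1 := by
    intro t ht
    rw [he, ENNReal.ofReal_le_one, Real.exp_le_one_iff, neg_nonpos]
    exact mul_nonneg hl0.le ht.1
  refine ⟨Real.toNNReal (Real.exp (l * T)) * 2, fun p hp c W hc hW hcW w hw hWw => ?_⟩
  set S := picard χ σ K F ρ W with hS
  have hS1 : ∀ n t, S (n + 1) t = W t - driftInt χ σ K F ρ (S n) t := fun n t => rfl
  -- The bound `2w` is invariant under the iteration, because `w + 2w / 2 = 2w`.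
  have hbound : ∀ n, AdmPath χ T α p (S n) ∧
      ∀ t ∈ Icc 0 T, e t * besovNorm χ (-α) p ∞ (S n t) ≤ 2 * w := by
    intro n
    induction n with
    | zero =>
      have h0 : S 0 = 0 := rfl
      refine ⟨⟨fun k => ?_, ?_⟩, fun t _ => ?_⟩
      · rw [h0]; exact aemeasurable_const
      · simp [h0, besovNorm_zero]
      · simp [h0, besovNorm_zero]
    | succ n ih =>
      have hb : ∀ t ∈ Icc 0 T, e t * besovNorm χ (-α) p ∞ (S (n + 1) t) ≤ 2 * w := by
        intro t ht
        rw [hS1]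
        have hsub : Ioo 0 t ⊆ Icc 0 T := Ioo_subset_Icc_self.trans (Icc_subset_Icc_right ht.2)
        calc e t * besovNorm χ (-α) p ∞ (W t - driftInt χ σ K F ρ (S n) t)
            ≤ e t * (w + ENNReal.ofReal C₁ * ∫⁻ s in Ioo 0 t,
                ENNReal.ofReal ((t - s) ^ (-(3 / 4) : ℝ)) * besovNorm χ (-α) p ∞ (S n s)) :=
              mul_le_mul' le_rfl ((besovNorm_sub_le hp le_top _ _ _).trans
                (add_le_add (hWw t ht) (hC₁ p hp _ ih.1 t ht)))
          _ ≤ w + ENNReal.ofReal C₁ * ((∫⁻ τ, singularKernel l τ) * (2 * w)) := by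
              rw [mul_add, mul_left_comm]
              exact add_le_add (mul_le_of_le_one_left' (he1 t ht)) (mul_le_mul' le_rfl
                (exp_mul_lintegral_le_sup fun s hs => ih.2 s (hsub hs)))
          _ ≤ w + 2⁻¹ * (2 * w) := by
              rw [← mul_assoc]
              exact add_le_add le_rfl (mul_le_mul' hl₁ le_rfl)
          _ = 2 * w := by
              rw [← mul_assoc, ENNReal.inv_mul_cancel two_ne_zero ENNReal.ofNat_ne_top, one_mul,
                two_mul]
      refine ⟨admPath_of_bound (B := eT * (2 * w)) (fun k => ?_) ?_ fun t ht => ?_, hb⟩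
      · exact (hW k).sub ((continuousOn_driftInt h hα hαβ (ih.1.mono le_rfl hp) k).aemeasurable
          measurableSet_Icc)
      · exact ENNReal.mul_ne_top heT_top (ENNReal.mul_ne_top ENNReal.ofNat_ne_top hw)
      · exact (hunit' t ht _).trans (mul_le_mul' le_rfl (hb t ht))
  have hadm : ∀ n, AdmPath χ T a 1 (S n) := fun n => (hbound n).1.mono hαa hp
  have hadm' : ∀ n, AdmPath χ T a 1 (c - S n) := fun n => hc.sub le_rfl (hadm n)
  have hdiff : ∀ n, ∀ t ∈ Icc 0 T, c t - S (n + 1) t = -driftInt χ σ K F ρ (c - S n) t := by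
    intro n t ht
    rw [hS1, driftInt_sub h ha haβ hc (hadm n) ht]
    nth_rw 1 [hcW t ht]
    abel
  -- No bound uniform in time is known for `c`, so the iterates are compared with it in `L¹` in time
  -- and in the weak Besov norm. There the distance is halved at every step.
  set I : ℕ → ℝ≥0∞ := fun n => ∫⁻ t in Icc 0 T, e t * besovNorm χ (-a) 1 ∞ ((c - S n) t) with hI
  have hIsucc : ∀ n, I (n + 1) ≤ 2⁻¹ * I n := by
    intro n
    calc I (n + 1) ≤ ∫⁻ t in Icc 0 T, ENNReal.ofReal C₂ * (e t * ∫⁻ s in Ioo 0 t,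
            ENNReal.ofReal ((t - s) ^ (-(3 / 4) : ℝ)) * besovNorm χ (-a) 1 ∞ ((c - S n) s)) := by
          refine setLIntegral_mono' measurableSet_Icc fun t ht => ?_
          rw [Pi.sub_apply, hdiff n t ht, besovNorm_neg, mul_left_comm]
          exact mul_le_mul' le_rfl (hC₂ 1 le_rfl _ (hadm' n) t ht)
      _ ≤ ENNReal.ofReal C₂ * ((∫⁻ τ, singularKernel l τ) * I n) := by
          rw [lintegral_const_mul' _ _ ENNReal.ofReal_ne_top]
          exact mul_le_mul' le_rfl (lintegral_exp_mul_lintegral_le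
            (aemeasurable_besovNorm le_rfl le_top (hadm' n).meas))
      _ ≤ 2⁻¹ * I n := by
          rw [← mul_assoc]
          exact mul_le_mul' hl₂ le_rfl
  have hI0 : I 0 ≠ ∞ := by
    refine ne_top_of_le_ne_top (hadm' 0).finite (setLIntegral_mono' measurableSet_Icc fun t ht => ?_)
    exact mul_le_of_le_one_left' (he1 t ht)
  have hIn : ∀ n, I n ≤ 2⁻¹ ^ n * I 0 := by
    intro n
    induction n with
    | zero => simp
    | succ n ih =>
      refine (hIsucc n).trans ((mul_le_mul_right ih _).trans (le_of_eq ?_))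
      rw [pow_succ']; ring
  have hI_tendsto : Tendsto I atTop (𝓝 0) := by
    have h1 : Tendsto (fun n : ℕ => (2⁻¹ : ℝ≥0∞) ^ n * I 0) atTop (𝓝 (0 * I 0)) :=
      ENNReal.Tendsto.mul_const
        (ENNReal.tendsto_pow_atTop_nhds_zero_of_lt_one (by simp)) (Or.inr hI0)
    rw [zero_mul] at h1
    exact tendsto_of_tendsto_of_tendsto_of_le_of_le tendsto_const_nhds h1 (fun _ => zero_le) hIn
  have hJ : ∀ n, ∫⁻ t in Icc 0 T, besovNorm χ (-a) 1 ∞ ((c - S n) t) ≤ eT * I n := by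
    intro n
    rw [hI, ← lintegral_const_mul' _ _ heT_top]
    exact setLIntegral_mono' measurableSet_Icc fun t ht => hunit' t ht _
  -- One application of the integrated drift upgrades convergence in `L¹` in time to convergence of
  -- every coefficient at every time.
  have hlim : ∀ t ∈ Icc 0 T, ∀ k, Tendsto (fun n => S (n + 1) t k) atTop (𝓝 (c t k)) := by
    intro t ht k
    obtain ⟨D, hD⟩ := exists_driftInt_coef_bound h ha haβ k
    rw [tendsto_iff_edist_tendsto_0]
    have h1 : Tendsto (fun n => (D : ℝ≥0∞) * (eT * I n)) atTop (𝓝 (D * (eT * 0))) :=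
      ENNReal.Tendsto.const_mul (ENNReal.Tendsto.const_mul hI_tendsto (Or.inr heT_top))
        (Or.inr ENNReal.coe_ne_top)
    rw [mul_zero, mul_zero] at h1
    refine tendsto_of_tendsto_of_tendsto_of_le_of_le tendsto_const_nhds h1 (fun _ => zero_le)
      fun n => ?_
    have h2 := congrFun (hdiff n t ht) k
    rw [edist_comm, edist_eq_enorm_sub]
    rw [Pi.sub_apply, Pi.neg_apply] at h2
    rw [h2, enorm_neg]
    exact (hD _ (hadm' n) t ht).trans (mul_le_mul' le_rfl (hJ n))
  intro t ht
  refine besovNorm_top_le fun j => ?_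
  -- Block norms pass to the limit of coefficients, so the uniform bound on the iterates descends to
  -- `c` although convergence is only known in the weak space.
  have hblock : blockNorm χ p j (c t) ≤ weight (- -α) j * (eT * (2 * w)) := by
    refine blockNorm_le_of_tendsto (hlim t ht) hp j (Frequently.of_forall fun n => ?_)
    refine (blockNorm_le (q := ∞) (by simp) (-α) p j _).trans (mul_le_mul' le_rfl ?_)
    exact (hunit' t ht _).trans (mul_le_mul' le_rfl ((hbound (n + 1)).2 t ht))
  refine (mul_le_mul_right hblock _).trans (le_of_eq ?_)
  rw [← mul_assoc, weight_mul_weight_neg, one_mul, heT, ← mul_assoc]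
  simp [ENNReal.ofReal]

theorem lintegral_singular_le {t : ℝ} (ht : t ∈ Icc 0 T) (hT : 0 < T) :
    ∫⁻ s in Ioo 0 t, ENNReal.ofReal ((t - s) ^ (-(3 / 4) : ℝ)) ≤
      ENNReal.ofReal (Real.exp 1) * ENNReal.ofReal (T ^ (1 / 4 : ℝ) * Real.Gamma (1 / 4)) := by
  -- At the rate `1 / T` removing the exponential weight costs at most a factor `e`.
  have h1 := exp_mul_lintegral_le_sup (l := 1 / T) (t := t) (g := fun _ => 1) (G := 1) fun s hs => by
    rw [mul_one, ENNReal.ofReal_le_one, Real.exp_le_one_iff, neg_nonpos]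
    have := hs.1
    positivity
  rw [lintegral_singularKernel (by positivity), one_div_one_div] at h1
  simp only [mul_one] at h1
  refine le_trans ?_ (mul_le_mul' le_rfl h1)
  rw [← mul_assoc]
  refine le_mul_of_one_le_left' ?_
  rw [← ENNReal.ofReal_mul (Real.exp_pos _).le, ← Real.exp_add, ← ENNReal.ofReal_one]
  refine ENNReal.ofReal_le_ofReal (Real.one_le_exp ?_)
  have : 1 / T * t ≤ 1 := by rw [one_div_mul_eq_div]; exact (div_le_one hT).2 ht.2
  linarith

/-- Blockwise bound for the integrated drift of a bounded path. -/
theorem exists_driftInt_block_bound_of_bounded (h : DriftData χ T σ β R κ K F ρ) {α : ℝ}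
    (hα : 0 < α) (hαβ : α < β) : ∃ C : ℝ, 0 < C ∧ ∀ p : ℝ≥0∞, 1 ≤ p → ∀ c,
      (∀ k, AEMeasurable (fun s => c s k) (volume.restrict (Icc 0 T))) → ∀ B : ℝ≥0∞, B ≠ ∞ →
      (∀ t ∈ Icc 0 T, besovNorm χ (-α) p ∞ (c t) ≤ B) →
      ∀ t ∈ Icc 0 T, ∀ j : ℕ, weight (-α) j * blockNorm χ p j (driftInt χ σ K F ρ c t) ≤
        ENNReal.ofReal (C * 2 ^ (-(1 / 2 * (j : ℝ)))) * B := by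
  obtain ⟨C, hC0, hC⟩ := exists_driftInt_block_bound h hα hαβ
  have hΓ : 0 < Real.Gamma (1 / 4) := Real.Gamma_pos_of_pos (by norm_num)
  have hT := h.time_pos
  refine ⟨C * (Real.exp 1 * (T ^ (1 / 4 : ℝ) * Real.Gamma (1 / 4))), by positivity,
    fun p hp c hc B hB hcB t ht j => ?_⟩
  refine (hC p hp c (admPath_of_bound hc hB hcB) t ht j).trans ?_
  have hsub : Ioo 0 t ⊆ Icc 0 T := Ioo_subset_Icc_self.trans (Icc_subset_Icc_right ht.2)
  calc _ ≤ ENNReal.ofReal (C * 2 ^ (-(1 / 2 * (j : ℝ)))) *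
        ∫⁻ s in Ioo 0 t, ENNReal.ofReal ((t - s) ^ (-(3 / 4) : ℝ)) * B :=
        mul_le_mul' le_rfl (setLIntegral_mono' measurableSet_Ioo fun s hs =>
          mul_le_mul' le_rfl (hcB s (hsub hs)))
    _ ≤ _ := by
        rw [lintegral_mul_const' _ _ hB, ← mul_assoc, mul_right_comm C,
          ENNReal.ofReal_mul (p := C * _) (by positivity),
          ENNReal.ofReal_mul (p := Real.exp 1) (by positivity)]
        gcongr
        exact lintegral_singular_le ht hT

end Path

end FluctuationSPDE

end

noncomputable section

namespace FluctuationSPDE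

variable {d : ℕ} {χ : DyadicPartition d}

/-! ### Functions of positive regularity -/

theorem fcoef_lpBlock (j : ℕ) (a : (Fin d → ℤ) → ℂ) (k : Fin d → ℤ) :
    fcoef (lpBlock χ j a) k = chiSymbol χ j k * a k := by
  rw [lpBlock_eq_trig, fcoef_trig]
  split_ifs with hk
  · rfl
  · rw [chiSymbol_eq_zero_of_notMem hk, zero_mul]

theorem weight_eq (s : ℝ) (j : ℕ) :
    weight s j = ENNReal.ofReal (2 ^ (-s) * 2 ^ (-(-s * j))) := by
  rw [weight, ← Real.rpow_add two_pos]
  congr 2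
  ring

/-- The series of blocks converges uniformly to a continuous periodic function. Its coefficients are
those of `f`, since the partition of unity sums to one at each frequency; the two functions then
coincide. -/
theorem hasSum_lpBlock {f : E d → ℂ} (hf : Continuous f) (hp : Periodic f) {u : ℕ → ℝ}
    (hu : Summable u) (h : ∀ j x, ‖lpBlock χ j (fcoef f) x‖ ≤ u j) (x : E d) :
    f x = ∑' j, lpBlock χ j (fcoef f) x := by
  set g : E d → ℂ := fun x => ∑' j, lpBlock χ j (fcoef f) x with hg
  have hgc : Continuous g := continuous_tsum (fun j => continuous_lpBlock j _) hu h
  have hgp : Periodic g := fun k x => by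
    simp only [hg]
    exact tsum_congr fun j => periodic_lpBlock j _ k x
  have hcoef : ∀ k, fcoef g k = fcoef f k := by
    intro k
    have h1 : HasSum (fun j => ∫ x, lpBlock χ j (fcoef f) x * fourierE (-k) x ∂torusMeasure d)
        (∫ x, ∑' j, lpBlock χ j (fcoef f) x * fourierE (-k) x ∂torusMeasure d) := by
      refine hasSum_integral_of_summable_integral_norm (fun j => integrable_torus_of_continuous
        ((continuous_lpBlock j _).mul (continuous_fourierE _))) ?_
      refine Summable.of_nonneg_of_le (fun j => integral_nonneg fun x => norm_nonneg _) (fun j => ?_)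
        (hu.mul_left ((torusMeasure d).real univ))
      rw [← smul_eq_mul, ← integral_const]
      refine integral_mono (integrable_torus_of_continuous
        ((continuous_lpBlock j _).mul (continuous_fourierE _)).norm) (integrable_const _) fun x => ?_
      simp only [norm_mul, norm_fourierE, mul_one]
      exact h j x
    have h2 : HasSum (fun j => chiSymbol χ j k * fcoef f k) (fcoef g k) := by
      have := h1.mul_left (((2 * Real.pi) ^ d : ℝ) : ℂ)⁻¹
      simp_rw [tsum_mul_right] at this
      simp only [← fcoef_lpBlock]
      exact this
    have h3 := (hasSum_chiSymbol (χ := χ) k).mul_right (fcoef f k)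
    rw [one_mul] at h3
    exact h2.unique h3
  have := eq_zero_of_fcoef_eq_zero (f := fun x => f x - g x) (hf.sub hgc)
    (fun k x => by simp only [hp k x, hgp k x]) (fun k => by
      rw [fcoef_sub (integrable_torus_of_continuous hf) (integrable_torus_of_continuous hgc),
        hcoef, sub_self]) x
  exact sub_eq_zero.1 this

theorem exists_enorm_le_besovNorm {β : ℝ} (hβ : 0 < β) (χ : DyadicPartition d) :
    ∃ C : NNReal, ∀ f : E d → ℂ, Continuous f → Periodic f → besovNorm χ β ∞ ∞ (fcoef f) ≠ ∞ →
      ∀ x, ‖f x‖ₑ ≤ C * besovNorm χ β ∞ ∞ (fcoef f) := by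
  have hsum : ∑' j, weight (-β) j ≠ ∞ := by
    simp_rw [weight_eq, neg_neg]
    exact tsum_ofReal_geometric_ne_top _ hβ
  refine ⟨(∑' j, weight (-β) j).toNNReal, fun f hf hp hfin x => ?_⟩
  rw [ENNReal.coe_toNNReal hsum, ← ENNReal.tsum_mul_right]
  have hle : ∀ j x, ‖lpBlock χ j (fcoef f) x‖ₑ ≤ weight (-β) j * besovNorm χ β ∞ ∞ (fcoef f) :=
    fun j x => (enorm_le_eLpNorm_top (continuous_lpBlock j _) (periodic_lpBlock j _) x).trans
      (blockNorm_le (by simp) β ∞ j _)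
  have hfin' : ∑' j, weight (-β) j * besovNorm χ β ∞ ∞ (fcoef f) ≠ ∞ := by
    rw [ENNReal.tsum_mul_right]; exact ENNReal.mul_ne_top hsum hfin
  rw [hasSum_lpBlock hf hp (ENNReal.summable_toReal hfin') (fun j x => by
    rw [← toReal_enorm]
    exact ENNReal.toReal_mono (ENNReal.mul_ne_top (weight_ne_top _ _) hfin) (hle j x)) x]
  exact (enorm_tsum_le_tsum_enorm).trans (ENNReal.tsum_le_tsum fun j => hle j x)

/-! ### Continuous paths in Hölder spaces: joint continuity and uniform bounds -/

section Holder

variable {T β : ℝ} {ρ : ℝ → E d → ℝ}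

theorem MemHolder.continuous_ofReal {f : E d → ℝ} (hf : MemHolder χ β f) :
    Continuous fun x => (f x : ℂ) := Complex.continuous_ofReal.comp hf.1

theorem MemHolder.periodic_ofReal {f : E d → ℝ} (hf : MemHolder χ β f) :
    Periodic fun x => (f x : ℂ) := fun k x => by simp only [hf.2.1 k x]

theorem fcoef_ofReal_sub {f g : E d → ℝ} (hf : MemHolder χ β f) (hg : MemHolder χ β g) :
    (fcoef fun x => ((f x - g x : ℝ) : ℂ)) =
      fcoef (fun x => (f x : ℂ)) - fcoef fun x => (g x : ℂ) := by
  ext k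
  rw [Pi.sub_apply, ← fcoef_sub (integrable_torus_of_continuous hf.continuous_ofReal)
    (integrable_torus_of_continuous hg.continuous_ofReal)]
  simp only [Complex.ofReal_sub]

theorem exists_edist_le_besovNorm (hβ : 0 < β) (h : ContinuousHolder χ T β ρ) :
    ∃ C : NNReal, ∀ t ∈ Icc 0 T, ∀ t₀ ∈ Icc 0 T, ∀ x, edist (ρ t x) (ρ t₀ x) ≤
      C * besovNorm χ β ∞ ∞ (fcoef fun x => ((ρ t x - ρ t₀ x : ℝ) : ℂ)) := by
  obtain ⟨C, hC⟩ := exists_enorm_le_besovNorm hβ χ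
  refine ⟨C, fun t ht t₀ ht₀ x => ?_⟩
  have h1 := h.1 t ht
  have h2 := h.1 t₀ ht₀
  have := hC (fun x => ((ρ t x - ρ t₀ x : ℝ) : ℂ)) (Complex.continuous_ofReal.comp (h1.1.sub h2.1))
    (fun k x => by simp only [h1.2.1 k x, h2.2.1 k x]) (by
      rw [fcoef_ofReal_sub h1 h2]
      exact ne_top_of_le_ne_top (ENNReal.add_ne_top.2 ⟨h1.2.2.ne, h2.2.2.ne⟩)
        (besovNorm_sub_le le_top le_top _ _ _)) x
  rwa [← ofReal_norm, Complex.norm_real, ofReal_norm, ← edist_eq_enorm_sub] at this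

theorem ContinuousHolder.continuousOn (hβ : 0 < β) (h : ContinuousHolder χ T β ρ) :
    ContinuousOn (fun z : ℝ × E d => ρ z.1 z.2) (Icc 0 T ×ˢ univ) := by
  obtain ⟨C, hC⟩ := exists_edist_le_besovNorm hβ h
  rintro ⟨t₀, x₀⟩ ⟨ht₀, -⟩
  rw [ContinuousWithinAt, tendsto_iff_edist_tendsto_0]
  have hfst : Tendsto (fun z : ℝ × E d => z.1) (𝓝[Icc 0 T ×ˢ univ] (t₀, x₀)) (𝓝[Icc 0 T] t₀) :=
    tendsto_nhdsWithin_iff.2 ⟨continuous_fst.continuousWithinAt,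
      eventually_nhdsWithin_of_forall fun z hz => hz.1⟩
  have h1 := ENNReal.Tendsto.const_mul (a := (C : ℝ≥0∞)) ((h.2 t₀ ht₀).comp hfst)
    (Or.inr ENNReal.coe_ne_top)
  have h2 : Tendsto (fun z : ℝ × E d => edist (ρ t₀ z.2) (ρ t₀ x₀))
      (𝓝[Icc 0 T ×ˢ univ] (t₀, x₀)) (𝓝 0) := by
    rw [← tendsto_iff_edist_tendsto_0]
    exact (((h.1 t₀ ht₀).1.comp continuous_snd).tendsto (t₀, x₀)).mono_left nhdsWithin_le_nhds
  have h3 := h1.add h2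
  rw [mul_zero, add_zero] at h3
  refine tendsto_of_tendsto_of_tendsto_of_le_of_le' tendsto_const_nhds h3
    (Eventually.of_forall fun _ => zero_le) ?_
  filter_upwards [self_mem_nhdsWithin] with z hz
  exact (edist_triangle _ (ρ t₀ z.2) _).trans (add_le_add (hC z.1 hz.1 t₀ ht₀ z.2) le_rfl)

theorem ContinuousHolder.exists_besov_bound (h : ContinuousHolder χ T β ρ) :
    ∃ B : NNReal, ∀ t ∈ Icc 0 T, besovNorm χ β ∞ ∞ (fcoef fun x => (ρ t x : ℂ)) ≤ B := by
  refine exists_bound_of_continuous le_top le_top (fun t ht => (h.1 t ht).2.2) fun t₀ ht₀ => ?_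
  refine (h.2 t₀ ht₀).congr' ?_
  filter_upwards [self_mem_nhdsWithin] with t ht
  rw [fcoef_ofReal_sub (h.1 t ht) (h.1 t₀ ht₀)]

theorem ContinuousHolder.exists_bound (hβ : 0 < β) (h : ContinuousHolder χ T β ρ) :
    ∃ L : ℝ, 0 ≤ L ∧ ∀ t ∈ Icc 0 T, ∀ x, |ρ t x| ≤ L := by
  obtain ⟨C, hC⟩ := exists_enorm_le_besovNorm hβ χ
  obtain ⟨B, hB⟩ := h.exists_besov_bound
  refine ⟨C * B, by positivity, fun t ht x => ?_⟩
  have h1 := h.1 t ht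
  have h2 := (hC _ h1.continuous_ofReal h1.periodic_ofReal h1.2.2.ne x).trans
    (mul_le_mul_right (hB t ht) _)
  rw [← ofReal_norm, Complex.norm_real, Real.norm_eq_abs, ← ENNReal.coe_mul,
    ← ENNReal.ofReal_coe_nnreal] at h2
  simpa using (ENNReal.ofReal_le_ofReal_iff (by positivity)).1 h2

theorem ContinuousHolder.continuousOn_fcoef (hβ : 0 < β) (h : ContinuousHolder χ T β ρ)
    (k : Fin d → ℤ) : ContinuousOn (fun s => fcoef (fun x => (ρ s x : ℂ)) k) (Icc 0 T) := by
  obtain ⟨L, hL0, hL⟩ := h.exists_bound hβ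
  simp only [fcoef]
  refine ContinuousOn.mul continuousOn_const ?_
  refine continuousOn_of_dominated (bound := fun _ => L) (fun t ht => ?_) (fun t ht => ?_)
    (integrable_const L) (Eventually.of_forall fun x => ?_)
  · exact ((h.1 t ht).continuous_ofReal.mul (continuous_fourierE _)).aestronglyMeasurable
  · refine Eventually.of_forall fun x => ?_
    rw [norm_mul, norm_fourierE, mul_one, Complex.norm_real]
    exact hL t ht x
  · refine ContinuousOn.mul (Complex.continuous_ofReal.comp_continuousOn ?_) continuousOn_const
    exact (h.continuousOn hβ).comp (f := fun t => (t, x)) (by fun_prop) fun t ht => ⟨ht, mem_univ _⟩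

end Holder

theorem blockNorm_le_of_besovNorm_le {β : ℝ} {u : (Fin d → ℤ) → ℂ} {B : ℝ}
    (h : besovNorm χ β ∞ ∞ u ≤ ENNReal.ofReal B) (j : ℕ) :
    blockNorm χ ∞ j u ≤ ENNReal.ofReal (2 ^ β * B * 2 ^ (-(β * j))) := by
  refine (blockNorm_le (q := ∞) (by simp) β ∞ j u).trans ((mul_le_mul_right h _).trans ?_)
  rw [weight_eq, ← ENNReal.ofReal_mul (by positivity), neg_neg]
  exact ENNReal.ofReal_le_ofReal (le_of_eq (by ring))

theorem NonvanishingDiffusion.exists_driftData {T σ β : ℝ} (hT : 0 < T) (hβ : 0 < β)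
    {K F : E d → E d} {ρ : ℝ → E d → ℝ} (hK : Periodic K) (hK1 : Integrable K (torusMeasure d))
    (h : NonvanishingDiffusion χ T σ β K F ρ) : ∃ R κ : ℝ, DriftData χ T σ β R κ K F ρ := by
  obtain ⟨B, hB⟩ := h.rho_holder.exists_besov_bound
  have hKi : ∀ i, ∫⁻ x, ‖((K x i : ℝ) : ℂ)‖ₑ ∂torusMeasure d ≠ ∞ := fun i =>
    (integrable_coord hK1 i).2.ne
  set κ : ℝ := ∑ i, (∫⁻ x, ‖((K x i : ℝ) : ℂ)‖ₑ ∂torusMeasure d).toReal with hκ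
  have hκ0 : 0 ≤ κ := Finset.sum_nonneg fun i _ => ENNReal.toReal_nonneg
  set BF : ℝ := ∑ i, (besovNorm χ β ∞ ∞ (fcoef fun x => (F x i : ℂ))).toReal with hBF
  have hBF0 : 0 ≤ BF := Finset.sum_nonneg fun i _ => ENNReal.toReal_nonneg
  have hkernel : ∀ i, MultBound
      (fun k => (((2 * Real.pi) ^ d : ℝ) : ℂ) * fcoef (fun x => (K x i : ℂ)) k)
      (ENNReal.ofReal κ) := fun i => (multBound_convolution (integrable_coord hK1 i)).mono (by
    rw [← ENNReal.ofReal_toReal (hKi i)]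
    exact ENNReal.ofReal_le_ofReal (Finset.single_le_sum
      (f := fun i => (∫⁻ x, ‖((K x i : ℝ) : ℂ)‖ₑ ∂torusMeasure d).toReal)
      (fun i _ => ENNReal.toReal_nonneg) (Finset.mem_univ i)))
  have hconv : ∀ s ∈ Icc 0 T, ∀ i, (fcoef fun x => (convFun K (ρ s) x i : ℂ)) =
      convCoef (fun x => (K x i : ℂ)) (fcoef fun x => (ρ s x : ℂ)) := fun s hs i => by
    ext k
    exact fcoef_convFun hK hK1 (h.rho_holder.1 s hs).1 (h.rho_holder.1 s hs).2.1 i k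
  have hρ : ∀ s ∈ Icc 0 T, ∀ j, blockNorm χ ∞ j (fcoef fun x => (ρ s x : ℂ)) ≤
      ENNReal.ofReal (2 ^ β * B * 2 ^ (-(β * j))) := fun s hs j =>
    blockNorm_le_of_besovNorm_le (by rw [ENNReal.ofReal_coe_nnreal]; exact hB s hs) j
  have hmono : ∀ {a : ℝ} (j : ℕ), a ≤ 2 ^ β * (B + κ * B + BF) →
      ENNReal.ofReal (a * 2 ^ (-(β * j))) ≤
        ENNReal.ofReal (2 ^ β * (B + κ * B + BF) * 2 ^ (-(β * j))) := fun j ha =>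
    ENNReal.ofReal_le_ofReal (mul_le_mul_of_nonneg_right ha (by positivity))
  have h2β : (0 : ℝ) < 2 ^ β := by positivity
  have hB0 : (0 : ℝ) ≤ B := B.coe_nonneg
  have hκB : 0 ≤ κ * B := by positivity
  -- A single constant dominates the bounds of `ρ`, of `K * ρ`, where convolution costs the factor
  -- `κ`, and of `F`. The factor `2 ^ β` again comes from the index shift in the weight.
  refine ⟨2 ^ β * (B + κ * B + BF), κ, hT, h.sigma_pos, by positivity, hκ0, fun s hs =>
    ⟨fun j => (hρ s hs j).trans (hmono j (by nlinarith)), fun i j => ?_, fun i j => ?_, hkernel⟩,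
    h.rho_holder.continuousOn_fcoef hβ, fun i k => ?_⟩
  · rw [hconv s hs i]
    refine ((hkernel i).blockNorm_le le_top j _).trans ((mul_le_mul_right (hρ s hs j) _).trans ?_)
    rw [← ENNReal.ofReal_mul hκ0, ← mul_assoc]
    exact hmono j (by nlinarith)
  · refine (blockNorm_le_of_besovNorm_le (B := BF) ?_ j).trans (hmono j (by nlinarith))
    rw [← ENNReal.ofReal_toReal (h.F_holder i).2.2.ne]
    exact ENNReal.ofReal_le_ofReal (Finset.single_le_sum
      (f := fun i => (besovNorm χ β ∞ ∞ (fcoef fun x => (F x i : ℂ))).toReal)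
      (fun i _ => ENNReal.toReal_nonneg) (Finset.mem_univ i))
  · refine ContinuousOn.congr (f := fun s => convCoef (fun x => (K x i : ℂ))
      (fcoef fun x => (ρ s x : ℂ)) k) ?_ fun s hs => congrFun (hconv s hs i) k
    exact continuousOn_const.mul (h.rho_holder.continuousOn_fcoef hβ k)

end FluctuationSPDE

end

noncomputable section

namespace FluctuationSPDE

variable {d : ℕ} {χ : DyadicPartition d}

/-! ### The gradient of the heat kernel -/

theorem summable_exp_neg_mul_int_sq {a : ℝ} (ha : 0 < a) :
    Summable fun n : ℤ => Real.exp (-(a * (n : ℝ) ^ 2)) := by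
  refine Summable.of_norm_bounded_eventually
    ((Real.summable_one_div_int_pow (p := 2)).2 one_lt_two |>.mul_left (1 / a)) ?_
  filter_upwards [(finite_singleton (0 : ℤ)).compl_mem_cofinite] with n hn
  have hn0 : (n : ℝ) ≠ 0 := by exact_mod_cast hn
  have hpos : 0 < a * (n : ℝ) ^ 2 := by positivity
  rw [Real.norm_of_nonneg (Real.exp_pos _).le, Real.exp_neg, one_div_mul_one_div, one_div]
  exact inv_anti₀ hpos (by linarith [Real.add_one_le_exp (a * (n : ℝ) ^ 2)])

theorem summable_exp_neg_mul_freq_sq {a : ℝ} (ha : 0 < a) :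
    Summable fun k : Fin d → ℤ => Real.exp (-(a * ‖freq k‖ ^ 2)) := by
  have h1 := summable_exp_neg_mul_int_sq ha
  set C := ∑' n : ℤ, Real.exp (-(a * (n : ℝ) ^ 2)) with hC
  refine summable_of_sum_le (c := C ^ d) (fun k => (Real.exp_pos _).le) fun S => ?_
  obtain ⟨N, hN⟩ : ∃ N : ℕ, S ⊆ box d N := by
    refine ⟨S.sup fun k => ∑ i, (k i).natAbs, fun k hk => mem_box.2 fun i => ?_⟩
    have h2 := Finset.le_sup (f := fun k : Fin d → ℤ => ∑ i, (k i).natAbs) hk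
    have h3 : (k i).natAbs ≤ ∑ i, (k i).natAbs :=
      Finset.single_le_sum (f := fun i => (k i).natAbs) (fun _ _ => zero_le) (Finset.mem_univ i)
    have h4 : (k i).natAbs ≤ S.sup fun k => ∑ i, (k i).natAbs := h3.trans h2
    rw [Int.abs_eq_natAbs]
    exact_mod_cast h4
  calc ∑ k ∈ S, Real.exp (-(a * ‖freq k‖ ^ 2))
      ≤ ∑ k ∈ box d N, Real.exp (-(a * ‖freq k‖ ^ 2)) :=
        Finset.sum_le_sum_of_subset_of_nonneg hN fun _ _ _ => (Real.exp_pos _).le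
    _ = ∑ k ∈ box d N, ∏ i, Real.exp (-(a * (k i : ℝ) ^ 2)) := by
        refine Finset.sum_congr rfl fun k _ => ?_
        rw [← Real.exp_sum, EuclideanSpace.norm_sq_eq]
        simp [freq, Finset.mul_sum]
    _ = ∏ _i : Fin d, ∑ n ∈ Finset.Icc (-(N : ℤ)) N, Real.exp (-(a * (n : ℝ) ^ 2)) := by
        rw [box, Finset.prod_univ_sum]
    _ ≤ ∏ _i : Fin d, C := Finset.prod_le_prod
        (fun _ _ => Finset.sum_nonneg fun _ _ => (Real.exp_pos _).le)
        fun _ _ => h1.sum_le_tsum _ fun _ _ => (Real.exp_pos _).le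
    _ = C ^ d := by simp

/-- Half of the Gaussian absorbs the factor `|k|`, the other half is summable. This justifies
differentiating and integrating the heat kernel term by term. -/
theorem summable_norm_freq_mul_exp {a : ℝ} (ha : 0 < a) :
    Summable fun k : Fin d → ℤ => ‖freq k‖ * Real.exp (-(a * ‖freq k‖ ^ 2)) := by
  refine Summable.of_nonneg_of_le (fun k => by positivity) (fun k => ?_)
    ((summable_exp_neg_mul_freq_sq (half_pos ha)).mul_left (1 + 2 / a))
  set x := ‖freq k‖ with hx
  have h1 : Real.exp (-(a * x ^ 2)) = Real.exp (-(a / 2 * x ^ 2)) * Real.exp (-(a / 2 * x ^ 2)) := by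
    rw [← Real.exp_add]; congr 1; ring
  have h2 : a / 2 * x ^ 2 + 1 ≤ Real.exp (a / 2 * x ^ 2) := Real.add_one_le_exp _
  have h3 : x ≤ (1 + 2 / a) * Real.exp (a / 2 * x ^ 2) := by
    have h4 : x ^ 2 = 2 / a * (a / 2 * x ^ 2) := by field_simp
    have h5 : 0 < 2 / a := by positivity
    have h6 : 0 ≤ a / 2 * x ^ 2 := by positivity
    nlinarith [sq_nonneg (x - 1), mul_le_mul_of_nonneg_left h2 h5.le]
  rw [h1, ← mul_assoc]
  refine mul_le_mul_of_nonneg_right ?_ (Real.exp_pos _).le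
  rw [Real.exp_neg]
  exact (mul_inv_le_iff₀ (Real.exp_pos _)).2 h3

/-- The real-linear form `x ↦ k · x`, with complex values. -/
def phase (k : Fin d → ℤ) : E d →L[ℝ] ℂ := Complex.ofRealCLM.comp (innerSL ℝ (freq k))

theorem fourierE_eq_exp_phase (k : Fin d → ℤ) (x : E d) :
    fourierE k x = Complex.exp (Complex.I * phase k x) := by
  rw [fourierE_eq_exp_inner, real_inner_comm]; rfl

theorem norm_phase_le (k : Fin d → ℤ) : ‖phase k‖ ≤ ‖freq k‖ := by
  refine ContinuousLinearMap.opNorm_le_bound _ (norm_nonneg _) fun x => ?_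
  simp only [phase, ContinuousLinearMap.comp_apply, innerSL_apply_apply, Complex.ofRealCLM_apply,
    Complex.norm_real]
  exact norm_inner_le_norm _ _

theorem phase_single (k : Fin d → ℤ) (i : Fin d) :
    phase k (EuclideanSpace.single i (1 : ℝ)) = (k i : ℂ) := by
  simp [phase, freq, EuclideanSpace.inner_single_right]

theorem hasFDerivAt_fourierE (k : Fin d → ℤ) (x : E d) :
    HasFDerivAt (fourierE k) ((fourierE k x) • (Complex.I • phase k)) x := by
  have h := (((phase k).hasFDerivAt (x := x)).const_mul Complex.I).cexp
  rw [← fourierE_eq_exp_phase] at h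
  exact h.congr_of_eventuallyEq (Eventually.of_forall fun y => fourierE_eq_exp_phase k y)

theorem norm_heatSymbol (σ t : ℝ) (k : Fin d → ℤ) :
    ‖heatSymbol σ t k‖ = Real.exp (-(σ * t * ‖freq k‖ ^ 2)) := by
  rw [heatSymbol, Complex.norm_real, Real.norm_of_nonneg (Real.exp_pos _).le]

theorem norm_coord_mul_heatSymbol_le (σ t : ℝ) (k : Fin d → ℤ) (i : Fin d) :
    ‖heatSymbol σ t k * (Complex.I * (k i : ℂ))‖ ≤
      ‖freq k‖ * Real.exp (-(σ * t * ‖freq k‖ ^ 2)) := by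
  rw [norm_mul, norm_heatSymbol, mul_comm]
  refine mul_le_mul_of_nonneg_right ?_ (Real.exp_pos _).le
  have := abs_le_norm_freq k i
  simpa using this

theorem pderiv_heatKernel {σ τ : ℝ} (h : 0 < σ * τ) (i : Fin d) (x : E d) :
    pderiv i (heatKernel σ τ) x = (((2 * Real.pi) ^ d : ℝ) : ℂ)⁻¹ *
      ∑' k : Fin d → ℤ, heatSymbol σ τ k * (Complex.I * (k i : ℂ)) * fourierE k x := by
  have hsum := summable_norm_freq_mul_exp (d := d) h
  have hb : ∀ (k : Fin d → ℤ) (x : E d),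
      ‖heatSymbol σ τ k • ((fourierE k x) • (Complex.I • phase k))‖ ≤
        ‖freq k‖ * Real.exp (-(σ * τ * ‖freq k‖ ^ 2)) := by
    intro k x
    rw [norm_smul, norm_smul, norm_smul, norm_fourierE, Complex.norm_I, one_mul, one_mul,
      norm_heatSymbol, mul_comm]
    exact mul_le_mul_of_nonneg_right (norm_phase_le k) (Real.exp_pos _).le
  have h1 : HasFDerivAt (fun x => ∑' k : Fin d → ℤ, heatSymbol σ τ k * fourierE k x)
      (∑' k : Fin d → ℤ, heatSymbol σ τ k • ((fourierE k x) • (Complex.I • phase k))) x := by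
    refine hasFDerivAt_tsum hsum (fun k x => (hasFDerivAt_fourierE k x).const_mul _) hb (x₀ := 0) ?_ x
    refine Summable.of_norm_bounded (summable_exp_neg_mul_freq_sq h) fun k => ?_
    rw [norm_mul, norm_fourierE, mul_one, norm_heatSymbol]
  have h2 := h1.const_mul (((2 * Real.pi) ^ d : ℝ) : ℂ)⁻¹
  have h3 : Summable fun k : Fin d → ℤ =>
      heatSymbol σ τ k • ((fourierE k x) • (Complex.I • phase k)) :=
    Summable.of_norm_bounded hsum fun k => hb k x
  rw [pderiv, show heatKernel σ τ = fun x => (((2 * Real.pi) ^ d : ℝ) : ℂ)⁻¹ *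
    ∑' k : Fin d → ℤ, heatSymbol σ τ k * fourierE k x from rfl, h2.fderiv,
    smul_apply, smul_eq_mul]
  congr 1
  have h4 := (ContinuousLinearMap.apply ℝ ℂ (EuclideanSpace.single i (1 : ℝ))).map_tsum h3
  simp only [ContinuousLinearMap.apply_apply] at h4
  rw [h4]
  refine tsum_congr fun k => ?_
  simp only [smul_apply, smul_eq_mul, phase_single]
  ring

theorem integral_pderiv_heatKernel {σ τ : ℝ} (h : 0 < σ * τ) (i : Fin d) (k : Fin d → ℤ)
    (y : E d) :
    ∫ x, pderiv i (heatKernel σ τ) (x - y) * fourierE (-k) x ∂torusMeasure d =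
      Complex.I * (k i : ℂ) * heatSymbol σ τ k * fourierE (-k) y := by
  have hsum := summable_norm_freq_mul_exp (d := d) h
  set V : ℂ := (((2 * Real.pi) ^ d : ℝ) : ℂ) with hV
  have hV0 : V ≠ 0 := by
    rw [hV]; exact_mod_cast (by positivity : ((2 * Real.pi) ^ d : ℝ) ≠ 0)
  set f : (Fin d → ℤ) → E d → ℂ := fun l x =>
    V⁻¹ * (heatSymbol σ τ l * (Complex.I * (l i : ℂ)) * fourierE (-l) y) * fourierE (l + -k) x with hf
  have h1 : ∀ x, pderiv i (heatKernel σ τ) (x - y) * fourierE (-k) x = ∑' l, f l x := by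
    intro x
    rw [pderiv_heatKernel h, ← hV, mul_assoc, ← tsum_mul_right, ← tsum_mul_left]
    refine tsum_congr fun l => ?_
    rw [hf, sub_eq_add_neg, fourierE_add_right, fourierE_neg_right]
    simp only
    rw [fourierE_add]
    ring
  have hfn : ∀ l x, ‖f l x‖ ≤ ‖V⁻¹‖ * (‖freq l‖ * Real.exp (-(σ * τ * ‖freq l‖ ^ 2))) := by
    intro l x
    rw [hf]
    simp only
    rw [norm_mul, norm_mul, norm_mul, norm_fourierE, norm_fourierE, mul_one, mul_one]
    exact mul_le_mul_of_nonneg_left (norm_coord_mul_heatSymbol_le σ τ l i) (norm_nonneg _)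
  have hfc : ∀ l, Continuous (f l) := fun l => continuous_const.mul (continuous_fourierE _)
  simp_rw [h1]
  have h2 := hasSum_integral_of_summable_integral_norm
    (fun l => integrable_torus_of_continuous (hfc l)) (μ := torusMeasure d) (by
      refine Summable.of_nonneg_of_le (fun l => integral_nonneg fun x => norm_nonneg _) (fun l => ?_)
        ((hsum.mul_left ‖V⁻¹‖).mul_left ((torusMeasure d).real univ))
      rw [← smul_eq_mul, ← integral_const]
      exact integral_mono (integrable_torus_of_continuous (hfc l).norm) (integrable_const _)
        fun x => hfn l x)
  rw [← h2.tsum_eq, tsum_eq_single k]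
  · simp only [hf]
    rw [integral_const_mul, integral_fourierE, if_pos (by simp), ← hV]
    field_simp
  · intro l hl
    simp only [hf]
    rw [integral_const_mul, integral_fourierE, if_neg (fun h0 => hl (by
      rwa [← sub_eq_add_neg, sub_eq_zero] at h0)), mul_zero]

/-- For `s < t` the heat kernel is a rapidly convergent series, and integration against a character
retains one term. The integrand of a coefficient of `Z_t` is thus an explicit heat factor times `√ρ
e_{-k}`. -/
theorem noiseKernel_fourierTest {σ : ℝ} (hσ : 0 < σ) (ρ : ℝ → E d → ℝ) (t : ℝ) (k : Fin d → ℤ)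
    (z : ℝ × E d) (i : Fin d) :
    noiseKernel σ ρ t (fourierTest (-k)) z i = (Ico 0 t).indicator (fun s =>
      (Real.sqrt (ρ s z.2) : ℂ) * (Complex.I * (k i : ℂ) * heatSymbol σ (t - s) k *
        fourierE (-k) z.2)) z.1 := by
  rw [noiseKernel]
  by_cases hz : z.1 ∈ Ico 0 t
  · rw [indicator_of_mem hz, indicator_of_mem hz, ← integral_pderiv_heatKernel
      (mul_pos hσ (sub_pos.2 hz.2))]
    rfl
  · rw [indicator_of_notMem hz, indicator_of_notMem hz]

end FluctuationSPDE

end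

/-! ### Gaussian moments, white noise and complex stochastic integrals -/

noncomputable section

namespace FluctuationSPDE

variable {d : ℕ} {χ : DyadicPartition d}

/-! ### Gaussian moments -/

/-- The moments of the standard Gaussian law. -/
def gaussMoment (n : ℕ) : ℝ := ∫ x, x ^ n ∂gaussianReal 0 1

theorem hasDerivAt_mul_exp_half_sq {f : ℝ → ℝ} {f' t : ℝ} (hf : HasDerivAt f f' t) :
    HasDerivAt (fun t => f t * Real.exp (t ^ 2 / 2)) ((f' + t * f t) * Real.exp (t ^ 2 / 2)) t := by
  have h1 : HasDerivAt (fun t : ℝ => t ^ 2 / 2) t t := by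
    have := ((hasDerivAt_id t).pow 2).div_const 2
    simpa using this
  exact (hf.mul h1.exp).congr_deriv (by ring)

/-- The exact value is needed for Wick's formula; of the other moments only finiteness and sign
matter. It is the fourth derivative at zero of `e^{t²/2}`. -/
theorem gaussMoment_four : gaussMoment 4 = 3 := by
  have h0 : gaussMoment 4 = iteratedDeriv 4 (mgf (fun x => x) (gaussianReal 0 1)) 0 := by
    rw [iteratedDeriv_mgf_zero] <;> simp [gaussMoment]
  have e0 : mgf (fun x => x) (gaussianReal 0 1) = fun t : ℝ => 1 * Real.exp (t ^ 2 / 2) := by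
    rw [mgf_fun_id_gaussianReal]; simp
  have e1 : deriv (fun t : ℝ => 1 * Real.exp (t ^ 2 / 2)) = fun t => t * Real.exp (t ^ 2 / 2) := by
    ext t
    rw [(hasDerivAt_mul_exp_half_sq (hasDerivAt_const t (1 : ℝ))).deriv]
    ring
  have e2 : deriv (fun t : ℝ => t * Real.exp (t ^ 2 / 2)) =
      fun t => (1 + t ^ 2) * Real.exp (t ^ 2 / 2) := by
    ext t
    rw [(hasDerivAt_mul_exp_half_sq (hasDerivAt_id' t)).deriv]
    ring
  have e3 : deriv (fun t : ℝ => (1 + t ^ 2) * Real.exp (t ^ 2 / 2)) =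
      fun t => (3 * t + t ^ 3) * Real.exp (t ^ 2 / 2) := by
    ext t
    rw [(hasDerivAt_mul_exp_half_sq ((hasDerivAt_pow 2 t).const_add 1)).deriv]
    simp only [Nat.cast_ofNat]
    ring
  have e4 : deriv (fun t : ℝ => (3 * t + t ^ 3) * Real.exp (t ^ 2 / 2)) =
      fun t => (3 + 6 * t ^ 2 + t ^ 4) * Real.exp (t ^ 2 / 2) := by
    ext t
    rw [(hasDerivAt_mul_exp_half_sq (((hasDerivAt_id' t).const_mul 3).fun_add
      (hasDerivAt_pow 3 t))).deriv]
    simp only [Nat.cast_ofNat]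
    ring
  rw [h0, e0]
  simp only [iteratedDeriv_succ, iteratedDeriv_zero, e1, e2, e3, e4]
  simp

theorem gaussMoment_nonneg (m : ℕ) : 0 ≤ gaussMoment (2 * m) :=
  integral_nonneg fun x => by
    simp only [Pi.zero_apply, pow_mul]
    positivity

/-! ### White noise -/

section Noise

variable {Ω : Type*} [MeasurableSpace Ω] {P : Measure Ω} {ξ : NoiseSpace d → Ω → ℝ}

theorem IsWhiteNoise.memLp (hξ : IsWhiteNoise P ξ) (h : NoiseSpace d) {p : ℝ≥0∞} (hp : p ≠ ∞) :
    MemLp (ξ h) p P := (hξ.gaussian.hasGaussianLaw_eval h).memLp hp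

theorem IsWhiteNoise.integrable_pow (hξ : IsWhiteNoise P ξ) (h : NoiseSpace d) (n : ℕ) :
    Integrable (fun ω => ξ h ω ^ n) P := by
  have := hξ.gaussian.isProbabilityMeasure
  refine ((hξ.memLp h (p := n) (by simp)).integrable_norm_pow' ).mono'
    ((hξ.memLp h (p := 1) (by simp)).1.pow n) (Eventually.of_forall fun ω => ?_)
  rw [norm_pow]

theorem IsWhiteNoise.map_eq (hξ : IsWhiteNoise P ξ) (h : NoiseSpace d) :
    P.map (ξ h) = (gaussianReal 0 1).map (‖h‖ * ·) := by
  have := hξ.gaussian.isProbabilityMeasure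
  rw [(hξ.gaussian.hasGaussianLaw_eval h).map_eq_gaussianReal, gaussianReal_map_const_mul,
    variance_eq_integral (hξ.gaussian.aemeasurable h), hξ.centered h]
  have h1 : ∫ ω, (ξ h ω - 0) ^ 2 ∂P = ‖h‖ ^ 2 := by
    simp only [sub_zero, pow_two]
    rw [hξ.covariance h h, real_inner_self_eq_norm_sq, pow_two]
  rw [h1, mul_zero, mul_one]
  congr 1
  exact Real.toNNReal_of_nonneg (sq_nonneg _)

theorem IsWhiteNoise.integral_pow (hξ : IsWhiteNoise P ξ) (h : NoiseSpace d) (n : ℕ) :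
    ∫ ω, ξ h ω ^ n ∂P = ‖h‖ ^ n * gaussMoment n := by
  have h1 : ∫ ω, ξ h ω ^ n ∂P = ∫ x, x ^ n ∂(P.map (ξ h)) :=
    (integral_map (f := fun x : ℝ => x ^ n) (hξ.gaussian.aemeasurable h)
      (measurable_id.pow_const n).aestronglyMeasurable).symm
  rw [h1, hξ.map_eq h, integral_map (f := fun x : ℝ => x ^ n) (by fun_prop)
    (measurable_id.pow_const n).aestronglyMeasurable, gaussMoment, ← integral_const_mul]
  simp_rw [mul_pow]

theorem IsWhiteNoise.lintegral_pow (hξ : IsWhiteNoise P ξ) (h : NoiseSpace d) (m : ℕ) :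
    ∫⁻ ω, ‖ξ h ω‖ₑ ^ (2 * m) ∂P = ENNReal.ofReal (gaussMoment (2 * m)) * ‖h‖ₑ ^ (2 * m) := by
  have h1 : ∀ ω, ‖ξ h ω‖ₑ ^ (2 * m) = ENNReal.ofReal (ξ h ω ^ (2 * m)) := fun ω => by
    rw [← ofReal_norm, ← ENNReal.ofReal_pow (norm_nonneg _), Real.norm_eq_abs, pow_mul, sq_abs,
      ← pow_mul]
  simp_rw [h1]
  rw [← ofReal_integral_eq_lintegral_ofReal (hξ.integrable_pow h _)
    (Eventually.of_forall fun ω => by simp only [Pi.zero_apply, pow_mul]; positivity),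
    hξ.integral_pow, mul_comm, ENNReal.ofReal_mul (gaussMoment_nonneg m),
    ENNReal.ofReal_pow (norm_nonneg _), ofReal_norm]

/-- Linearity is not part of the definition of a white noise. The covariance makes `ξ` an isometry
into `L²(Ω)`, so the defect of linearity has norm zero; the exceptional set depends on the
combination. -/
theorem IsWhiteNoise.lincomb (hξ : IsWhiteNoise P ξ) (a b : ℝ) (f g : NoiseSpace d) :
    ξ (a • f + b • g) =ᵐ[P] fun ω => a * ξ f ω + b * ξ g ω := by
  set Φ : NoiseSpace d → Lp ℝ 2 P := fun h => (hξ.memLp h (p := 2) (by simp)).toLp (ξ h) with hΦ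
  have hinner : ∀ f g, ⟪Φ f, Φ g⟫_ℝ = ⟪f, g⟫_ℝ := by
    intro f g
    rw [← hξ.covariance f g, L2.inner_def]
    refine integral_congr_ae ?_
    filter_upwards [(hξ.memLp f (p := 2) (by simp)).coeFn_toLp,
      (hξ.memLp g (p := 2) (by simp)).coeFn_toLp] with ω h1 h2
    rw [hΦ, h1, h2]
    simp [mul_comm]
  have h0 : Φ (a • f + b • g) - (a • Φ f + b • Φ g) = 0 := by
    rw [← inner_self_eq_zero (𝕜 := ℝ)]
    simp only [inner_sub_left, inner_sub_right, inner_add_left, inner_add_right, inner_smul_left,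
      inner_smul_right, hinner]
    simp only [conj_trivial]
    ring
  have h1 := sub_eq_zero.1 h0
  filter_upwards [(hξ.memLp (a • f + b • g) (p := 2) (by simp)).coeFn_toLp,
    (hξ.memLp f (p := 2) (by simp)).coeFn_toLp, (hξ.memLp g (p := 2) (by simp)).coeFn_toLp,
    Lp.coeFn_add (a • Φ f) (b • Φ g), Lp.coeFn_smul a (Φ f), Lp.coeFn_smul b (Φ g)]
    with ω e1 e2 e3 e4 e5 e6
  rw [← e1, ← e2, ← e3]
  change (Φ (a • f + b • g)) ω = a * (Φ f) ω + b * (Φ g) ω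
  rw [h1, e4, Pi.add_apply, e5, e6]
  simp

/-- Wick's formula for the squares. -/
theorem IsWhiteNoise.integral_sq_mul_sq (hξ : IsWhiteNoise P ξ) (f g : NoiseSpace d) :
    Integrable (fun ω => ξ f ω ^ 2 * ξ g ω ^ 2) P ∧
    ∫ ω, ξ f ω ^ 2 * ξ g ω ^ 2 ∂P = ‖f‖ ^ 2 * ‖g‖ ^ 2 + 2 * ⟪f, g⟫_ℝ ^ 2 := by
  have hp := hξ.lincomb 1 1 f g
  have hm := hξ.lincomb 1 (-1) f g
  set u := (1 : ℝ) • f + (1 : ℝ) • g with hu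
  set v := (1 : ℝ) • f + (-1 : ℝ) • g with hv
  -- The polarization `12 a²b² = (a+b)⁴ + (a-b)⁴ - 2a⁴ - 2b⁴` reduces the mixed moment to fourth
  -- moments of single Gaussian variables.
  have key : (fun ω => ξ f ω ^ 2 * ξ g ω ^ 2) =ᵐ[P] fun ω =>
      1 / 12 * ((ξ u ω ^ 4 + ξ v ω ^ 4) - 2 * (ξ f ω ^ 4 + ξ g ω ^ 4)) := by
    filter_upwards [hp, hm] with ω h1 h2
    rw [h1, h2]
    ring
  have hi := fun h => hξ.integrable_pow h 4
  have i1 : Integrable (fun ω => ξ u ω ^ 4 + ξ v ω ^ 4) P := (hi u).add (hi v)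
  have i2 : Integrable (fun ω => 2 * (ξ f ω ^ 4 + ξ g ω ^ 4)) P := ((hi f).add (hi g)).const_mul 2
  have hint : Integrable (fun ω =>
      1 / 12 * ((ξ u ω ^ 4 + ξ v ω ^ 4) - 2 * (ξ f ω ^ 4 + ξ g ω ^ 4))) P :=
    (i1.sub i2).const_mul _
  refine ⟨hint.congr key.symm, ?_⟩
  rw [integral_congr_ae key, integral_const_mul, integral_sub i1 i2, integral_const_mul, integral_add (hi u) (hi v),
    integral_add (hi f) (hi g)]
  simp only [hξ.integral_pow, gaussMoment_four]
  have hu2 : ‖u‖ ^ 2 = ‖f‖ ^ 2 + 2 * ⟪f, g⟫_ℝ + ‖g‖ ^ 2 := by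
    rw [hu, one_smul, one_smul, norm_add_sq_real]
  have hv2 : ‖v‖ ^ 2 = ‖f‖ ^ 2 - 2 * ⟪f, g⟫_ℝ + ‖g‖ ^ 2 := by
    rw [hv, one_smul, neg_one_smul, ← sub_eq_add_neg, norm_sub_sq_real]
  have e4 : ∀ x : ℝ, x ^ 4 = (x ^ 2) ^ 2 := fun x => by ring
  rw [e4 ‖u‖, e4 ‖v‖, hu2, hv2]
  ring

/-- The second moment of a sum of squares of a Gaussian family. -/
theorem IsWhiteNoise.integral_sum_sq_sub_sq (hξ : IsWhiteNoise P ξ) {ι : Type*} (I : Finset ι)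
    (f : ι → NoiseSpace d) {L : ℝ} (hL : ∀ g : NoiseSpace d, ∑ i ∈ I, ⟪g, f i⟫_ℝ ^ 2 ≤ L * ‖g‖ ^ 2) :
    Integrable (fun ω => (∑ i ∈ I, ξ (f i) ω ^ 2 - ∑ i ∈ I, ‖f i‖ ^ 2) ^ 2) P ∧
    ∫ ω, (∑ i ∈ I, ξ (f i) ω ^ 2 - ∑ i ∈ I, ‖f i‖ ^ 2) ^ 2 ∂P ≤ 2 * L * ∑ i ∈ I, ‖f i‖ ^ 2 := by
  have := hξ.gaussian.isProbabilityMeasure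
  set M := ∑ i ∈ I, ‖f i‖ ^ 2 with hM
  have hi2 := fun h => hξ.integrable_pow h 2
  have hE2 : ∀ h, ∫ ω, ξ h ω ^ 2 ∂P = ‖h‖ ^ 2 := fun h => by
    simp_rw [pow_two]; rw [hξ.covariance, real_inner_self_eq_norm_mul_norm]
  have hexp : ∀ ω, (∑ i ∈ I, ξ (f i) ω ^ 2 - M) ^ 2 =
      (∑ i ∈ I, ∑ j ∈ I, ξ (f i) ω ^ 2 * ξ (f j) ω ^ 2) - 2 * M * ∑ i ∈ I, ξ (f i) ω ^ 2 + M ^ 2 := by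
    intro ω
    rw [← Finset.sum_mul_sum]
    ring
  have h1 : Integrable (fun ω => ∑ i ∈ I, ∑ j ∈ I, ξ (f i) ω ^ 2 * ξ (f j) ω ^ 2) P :=
    integrable_finsetSum _ fun i _ => integrable_finsetSum _ fun j _ =>
      (hξ.integral_sq_mul_sq (f i) (f j)).1
  have h2 : Integrable (fun ω => 2 * M * ∑ i ∈ I, ξ (f i) ω ^ 2) P :=
    (integrable_finsetSum _ fun i _ => hi2 (f i)).const_mul _
  have h12 : Integrable (fun ω => (∑ i ∈ I, ∑ j ∈ I, ξ (f i) ω ^ 2 * ξ (f j) ω ^ 2) -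
      2 * M * ∑ i ∈ I, ξ (f i) ω ^ 2) P := h1.sub h2
  simp_rw [hexp]
  refine ⟨h12.add (integrable_const _), ?_⟩
  rw [integral_add h12 (integrable_const _), integral_sub h1 h2, integral_const_mul,
    integral_finsetSum _ fun i _ => hi2 (f i), integral_finsetSum _ fun i _ =>
      integrable_finsetSum _ fun j _ => (hξ.integral_sq_mul_sq (f i) (f j)).1]
  simp_rw [hE2, ← hM]
  -- By Wick's formula the products of variances add up to `M²` and cancel. The variance is twice
  -- the sum of the squared covariances, which `hL` bounds row by row.
  have h3 : ∀ i, ∫ ω, ∑ j ∈ I, ξ (f i) ω ^ 2 * ξ (f j) ω ^ 2 ∂P =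
      ‖f i‖ ^ 2 * M + 2 * ∑ j ∈ I, ⟪f i, f j⟫_ℝ ^ 2 := by
    intro i
    rw [integral_finsetSum _ fun j _ => (hξ.integral_sq_mul_sq (f i) (f j)).1]
    simp_rw [(hξ.integral_sq_mul_sq _ _).2]
    rw [Finset.sum_add_distrib, ← Finset.mul_sum, ← Finset.mul_sum, ← hM]
  simp_rw [h3]
  rw [Finset.sum_add_distrib, ← Finset.sum_mul, ← hM, ← Finset.mul_sum]
  have h4 : ∑ i ∈ I, ∑ j ∈ I, ⟪f i, f j⟫_ℝ ^ 2 ≤ L * M := by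
    rw [hM, Finset.mul_sum]
    exact Finset.sum_le_sum fun i _ => hL (f i)
  simp only [integral_const, probReal_univ, smul_eq_mul, one_mul]
  nlinarith

/-! ### Complex noise integrals -/

theorem noiseIntegral_of_memLp {Ω : Type*} {ξ : NoiseSpace d → Ω → ℝ} {g : ℝ × E d → E d} (hg : MemLp g 2 (spaceTime d)) :
    noiseIntegral ξ g = ξ (hg.toLp g) := by
  ext ω; rw [noiseIntegral, dif_pos hg]

theorem IsWhiteNoise.noiseIntegral_lincomb (hξ : IsWhiteNoise P ξ) (a b : ℝ) {f g : ℝ × E d → E d}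
    (hf : MemLp f 2 (spaceTime d)) (hg : MemLp g 2 (spaceTime d)) :
    noiseIntegral ξ (a • f + b • g) =ᵐ[P]
      fun ω => a * noiseIntegral ξ f ω + b * noiseIntegral ξ g ω := by
  rw [noiseIntegral_of_memLp hf, noiseIntegral_of_memLp hg,
    noiseIntegral_of_memLp ((hf.const_smul a).add (hg.const_smul b)),
    MemLp.toLp_add (hf.const_smul a) (hg.const_smul b), MemLp.toLp_const_smul,
    MemLp.toLp_const_smul]
  exact hξ.lincomb a b _ _

/-- The real part of a complex vector field. -/
def reField (G : ℝ × E d → Fin d → ℂ) (z : ℝ × E d) : E d := WithLp.toLp 2 fun i => (G z i).re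

/-- The imaginary part of a complex vector field. -/
def imField (G : ℝ × E d → Fin d → ℂ) (z : ℝ × E d) : E d := WithLp.toLp 2 fun i => (G z i).im

/-- Square integrable complex vector fields. -/
structure SqIntegrable (G : ℝ × E d → Fin d → ℂ) : Prop where
  re : MemLp (reField G) 2 (spaceTime d)
  im : MemLp (imField G) 2 (spaceTime d)

/-- The stochastic integral of a complex vector field. -/
def cNoise (ξ : NoiseSpace d → Ω → ℝ) (G : ℝ × E d → Fin d → ℂ) (ω : Ω) : ℂ :=
  (noiseIntegral ξ (reField G) ω : ℂ) + Complex.I * (noiseIntegral ξ (imField G) ω : ℂ)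

/-- The squared `L^2` norm of a complex vector field. -/
def energy (G : ℝ × E d → Fin d → ℂ) : ℝ≥0∞ := ∫⁻ z, ∑ i, ‖G z i‖ₑ ^ 2 ∂spaceTime d

theorem stochConv_eq {Ω : Type*} {ξ : NoiseSpace d → Ω → ℝ} (σ : ℝ) (ρ : ℝ → E d → ℝ) (t : ℝ) (φ : TestFun d) :
    stochConv ξ σ ρ t φ = cNoise ξ (noiseKernel σ ρ t φ) := rfl

theorem reField_lincomb (a b : ℂ) (G H : ℝ × E d → Fin d → ℂ) :
    reField (a • G + b • H) = ((1 : ℝ) • (a.re • reField G + (-a.im) • imField G) +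
      (1 : ℝ) • (b.re • reField H + (-b.im) • imField H)) := by
  ext z i; simp [reField, imField]; ring

theorem imField_lincomb (a b : ℂ) (G H : ℝ × E d → Fin d → ℂ) :
    imField (a • G + b • H) = ((1 : ℝ) • (a.im • reField G + a.re • imField G) +
      (1 : ℝ) • (b.im • reField H + b.re • imField H)) := by
  ext z i; simp [reField, imField]; ring

theorem SqIntegrable.lincomb {G H : ℝ × E d → Fin d → ℂ} (hG : SqIntegrable G)
    (hH : SqIntegrable H) (a b : ℂ) : SqIntegrable (a • G + b • H) := by
  constructor
  · rw [reField_lincomb]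
    exact (((hG.re.const_smul _).add (hG.im.const_smul _)).const_smul _).add
      (((hH.re.const_smul _).add (hH.im.const_smul _)).const_smul _)
  · rw [imField_lincomb]
    exact (((hG.re.const_smul _).add (hG.im.const_smul _)).const_smul _).add
      (((hH.re.const_smul _).add (hH.im.const_smul _)).const_smul _)

theorem IsWhiteNoise.cNoise_lincomb (hξ : IsWhiteNoise P ξ) {G H : ℝ × E d → Fin d → ℂ}
    (hG : SqIntegrable G) (hH : SqIntegrable H) (a b : ℂ) :
    cNoise ξ (a • G + b • H) =ᵐ[P] fun ω => a * cNoise ξ G ω + b * cNoise ξ H ω := by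
  have m1 := (hG.re.const_smul a.re).add (hG.im.const_smul (-a.im))
  have m2 := (hH.re.const_smul b.re).add (hH.im.const_smul (-b.im))
  have m3 := (hG.re.const_smul a.im).add (hG.im.const_smul a.re)
  have m4 := (hH.re.const_smul b.im).add (hH.im.const_smul b.re)
  filter_upwards [hξ.noiseIntegral_lincomb 1 1 m1 m2, hξ.noiseIntegral_lincomb 1 1 m3 m4,
    hξ.noiseIntegral_lincomb a.re (-a.im) hG.re hG.im,
    hξ.noiseIntegral_lincomb b.re (-b.im) hH.re hH.im,
    hξ.noiseIntegral_lincomb a.im a.re hG.re hG.im,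
    hξ.noiseIntegral_lincomb b.im b.re hH.re hH.im] with ω e1 e2 e3 e4 e5 e6
  rw [cNoise, reField_lincomb, imField_lincomb, e1, e2, e3, e4, e5, e6, cNoise, cNoise]
  apply Complex.ext <;> simp <;> ring

theorem sqIntegrable_zero : SqIntegrable (0 : ℝ × E d → Fin d → ℂ) := by
  have h1 : reField (0 : ℝ × E d → Fin d → ℂ) = fun _ => 0 := by ext z i; simp [reField]
  have h2 : imField (0 : ℝ × E d → Fin d → ℂ) = fun _ => 0 := by ext z i; simp [imField]
  constructor
  · rw [h1]; exact MemLp.zero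
  · rw [h2]; exact MemLp.zero

theorem IsWhiteNoise.cNoise_sum (hξ : IsWhiteNoise P ξ) {ι : Type*} [DecidableEq ι] (I : Finset ι)
    {G : ι → ℝ × E d → Fin d → ℂ} (hG : ∀ i ∈ I, SqIntegrable (G i)) (c : ι → ℂ) :
    SqIntegrable (∑ i ∈ I, c i • G i) ∧
    cNoise ξ (∑ i ∈ I, c i • G i) =ᵐ[P] fun ω => ∑ i ∈ I, c i * cNoise ξ (G i) ω := by
  induction I using Finset.induction_on with
  | empty =>
    simp only [Finset.sum_empty]
    refine ⟨sqIntegrable_zero, ?_⟩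
    filter_upwards [hξ.cNoise_lincomb (sqIntegrable_zero (d := d)) sqIntegrable_zero 0 0] with ω h
    simpa using h
  | insert i I hi ih =>
    obtain ⟨h1, h2⟩ := ih fun j hj => hG j (Finset.mem_insert_of_mem hj)
    have h3 := hG i (Finset.mem_insert_self i I)
    have h4 : ∑ j ∈ insert i I, c j • G j = c i • G i + (1 : ℂ) • ∑ j ∈ I, c j • G j := by
      rw [Finset.sum_insert hi, one_smul]
    rw [h4]
    refine ⟨h3.lincomb h1 _ _, ?_⟩
    filter_upwards [h2, hξ.cNoise_lincomb h3 h1 (c i) 1] with ω e1 e2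
    rw [e2, e1, Finset.sum_insert hi, one_mul]

theorem enorm_toLp_sq {g : ℝ × E d → E d} (hg : MemLp g 2 (spaceTime d)) :
    ‖hg.toLp g‖ₑ ^ 2 = ∫⁻ z, ‖g z‖ₑ ^ 2 ∂spaceTime d := by
  rw [Lp.enorm_toLp, eLpNorm_eq_lintegral_rpow_enorm_toReal two_ne_zero ENNReal.ofNat_ne_top,
    ← ENNReal.rpow_natCast, ← ENNReal.rpow_mul]
  simp

theorem enorm_toLp_coord_sq (g : Fin d → ℝ) :
    ‖(WithLp.toLp 2 g : E d)‖ₑ ^ 2 = ∑ i, ‖g i‖ₑ ^ 2 := by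
  rw [← ofReal_norm, ← ENNReal.ofReal_pow (norm_nonneg _), EuclideanSpace.norm_sq_eq,
    ENNReal.ofReal_sum_of_nonneg fun i _ => sq_nonneg _]
  refine Finset.sum_congr rfl fun i _ => ?_
  rw [ENNReal.ofReal_pow (norm_nonneg _), ofReal_norm]

theorem enorm_sq_eq_re_im (w : ℂ) : ‖w‖ₑ ^ 2 = ‖w.re‖ₑ ^ 2 + ‖w.im‖ₑ ^ 2 := by
  rw [← ofReal_norm, ← ofReal_norm, ← ofReal_norm, ← ENNReal.ofReal_pow (norm_nonneg _),
    ← ENNReal.ofReal_pow (norm_nonneg _), ← ENNReal.ofReal_pow (norm_nonneg _),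
    ← ENNReal.ofReal_add (by positivity) (by positivity)]
  congr 1
  rw [Complex.sq_norm, Complex.normSq_apply, Real.norm_eq_abs, Real.norm_eq_abs, sq_abs, sq_abs]
  ring

theorem SqIntegrable.energy_eq {G : ℝ × E d → Fin d → ℂ} (hG : SqIntegrable G) :
    ‖hG.re.toLp (reField G)‖ₑ ^ 2 + ‖hG.im.toLp (imField G)‖ₑ ^ 2 = energy G := by
  rw [enorm_toLp_sq, enorm_toLp_sq, ← lintegral_add_left' (hG.re.1.enorm.pow_const _)]
  simp only [energy, reField, imField, enorm_toLp_coord_sq, enorm_sq_eq_re_im,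
    Finset.sum_add_distrib]

/-- Hypercontractivity, in its simplest form. -/
theorem IsWhiteNoise.lintegral_cNoise_le (hξ : IsWhiteNoise P ξ) {G : ℝ × E d → Fin d → ℂ}
    (hG : SqIntegrable G) (m : ℕ) :
    ∫⁻ ω, ‖cNoise ξ G ω‖ₑ ^ (2 * m) ∂P ≤
      ENNReal.ofReal (2 ^ (m + 1) * gaussMoment (2 * m)) * energy G ^ m := by
  have h1 : ∀ x y : ℝ, ‖(x : ℂ) + Complex.I * (y : ℂ)‖ₑ ^ (2 * m) ≤
      2 ^ m * (‖x‖ₑ ^ (2 * m) + ‖y‖ₑ ^ (2 * m)) := by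
    intro x y
    have h2 : ‖(x : ℂ) + Complex.I * (y : ℂ)‖ₑ ^ 2 = ‖x‖ₑ ^ 2 + ‖y‖ₑ ^ 2 := by
      rw [enorm_sq_eq_re_im]; simp
    rw [pow_mul, h2, pow_mul, pow_mul]
    have h3 : ∀ a b : ℝ≥0∞, a ≤ b → (a + b) ^ m ≤ 2 ^ m * (a ^ m + b ^ m) := fun a b hab => by
      calc (a + b) ^ m ≤ (2 * b) ^ m := by rw [two_mul]; gcongr
        _ = 2 ^ m * b ^ m := mul_pow _ _ _
        _ ≤ _ := by gcongr; exact le_add_self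
    rcases le_total (‖x‖ₑ ^ 2) (‖y‖ₑ ^ 2) with h | h
    · exact h3 _ _ h
    · rw [add_comm, add_comm ((‖x‖ₑ ^ 2) ^ m)]; exact h3 _ _ h
  have hR : ‖hG.re.toLp (reField G)‖ₑ ^ 2 ≤ energy G := hG.energy_eq ▸ le_self_add
  have hI : ‖hG.im.toLp (imField G)‖ₑ ^ 2 ≤ energy G := hG.energy_eq ▸ le_add_self
  have hmeas : ∀ h, AEMeasurable (fun ω => ‖ξ h ω‖ₑ ^ (2 * m)) P := fun h =>
    (hξ.gaussian.aemeasurable h).enorm.pow_const _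
  calc ∫⁻ ω, ‖cNoise ξ G ω‖ₑ ^ (2 * m) ∂P
      ≤ ∫⁻ ω, 2 ^ m * (‖ξ (hG.re.toLp (reField G)) ω‖ₑ ^ (2 * m) +
          ‖ξ (hG.im.toLp (imField G)) ω‖ₑ ^ (2 * m)) ∂P := by
        refine lintegral_mono fun ω => ?_
        rw [cNoise, noiseIntegral_of_memLp hG.re, noiseIntegral_of_memLp hG.im]
        exact h1 _ _
    _ = 2 ^ m * (ENNReal.ofReal (gaussMoment (2 * m)) * (‖hG.re.toLp (reField G)‖ₑ ^ 2) ^ m +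
          ENNReal.ofReal (gaussMoment (2 * m)) * (‖hG.im.toLp (imField G)‖ₑ ^ 2) ^ m) := by
        rw [lintegral_const_mul' _ _ (by simp), lintegral_add_left' (hmeas _), hξ.lintegral_pow,
          hξ.lintegral_pow, pow_mul, pow_mul]
    _ ≤ 2 ^ m * (ENNReal.ofReal (gaussMoment (2 * m)) * energy G ^ m +
          ENNReal.ofReal (gaussMoment (2 * m)) * energy G ^ m) := by gcongr
    _ = _ := by
        rw [ENNReal.ofReal_mul (by positivity), ENNReal.ofReal_pow (by norm_num), ← two_mul,
          pow_succ]
        simp only [ENNReal.ofReal_ofNat]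
        ring

end Noise

end FluctuationSPDE

end

noncomputable section

namespace FluctuationSPDE

variable {d : ℕ} {χ : DyadicPartition d}

/-! ### The integrands of the stochastic convolution -/

/-- A jointly continuous, bounded family of probability densities. -/
structure DensityData (T L : ℝ) (ρ : ℝ → E d → ℝ) : Prop where
  cont : ContinuousOn (fun z : ℝ × E d => ρ z.1 z.2) (Icc 0 T ×ˢ univ)
  nonneg : ∀ t ∈ Icc 0 T, ∀ x, 0 ≤ ρ t x
  le : ∀ t ∈ Icc 0 T, ∀ x, ρ t x ≤ L
  mass : ∀ t ∈ Icc 0 T, ∫ x, ρ t x ∂torusMeasure d = 1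

/-- The vector field `1_{[0,T)}(s) √ρ_s(y) ∑ₖ i k γ_s(k) e_{-k}(y)`. -/
def noiseField (T : ℝ) (ρ : ℝ → E d → ℝ) (S : Finset (Fin d → ℤ)) (γ : ℝ → (Fin d → ℤ) → ℂ)
    (z : ℝ × E d) (i : Fin d) : ℂ :=
  (Ico 0 T).indicator (fun s => (Real.sqrt (ρ s z.2) : ℂ) *
    ∑ k ∈ S, Complex.I * (k i : ℂ) * γ s k * fourierE (-k) z.2) z.1

theorem sqIntegrable_of_energy {G : ℝ × E d → Fin d → ℂ}
    (hm : ∀ i, AEStronglyMeasurable (fun z => G z i) (spaceTime d)) (hG : energy G ≠ ∞) :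
    SqIntegrable G := by
  have key : ∀ g : ℝ × E d → Fin d → ℝ,
      (∀ i, AEStronglyMeasurable (fun z => g z i) (spaceTime d)) →
      (∀ z i, ‖g z i‖ₑ ≤ ‖G z i‖ₑ) →
      MemLp (fun z => (WithLp.toLp 2 (g z) : E d)) 2 (spaceTime d) := by
    intro g hg hle
    refine ⟨?_, ?_⟩
    · have h1 : AEStronglyMeasurable g (spaceTime d) :=
        (aemeasurable_pi_iff.2 fun i => (hg i).aemeasurable).aestronglyMeasurable
      exact (PiLp.continuous_toLp 2 fun _ : Fin d => ℝ).comp_aestronglyMeasurable h1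
    · rw [eLpNorm_lt_top_iff_lintegral_rpow_enorm_lt_top two_ne_zero ENNReal.ofNat_ne_top]
      refine lt_of_le_of_lt ?_ hG.lt_top
      refine lintegral_mono fun z => ?_
      rw [ENNReal.toReal_ofNat, ENNReal.rpow_ofNat, enorm_toLp_coord_sq]
      exact Finset.sum_le_sum fun i _ => by gcongr; exact hle z i
  refine ⟨key _ (fun i => ?_) fun z i => ?_, key _ (fun i => ?_) fun z i => ?_⟩
  · exact Complex.continuous_re.comp_aestronglyMeasurable (hm i)
  · rw [enorm_le_iff_norm_le]; exact Complex.abs_re_le_norm _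
  · exact Complex.continuous_im.comp_aestronglyMeasurable (hm i)
  · rw [enorm_le_iff_norm_le]; exact Complex.abs_im_le_norm _

/-! ### Energies of the noise integrands -/

section Field

variable {T L : ℝ} {ρ : ℝ → E d → ℝ}

theorem aestronglyMeasurable_noiseField (hρ : DensityData T L ρ) (S : Finset (Fin d → ℤ))
    {γ : ℝ → (Fin d → ℤ) → ℂ} (hγ : ∀ k, Measurable fun s => γ s k) (i : Fin d) :
    AEStronglyMeasurable (fun z => noiseField T ρ S γ z i) (spaceTime d) := by
  have hset : MeasurableSet (Ico (0 : ℝ) T ×ˢ (univ : Set (E d))) :=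
    measurableSet_Ico.prod MeasurableSet.univ
  have h1 : (fun z => noiseField T ρ S γ z i) = (Ico (0 : ℝ) T ×ˢ (univ : Set (E d))).indicator
      fun z => (Real.sqrt (ρ z.1 z.2) : ℂ) *
        ∑ k ∈ S, Complex.I * (k i : ℂ) * γ z.1 k * fourierE (-k) z.2 := by
    ext z
    by_cases hz : z.1 ∈ Ico 0 T <;> simp [noiseField, hz, indicator]
  rw [h1, aestronglyMeasurable_indicator_iff hset]
  refine AEStronglyMeasurable.mul ?_ ?_
  · refine Complex.continuous_ofReal.comp_aestronglyMeasurable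
      (Real.continuous_sqrt.comp_aestronglyMeasurable ?_)
    exact (hρ.cont.mono (prod_mono Ico_subset_Icc_self subset_rfl)).aestronglyMeasurable hset
  · refine Measurable.aestronglyMeasurable ?_
    refine Finset.measurable_fun_sum _ fun k _ => ?_
    exact (((hγ k).comp measurable_fst).const_mul _).mul
      ((continuous_fourierE (-k)).measurable.comp measurable_snd)

theorem lintegral_trig_neg_sq (S : Finset (Fin d → ℤ)) (c : (Fin d → ℤ) → ℂ) :
    ∫⁻ y, ‖∑ k ∈ S, c k * fourierE (-k) y‖ₑ ^ 2 ∂torusMeasure d =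
      ENNReal.ofReal ((2 * Real.pi) ^ d) * ∑ k ∈ S, ‖c k‖ₑ ^ 2 := by
  have h1 : ∀ y : E d, ‖∑ k ∈ S, c k * fourierE (-k) y‖ₑ ^ 2 =
      ENNReal.ofReal (‖trig S (fun k => (starRingEnd ℂ) (c k)) y‖ ^ 2) := by
    intro y
    have h2 : trig S (fun k => (starRingEnd ℂ) (c k)) y =
        (starRingEnd ℂ) (∑ k ∈ S, c k * fourierE (-k) y) := by
      rw [map_sum, trig]
      refine Finset.sum_congr rfl fun k _ => ?_
      rw [map_mul, conj_fourierE, neg_neg]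
    rw [h2, RCLike.norm_conj, ENNReal.ofReal_pow (norm_nonneg _), ofReal_norm]
  have h2 : Integrable (fun y => ‖trig S (fun k => (starRingEnd ℂ) (c k)) y‖ ^ 2)
      (torusMeasure d) := integrable_torus_of_continuous ((continuous_trig _ _).norm.pow 2)
  simp_rw [h1]
  rw [← ofReal_integral_eq_lintegral_ofReal h2
    (Eventually.of_forall fun _ => by positivity), parseval_trig,
    ENNReal.ofReal_mul (by positivity), ENNReal.ofReal_sum_of_nonneg fun _ _ => by positivity]
  congr 1
  refine Finset.sum_congr rfl fun k _ => ?_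
  rw [RCLike.norm_conj, ENNReal.ofReal_pow (norm_nonneg _), ofReal_norm]

theorem sum_enorm_coord_sq (k : Fin d → ℤ) :
    ∑ i, ‖(k i : ℂ)‖ₑ ^ 2 = ENNReal.ofReal (‖freq k‖ ^ 2) := by
  rw [EuclideanSpace.norm_sq_eq, ENNReal.ofReal_sum_of_nonneg fun _ _ => by positivity]
  refine Finset.sum_congr rfl fun i _ => ?_
  rw [ENNReal.ofReal_pow (norm_nonneg _), ofReal_norm, ← ofReal_norm, ← ofReal_norm]
  simp [freq]

theorem enorm_sqrt_mul_sq {x : ℝ} (hx : 0 ≤ x) (w : ℂ) :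
    ‖(Real.sqrt x : ℂ) * w‖ₑ ^ 2 = ENNReal.ofReal x * ‖w‖ₑ ^ 2 := by
  rw [enorm_mul, mul_pow]
  congr 1
  rw [← ofReal_norm, Complex.norm_real, Real.norm_of_nonneg (Real.sqrt_nonneg _),
    ← ENNReal.ofReal_pow (Real.sqrt_nonneg _), Real.sq_sqrt hx]

theorem enorm_I : ‖Complex.I‖ₑ = 1 := by rw [← ofReal_norm]; simp

theorem energy_noiseField (hρ : DensityData T L ρ) (S : Finset (Fin d → ℤ))
    {γ : ℝ → (Fin d → ℤ) → ℂ} (hγ : ∀ k, Measurable fun s => γ s k) :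
    energy (noiseField T ρ S γ) = ∫⁻ s in Ico 0 T, ∫⁻ y, ENNReal.ofReal (ρ s y) *
      ∑ i, ‖∑ k ∈ S, Complex.I * (k i : ℂ) * γ s k * fourierE (-k) y‖ₑ ^ 2 ∂torusMeasure d := by
  rw [energy, spaceTime, lintegral_prod _ (Finset.aemeasurable_fun_sum _ fun i _ =>
    (aestronglyMeasurable_noiseField hρ S hγ i).enorm.pow_const 2)]
  have h1 : ∀ s, ∫⁻ y, ∑ i, ‖noiseField T ρ S γ (s, y) i‖ₑ ^ 2 ∂torusMeasure d =
      (Ico 0 T).indicator (fun s => ∫⁻ y, ENNReal.ofReal (ρ s y) *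
        ∑ i, ‖∑ k ∈ S, Complex.I * (k i : ℂ) * γ s k * fourierE (-k) y‖ₑ ^ 2
          ∂torusMeasure d) s := by
    intro s
    by_cases hs : s ∈ Ico 0 T
    · rw [indicator_of_mem hs]
      refine lintegral_congr fun y => ?_
      simp only [noiseField, indicator_of_mem hs]
      rw [Finset.mul_sum]
      exact Finset.sum_congr rfl fun i _ =>
        enorm_sqrt_mul_sq (hρ.nonneg s (Ico_subset_Icc_self hs) y) _
    · rw [indicator_of_notMem hs]
      simp [noiseField, indicator_of_notMem hs]
  simp_rw [h1]
  rw [lintegral_indicator measurableSet_Ico, Measure.restrict_restrict measurableSet_Ico,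
    inter_eq_left.2 fun s hs => hs.1]

/-- The weight `ρ` destroys the orthogonality of the characters. Replacing it by its upper bound `L`
restores Parseval's identity and leaves a diagonal sum. -/
theorem energy_noiseField_le (hρ : DensityData T L ρ) (S : Finset (Fin d → ℤ))
    {γ : ℝ → (Fin d → ℤ) → ℂ} (hγ : ∀ k, Measurable fun s => γ s k) :
    energy (noiseField T ρ S γ) ≤ ENNReal.ofReal L * ENNReal.ofReal ((2 * Real.pi) ^ d) *
      ∑ k ∈ S, ENNReal.ofReal (‖freq k‖ ^ 2) * ∫⁻ s in Ico 0 T, ‖γ s k‖ₑ ^ 2 := by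
  rw [energy_noiseField hρ S hγ]
  have hm : ∀ k ∈ S, Measurable fun s => ENNReal.ofReal (‖freq k‖ ^ 2) * ‖γ s k‖ₑ ^ 2 :=
    fun k _ => ((hγ k).enorm.pow_const 2).const_mul _
  have h1 : ∀ s ∈ Ico 0 T, ∫⁻ y, ENNReal.ofReal (ρ s y) *
      ∑ i, ‖∑ k ∈ S, Complex.I * (k i : ℂ) * γ s k * fourierE (-k) y‖ₑ ^ 2 ∂torusMeasure d ≤
      ENNReal.ofReal L * ENNReal.ofReal ((2 * Real.pi) ^ d) *
        ∑ k ∈ S, ENNReal.ofReal (‖freq k‖ ^ 2) * ‖γ s k‖ₑ ^ 2 := by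
    intro s hs
    calc _ ≤ ∫⁻ y, ENNReal.ofReal L *
          ∑ i, ‖∑ k ∈ S, Complex.I * (k i : ℂ) * γ s k * fourierE (-k) y‖ₑ ^ 2 ∂torusMeasure d :=
          lintegral_mono fun y => mul_le_mul'
            (ENNReal.ofReal_le_ofReal (hρ.le s (Ico_subset_Icc_self hs) y)) le_rfl
      _ = ENNReal.ofReal L * ∑ i, ENNReal.ofReal ((2 * Real.pi) ^ d) *
            ∑ k ∈ S, ‖Complex.I * (k i : ℂ) * γ s k‖ₑ ^ 2 := by
          rw [lintegral_const_mul' _ _ ENNReal.ofReal_ne_top, lintegral_finsetSum]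
          · simp_rw [lintegral_trig_neg_sq]
          · intro i _
            refine (Measurable.enorm ?_).pow_const 2
            exact Finset.measurable_fun_sum _ fun k _ =>
              (continuous_fourierE (-k)).measurable.const_mul _
      _ = _ := by
          rw [← Finset.mul_sum, Finset.sum_comm, ← mul_assoc]
          congr 1
          refine Finset.sum_congr rfl fun k _ => ?_
          simp_rw [enorm_mul, enorm_I, one_mul, mul_pow]
          rw [← Finset.sum_mul, sum_enorm_coord_sq]
  refine (setLIntegral_mono' measurableSet_Ico h1).trans (le_of_eq ?_)
  rw [lintegral_const_mul' _ _ (ENNReal.mul_ne_top ENNReal.ofReal_ne_top ENNReal.ofReal_ne_top),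
    lintegral_finsetSum _ hm]
  congr 1
  exact Finset.sum_congr rfl fun k _ => lintegral_const_mul' _ _ ENNReal.ofReal_ne_top

/-- A single character has modulus one and `ρ_s` has mass one, so here the energy is exact. This
gives the lower bound needed for irregularity without any lower bound on `ρ`. -/
theorem energy_noiseField_singleton (hρ : DensityData T L ρ) (k : Fin d → ℤ)
    {γ : ℝ → (Fin d → ℤ) → ℂ} (hγ : ∀ k, Measurable fun s => γ s k) :
    energy (noiseField T ρ {k} γ) =
      ENNReal.ofReal (‖freq k‖ ^ 2) * ∫⁻ s in Ico 0 T, ‖γ s k‖ₑ ^ 2 := by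
  rw [energy_noiseField hρ _ hγ, ← lintegral_const_mul' _ _ ENNReal.ofReal_ne_top]
  refine setLIntegral_congr_fun measurableSet_Ico fun s hs => ?_
  have hs' := Ico_subset_Icc_self hs
  have h1 : ∀ y : E d, ∑ i, ‖∑ k ∈ {k}, Complex.I * (k i : ℂ) * γ s k * fourierE (-k) y‖ₑ ^ 2 =
      ENNReal.ofReal (‖freq k‖ ^ 2) * ‖γ s k‖ₑ ^ 2 := by
    intro y
    have h2 : ‖fourierE (-k) y‖ₑ = 1 := by rw [← ofReal_norm, norm_fourierE]; simp
    simp_rw [Finset.sum_singleton, enorm_mul, enorm_I, h2, one_mul, mul_one, mul_pow]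
    rw [← Finset.sum_mul, sum_enorm_coord_sq]
  have hc : Continuous (ρ s) := by
    have := hρ.cont.comp (f := fun y : E d => (s, y)) (s := univ) (by fun_prop)
      fun y _ => ⟨hs', mem_univ _⟩
    exact continuousOn_univ.1 this
  have hm : Measurable fun y => ENNReal.ofReal (ρ s y) :=
    ENNReal.measurable_ofReal.comp hc.measurable
  simp_rw [h1]
  rw [lintegral_mul_const _ hm, ← ofReal_integral_eq_lintegral_ofReal (integrable_torus_of_continuous hc)
      (Eventually.of_forall (hρ.nonneg s hs')), hρ.mass s hs', ENNReal.ofReal_one, one_mul]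

theorem noiseField_sum (S : Finset (Fin d → ℤ)) (c : (Fin d → ℤ) → ℂ)
    (γ : ℝ → (Fin d → ℤ) → ℂ) :
    ∑ k ∈ S, c k • noiseField T ρ {k} γ = noiseField T ρ S fun s k => c k * γ s k := by
  ext z i
  simp only [Finset.sum_apply, Pi.smul_apply, smul_eq_mul, noiseField, Finset.sum_singleton]
  by_cases hz : z.1 ∈ Ico 0 T
  · simp only [indicator_of_mem hz]
    rw [Finset.mul_sum]
    exact Finset.sum_congr rfl fun k _ => by ring
  · simp [indicator_of_notMem hz]

theorem noiseField_lincomb (a b : ℂ) (S : Finset (Fin d → ℤ)) (γ γ' : ℝ → (Fin d → ℤ) → ℂ) :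
    a • noiseField T ρ S γ + b • noiseField T ρ S γ' =
      noiseField T ρ S fun s k => a * γ s k + b * γ' s k := by
  ext z i
  simp only [Pi.add_apply, Pi.smul_apply, smul_eq_mul, noiseField]
  by_cases hz : z.1 ∈ Ico 0 T
  · simp only [indicator_of_mem hz]
    rw [mul_left_comm, mul_left_comm b, ← mul_add, Finset.mul_sum, Finset.mul_sum,
      ← Finset.sum_add_distrib]
    congr 1
    exact Finset.sum_congr rfl fun k _ => by ring
  · simp [indicator_of_notMem hz]

/-! ### Heat profiles -/

/-- The profile `s ↦ 1_{s<t} e^{-σ(t-s)|k|²}`. -/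
def heatProfile (σ t s : ℝ) (k : Fin d → ℤ) : ℂ :=
  (Iio t).indicator (fun s => heatSymbol σ (t - s) k) s

theorem measurable_heatProfile (σ t : ℝ) (k : Fin d → ℤ) :
    Measurable fun s => heatProfile σ t s k := by
  refine Measurable.indicator ?_ measurableSet_Iio
  exact Continuous.measurable (by unfold heatSymbol; fun_prop)

theorem noiseKernel_eq_noiseField {σ : ℝ} (hσ : 0 < σ) {t : ℝ} (ht : t ∈ Icc 0 T)
    (k : Fin d → ℤ) :
    noiseKernel σ ρ t (fourierTest (-k)) = noiseField T ρ {k} (heatProfile σ t) := by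
  ext z i
  rw [noiseKernel_fourierTest hσ, noiseField]
  by_cases hz : z.1 ∈ Ico 0 t
  · rw [indicator_of_mem hz, indicator_of_mem (Ico_subset_Ico_right ht.2 hz),
      Finset.sum_singleton, heatProfile, indicator_of_mem (by exact hz.2)]
  · rw [indicator_of_notMem hz]
    by_cases hz' : z.1 ∈ Ico 0 T
    · rw [indicator_of_mem hz', Finset.sum_singleton, heatProfile, indicator_of_notMem
        (show z.1 ∉ Iio t from fun h => hz ⟨hz'.1, h⟩)]
      simp
    · rw [indicator_of_notMem hz']

theorem enorm_heatSymbol_le_one {σ t : ℝ} (h : 0 ≤ σ * t) (k : Fin d → ℤ) :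
    ‖heatSymbol σ t k‖ₑ ≤ 1 := by
  rw [← ofReal_norm, norm_heatSymbol, ENNReal.ofReal_le_one, Real.exp_le_one_iff, neg_nonpos]
  positivity

theorem enorm_heatProfile_le_one {σ : ℝ} (hσ : 0 < σ) (t s : ℝ) (k : Fin d → ℤ) :
    ‖heatProfile σ t s k‖ₑ ≤ 1 := by
  rw [heatProfile]
  by_cases hs : s ∈ Iio t
  · rw [indicator_of_mem hs]
    exact enorm_heatSymbol_le_one (mul_nonneg hσ.le (sub_nonneg.2 (le_of_lt hs))) k
  · rw [indicator_of_notMem hs]; simp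

theorem sqIntegrable_noiseField (hρ : DensityData T L ρ) (S : Finset (Fin d → ℤ))
    {γ : ℝ → (Fin d → ℤ) → ℂ} (hγ : ∀ k, Measurable fun s => γ s k)
    (hb : ∀ k, ∃ C : NNReal, ∀ s, ‖γ s k‖ₑ ≤ C) : SqIntegrable (noiseField T ρ S γ) := by
  refine sqIntegrable_of_energy (aestronglyMeasurable_noiseField hρ S hγ)
    (ne_top_of_le_ne_top ?_ (energy_noiseField_le hρ S hγ))
  refine ENNReal.mul_ne_top (ENNReal.mul_ne_top ENNReal.ofReal_ne_top ENNReal.ofReal_ne_top)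
    (ENNReal.sum_ne_top.2 fun k _ => ENNReal.mul_ne_top ENNReal.ofReal_ne_top ?_)
  obtain ⟨C, hC⟩ := hb k
  refine ne_top_of_le_ne_top ?_ (lintegral_mono fun s => pow_le_pow_left' (hC s) 2)
  rw [lintegral_const, Measure.restrict_apply_univ]
  exact ENNReal.mul_ne_top (by simp) (by simp)

/-- The exact `L^2` norm in time of a heat profile. -/
theorem lintegral_heatProfile_sq {σ : ℝ} (hσ : 0 < σ) {t : ℝ} (ht : t ∈ Icc 0 T)
    (k : Fin d → ℤ) :
    ENNReal.ofReal (‖freq k‖ ^ 2) * ∫⁻ s in Ico 0 T, ‖heatProfile σ t s k‖ₑ ^ 2 =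
      ENNReal.ofReal ((1 - Real.exp (-(2 * σ * ‖freq k‖ ^ 2 * t))) / (2 * σ)) := by
  set κ := ‖freq k‖ ^ 2 with hκ
  have hκ0 : 0 ≤ κ := by positivity
  have h1 : ∀ s, ‖heatProfile σ t s k‖ₑ ^ 2 = (Iio t).indicator
      (fun s => ENNReal.ofReal (Real.exp (2 * σ * κ * (s - t)))) s := by
    intro s
    rw [heatProfile]
    by_cases hs : s ∈ Iio t
    · rw [indicator_of_mem hs, indicator_of_mem hs, ← ofReal_norm, norm_heatSymbol,
        ← ENNReal.ofReal_pow (Real.exp_pos _).le, ← Real.exp_nat_mul]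
      congr 2
      push_cast
      ring
    · rw [indicator_of_notMem hs, indicator_of_notMem hs]; simp
  simp_rw [h1]
  rw [lintegral_indicator measurableSet_Iio, Measure.restrict_restrict measurableSet_Iio,
    show Iio t ∩ Ico 0 T = Ico 0 t by
      ext s; constructor
      · rintro ⟨h1, h2⟩; exact ⟨h2.1, h1⟩
      · rintro ⟨h1, h2⟩; exact ⟨h2, h1, h2.trans_le ht.2⟩,
    ← ofReal_integral_eq_lintegral_ofReal
      ((Continuous.integrableOn_Icc (by fun_prop)).mono_set Ico_subset_Icc_self)
      (Eventually.of_forall fun s => (Real.exp_pos _).le), ← ENNReal.ofReal_mul hκ0,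
    integral_Ico_eq_integral_Ioc, ← intervalIntegral.integral_of_le ht.1]
  congr 1
  rcases hκ0.eq_or_lt with h0 | hpos
  · rw [← h0]; simp
  have hc : 2 * σ * κ ≠ 0 := by positivity
  have h2 : ∀ s ∈ uIcc 0 t, HasDerivAt (fun s => Real.exp (2 * σ * κ * (s - t)) / (2 * σ * κ))
      (Real.exp (2 * σ * κ * (s - t))) s := by
    intro s _
    have := ((((hasDerivAt_id s).sub_const t).const_mul (2 * σ * κ)).exp).div_const (2 * σ * κ)
    refine this.congr_deriv ?_
    simp only [id]
    field_simp
  rw [intervalIntegral.integral_eq_sub_of_hasDerivAt h2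
    (Continuous.intervalIntegrable (by fun_prop) _ _)]
  simp only [sub_self, mul_zero, Real.exp_zero, zero_sub, mul_neg]
  field_simp

/-- The bound does not depend on `k`: the gradient loses what the heat semigroup gains. The
stochastic convolution is therefore as rough in space as white noise. -/
theorem lintegral_heatProfile_sq_le {σ : ℝ} (hσ : 0 < σ) {t : ℝ} (ht : t ∈ Icc 0 T)
    (k : Fin d → ℤ) :
    ENNReal.ofReal (‖freq k‖ ^ 2) * ∫⁻ s in Ico 0 T, ‖heatProfile σ t s k‖ₑ ^ 2 ≤
      ENNReal.ofReal (1 / (2 * σ)) := by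
  rw [lintegral_heatProfile_sq hσ ht]
  refine ENNReal.ofReal_le_ofReal (div_le_div_of_nonneg_right ?_ (by positivity))
  linarith [Real.exp_pos (-(2 * σ * ‖freq k‖ ^ 2 * t))]

end Field

end FluctuationSPDE

end

noncomputable section

namespace FluctuationSPDE

variable {d : ℕ} {χ : DyadicPartition d}

/-! ### Time increments of the heat profiles -/

/-- On `[s, t)` only the later profile is present and it is at most one. Before `s` the profiles
differ by a factor whose distance to one is controlled by `1 - e^{-x} ≤ x`. -/
theorem norm_heatProfile_sub_le {σ : ℝ} (hσ : 0 < σ) {s t : ℝ} (hst : s ≤ t) (r : ℝ)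
    (k : Fin d → ℤ) : ‖heatProfile σ t r k - heatProfile σ s r k‖ₑ ^ 2 ≤
      (Ico s t).indicator 1 r + ENNReal.ofReal ((σ * ‖freq k‖ ^ 2 * (t - s)) ^ 2) := by
  rcases lt_or_ge r s with hr | hr
  · have hrt : r < t := hr.trans_le hst
    refine le_add_left ?_
    rw [heatProfile, heatProfile, indicator_of_mem (show r ∈ Iio t from hrt),
      indicator_of_mem (show r ∈ Iio s from hr), ← ofReal_norm, ← ENNReal.ofReal_pow (norm_nonneg _)]
    refine ENNReal.ofReal_le_ofReal (pow_le_pow_left₀ (norm_nonneg _) ?_ 2)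
    rw [heatSymbol, heatSymbol, ← Complex.ofReal_sub, Complex.norm_real, Real.norm_eq_abs,
      abs_le]
    set κ := ‖freq k‖ ^ 2
    have hκ : 0 ≤ κ := by positivity
    have e1 : -(σ * (t - r) * κ) = -(σ * (s - r) * κ) + -(σ * κ * (t - s)) := by ring
    rw [e1, Real.exp_add]
    have h1 : Real.exp (-(σ * (s - r) * κ)) ≤ 1 := by
      rw [Real.exp_le_one_iff, neg_nonpos]
      have := sub_nonneg.2 hr.le
      positivity
    have h2 := Real.add_one_le_exp (-(σ * κ * (t - s)))
    have h3 : 0 ≤ σ * κ * (t - s) := mul_nonneg (by positivity) (sub_nonneg.2 hst)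
    have h4 : Real.exp (-(σ * κ * (t - s))) ≤ 1 := by
      rw [Real.exp_le_one_iff]; linarith
    have h5 := Real.exp_pos (-(σ * (s - r) * κ))
    constructor <;> nlinarith
  · rw [heatProfile, heatProfile, indicator_of_notMem (show r ∉ Iio s from not_lt.2 hr), sub_zero]
    rcases lt_or_ge r t with hrt | hrt
    · rw [indicator_of_mem (show r ∈ Ico s t from ⟨hr, hrt⟩), indicator_of_mem
        (show r ∈ Iio t from hrt)]
      refine le_add_right ?_
      exact pow_le_one' (enorm_heatSymbol_le_one (mul_nonneg hσ.le (sub_nonneg.2 hrt.le)) k) 2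
    · rw [indicator_of_notMem (show r ∉ Iio t from not_lt.2 hrt)]
      simp

theorem lintegral_heatProfile_sub_le {σ T : ℝ} (hσ : 0 < σ) {s t : ℝ} (hs : 0 ≤ s) (hst : s ≤ t)
    (ht : t ≤ T) (k : Fin d → ℤ) : ENNReal.ofReal (‖freq k‖ ^ 2) *
      ∫⁻ r in Ico 0 T, ‖heatProfile σ t r k - heatProfile σ s r k‖ₑ ^ 2 ≤
      ENNReal.ofReal (‖freq k‖ ^ 2 * (1 + T ^ 2 * σ ^ 2 * (‖freq k‖ ^ 2) ^ 2) * (t - s)) := by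
  set κ := ‖freq k‖ ^ 2 with hκ
  have hκ0 : 0 ≤ κ := by positivity
  have hts := sub_nonneg.2 hst
  have hT : 0 ≤ T := hs.trans (hst.trans ht)
  rw [mul_assoc, ENNReal.ofReal_mul hκ0]
  gcongr
  calc ∫⁻ r in Ico 0 T, ‖heatProfile σ t r k - heatProfile σ s r k‖ₑ ^ 2
      ≤ ∫⁻ r in Ico 0 T, ((Ico s t).indicator 1 r + ENNReal.ofReal ((σ * κ * (t - s)) ^ 2)) :=
        lintegral_mono fun r => norm_heatProfile_sub_le hσ hst r k
    _ ≤ ENNReal.ofReal (t - s) + ENNReal.ofReal ((σ * κ * (t - s)) ^ 2) * ENNReal.ofReal T := by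
        rw [lintegral_add_right _ measurable_const, lintegral_const, Measure.restrict_apply_univ,
          Real.volume_Ico, sub_zero]
        gcongr
        refine (setLIntegral_le_lintegral _ _).trans ?_
        rw [lintegral_indicator_one measurableSet_Ico, Real.volume_Ico]
    _ ≤ _ := by
        rw [← ENNReal.ofReal_mul (by positivity), ← ENNReal.ofReal_add hts (by positivity)]
        refine ENNReal.ofReal_le_ofReal ?_
        have h1 : t - s ≤ T := by linarith
        have h2 : 0 ≤ (σ * κ) ^ 2 * T * (t - s) := by positivity
        nlinarith [mul_le_mul_of_nonneg_left h1 h2]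

/-- On the frequencies of the `j`-th block, increments of heat profiles are small. -/
theorem exists_heatProfile_increment_bound {σ T : ℝ} (hσ : 0 < σ) (hT : 0 < T) :
    ∃ A B : NNReal, ∀ (j : ℕ) (k : Fin d → ℤ), ‖freq k‖ ≤ 4 / 3 * 2 ^ j →
      ∀ s ∈ Icc 0 T, ∀ t ∈ Icc 0 T, ENNReal.ofReal (‖freq k‖ ^ 2) *
        ∫⁻ r in Ico 0 T, ‖heatProfile σ t r k - heatProfile σ s r k‖ₑ ^ 2 ≤
        min (A : ℝ≥0∞) (B * 2 ^ (6 * j) * ENNReal.ofReal |t - s|) := by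
  -- `2 / σ` comes from `(a-b)² ≤ 2a² + 2b²` with both energies at most `1 / (2σ)`. The second
  -- constant uses `|k|² ≤ 2 · 2^{2j}`; the crude growth `2^{6j}` is harmless since it will only
  -- enter to a fixed power.
  refine ⟨Real.toNNReal (2 / σ), Real.toNNReal (2 * (1 + 4 * T ^ 2 * σ ^ 2)), fun j k hk => ?_⟩
  have key : ∀ s ∈ Icc 0 T, ∀ t ∈ Icc 0 T, s ≤ t → ENNReal.ofReal (‖freq k‖ ^ 2) *
        ∫⁻ r in Ico 0 T, ‖heatProfile σ t r k - heatProfile σ s r k‖ₑ ^ 2 ≤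
        min (Real.toNNReal (2 / σ) : ℝ≥0∞) (Real.toNNReal (2 * (1 + 4 * T ^ 2 * σ ^ 2)) *
          2 ^ (6 * j) * ENNReal.ofReal |t - s|) := by
    intro s hs t ht hst
    refine le_min ?_ ?_
    · have hsq : ∀ r, ‖heatProfile σ t r k - heatProfile σ s r k‖ₑ ^ 2 ≤
          2 * ‖heatProfile σ t r k‖ₑ ^ 2 + 2 * ‖heatProfile σ s r k‖ₑ ^ 2 := by
        intro r
        simp only [← ofReal_norm, ← ENNReal.ofReal_pow (norm_nonneg _)]
        rw [← ENNReal.ofReal_ofNat 2, ← ENNReal.ofReal_mul (by norm_num),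
          ← ENNReal.ofReal_mul (by norm_num), ← ENNReal.ofReal_add (by positivity) (by positivity)]
        refine ENNReal.ofReal_le_ofReal ?_
        have h1 := norm_sub_le (heatProfile σ t r k) (heatProfile σ s r k)
        nlinarith [norm_nonneg (heatProfile σ t r k - heatProfile σ s r k),
          sq_nonneg (‖heatProfile σ t r k‖ - ‖heatProfile σ s r k‖)]
      have hm : ∀ t, Measurable fun r => 2 * ‖heatProfile σ t r k‖ₑ ^ 2 := fun t =>
        ((measurable_heatProfile σ t k).enorm.pow_const 2).const_mul 2
      calc _ ≤ ENNReal.ofReal (‖freq k‖ ^ 2) * ∫⁻ r in Ico 0 T,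
            (2 * ‖heatProfile σ t r k‖ₑ ^ 2 + 2 * ‖heatProfile σ s r k‖ₑ ^ 2) :=
            mul_le_mul' le_rfl (lintegral_mono hsq)
        _ = 2 * (ENNReal.ofReal (‖freq k‖ ^ 2) * ∫⁻ r in Ico 0 T, ‖heatProfile σ t r k‖ₑ ^ 2) +
            2 * (ENNReal.ofReal (‖freq k‖ ^ 2) *
              ∫⁻ r in Ico 0 T, ‖heatProfile σ s r k‖ₑ ^ 2) := by
            rw [lintegral_add_left (hm t), lintegral_const_mul' _ _ ENNReal.ofNat_ne_top,
              lintegral_const_mul' _ _ ENNReal.ofNat_ne_top]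
            ring
        _ ≤ 2 * ENNReal.ofReal (1 / (2 * σ)) + 2 * ENNReal.ofReal (1 / (2 * σ)) := by
            gcongr
            · exact lintegral_heatProfile_sq_le hσ ht k
            · exact lintegral_heatProfile_sq_le hσ hs k
        _ = ENNReal.ofReal (2 / σ) := by
            rw [← ENNReal.ofReal_ofNat 2, ← ENNReal.ofReal_mul (by norm_num),
              ← ENNReal.ofReal_add (by positivity) (by positivity)]
            congr 1
            field_simp
            norm_num
    · refine (lintegral_heatProfile_sub_le hσ hs.1 hst ht.2 k).trans ?_
      have h2j : (1 : ℝ) ≤ 2 ^ j := one_le_pow₀ (by norm_num)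
      set κ := ‖freq k‖ ^ 2 with hκ
      have hκ0 : 0 ≤ κ := by positivity
      have hκj : κ ≤ 2 * (2 ^ j) ^ 2 := by
        have : κ ≤ (4 / 3 * 2 ^ j) ^ 2 := pow_le_pow_left₀ (norm_nonneg _) hk 2
        nlinarith
      have hts := sub_nonneg.2 hst
      have e1 : (2 : ℝ≥0∞) ^ (6 * j) = ENNReal.ofReal (((2 : ℝ) ^ j) ^ 6) := by
        rw [← pow_mul, ENNReal.ofReal_pow (by norm_num), ENNReal.ofReal_ofNat, mul_comm]
      rw [e1, ← ENNReal.ofReal.eq_1, ← ENNReal.ofReal_mul (by positivity),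
        ← ENNReal.ofReal_mul (by positivity), abs_of_nonneg hts]
      refine ENNReal.ofReal_le_ofReal (mul_le_mul_of_nonneg_right ?_ hts)
      set x := (2 : ℝ) ^ j
      have hx2 : 1 ≤ x ^ 2 := one_le_pow₀ h2j
      have hx4 : 1 ≤ x ^ 4 := one_le_pow₀ h2j
      calc κ * (1 + T ^ 2 * σ ^ 2 * κ ^ 2)
          ≤ (2 * x ^ 2) * (1 + T ^ 2 * σ ^ 2 * (2 * x ^ 2) ^ 2) := by gcongr
        _ = 2 * x ^ 2 * 1 + 8 * (T ^ 2 * σ ^ 2) * x ^ 6 := by ring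
        _ ≤ 2 * x ^ 2 * x ^ 4 + 8 * (T ^ 2 * σ ^ 2) * x ^ 6 := by gcongr
        _ = _ := by ring
  intro s hs t ht
  rcases le_total s t with h | h
  · exact key s hs t ht h
  · have := key t ht s hs h
    rw [abs_sub_comm]
    refine le_trans (le_of_eq ?_) this
    congr 1
    refine lintegral_congr fun r => ?_
    rw [← enorm_neg, neg_sub]

/-! ### Bernstein's inequality -/

theorem exists_trig_mul (m n : ℕ) (c c' : (Fin d → ℤ) → ℂ) : ∃ c'' : (Fin d → ℤ) → ℂ,
    ∀ x, trig (box d m) c x * trig (box d n) c' x = trig (box d (m + n)) c'' x := by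
  refine ⟨fun k => ∑ l ∈ box d m, ∑ l' ∈ box d n, if l + l' = k then c l * c' l' else 0,
    fun x => ?_⟩
  simp only [trig]
  rw [Finset.sum_mul_sum]
  simp_rw [Finset.sum_mul]
  symm
  rw [Finset.sum_comm]
  refine Finset.sum_congr rfl fun l hl => ?_
  rw [Finset.sum_comm]
  refine Finset.sum_congr rfl fun l' hl' => ?_
  have hmem : l + l' ∈ box d (m + n) := by
    rw [mem_box] at *
    intro i
    have := abs_add_le (l i) (l' i)
    have h1 := hl i
    have h2 := hl' i
    simp only [Pi.add_apply]
    push_cast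
    linarith
  rw [Finset.sum_eq_single (l + l')]
  · rw [if_pos rfl, fourierE_add]; ring
  · intro k _ hk
    rw [if_neg (Ne.symm hk), zero_mul]
  · exact fun h => absurd hmem h

theorem exists_trig_pow (n m : ℕ) (c : (Fin d → ℤ) → ℂ) : ∃ c' : (Fin d → ℤ) → ℂ,
    ∀ x, trig (box d n) c x ^ m = trig (box d (m * n)) c' x := by
  induction m with
  | zero =>
    refine ⟨fun _ => 1, fun x => ?_⟩
    have h0 : box d (0 * n) = {0} := by
      ext k
      rw [zero_mul, mem_box, Finset.mem_singleton]
      refine ⟨fun h => funext fun i => ?_, fun h i => by simp [h]⟩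
      simpa using h i
    rw [pow_zero, h0]
    simp [trig, fourierE_zero]
  | succ m ih =>
    obtain ⟨c', hc'⟩ := ih
    obtain ⟨c'', hc''⟩ := exists_trig_mul (m * n) n c' c
    refine ⟨c'', fun x => ?_⟩
    rw [pow_succ, hc', hc'', Nat.succ_mul]

theorem norm_trig_sq_le (n : ℕ) (c : (Fin d → ℤ) → ℂ) (x : E d) :
    ‖trig (box d n) c x‖ ^ 2 ≤ (box d n).card * ((2 * Real.pi) ^ d)⁻¹ *
      ∫ y, ‖trig (box d n) c y‖ ^ 2 ∂torusMeasure d := by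
  rw [parseval_trig, mul_assoc, inv_mul_cancel_left₀ (by positivity)]
  exact (pow_le_pow_left₀ (norm_nonneg _) (norm_trig_le _ _ _) 2).trans sq_sum_le_card_mul_sum_sq

/-- The power `f^m` of a block is again a trigonometric polynomial, with about `2^{dj}` frequencies.
Cauchy–Schwarz and Parseval bound the supremum of `|f^m|²` by that number times its integral. -/
theorem exists_bernstein {m : ℕ} (hm : 1 ≤ m) (χ : DyadicPartition d) :
    ∃ C : NNReal, ∀ j a, blockNorm χ ∞ j a ^ (2 * m) ≤
      C * 2 ^ (d * j) * ∫⁻ x, ‖lpBlock χ j a x‖ₑ ^ (2 * m) ∂torusMeasure d := by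
  refine ⟨Real.toNNReal ((5 * m) ^ d * ((2 * Real.pi) ^ d)⁻¹), fun j a => ?_⟩
  set f := lpBlock χ j a with hf
  have hfc : Continuous f := continuous_lpBlock j a
  have hpow : ∀ x, ‖f x‖ₑ ^ (2 * m) = ENNReal.ofReal (‖f x ^ m‖ ^ 2) := fun x => by
    rw [norm_pow, ← pow_mul, ENNReal.ofReal_pow (norm_nonneg _), ofReal_norm, mul_comm]
  have hint : ∫⁻ x, ‖f x‖ₑ ^ (2 * m) ∂torusMeasure d =
      ENNReal.ofReal (∫ x, ‖f x ^ m‖ ^ 2 ∂torusMeasure d) := by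
    have h1 : Integrable (fun x => ‖f x ^ m‖ ^ 2) (torusMeasure d) :=
      integrable_torus_of_continuous ((hfc.pow m).norm.pow 2)
    rw [ofReal_integral_eq_lintegral_ofReal h1 (Eventually.of_forall fun _ => by positivity)]
    simp_rw [hpow]
  obtain ⟨c, hc⟩ := exists_trig_pow (2 ^ (j + 1)) m fun k => chiSymbol χ j k * a k
  rw [← lpBlock_eq_trig, ← hf] at hc
  -- Each side of the box has `4m · 2^j + 1` points, hence at most `5m · 2^j`.
  have hcard : ((box d (m * 2 ^ (j + 1))).card : ℝ) ≤ (5 * m) ^ d * 2 ^ (d * j) := by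
    rw [card_box]
    push_cast
    rw [mul_comm d j, pow_mul, ← mul_pow]
    have h1 : (1 : ℝ) ≤ m := by exact_mod_cast hm
    have h2 : (1 : ℝ) ≤ 2 ^ j := one_le_pow₀ (by norm_num)
    refine pow_le_pow_left₀ (by positivity) ?_ d
    rw [pow_succ]
    nlinarith [mul_le_mul h1 h2 (by norm_num) (by positivity)]
  have hpt : ∀ x, ‖f x‖ₑ ^ (2 * m) ≤ ENNReal.ofReal ((5 * m) ^ d * ((2 * Real.pi) ^ d)⁻¹) *
      2 ^ (d * j) * ∫⁻ x, ‖f x‖ₑ ^ (2 * m) ∂torusMeasure d := by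
    intro x
    have e1 : (2 : ℝ≥0∞) ^ (d * j) = ENNReal.ofReal ((2 : ℝ) ^ (d * j)) := by
      rw [ENNReal.ofReal_pow (by norm_num), ENNReal.ofReal_ofNat]
    rw [hint, hpow, e1, ← ENNReal.ofReal_mul (by positivity), ← ENNReal.ofReal_mul (by positivity)]
    refine ENNReal.ofReal_le_ofReal ?_
    simp_rw [hc]
    refine (norm_trig_sq_le _ _ _).trans ?_
    refine mul_le_mul_of_nonneg_right ?_ (integral_nonneg fun _ => by positivity)
    calc _ ≤ (5 * m) ^ d * 2 ^ (d * j) * ((2 * Real.pi) ^ d)⁻¹ := by gcongr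
      _ = _ := by ring
  have h2m : 2 * m ≠ 0 := by omega
  set B := (ENNReal.ofReal ((5 * m) ^ d * ((2 * Real.pi) ^ d)⁻¹) *
      2 ^ (d * j) * ∫⁻ x, ‖f x‖ₑ ^ (2 * m) ∂torusMeasure d) with hB
  have h2 : blockNorm χ ∞ j a ≤ B ^ ((2 * m : ℕ) : ℝ)⁻¹ := by
    refine eLpNorm_top_le fun x => ?_
    rw [ENNReal.le_rpow_inv_iff (by positivity), ENNReal.rpow_natCast]
    exact hpt x
  calc blockNorm χ ∞ j a ^ (2 * m) ≤ (B ^ ((2 * m : ℕ) : ℝ)⁻¹) ^ (2 * m) := by gcongr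
    _ = B := by rw [← ENNReal.rpow_natCast, ENNReal.rpow_inv_rpow (by exact_mod_cast h2m)]

end FluctuationSPDE

end

noncomputable section

namespace FluctuationSPDE

variable {d : ℕ} {χ : DyadicPartition d}

/-! ### Moments of the increments of the stochastic convolution -/

section Increments

variable {Ω : Type*} [MeasurableSpace Ω] {P : Measure Ω} {ξ : NoiseSpace d → Ω → ℝ}
  {T L σ : ℝ} {ρ : ℝ → E d → ℝ}

/-- The Fourier coefficients of `Z_t`. -/
def noiseCoef (ξ : NoiseSpace d → Ω → ℝ) (σ : ℝ) (ρ : ℝ → E d → ℝ) (t : ℝ) (ω : Ω)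
    (k : Fin d → ℤ) : ℂ :=
  (((2 * Real.pi) ^ d : ℝ) : ℂ)⁻¹ * stochConv ξ σ ρ t (fourierTest (-k)) ω

theorem IsWhiteNoise.aemeasurable_cNoise (hξ : IsWhiteNoise P ξ) {G : ℝ × E d → Fin d → ℂ}
    (hG : SqIntegrable G) : AEMeasurable (cNoise ξ G) P := by
  have h : ∀ g : ℝ × E d → E d, MemLp g 2 (spaceTime d) → AEMeasurable (noiseIntegral ξ g) P :=
    fun g hg => by
      rw [noiseIntegral_of_memLp hg]
      exact (hξ.memLp (hg.toLp g) (p := 2) (by simp)).1.aemeasurable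
  exact (Complex.measurable_ofReal.comp_aemeasurable (h _ hG.re)).add
    ((Complex.measurable_ofReal.comp_aemeasurable (h _ hG.im)).const_mul _)

theorem sqIntegrable_heatProfile (hρ : DensityData T L ρ) (hσ : 0 < σ) (t : ℝ)
    (S : Finset (Fin d → ℤ)) : SqIntegrable (noiseField T ρ S (heatProfile σ t)) :=
  sqIntegrable_noiseField hρ S (measurable_heatProfile σ t)
    fun k => ⟨1, fun s => enorm_heatProfile_le_one hσ t s k⟩

theorem noiseCoef_eq {Ω : Type*} {ξ : NoiseSpace d → Ω → ℝ} (hσ : 0 < σ) {t : ℝ} (ht : t ∈ Icc 0 T) (ω : Ω) (k : Fin d → ℤ) :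
    noiseCoef ξ σ ρ t ω k = (((2 * Real.pi) ^ d : ℝ) : ℂ)⁻¹ *
      cNoise ξ (noiseField T ρ {k} (heatProfile σ t)) ω := by
  rw [noiseCoef, stochConv_eq, noiseKernel_eq_noiseField hσ ht]

theorem aemeasurable_noiseCoef (hξ : IsWhiteNoise P ξ) (hρ : DensityData T L ρ) (hσ : 0 < σ)
    {t : ℝ} (ht : t ∈ Icc 0 T) (k : Fin d → ℤ) : AEMeasurable (fun ω => noiseCoef ξ σ ρ t ω k) P := by
  simp_rw [noiseCoef_eq hσ ht]
  exact (hξ.aemeasurable_cNoise (sqIntegrable_heatProfile hρ hσ t {k})).const_mul _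

theorem sum_noiseCoef_sub (hξ : IsWhiteNoise P ξ) (hρ : DensityData T L ρ) (hσ : 0 < σ)
    {s t : ℝ} (hs : s ∈ Icc 0 T) (ht : t ∈ Icc 0 T) (S : Finset (Fin d → ℤ))
    (c : (Fin d → ℤ) → ℂ) :
    SqIntegrable (noiseField T ρ S fun r k => c k * ((((2 * Real.pi) ^ d : ℝ) : ℂ)⁻¹ *
      (heatProfile σ t r k - heatProfile σ s r k))) ∧
    (fun ω => ∑ k ∈ S, c k * (noiseCoef ξ σ ρ t ω k - noiseCoef ξ σ ρ s ω k)) =ᵐ[P]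
      cNoise ξ (noiseField T ρ S fun r k => c k * ((((2 * Real.pi) ^ d : ℝ) : ℂ)⁻¹ *
        (heatProfile σ t r k - heatProfile σ s r k))) := by
  classical
  set z : ℂ := (((2 * Real.pi) ^ d : ℝ) : ℂ)⁻¹ with hz
  set δ : ℝ → (Fin d → ℤ) → ℂ := fun r k => z * heatProfile σ t r k + -z * heatProfile σ s r k
    with hδ
  have hδ' : ∀ r k, z * (heatProfile σ t r k - heatProfile σ s r k) = δ r k := fun r k => by
    simp only [hδ]; ring
  simp_rw [hδ']
  have hmδ : ∀ k, Measurable fun r => δ r k := fun k =>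
    ((measurable_heatProfile σ t k).const_mul _).add ((measurable_heatProfile σ s k).const_mul _)
  have hbδ : ∀ k, ∃ C : NNReal, ∀ r, ‖δ r k‖ₑ ≤ C := fun k => by
    refine ⟨‖z‖₊ + ‖z‖₊, fun r => ?_⟩
    push_cast
    refine (enorm_add_le _ _).trans ?_
    rw [enorm_mul, enorm_mul, enorm_neg]
    exact add_le_add (mul_le_of_le_one_right' (enorm_heatProfile_le_one hσ t r k))
      (mul_le_of_le_one_right' (enorm_heatProfile_le_one hσ s r k))
  obtain ⟨h1, h2⟩ := hξ.cNoise_sum S (G := fun k => noiseField T ρ {k} δ)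
    (fun k _ => sqIntegrable_noiseField hρ {k} hmδ hbδ) c
  rw [noiseField_sum] at h1 h2
  refine ⟨h1, ?_⟩
  have h3 : ∀ k, cNoise ξ (noiseField T ρ {k} δ) =ᵐ[P] fun ω =>
      noiseCoef ξ σ ρ t ω k - noiseCoef ξ σ ρ s ω k := by
    intro k
    have := hξ.cNoise_lincomb (sqIntegrable_heatProfile hρ hσ t {k})
      (sqIntegrable_heatProfile hρ hσ s {k}) z (-z)
    rw [noiseField_lincomb] at this
    filter_upwards [this] with ω hω
    rw [noiseCoef_eq hσ ht, noiseCoef_eq hσ hs, hω]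
    ring
  filter_upwards [h2, ae_all_iff.2 h3] with ω e2 e3
  rw [e2]
  exact Finset.sum_congr rfl fun k _ => by rw [e3]

theorem enorm_inv_two_pi_pow_le_one (d : ℕ) : ‖(((2 * Real.pi) ^ d : ℝ) : ℂ)⁻¹‖ₑ ≤ 1 := by
  rw [← ofReal_norm, norm_inv, Complex.norm_real, Real.norm_of_nonneg (by positivity),
    ENNReal.ofReal_le_one]
  exact inv_le_one_of_one_le₀ (one_le_pow₀ (by linarith [Real.pi_gt_three]))

/-- At a fixed point the increment of a block is one stochastic integral, so its `2m`-th moment is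
controlled by the `m`-th power of its energy. That energy is at most the number of frequencies times
the increment bound of a profile. -/
theorem exists_lintegral_lpBlock_increment_le (hξ : IsWhiteNoise P ξ) (hρ : DensityData T L ρ)
    (hσ : 0 < σ) (hT : 0 < T) {m : ℕ} (hm : 2 ≤ m) (χ : DyadicPartition d) :
    ∃ C : NNReal, ∀ j, ∀ s ∈ Icc 0 T, ∀ t ∈ Icc 0 T, ∀ x,
      ∫⁻ ω, ‖lpBlock χ j (noiseCoef ξ σ ρ t ω - noiseCoef ξ σ ρ s ω) x‖ₑ ^ (2 * m) ∂P ≤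
        C * 2 ^ ((d * m + 12) * j) * ENNReal.ofReal |t - s| ^ 2 := by
  obtain ⟨A, B, hAB⟩ := exists_heatProfile_increment_bound (d := d) hσ hT
  set g := Real.toNNReal (2 ^ (m + 1) * gaussMoment (2 * m)) with hg
  set V := Real.toNNReal L * Real.toNNReal ((2 * Real.pi) ^ d) with hV
  refine ⟨g * (V * 8 ^ d) ^ m * A ^ (m - 2) * B ^ 2, fun j s hs t ht x => ?_⟩
  set S := box d (2 ^ (j + 1)) with hS
  obtain ⟨h1, h2⟩ := sum_noiseCoef_sub hξ hρ hσ hs ht S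
    fun k => chiSymbol χ j k * fourierE k x
  set γ : ℝ → (Fin d → ℤ) → ℂ := fun r k => chiSymbol χ j k * fourierE k x *
    ((((2 * Real.pi) ^ d : ℝ) : ℂ)⁻¹ * (heatProfile σ t r k - heatProfile σ s r k)) with hγ
  have h3 : ∫⁻ ω, ‖lpBlock χ j (noiseCoef ξ σ ρ t ω - noiseCoef ξ σ ρ s ω) x‖ₑ ^ (2 * m) ∂P =
      ∫⁻ ω, ‖cNoise ξ (noiseField T ρ S γ) ω‖ₑ ^ (2 * m) ∂P := by
    refine lintegral_congr_ae ?_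
    filter_upwards [h2] with ω hω
    rw [← hω, lpBlock_eq_trig, trig]
    congr 2
    refine Finset.sum_congr rfl fun k _ => ?_
    simp only [Pi.sub_apply]
    ring
  have hmγ : ∀ k, Measurable fun r => γ r k := fun k =>
    (((measurable_heatProfile σ t k).sub (measurable_heatProfile σ s k)).const_mul _).const_mul _
  set D := min (A : ℝ≥0∞) (B * 2 ^ (6 * j) * ENNReal.ofReal |t - s|) with hD
  have h4 : ∀ k ∈ S, ENNReal.ofReal (‖freq k‖ ^ 2) * ∫⁻ r in Ico 0 T, ‖γ r k‖ₑ ^ 2 ≤ D := by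
    intro k _
    by_cases hk : chiSymbol χ j k = 0
    · simp [hγ, hk]
    · refine le_trans ?_ (hAB j k (norm_freq_le_of_chiSymbol hk) s hs t ht)
      gcongr with r
      rw [hγ, enorm_mul, enorm_mul, enorm_mul]
      have e1 : ‖chiSymbol χ j k‖ₑ ≤ 1 := by
        rw [← ofReal_norm]; exact ENNReal.ofReal_le_one.2 (norm_chiSymbol_le j k)
      have e2 : ‖fourierE k x‖ₑ = 1 := by rw [← ofReal_norm, norm_fourierE, ENNReal.ofReal_one]
      rw [e2, mul_one]
      exact (mul_le_of_le_one_left' e1).trans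
        (mul_le_of_le_one_left' (enorm_inv_two_pi_pow_le_one d))
  have hcard : (S.card : ℝ≥0∞) ≤ 8 ^ d * 2 ^ (d * j) := by
    have := card_box_two_pow_le (d := d) j
    rw [← Nat.cast_mul, Real.rpow_natCast] at this
    exact_mod_cast this
  have h5 : energy (noiseField T ρ S γ) ≤ V * (8 ^ d * 2 ^ (d * j) * D) := by
    refine (energy_noiseField_le hρ S hmγ).trans ?_
    rw [hV]
    push_cast
    refine mul_le_mul' le_rfl ?_
    refine (Finset.sum_le_card_nsmul S _ D h4).trans ?_
    rw [nsmul_eq_mul]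
    gcongr
  -- Only two of the `m` factors use the time increment: the power `|t - s|²` suffices for chaining,
  -- and the loss `2^{12j}` is then independent of `m`.
  have h6 : D ^ m ≤ A ^ (m - 2) * (B * 2 ^ (6 * j) * ENNReal.ofReal |t - s|) ^ 2 := by
    obtain ⟨m', rfl⟩ := Nat.exists_eq_add_of_le' hm
    rw [Nat.add_sub_cancel, pow_add]
    gcongr
    · exact min_le_left _ _
    · exact min_le_right _ _
  rw [h3]
  calc _ ≤ (g : ℝ≥0∞) * energy (noiseField T ρ S γ) ^ m := hξ.lintegral_cNoise_le h1 m
    _ ≤ g * (V * (8 ^ d * 2 ^ (d * j) * D)) ^ m := by gcongr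
    _ = g * (V * 8 ^ d) ^ m * 2 ^ (d * j * m) * D ^ m := by
      rw [pow_mul 2 (d * j) m]; ring
    _ ≤ g * (V * 8 ^ d) ^ m * 2 ^ (d * j * m) *
        (A ^ (m - 2) * (B * 2 ^ (6 * j) * ENNReal.ofReal |t - s|) ^ 2) := by gcongr
    _ = _ := by
      have e : (2 : ℝ≥0∞) ^ ((d * m + 12) * j) = 2 ^ (d * j * m) * (2 ^ (6 * j)) ^ 2 := by
        rw [← pow_mul, ← pow_add]; congr 1; ring
      rw [e]; push_cast; ring

theorem aemeasurable_lpBlock_prod [SFinite P] {a : Ω → (Fin d → ℤ) → ℂ}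
    (ha : ∀ k, AEMeasurable (fun ω => a ω k) P) (j : ℕ) :
    AEMeasurable (fun z : Ω × E d => lpBlock χ j (a z.1) z.2) (P.prod (torusMeasure d)) := by
  simp_rw [lpBlock_eq_trig, trig]
  refine Finset.aemeasurable_fun_sum _ fun k _ => ?_
  exact ((ha k).comp_fst.const_mul _).mul
    ((continuous_fourierE k).measurable.comp measurable_snd).aemeasurable

/-- Bernstein and Fubini pass from points to the supremum in space. After a `2m`-th root the
exponent is `d/2 + (d + 12)/(2m)` per dyadic scale, which tends to `d/2` as `m` grows. -/
theorem exists_lintegral_blockNorm_increment_le (hξ : IsWhiteNoise P ξ) (hρ : DensityData T L ρ)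
    (hσ : 0 < σ) (hT : 0 < T) {m : ℕ} (hm : 2 ≤ m) (χ : DyadicPartition d) :
    ∃ C : NNReal, ∀ j, ∀ s ∈ Icc 0 T, ∀ t ∈ Icc 0 T,
      ∫⁻ ω, blockNorm χ ∞ j (noiseCoef ξ σ ρ t ω - noiseCoef ξ σ ρ s ω) ^ (2 * m) ∂P ≤
        C * 2 ^ ((d * m + d + 12) * j) * ENNReal.ofReal |t - s| ^ 2 := by
  have := hξ.gaussian.isProbabilityMeasure
  have : IsFiniteMeasure (torusMeasure d) := ⟨by rw [torusMeasure_univ]; exact ENNReal.ofReal_lt_top⟩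
  obtain ⟨C, hC⟩ := exists_lintegral_lpBlock_increment_le hξ hρ hσ hT hm χ
  obtain ⟨C', hC'⟩ := exists_bernstein (one_le_two.trans hm) χ
  refine ⟨C' * C * Real.toNNReal ((2 * Real.pi) ^ d), fun j s hs t ht => ?_⟩
  have hmeas := (aemeasurable_lpBlock_prod (χ := χ)
    (a := fun ω => noiseCoef ξ σ ρ t ω - noiseCoef ξ σ ρ s ω)
    (fun k => (aemeasurable_noiseCoef hξ hρ hσ ht k).sub (aemeasurable_noiseCoef hξ hρ hσ hs k))
    j).enorm.pow_const (2 * m)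
  calc _ ≤ ∫⁻ ω, C' * 2 ^ (d * j) * ∫⁻ x,
        ‖lpBlock χ j (noiseCoef ξ σ ρ t ω - noiseCoef ξ σ ρ s ω) x‖ₑ ^ (2 * m) ∂torusMeasure d ∂P :=
        lintegral_mono fun ω => hC' j _
    _ = C' * 2 ^ (d * j) * ∫⁻ x, ∫⁻ ω,
        ‖lpBlock χ j (noiseCoef ξ σ ρ t ω - noiseCoef ξ σ ρ s ω) x‖ₑ ^ (2 * m) ∂P ∂torusMeasure d := by
        rw [lintegral_const_mul' _ _ (ENNReal.mul_ne_top ENNReal.coe_ne_top (by simp)),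
          lintegral_lintegral_swap hmeas]
    _ ≤ C' * 2 ^ (d * j) * ∫⁻ _, C * 2 ^ ((d * m + 12) * j) * ENNReal.ofReal |t - s| ^ 2
        ∂torusMeasure d := by
        gcongr with x
        exact hC j s hs t ht x
    _ = _ := by
      rw [lintegral_const, torusMeasure_univ]
      have e : (2 : ℝ≥0∞) ^ ((d * m + d + 12) * j) = 2 ^ (d * j) * 2 ^ ((d * m + 12) * j) := by
        rw [← pow_add]; congr 1; ring
      rw [e]; push_cast
      rw [← ENNReal.ofReal]; ring

end Increments

end FluctuationSPDE

end

noncomputable section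

namespace FluctuationSPDE

variable {d : ℕ} {χ : DyadicPartition d}

/-! ### Chaining along the dyadic times -/

/-- The dyadic times `T i / 2^n` of `[0, T]`. -/
def dyadicTime (T : ℝ) : Set ℝ := {t | ∃ n i : ℕ, i ≤ 2 ^ n ∧ t = T * i / 2 ^ n}

theorem countable_dyadicTime (T : ℝ) : (dyadicTime T).Countable := by
  refine (countable_range fun z : ℕ × ℕ => T * z.2 / 2 ^ z.1).mono ?_
  rintro t ⟨n, i, -, rfl⟩
  exact ⟨(n, i), rfl⟩

theorem zero_mem_dyadicTime (T : ℝ) : (0 : ℝ) ∈ dyadicTime T := ⟨0, 0, by simp, by simp⟩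

theorem div_mem_Icc {T : ℝ} (hT : 0 ≤ T) {n i : ℕ} (h : i ≤ 2 ^ n) :
    T * i / 2 ^ n ∈ Icc 0 T := by
  have h' : (i : ℝ) ≤ 2 ^ n := by exact_mod_cast h
  refine ⟨by positivity, ?_⟩
  rw [div_le_iff₀ (by positivity)]
  gcongr

theorem dyadicTime_subset {T : ℝ} (hT : 0 ≤ T) : dyadicTime T ⊆ Icc 0 T := by
  rintro t ⟨n, i, hi, rfl⟩
  exact div_mem_Icc hT hi

theorem subset_closure_dyadicTime {T : ℝ} (hT : 0 < T) : Icc 0 T ⊆ closure (dyadicTime T) := by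
  intro t ht
  rw [Metric.mem_closure_iff]
  intro ε hε
  obtain ⟨n, hn⟩ := exists_pow_lt_of_lt_one (show 0 < ε / T by positivity)
    (show (1 / 2 : ℝ) < 1 by norm_num)
  have ht' : 0 ≤ t * 2 ^ n / T := div_nonneg (mul_nonneg ht.1 (by positivity)) hT.le
  set i := ⌊t * 2 ^ n / T⌋₊ with hi
  have h1 : (i : ℝ) ≤ t * 2 ^ n / T := Nat.floor_le ht'
  have h2 : t * 2 ^ n / T < i + 1 := Nat.lt_floor_add_one _
  rw [le_div_iff₀ hT] at h1
  rw [div_lt_iff₀ hT] at h2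
  have h2n : (0 : ℝ) < 2 ^ n := by positivity
  refine ⟨T * i / 2 ^ n, ⟨n, i, ?_, rfl⟩, ?_⟩
  · have : (i : ℝ) * T ≤ 2 ^ n * T := by nlinarith [ht.2]
    exact_mod_cast le_of_mul_le_mul_right this hT
  · have e1 : T * i / 2 ^ n ≤ t := by rw [div_le_iff₀ h2n]; linarith
    have e2 : t < T * i / 2 ^ n + T * (1 / 2) ^ n := by
      rw [one_div, inv_pow, ← div_eq_mul_inv, ← add_div, lt_div_iff₀ h2n]; linarith
    rw [Real.dist_eq, abs_of_nonneg (by linarith)]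
    rw [lt_div_iff₀ hT] at hn
    linarith

theorem ENNReal.tsum_mul_pow_le {q : ℕ} (hq : q ≠ 0) (a x : ℕ → ℝ≥0∞) :
    (∑' l, a l * x l) ^ q ≤ (∑' l, a l) ^ q * ∑' l, x l ^ q := by
  have h1 : ∀ l, x l ≤ (∑' l, x l ^ q) ^ (q : ℝ)⁻¹ := fun l => by
    rw [ENNReal.le_rpow_inv_iff (by positivity), ENNReal.rpow_natCast]
    exact ENNReal.le_tsum l
  calc (∑' l, a l * x l) ^ q ≤ (∑' l, a l * (∑' l, x l ^ q) ^ (q : ℝ)⁻¹) ^ q := by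
        gcongr with l; exact h1 l
    _ = _ := by
      rw [ENNReal.tsum_mul_right, mul_pow]
      congr 1
      rw [← ENNReal.rpow_natCast, ENNReal.rpow_inv_rpow (by exact_mod_cast hq)]

/-- A geometric weight exchanges the power of a sum for a sum of powers at an arbitrarily small
exponential price, so that moments can be taken term by term. -/
theorem ENNReal.tsum_pow_le {q : ℕ} (hq : q ≠ 0) {θ : ℝ} (y : ℕ → ℝ≥0∞) :
    (∑' l, y l) ^ q ≤ (∑' l : ℕ, ENNReal.ofReal (2 ^ (-(θ * l)))) ^ q *
      ∑' l : ℕ, ENNReal.ofReal (2 ^ (q * θ * l)) * y l ^ q := by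
  have h1 : ∀ l, y l = ENNReal.ofReal (2 ^ (-(θ * l))) * (ENNReal.ofReal (2 ^ (θ * l)) * y l) := by
    intro l
    rw [← mul_assoc, ← ENNReal.ofReal_mul (by positivity), ← Real.rpow_add two_pos]
    simp
  have h2 : ∀ l : ℕ, (ENNReal.ofReal (2 ^ (θ * l)) * y l) ^ q =
      ENNReal.ofReal (2 ^ (q * θ * l)) * y l ^ q := by
    intro l
    rw [mul_pow, ← ENNReal.ofReal_pow (by positivity), ← Real.rpow_natCast, ← Real.rpow_mul two_pos.le]
    congr 3
    ring
  calc (∑' l, y l) ^ q = (∑' l : ℕ, ENNReal.ofReal (2 ^ (-(θ * l))) *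
        (ENNReal.ofReal (2 ^ (θ * l)) * y l)) ^ q := by congr 2; exact funext h1
    _ ≤ _ := ENNReal.tsum_mul_pow_le hq _ _
    _ = _ := by simp_rw [h2]

/-- A dyadic time of level `n + 1` is of level `n` or the right neighbour of such a time, so each
level costs at most one increment. -/
theorem le_sum_of_dyadic {V : ℝ → ℝ → ℝ≥0∞} (hV0 : V 0 0 = 0)
    (hV : ∀ s t u, V s u ≤ V s t + V t u) {T : ℝ} {y : ℕ → ℝ≥0∞}
    (hy : ∀ n i : ℕ, i < 2 ^ n → V (T * i / 2 ^ n) (T * (i + 1 : ℕ) / 2 ^ n) ≤ y n) (n : ℕ) :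
    ∀ i : ℕ, i ≤ 2 ^ n → V 0 (T * i / 2 ^ n) ≤ ∑ l ∈ Finset.range (n + 1), y l := by
  induction n with
  | zero =>
    intro i hi
    rw [pow_zero] at hi
    interval_cases i
    · simp [hV0]
    · simpa using hy 0 0 (by simp)
  | succ n ih =>
    have key : ∀ i : ℕ, T * ((2 * i : ℕ) : ℝ) / 2 ^ (n + 1) = T * i / 2 ^ n := by
      intro i
      rw [pow_succ]
      push_cast
      field_simp
    intro i hi
    rw [Finset.sum_range_succ]
    rcases Nat.even_or_odd' i with ⟨m, rfl | rfl⟩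
    · rw [key]
      exact le_add_right (ih m (by rw [pow_succ] at hi; omega))
    · refine (hV 0 (T * m / 2 ^ n) _).trans (add_le_add (ih m (by rw [pow_succ] at hi; omega)) ?_)
      have := hy (n + 1) (2 * m) (by omega)
      rwa [key] at this

/-- Level `n` has `2^n` increments, each of moment at most `B (T 2^{-n})²`. Replacing their maximum
by their sum leaves `B T² 2^{-n}`, which is summable with room for a weight. -/
theorem exists_chaining_bound {T : ℝ} (hT : 0 < T) {q : ℕ} (hq : q ≠ 0) :
    ∃ C : NNReal, ∀ {Ω : Type*} [MeasurableSpace Ω] (P : Measure Ω) (V : ℝ → ℝ → Ω → ℝ≥0∞) (B : ℝ≥0∞),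
      (∀ ω, V 0 0 ω = 0) → (∀ ω s t u, V s u ω ≤ V s t ω + V t u ω) →
      (∀ s ∈ Icc 0 T, ∀ t ∈ Icc 0 T, AEMeasurable (V s t) P) →
      (∀ s ∈ Icc 0 T, ∀ t ∈ Icc 0 T, ∫⁻ ω, V s t ω ^ q ∂P ≤ B * ENNReal.ofReal |t - s| ^ 2) →
      ∫⁻ ω, (⨆ t ∈ dyadicTime T, V 0 t ω) ^ q ∂P ≤ C * B := by
  have hq0 : (0 : ℝ) < q := by exact_mod_cast Nat.pos_of_ne_zero hq
  -- The weight then costs `2^{qθl} = 2^{l/2}` at level `l`, against the available decay `2^{-l}`.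
  set θ : ℝ := 1 / (2 * q) with hθ
  have hθ0 : 0 < θ := by positivity
  set A := (∑' l : ℕ, ENNReal.ofReal (2 ^ (-(θ * l)))) ^ q with hA
  have hA' : A ≠ ∞ := by
    refine ENNReal.pow_ne_top ?_
    have := tsum_ofReal_geometric_ne_top 1 hθ0
    simpa using this
  set A' := ∑' l : ℕ, ENNReal.ofReal (T ^ 2 * 2 ^ (-(1 / 2 * (l : ℝ)))) with hA1
  have hA1' : A' ≠ ∞ := tsum_ofReal_geometric_ne_top (T ^ 2) (by norm_num)
  refine ⟨(A * A').toNNReal, fun {Ω} _ P V B hV0 hV hVm hVB => ?_⟩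
  rw [ENNReal.coe_toNNReal (ENNReal.mul_ne_top hA' hA1')]
  set Y : ℕ → Ω → ℝ≥0∞ := fun n ω =>
    ∑ i ∈ Finset.range (2 ^ n), V (T * i / 2 ^ n) (T * (i + 1 : ℕ) / 2 ^ n) ω ^ q with hY
  have hmem : ∀ n i : ℕ, i < 2 ^ n → T * i / 2 ^ n ∈ Icc 0 T ∧ T * (i + 1 : ℕ) / 2 ^ n ∈ Icc 0 T :=
    fun n i hi => ⟨div_mem_Icc hT.le hi.le, div_mem_Icc hT.le hi⟩
  have hYm : ∀ n, AEMeasurable (Y n) P := fun n =>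
    Finset.aemeasurable_fun_sum _ fun i hi =>
      (hVm _ (hmem n i (Finset.mem_range.1 hi)).1 _ (hmem n i (Finset.mem_range.1 hi)).2).pow_const q
  have hYB : ∀ n, ∫⁻ ω, Y n ω ∂P ≤ B * ENNReal.ofReal (T ^ 2 * 2 ^ (-(n : ℝ))) := by
    intro n
    rw [hY, lintegral_finsetSum' _ fun i hi =>
      (hVm _ (hmem n i (Finset.mem_range.1 hi)).1 _ (hmem n i (Finset.mem_range.1 hi)).2).pow_const q]
    refine (Finset.sum_le_card_nsmul _ _ (B * ENNReal.ofReal (T / 2 ^ n) ^ 2) fun i hi => ?_).trans ?_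
    · refine (hVB _ (hmem n i (Finset.mem_range.1 hi)).1 _
        (hmem n i (Finset.mem_range.1 hi)).2).trans (le_of_eq ?_)
      congr 3
      rw [← sub_div, ← mul_sub]
      push_cast
      rw [add_sub_cancel_left, mul_one, abs_of_nonneg (by positivity)]
    · rw [Finset.card_range, nsmul_eq_mul, mul_left_comm, ← ENNReal.ofReal_pow (by positivity)]
      gcongr
      rw [show ((2 ^ n : ℕ) : ℝ≥0∞) = ENNReal.ofReal (2 ^ n) by
        rw [ENNReal.ofReal_pow (by norm_num)]; simp, ← ENNReal.ofReal_mul (by positivity)]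
      refine ENNReal.ofReal_le_ofReal (le_of_eq ?_)
      rw [Real.rpow_neg two_pos.le, Real.rpow_natCast]
      field_simp
  have hsup : ∀ ω, (⨆ t ∈ dyadicTime T, V 0 t ω) ≤ ∑' l, Y l ω ^ (q : ℝ)⁻¹ := by
    intro ω
    refine iSup₂_le ?_
    rintro t ⟨n, i, hi, rfl⟩
    refine (le_sum_of_dyadic (V := fun s t => V s t ω) (hV0 ω) (hV ω) (fun n i hi => ?_) n i hi).trans
      (ENNReal.sum_le_tsum _)
    rw [ENNReal.le_rpow_inv_iff (by positivity), ENNReal.rpow_natCast]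
    exact Finset.single_le_sum (f := fun i : ℕ =>
      V (T * i / 2 ^ n) (T * (i + 1 : ℕ) / 2 ^ n) ω ^ q) (fun _ _ => zero_le)
      (Finset.mem_range.2 hi)
  calc ∫⁻ ω, (⨆ t ∈ dyadicTime T, V 0 t ω) ^ q ∂P
      ≤ ∫⁻ ω, A * ∑' l : ℕ, ENNReal.ofReal (2 ^ (q * θ * l)) * Y l ω ∂P := by
        refine lintegral_mono fun ω => ?_
        refine (pow_le_pow_left' (hsup ω) q).trans
          ((ENNReal.tsum_pow_le hq (θ := θ) _).trans (le_of_eq ?_))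
        congr 2
        ext l
        rw [← ENNReal.rpow_natCast (Y l ω ^ (q : ℝ)⁻¹), ENNReal.rpow_inv_rpow hq0.ne']
    _ = A * ∑' l : ℕ, ENNReal.ofReal (2 ^ (q * θ * l)) * ∫⁻ ω, Y l ω ∂P := by
        rw [lintegral_const_mul' _ _ hA', lintegral_tsum fun l => (hYm l).const_mul _]
        congr 2
        ext l
        rw [lintegral_const_mul' _ _ ENNReal.ofReal_ne_top]
    _ ≤ A * ∑' l : ℕ, B * ENNReal.ofReal (T ^ 2 * 2 ^ (-(1 / 2 * (l : ℝ)))) := by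
        refine mul_le_mul' le_rfl (ENNReal.tsum_le_tsum fun l => ?_)
        refine (mul_le_mul' le_rfl (hYB l)).trans (le_of_eq ?_)
        rw [mul_left_comm, ← ENNReal.ofReal_mul (by positivity)]
        congr 2
        rw [mul_left_comm, ← Real.rpow_add two_pos]
        congr 2
        rw [hθ]
        field_simp
        ring
    _ = _ := by rw [ENNReal.tsum_mul_left, mul_left_comm, mul_comm]

end FluctuationSPDE

end

noncomputable section

namespace FluctuationSPDE

variable {d : ℕ} {χ : DyadicPartition d}

/-! ### Moments of the stochastic convolution -/

section NoiseSup

variable {Ω : Type*} [MeasurableSpace Ω] {P : Measure Ω} {ξ : NoiseSpace d → Ω → ℝ}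
  {T L σ : ℝ} {ρ : ℝ → E d → ℝ}

theorem IsWhiteNoise.cNoise_zero (hξ : IsWhiteNoise P ξ) : ∀ᵐ ω ∂P, cNoise ξ 0 ω = 0 := by
  have := hξ.cNoise_lincomb (sqIntegrable_zero (d := d)) sqIntegrable_zero 0 0
  simpa [EventuallyEq] using this

theorem noiseCoef_zero_ae (hξ : IsWhiteNoise P ξ) (hσ : 0 < σ) (hT : 0 < T) :
    ∀ᵐ ω ∂P, noiseCoef ξ σ ρ 0 ω = 0 := by
  filter_upwards [hξ.cNoise_zero] with ω hω
  ext k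
  have h : noiseField T ρ {k} (heatProfile σ 0) = 0 := by
    ext z i
    rw [noiseField]
    by_cases hz : z.1 ∈ Ico 0 T
    · rw [indicator_of_mem hz, Finset.sum_singleton, heatProfile,
        indicator_of_notMem (show z.1 ∉ Iio 0 from not_lt.2 hz.1)]
      simp
    · rw [indicator_of_notMem hz]; rfl
  rw [noiseCoef_eq hσ (left_mem_Icc.2 hT.le), h, hω, mul_zero]
  rfl

/-- The supremum over the dyadic times of the norms of the blocks of the stochastic convolution. -/
def noiseSup (χ : DyadicPartition d) (ξ : NoiseSpace d → Ω → ℝ) (σ : ℝ) (ρ : ℝ → E d → ℝ) (T : ℝ)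
    (j : ℕ) (ω : Ω) : ℝ≥0∞ :=
  ⨆ t ∈ dyadicTime T, blockNorm χ ∞ j (noiseCoef ξ σ ρ t ω)

theorem aemeasurable_noiseSup (hξ : IsWhiteNoise P ξ) (hρ : DensityData T L ρ) (hσ : 0 < σ)
    (hT : 0 < T) (j : ℕ) : AEMeasurable (noiseSup χ ξ σ ρ T j) P := by
  refine AEMeasurable.biSup _ (countable_dyadicTime T) fun t ht => ?_
  exact aemeasurable_blockNorm le_top _
    fun k => aemeasurable_noiseCoef hξ hρ hσ (dyadicTime_subset hT.le ht) k

/-- Chaining is applied to the block norms of the increments, which satisfy the triangle inequality,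
starting from `Z_0 = 0` almost surely. -/
theorem exists_lintegral_noiseSup_le (hξ : IsWhiteNoise P ξ) (hρ : DensityData T L ρ)
    (hσ : 0 < σ) (hT : 0 < T) {m : ℕ} (hm : 2 ≤ m) (χ : DyadicPartition d) :
    ∃ C : NNReal, ∀ j, ∫⁻ ω, noiseSup χ ξ σ ρ T j ω ^ (2 * m) ∂P ≤
      C * 2 ^ ((d * m + d + 12) * j) := by
  obtain ⟨C, hC⟩ := exists_lintegral_blockNorm_increment_le hξ hρ hσ hT hm χ
  obtain ⟨C', hC'⟩ := exists_chaining_bound hT (q := 2 * m) (by omega)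
  refine ⟨C' * C, fun j => ?_⟩
  have h := hC' P (fun s t ω => blockNorm χ ∞ j (noiseCoef ξ σ ρ t ω - noiseCoef ξ σ ρ s ω))
    (C * 2 ^ ((d * m + d + 12) * j)) (fun ω => ?_) (fun ω s t u => ?_) (fun s hs t ht => ?_) (hC j)
  · refine le_trans (le_of_eq (lintegral_congr_ae ?_)) (h.trans_eq (by push_cast; ring))
    filter_upwards [noiseCoef_zero_ae (ρ := ρ) hξ hσ hT] with ω hω
    simp only [hω, sub_zero, noiseSup]
  · rw [sub_self]
    exact le_zero_iff.1 ((blockNorm_le_sum _ j 0).trans_eq (by simp))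
  · have := blockNorm_add_le (χ := χ) (p := ∞) le_top j (noiseCoef ξ σ ρ t ω - noiseCoef ξ σ ρ s ω)
      (noiseCoef ξ σ ρ u ω - noiseCoef ξ σ ρ t ω)
    rwa [add_comm, sub_add_sub_cancel] at this
  · exact aemeasurable_blockNorm le_top _ fun k =>
      (aemeasurable_noiseCoef hξ hρ hσ ht k).sub (aemeasurable_noiseCoef hξ hρ hσ hs k)

theorem lintegral_noise_tsum_lt_top (hξ : IsWhiteNoise P ξ) (hρ : DensityData T L ρ)
    (hσ : 0 < σ) (hT : 0 < T) {α : ℝ} (hα : (d : ℝ) / 2 < α) (χ : DyadicPartition d) {r : ℝ}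
    (hr : 0 < r) : ∫⁻ ω, (∑' j, weight (-α) j * noiseSup χ ξ σ ρ T j ω) ^ r ∂P < ∞ := by
  have := hξ.gaussian.isProbabilityMeasure
  set θ := (α - d / 2) / 2 with hθ
  have hθ0 : 0 < θ := by rw [hθ]; linarith
  -- With `α = d/2 + 2θ`, the weighted `2m`-th moment of block `j` grows with exponent `(d + 12 -
  -- 2mθ) j`. Requiring `2mθ ≥ d + 13` turns this into decay `2^{-j}`; the other condition gives `2m
  -- ≥ r`.
  obtain ⟨m, hm⟩ := exists_nat_ge (max (max 2 r) ((d + 13) / (2 * θ)))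
  have hm2 : 2 ≤ m := by exact_mod_cast (le_max_left _ _).trans ((le_max_left _ _).trans hm)
  have hmr : r ≤ ((2 * m : ℕ) : ℝ) := by
    have := (le_max_right (2 : ℝ) r).trans ((le_max_left _ _).trans hm)
    push_cast; linarith
  have hmθ : d + 13 ≤ 2 * m * θ := by
    have := (le_max_right _ _).trans hm
    rw [div_le_iff₀ (by positivity)] at this
    linarith
  obtain ⟨C, hC⟩ := exists_lintegral_noiseSup_le hξ hρ hσ hT hm2 χ
  set A := (∑' l : ℕ, ENNReal.ofReal (2 ^ (-(θ * l)))) ^ (2 * m) with hA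
  have hA' : A ≠ ∞ := by
    refine ENNReal.pow_ne_top ?_
    have := tsum_ofReal_geometric_ne_top 1 hθ0
    simpa using this
  have hmeas : ∀ j, AEMeasurable (noiseSup χ ξ σ ρ T j) P := aemeasurable_noiseSup hξ hρ hσ hT
  have key : ∫⁻ ω, (∑' j, weight (-α) j * noiseSup χ ξ σ ρ T j ω) ^ (2 * m) ∂P < ∞ := by
    have hj : ∀ j : ℕ, ∫⁻ ω, ENNReal.ofReal (2 ^ ((2 * m : ℕ) * θ * j)) *
        (weight (-α) j * noiseSup χ ξ σ ρ T j ω) ^ (2 * m) ∂P ≤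
        C * ENNReal.ofReal ((2 ^ α) ^ (2 * m) * 2 ^ (-(1 * (j : ℝ)))) := by
      intro j
      simp_rw [mul_pow, ← mul_assoc]
      have hw : ENNReal.ofReal (2 ^ ((2 * m : ℕ) * θ * j)) * weight (-α) j ^ (2 * m) =
          ENNReal.ofReal (2 ^ ((2 * m : ℕ) * θ * j) * ((2 ^ α) * 2 ^ (-(α * j))) ^ (2 * m)) := by
        rw [weight_eq, neg_neg, ← ENNReal.ofReal_pow (by positivity), ← ENNReal.ofReal_mul (by positivity)]
      rw [hw, lintegral_const_mul' _ _ ENNReal.ofReal_ne_top]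
      refine (mul_le_mul' le_rfl (hC j)).trans ?_
      have e1 : (2 : ℝ≥0∞) ^ ((d * m + d + 12) * j) =
          ENNReal.ofReal ((2 : ℝ) ^ (((d * m + d + 12) * j : ℕ) : ℝ)) := by
        rw [Real.rpow_natCast, ENNReal.ofReal_pow (by norm_num), ENNReal.ofReal_ofNat]
      rw [e1, mul_left_comm, ← ENNReal.ofReal_mul (by positivity)]
      refine mul_le_mul' le_rfl (ENNReal.ofReal_le_ofReal ?_)
      rw [mul_pow, mul_left_comm, mul_assoc]
      refine mul_le_mul_of_nonneg_left ?_ (by positivity)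
      rw [← Real.rpow_natCast (2 ^ (-(α * (j : ℝ)))), ← Real.rpow_mul two_pos.le,
        ← Real.rpow_add two_pos, ← Real.rpow_add two_pos]
      refine Real.rpow_le_rpow_of_exponent_le one_le_two ?_
      push_cast
      have hα' : α = d / 2 + 2 * θ := by rw [hθ]; ring
      have hj0 : (0 : ℝ) ≤ j := by positivity
      rw [hα']
      nlinarith [mul_le_mul_of_nonneg_right hmθ hj0]
    calc _ ≤ ∫⁻ ω, A * ∑' j : ℕ, ENNReal.ofReal (2 ^ ((2 * m : ℕ) * θ * j)) *
          (weight (-α) j * noiseSup χ ξ σ ρ T j ω) ^ (2 * m) ∂P :=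
          lintegral_mono fun ω => ENNReal.tsum_pow_le (by omega) _
      _ = A * ∑' j : ℕ, ∫⁻ ω, ENNReal.ofReal (2 ^ ((2 * m : ℕ) * θ * j)) *
          (weight (-α) j * noiseSup χ ξ σ ρ T j ω) ^ (2 * m) ∂P := by
          rw [lintegral_const_mul' _ _ hA', lintegral_tsum fun j =>
            (((hmeas j).const_mul _).pow_const _).const_mul _]
      _ ≤ A * ∑' j : ℕ, C * ENNReal.ofReal ((2 ^ α) ^ (2 * m) * 2 ^ (-(1 * (j : ℝ)))) :=
          mul_le_mul' le_rfl (ENNReal.tsum_le_tsum hj)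
      _ < ∞ := by
          rw [ENNReal.tsum_mul_left]
          exact (ENNReal.mul_ne_top hA' (ENNReal.mul_ne_top ENNReal.coe_ne_top
            (tsum_ofReal_geometric_ne_top _ one_pos))).lt_top
  have hle : ∀ x : ℝ≥0∞, x ^ r ≤ 1 + x ^ (2 * m) := by
    intro x
    rcases le_total x 1 with hx | hx
    · exact le_add_right (ENNReal.rpow_le_one hx hr.le)
    · refine le_add_left ?_
      rw [← ENNReal.rpow_natCast]
      exact ENNReal.rpow_le_rpow_of_exponent_le hx hmr
  calc _ ≤ ∫⁻ ω, 1 + (∑' j, weight (-α) j * noiseSup χ ξ σ ρ T j ω) ^ (2 * m) ∂P :=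
        lintegral_mono fun ω => hle _
    _ < ∞ := by
      rw [lintegral_add_left measurable_const, lintegral_one, measure_univ]
      exact ENNReal.add_lt_top.2 ⟨ENNReal.one_lt_top, key⟩

end NoiseSup

end FluctuationSPDE

end

noncomputable section

namespace FluctuationSPDE

variable {d : ℕ} {χ : DyadicPartition d}

/-! ### Irregularity of the stochastic convolution -/

section Irregularity

theorem toLp_reField_sum {ι : Type*} [DecidableEq ι] (S : Finset ι) {G : ι → ℝ × E d → Fin d → ℂ}
    (hG : ∀ k, SqIntegrable (G k)) (c : ι → ℂ) :
    ∃ h : MemLp (reField (∑ k ∈ S, c k • G k)) 2 (spaceTime d), h.toLp _ =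
      ∑ k ∈ S, ((c k).re • (hG k).re.toLp _ + (-(c k).im) • (hG k).im.toLp _) := by
  induction S using Finset.induction_on with
  | empty =>
    have h0 : reField (∑ k ∈ (∅ : Finset ι), c k • G k) = 0 := by ext z i; simp [reField]
    simp_rw [h0]
    exact ⟨MemLp.zero, by simp⟩
  | insert k S hk ih =>
    obtain ⟨h, e⟩ := ih
    have h1 : reField (∑ k ∈ insert k S, c k • G k) =
        ((c k).re • reField (G k) + (-(c k).im) • imField (G k)) + reField (∑ k ∈ S, c k • G k) := by
      rw [Finset.sum_insert hk]
      ext z i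
      simp [reField, imField]
      ring
    have h2 := ((hG k).re.const_smul (c k).re).add ((hG k).im.const_smul (-(c k).im))
    simp_rw [h1]
    refine ⟨h2.add h, ?_⟩
    rw [MemLp.toLp_add h2 h, MemLp.toLp_add ((hG k).re.const_smul (c k).re)
      ((hG k).im.const_smul (-(c k).im)), MemLp.toLp_const_smul, MemLp.toLp_const_smul, e,
      Finset.sum_insert hk]

/-- A bound on synthesis is a bound on analysis. -/
theorem sum_inner_sq_le_of_norm_sum_sq_le {ι H : Type*} [NormedAddCommGroup H]
    [InnerProductSpace ℝ H] (I : Finset ι) (f : ι → H) {Λ : ℝ} (hΛ : 0 ≤ Λ)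
    (h : ∀ x : ι → ℝ, ‖∑ i ∈ I, x i • f i‖ ^ 2 ≤ Λ * ∑ i ∈ I, x i ^ 2) (g : H) :
    ∑ i ∈ I, ⟪g, f i⟫_ℝ ^ 2 ≤ Λ * ‖g‖ ^ 2 := by
  set Q := ∑ i ∈ I, ⟪g, f i⟫_ℝ ^ 2 with hQ
  have hQ0 : 0 ≤ Q := Finset.sum_nonneg fun _ _ => sq_nonneg _
  have h1 := h fun i => ⟪g, f i⟫_ℝ
  have h2 : Q = ⟪g, ∑ i ∈ I, ⟪g, f i⟫_ℝ • f i⟫_ℝ := by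
    rw [inner_sum, hQ]
    exact Finset.sum_congr rfl fun i _ => by rw [real_inner_smul_right, pow_two]
  have h3 : Q ≤ ‖g‖ * ‖∑ i ∈ I, ⟪g, f i⟫_ℝ • f i‖ := h2.le.trans (real_inner_le_norm _ _)
  have h4 : Q ^ 2 ≤ ‖g‖ ^ 2 * (Λ * Q) := by
    calc Q ^ 2 ≤ (‖g‖ * ‖∑ i ∈ I, ⟪g, f i⟫_ℝ • f i‖) ^ 2 := pow_le_pow_left₀ hQ0 h3 2
      _ ≤ _ := by rw [mul_pow]; exact mul_le_mul_of_nonneg_left h1 (sq_nonneg _)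
  rcases hQ0.eq_or_lt with h0 | h0
  · rw [← h0]; positivity
  · nlinarith

variable {Ω : Type*} [MeasurableSpace Ω] {P : Measure Ω} {ξ : NoiseSpace d → Ω → ℝ}
  {T L σ : ℝ} {ρ : ℝ → E d → ℝ}

/-- The real and imaginary parts of the integrands of the Fourier coefficients of `Z_T`. -/
def noiseFrame (hρ : DensityData T L ρ) (hσ : 0 < σ) (i : (Fin d → ℤ) × Bool) : NoiseSpace d :=
  bif i.2 then (sqIntegrable_heatProfile hρ hσ T {i.1}).re.toLp _
  else (sqIntegrable_heatProfile hρ hσ T {i.1}).im.toLp _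

theorem sum_noiseFrame {A : Type*} [AddCommMonoid A] (S : Finset (Fin d → ℤ))
    (f : (Fin d → ℤ) × Bool → A) :
    ∑ i ∈ S ×ˢ (Finset.univ : Finset Bool), f i = ∑ k ∈ S, (f (k, true) + f (k, false)) := by
  rw [Finset.sum_product]
  simp

/-- A real combination of real and imaginary parts is the real part of a complex combination of the
integrands, with coefficients `x(k, true) - i x(k, false)`. Its energy is bounded diagonally because
`ρ` is bounded. -/
theorem norm_sum_noiseFrame_sq_le (hρ : DensityData T L ρ) (hσ : 0 < σ) (hT : 0 < T)
    (S : Finset (Fin d → ℤ)) (x : (Fin d → ℤ) × Bool → ℝ) :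
    ‖∑ i ∈ S ×ˢ Finset.univ, x i • noiseFrame hρ hσ i‖ ^ 2 ≤
      (L.toNNReal * ((2 * Real.pi) ^ d) * (1 / (2 * σ))) * ∑ i ∈ S ×ˢ Finset.univ, x i ^ 2 := by
  classical
  set c : (Fin d → ℤ) → ℂ := fun k => ⟨x (k, true), -x (k, false)⟩ with hc
  obtain ⟨h, e⟩ := toLp_reField_sum S (fun k => sqIntegrable_heatProfile hρ hσ T {k}) c
  have e1 : ∑ i ∈ S ×ˢ Finset.univ, x i • noiseFrame hρ hσ i = h.toLp _ := by
    rw [e, sum_noiseFrame]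
    simp [hc, noiseFrame]
  have e2 : ∑ i ∈ S ×ˢ Finset.univ, x i ^ 2 = ∑ k ∈ S, ‖c k‖ ^ 2 := by
    rw [sum_noiseFrame]
    refine Finset.sum_congr rfl fun k _ => ?_
    rw [Complex.sq_norm, Complex.normSq_apply]
    simp only [hc]; ring
  have hm : ∀ k, Measurable fun s => c k * heatProfile σ T s k :=
    fun k => (measurable_heatProfile σ T k).const_mul _
  have hb : ∀ k, ∃ C : NNReal, ∀ s, ‖c k * heatProfile σ T s k‖ₑ ≤ C := fun k => by
    refine ⟨‖c k‖₊, fun s => ?_⟩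
    rw [enorm_mul]
    exact mul_le_of_le_one_right' (enorm_heatProfile_le_one hσ T s k)
  have hsq := sqIntegrable_noiseField hρ S hm hb
  have e3 : ‖h.toLp _‖ₑ ^ 2 ≤ energy (noiseField T ρ S fun s k => c k * heatProfile σ T s k) := by
    rw [← hsq.energy_eq]
    refine le_add_right (le_of_eq ?_)
    simp_rw [noiseField_sum]
  have e4 := e3.trans (energy_noiseField_le hρ S hm)
  have e5 : ∀ k ∈ S, ENNReal.ofReal (‖freq k‖ ^ 2) *
      ∫⁻ s in Ico 0 T, ‖c k * heatProfile σ T s k‖ₑ ^ 2 ≤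
      ENNReal.ofReal (‖c k‖ ^ 2 * (1 / (2 * σ))) := by
    intro k _
    simp_rw [enorm_mul, mul_pow]
    rw [lintegral_const_mul' _ _ (by simp), mul_left_comm, ENNReal.ofReal_mul (by positivity),
      ENNReal.ofReal_pow (norm_nonneg (c k)), ofReal_norm (c k)]
    refine mul_le_mul' le_rfl ?_
    exact lintegral_heatProfile_sq_le hσ (right_mem_Icc.2 hT.le) k
  have e6 := e4.trans (mul_le_mul' le_rfl (Finset.sum_le_sum e5))
  rw [← ENNReal.ofReal_sum_of_nonneg fun _ _ => by positivity, show ENNReal.ofReal L = ENNReal.ofReal (L.toNNReal : ℝ) from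
      (ENNReal.ofReal_coe_nnreal (p := L.toNNReal)).symm,
    ← ENNReal.ofReal_mul (by positivity), ← ENNReal.ofReal_mul (by positivity), ← ofReal_norm,
    ← ENNReal.ofReal_pow (norm_nonneg _), ENNReal.ofReal_le_ofReal_iff (by positivity)] at e6
  rw [e1, e2]
  refine e6.trans (le_of_eq ?_)
  rw [← Finset.sum_mul]
  ring

theorem norm_noiseFrame_sq (hρ : DensityData T L ρ) (hσ : 0 < σ) (hT : 0 < T) (k : Fin d → ℤ) :
    ‖noiseFrame hρ hσ (k, true)‖ ^ 2 + ‖noiseFrame hρ hσ (k, false)‖ ^ 2 =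
      (1 - Real.exp (-(2 * σ * ‖freq k‖ ^ 2 * T))) / (2 * σ) := by
  have h := (sqIntegrable_heatProfile hρ hσ T {k}).energy_eq
  rw [energy_noiseField_singleton hρ k (measurable_heatProfile σ T),
    lintegral_heatProfile_sq hσ (right_mem_Icc.2 hT.le), ← ofReal_norm, ← ofReal_norm,
    ← ENNReal.ofReal_pow (norm_nonneg _), ← ENNReal.ofReal_pow (norm_nonneg _),
    ← ENNReal.ofReal_add (by positivity) (by positivity), ENNReal.ofReal_eq_ofReal_iff (by positivity)] at h
  · exact h
  · refine div_nonneg (sub_nonneg.2 (Real.exp_le_one_iff.2 ?_)) (by positivity)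
    rw [neg_nonpos]; positivity

theorem norm_cNoise_sq {Ω : Type*} {ξ : NoiseSpace d → Ω → ℝ} (hρ : DensityData T L ρ) (hσ : 0 < σ) (k : Fin d → ℤ) (ω : Ω) :
    ‖cNoise ξ (noiseField T ρ {k} (heatProfile σ T)) ω‖ ^ 2 =
      ξ (noiseFrame hρ hσ (k, true)) ω ^ 2 + ξ (noiseFrame hρ hσ (k, false)) ω ^ 2 := by
  have h := sqIntegrable_heatProfile hρ hσ T {k}
  rw [cNoise, noiseIntegral_of_memLp h.re, noiseIntegral_of_memLp h.im, Complex.sq_norm,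
    Complex.normSq_apply]
  simp [noiseFrame]
  ring

theorem two_pow_le_card_box_sub_one (hd : 0 < d) (J : ℕ) :
    (2 : ℝ) ^ (d * J) ≤ (box d (2 ^ J)).card - 1 := by
  have h : (2 ^ J) ^ d + 1 ≤ (2 * 2 ^ J + 1) ^ d := by
    calc (2 ^ J) ^ d + 1 = (2 ^ J) ^ d + 1 ^ d := by rw [one_pow]
      _ ≤ (2 ^ J + 1) ^ d := pow_add_pow_le (by positivity) (by positivity) hd.ne'
      _ ≤ _ := Nat.pow_le_pow_left (by omega) d
  rw [card_box, mul_comm d J, pow_mul]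
  have h' : (((2 ^ J) ^ d + 1 : ℕ) : ℝ) ≤ ((2 * 2 ^ J + 1) ^ d : ℕ) := by exact_mod_cast h
  push_cast at h' ⊢
  linarith

/-- The sum of squares has mean `M J` of order at least `2^{dJ}` and variance at most a constant
times `M J`, since the frame operator of the integrands is bounded. It therefore exceeds half its
mean with probability tending to one. -/
theorem ae_not_tendsto_sum_noiseCoef (hd : 0 < d) (hξ : IsWhiteNoise P ξ)
    (hρ : DensityData T L ρ) (hσ : 0 < σ) (hT : 0 < T) :
    ∀ᵐ ω ∂P, ¬ Tendsto (fun J : ℕ => (∑ k ∈ box d (2 ^ J), ‖noiseCoef ξ σ ρ T ω k‖ ^ 2) /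
      2 ^ (d * J)) atTop (𝓝 0) := by
  have := hξ.gaussian.isProbabilityMeasure
  set Λ : ℝ := L.toNNReal * ((2 * Real.pi) ^ d) * (1 / (2 * σ)) with hΛ
  have hΛ0 : 0 ≤ Λ := by positivity
  set f := noiseFrame hρ hσ with hf
  set I : ℕ → Finset ((Fin d → ℤ) × Bool) := fun J => box d (2 ^ J) ×ˢ Finset.univ with hI
  set M : ℕ → ℝ := fun J => ∑ i ∈ I J, ‖f i‖ ^ 2 with hM
  set X : ℕ → Ω → ℝ := fun J ω => ∑ i ∈ I J, ξ (f i) ω ^ 2 with hX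
  set c₀ : ℝ := (1 - Real.exp (-(2 * σ * T))) / (2 * σ) with hc₀
  have hc₀' : 0 < c₀ := by
    refine div_pos (sub_pos.2 (Real.exp_lt_one_iff.2 ?_)) (by positivity)
    rw [neg_lt_zero]; positivity
  -- The zero frequency carries no noise because of the gradient; every other one has `|k| ≥ 1` and
  -- contributes at least `c₀`.
  have hMlow : ∀ J, c₀ * 2 ^ (d * J) ≤ M J := by
    intro J
    have h0 : (0 : Fin d → ℤ) ∈ box d (2 ^ J) := by rw [mem_box]; intro i; simp
    have h1 : M J = ∑ k ∈ box d (2 ^ J), (1 - Real.exp (-(2 * σ * ‖freq k‖ ^ 2 * T))) / (2 * σ) := by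
      simp only [hM, hI]
      rw [sum_noiseFrame]
      exact Finset.sum_congr rfl fun k _ => norm_noiseFrame_sq hρ hσ hT k
    have hnn : ∀ k : Fin d → ℤ, 0 ≤ (1 - Real.exp (-(2 * σ * ‖freq k‖ ^ 2 * T))) / (2 * σ) := by
      intro k
      refine div_nonneg (sub_nonneg.2 (Real.exp_le_one_iff.2 ?_)) (by positivity)
      rw [neg_nonpos]; positivity
    have h2 : ((box d (2 ^ J)).erase 0).card • c₀ ≤
        ∑ k ∈ (box d (2 ^ J)).erase 0, (1 - Real.exp (-(2 * σ * ‖freq k‖ ^ 2 * T))) / (2 * σ) := by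
      refine Finset.card_nsmul_le_sum _ _ _ fun k hk => ?_
      have hk0 : k ≠ 0 := (Finset.mem_erase.1 hk).1
      obtain ⟨i, hi⟩ : ∃ i, k i ≠ 0 := by
        by_contra! h; exact hk0 (funext h)
      have hk1 : 1 ≤ ‖freq k‖ := by
        refine le_trans ?_ (abs_le_norm_freq k i)
        exact_mod_cast Int.one_le_abs hi
      have hk2 : 1 ≤ ‖freq k‖ ^ 2 := one_le_pow₀ hk1
      rw [hc₀]
      have : 2 * σ * T ≤ 2 * σ * ‖freq k‖ ^ 2 * T := by
        have : 0 < 2 * σ * T := by positivity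
        nlinarith
      gcongr
    have h3 : ((box d (2 ^ J)).erase 0).card = (box d (2 ^ J)).card - 1 := Finset.card_erase_of_mem h0
    have h4 : 1 ≤ (box d (2 ^ J)).card := Finset.card_pos.2 ⟨0, h0⟩
    rw [nsmul_eq_mul, h3, Nat.cast_sub h4, Nat.cast_one] at h2
    have h5 := two_pow_le_card_box_sub_one hd J
    calc c₀ * 2 ^ (d * J) ≤ ((box d (2 ^ J)).card - 1) * c₀ := by
          rw [mul_comm]; gcongr
      _ ≤ _ := h2
      _ ≤ M J := by
        rw [h1]
        exact Finset.sum_le_sum_of_subset_of_nonneg (Finset.erase_subset _ _) fun k _ _ => hnn k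
  have hM0 : ∀ J, 0 < M J := fun J => lt_of_lt_of_le (by positivity) (hMlow J)
  have hMtop : Tendsto M atTop atTop := by
    refine tendsto_atTop_mono (fun J => ?_)
      ((tendsto_pow_atTop_atTop_of_one_lt (one_lt_two (α := ℝ))).const_mul_atTop hc₀')
    refine le_trans ?_ (hMlow J)
    gcongr
    · norm_num
    · nlinarith
  -- Chebyshev: variance `2 Λ M` against a squared deviation of `M² / 4`.
  have hcheb : ∀ J, P.real {ω | X J ω ≤ M J / 2} ≤ 8 * Λ / M J := by
    intro J
    obtain ⟨h1, h2⟩ := hξ.integral_sum_sq_sub_sq (I J) f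
      (sum_inner_sq_le_of_norm_sum_sq_le (I J) f hΛ0 (norm_sum_noiseFrame_sq_le hρ hσ hT _))
    have h3 := (mul_meas_ge_le_integral_of_nonneg
      (Eventually.of_forall fun ω => sq_nonneg _) h1 (M J ^ 2 / 4)).trans h2
    have h4 : {ω | X J ω ≤ M J / 2} ⊆ {ω | M J ^ 2 / 4 ≤ (X J ω - M J) ^ 2} := by
      intro ω hω
      have hω' : X J ω ≤ M J / 2 := hω
      have := hM0 J
      change M J ^ 2 / 4 ≤ (X J ω - M J) ^ 2
      nlinarith
    have h5 := measureReal_mono h4 (μ := P) (measure_ne_top _ _)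
    rw [le_div_iff₀ (hM0 J)]
    have h6 : M J ^ 2 / 4 * P.real {ω | X J ω ≤ M J / 2} ≤ 2 * Λ * M J :=
      (mul_le_mul_of_nonneg_left h5 (by positivity)).trans h3
    have := hM0 J
    nlinarith
  have hlim : Tendsto (fun J => 8 * Λ / M J) atTop (𝓝 0) := hMtop.const_div_atTop _
  set z : ℝ := ((2 * Real.pi) ^ d)⁻¹ ^ 2 with hz
  have hz0 : 0 < z := by positivity
  have hXeq : ∀ J ω, ∑ k ∈ box d (2 ^ J), ‖noiseCoef ξ σ ρ T ω k‖ ^ 2 = z * X J ω := by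
    intro J ω
    simp only [hX, hI]
    rw [sum_noiseFrame, Finset.mul_sum]
    refine Finset.sum_congr rfl fun k _ => ?_
    rw [noiseCoef_eq hσ (right_mem_Icc.2 hT.le), norm_mul, mul_pow, norm_cNoise_sq hρ hσ, norm_inv,
      Complex.norm_real, Real.norm_of_nonneg (by positivity)]
  -- Staying below half the mean for all `J ≥ n` is contained in each single event, whose
  -- probability tends to zero; neither independence nor Borel–Cantelli is needed.
  have hnull : ∀ n : ℕ, P (⋂ J ≥ n, {ω | X J ω ≤ M J / 2}) = 0 := by
    intro n
    rw [← measureReal_eq_zero_iff]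
    refine le_antisymm (ge_of_tendsto hlim ?_) measureReal_nonneg
    filter_upwards [eventually_ge_atTop n] with J hJ
    exact (measureReal_mono (biInter_subset_of_mem (show J ∈ {J | J ≥ n} from hJ))).trans (hcheb J)
  refine measure_mono_null ?_ (measure_iUnion_null hnull)
  intro ω hω
  have hω' := not_not.1 hω
  obtain ⟨n, hn⟩ := eventually_atTop.1 (hω'.eventually_lt_const (show 0 < z * c₀ / 2 by positivity))
  refine mem_iUnion.2 ⟨n, mem_iInter₂.2 fun J hJ => ?_⟩
  have h1 := hn J hJ
  rw [hXeq, div_lt_iff₀ (by positivity)] at h1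
  have h2 := hMlow J
  change X J ω ≤ M J / 2
  have h3 : z * X J ω < z * (c₀ * 2 ^ (d * J) / 2) := by linarith
  have := lt_of_mul_lt_mul_left h3 hz0.le
  linarith

end Irregularity

end FluctuationSPDE

end

noncomputable section

namespace FluctuationSPDE

variable {d : ℕ} {χ : DyadicPartition d}

/-! ### Square sums of Fourier coefficients and the critical regularity -/

theorem norm_freq_le_of_mem_box {n : ℕ} {k : Fin d → ℤ} (h : k ∈ box d n) : ‖freq k‖ ≤ d * n := by
  have h1 : ‖freq k‖ ^ 2 ≤ (d * n : ℝ) ^ 2 := by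
    rw [EuclideanSpace.norm_sq_eq]
    calc ∑ i, ‖freq k i‖ ^ 2 ≤ ∑ _i : Fin d, (n : ℝ) ^ 2 := by
          refine Finset.sum_le_sum fun i _ => pow_le_pow_left₀ (norm_nonneg _) ?_ 2
          rw [Real.norm_eq_abs]
          have := mem_box.1 h i
          change |(k i : ℝ)| ≤ n
          exact_mod_cast this
      _ = d * (n : ℝ) ^ 2 := by simp
      _ ≤ (d : ℝ) ^ 2 * (n : ℝ) ^ 2 := by
          gcongr
          exact_mod_cast Nat.le_self_pow two_ne_zero d
      _ = _ := by ring
  exact (pow_le_pow_iff_left₀ (norm_nonneg _) (by positivity) two_ne_zero).1 h1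

theorem eLpNorm_lpPartial_le {p : ℝ≥0∞} (hp : 1 ≤ p) (N : ℕ) (a : (Fin d → ℤ) → ℂ) :
    eLpNorm (lpPartial χ N a) p (torusMeasure d) ≤
      ∑ j ∈ Finset.range (N + 1), blockNorm χ p j a := by
  have h := eLpNorm_trig_sum_le hp (box d (2 ^ (N + 1))) (Finset.range (N + 1))
    fun j k => chiSymbol χ j k * a k
  rw [lpPartial_eq_trig]
  simp only [lowSymbol, Finset.sum_mul]
  refine h.trans (Finset.sum_le_sum fun j hj => le_of_eq ?_)
  rw [blockNorm, lpBlock_eq_trig_of_le (N := N) (by have := Finset.mem_range.1 hj; omega)]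

theorem sum_box_sq_le (J : ℕ) (a : (Fin d → ℤ) → ℂ) :
    ∑ k ∈ box d (2 ^ J), ‖a k‖ ^ 2 ≤
      (∑ j ∈ Finset.range (J + d + 2), (blockNorm χ 2 j a).toReal) ^ 2 := by
  -- A frequency of the cubic box has Euclidean norm at most `d · 2^J`, which is below `2^{J+d}`.
  -- This many blocks make the partial sum exact there.
  set N := J + d + 1 with hN
  have h1 := eLpNorm_lpPartial_le (χ := χ) one_le_two N a
  rw [lpPartial_eq_trig, eLpNorm_two_trig] at h1
  have h2 := ENNReal.toReal_mono (ENNReal.sum_ne_top.2 fun j _ => blockNorm_ne_top _ j a) h1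
  rw [ENNReal.toReal_ofReal (Real.sqrt_nonneg _),
    ENNReal.toReal_sum fun j _ => blockNorm_ne_top _ j a, Real.sqrt_le_iff] at h2
  refine le_trans ?_ h2.2
  have hπ : (1 : ℝ) ≤ (2 * Real.pi) ^ d := one_le_pow₀ (by linarith [Real.pi_gt_three])
  refine le_trans ?_ (le_mul_of_one_le_left (Finset.sum_nonneg fun _ _ => by positivity) hπ)
  refine le_trans (Finset.sum_le_sum fun k hk => ?_) (Finset.sum_le_sum_of_subset_of_nonneg
    (box_mono (Nat.pow_le_pow_right two_pos (show J ≤ N + 1 by omega))) fun k _ _ => by positivity)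
  rw [lowSymbol_eq_one, one_mul]
  have h3 := norm_freq_le_of_mem_box hk
  have h4 : (d : ℝ) < 2 ^ d := by exact_mod_cast Nat.lt_two_pow_self
  have h5 : (2 : ℝ) ^ (N + 1) = 2 ^ J * 2 ^ d * 4 := by rw [hN]; ring
  have h6 : (0 : ℝ) < 2 ^ J := by positivity
  push_cast at h3
  rw [h5]
  nlinarith [mul_pos h6 (show (0 : ℝ) < 2 ^ d by positivity)]

/-- Blocks that are `o(θ^j)`, `θ = 2^{d/2}`, have partial sums `o(θ^J)`, as a geometric sum is
governed by its last terms. Squaring gives `o(2^{dJ})`. -/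
theorem tendsto_sum_box_sq (hd : 0 < d) {a : (Fin d → ℤ) → ℂ}
    (h : Tendsto (fun j => weight (-((d : ℝ) / 2)) j * blockNorm χ 2 j a) atTop (𝓝 0)) :
    Tendsto (fun J : ℕ => (∑ k ∈ box d (2 ^ J), ‖a k‖ ^ 2) / 2 ^ (d * J)) atTop (𝓝 0) := by
  set θ : ℝ := 2 ^ ((d : ℝ) / 2) with hθ
  have hθ1 : 1 < θ := Real.one_lt_rpow one_lt_two (by positivity)
  have hθ0 : 0 < θ := one_pos.trans hθ1
  have hθ2 : θ ^ 2 = 2 ^ d := by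
    rw [hθ, ← Real.rpow_natCast, ← Real.rpow_mul two_pos.le, ← Real.rpow_natCast]
    congr 1
    push_cast
    ring
  set b : ℕ → ℝ := fun j => (blockNorm χ 2 j a).toReal with hb
  have hlit : b =o[atTop] fun j => θ ^ j := by
    rw [Asymptotics.isLittleO_iff_tendsto fun j hj => absurd hj (by positivity)]
    have h1 := (ENNReal.tendsto_toReal ENNReal.zero_ne_top).comp h
    have h2 := h1.const_mul θ⁻¹
    simp only [ENNReal.toReal_zero, mul_zero] at h2
    refine h2.congr fun j => ?_
    simp only [Function.comp]
    rw [ENNReal.toReal_mul, weight_eq, ENNReal.toReal_ofReal (by positivity), neg_neg, ← hθ,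
      Real.rpow_neg two_pos.le, Real.rpow_mul two_pos.le, ← hθ, Real.rpow_natCast]
    simp only [hb]
    field_simp
  have hgeom : ∀ n, ∑ i ∈ Finset.range n, θ ^ i = (θ ^ n - 1) / (θ - 1) := fun n =>
    geom_sum_eq hθ1.ne' n
  have hθ' : 0 < θ - 1 := sub_pos.2 hθ1
  have hsum := hlit.sum_range (fun j => (pow_pos hθ0 j).le) (by
    simp_rw [hgeom]
    exact (tendsto_atTop_add_const_right _ _
      (tendsto_pow_atTop_atTop_of_one_lt hθ1)).atTop_div_const hθ')
  have hsum2 : (fun n => ∑ i ∈ Finset.range n, b i) =o[atTop] fun n => θ ^ n := by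
    refine hsum.trans_isBigO (Asymptotics.IsBigO.of_bound (θ - 1)⁻¹ (Eventually.of_forall fun n => ?_))
    rw [hgeom, Real.norm_of_nonneg, Real.norm_of_nonneg (by positivity), div_eq_inv_mul]
    · gcongr; linarith
    · exact div_nonneg (sub_nonneg.2 (one_le_pow₀ hθ1.le)) hθ'.le
  have hsum3 := (Asymptotics.isLittleO_iff_tendsto fun j hj => absurd hj (by positivity)).1 hsum2
  have h4 := ((hsum3.comp (tendsto_add_atTop_nat (d + 2))).mul_const (θ ^ (d + 2))).pow 2
  rw [zero_mul, zero_pow two_ne_zero] at h4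
  refine squeeze_zero (fun J => by positivity) (fun J => ?_) h4
  simp only [Function.comp]
  have h5 : (2 : ℝ) ^ (d * J) = (θ ^ J) ^ 2 := by
    rw [pow_mul, ← hθ2, ← pow_mul, ← pow_mul, mul_comm]
  rw [h5, div_mul_eq_mul_div, pow_add θ J (d + 2), mul_div_mul_right _ _ (by positivity), div_pow]
  gcongr
  exact sum_box_sq_le J a

end FluctuationSPDE

end

noncomputable section

namespace FluctuationSPDE

variable {d : ℕ} {χ : DyadicPartition d}

/-! ### Paths of mild solutions -/

section MildPath

variable {T σ β R κ : ℝ} {K F : E d → E d} {ρ : ℝ → E d → ℝ}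

/-- A path that solves the mild equation with noise term `z`, at the dyadic times. -/
structure MildPath (χ : DyadicPartition d) (T σ : ℝ) (K F : E d → E d) (ρ : ℝ → E d → ℝ) (a : ℝ)
    (u₀ : Dist d) (z : ℝ → (Fin d → ℤ) → ℂ) (u : ℝ → Dist d) : Prop where
  cont : ∀ k, ContinuousOn (fun t => (u t).coef k) (Icc 0 T)
  adm : AdmPath χ T a 1 fun t => (u t).coef
  eq : ∀ t ∈ dyadicTime T, ∀ k, (u t).coef k = heatSymbol σ t k * u₀.coef k -
    driftInt χ σ K F ρ (fun s => (u s).coef) t k - (Real.sqrt (2 * σ) : ℂ) * z t k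

theorem blockNorm_le_top {p : ℝ≥0∞} (j : ℕ) (a : (Fin d → ℤ) → ℂ) :
    blockNorm χ p j a ≤ torusMeasure d univ ^ p.toReal⁻¹ * blockNorm χ ∞ j a := by
  have := eLpNorm_le_eLpNorm_mul_rpow_measure_univ (μ := torusMeasure d) (p := p) (q := ∞) le_top
    (continuous_lpBlock (χ := χ) j a).aestronglyMeasurable
  rw [mul_comm]
  simpa [blockNorm] using this

theorem blockNorm_le_of_dyadic {u : ℝ → (Fin d → ℤ) → ℂ} (hT : 0 < T)
    (hu : ∀ k, ContinuousOn (fun t => u t k) (Icc 0 T)) {p : ℝ≥0∞} (hp : 1 ≤ p) (j : ℕ) {B : ℝ≥0∞}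
    (hB : ∀ t ∈ dyadicTime T, blockNorm χ p j (u t) ≤ B) :
    ∀ t ∈ Icc 0 T, blockNorm χ p j (u t) ≤ B := by
  intro t ht
  have : (𝓝[dyadicTime T] t).NeBot :=
    mem_closure_iff_nhdsWithin_neBot.1 (subset_closure_dyadicTime hT ht)
  refine blockNorm_le_of_tendsto (l := 𝓝[dyadicTime T] t) (fun k => ?_) hp j
    (eventually_mem_nhdsWithin.mono fun s hs => hB s hs).frequently
  exact (hu k t ht).mono_left (nhdsWithin_mono _ (dyadicTime_subset hT.le))

/-- The Volterra bound first controls the path in `B^{-α}_{p,∞}`. Re-inserting this in the equation,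
the integrated drift has blocks of size `2^{-j/2}`, summable over `j`, so the summability `q` of the
initial condition is recovered. -/
theorem MildPath.exists_bound (h : DriftData χ T σ β R κ K F ρ) {α a : ℝ} (hd : 0 < d)
    (hα : (d : ℝ) / 2 < α) (hαa : α ≤ a) (haβ : a < β) {p q : ℝ≥0∞} (hp : 1 ≤ p) (hq : 1 ≤ q) :
    ∃ A : NNReal, ∀ (u₀ : Dist d) (z : ℝ → (Fin d → ℤ) → ℂ) (u : ℝ → Dist d),
      MildPath χ T σ K F ρ a u₀ z u → MemBesov χ (-α) p q u₀ →
      besovNorm χ (-α) p q u₀.coef ≠ ∞ →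
      ∑' j, weight (-α) j * ⨆ t ∈ dyadicTime T, blockNorm χ ∞ j (z t) ≠ ∞ →
      ContinuousBesov χ T (-α) p q u ∧
      ∀ t ∈ Icc 0 T, besovNorm χ (-α) p q (u t).coef ≤ A * (besovNorm χ (-α) p q u₀.coef +
        ∑' j, weight (-α) j * ⨆ t ∈ dyadicTime T, blockNorm χ ∞ j (z t)) := by
  have hT := h.time_pos
  have hσ := h.sigma_pos
  have hα0 : 0 < α := lt_trans (by positivity) hα
  have hαβ := hαa.trans_lt haβ
  have hq0 : q ≠ 0 := (zero_lt_one.trans_le hq).ne'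
  obtain ⟨A, hA⟩ := exists_volterra_bound h hα0 hαa haβ
  obtain ⟨C, hC0, hC⟩ := exists_driftInt_block_bound_of_bounded h hα0 hαβ
  set V := ‖(Real.sqrt (2 * σ) : ℂ)‖ₑ * torusMeasure d univ ^ p.toReal⁻¹ with hV
  have hVt : V ≠ ∞ := ENNReal.mul_ne_top enorm_ne_top (torusVol_rpow_ne_top d _)
  set G := ∑' j : ℕ, ENNReal.ofReal (C * 2 ^ (-(1 / 2 * (j : ℝ)))) with hG
  have hGt : G ≠ ∞ := tsum_ofReal_geometric_ne_top C (by norm_num)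
  have hfin : (1 + G * A) * (1 + V) ≠ ∞ := ENNReal.mul_ne_top
    (ENNReal.add_ne_top.2 ⟨by simp, ENNReal.mul_ne_top hGt (by simp)⟩)
    (ENNReal.add_ne_top.2 ⟨by simp, hVt⟩)
  refine ⟨((1 + G * A) * (1 + V)).toNNReal, fun u₀ z u hu hm hn₀ hz => ?_⟩
  rw [ENNReal.coe_toNNReal hfin]
  set n : ℕ → ℝ≥0∞ := fun j => ⨆ t ∈ dyadicTime T, blockNorm χ ∞ j (z t) with hn
  set c : ℝ → (Fin d → ℤ) → ℂ := fun t => (u t).coef with hc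
  -- The equation is known at dyadic times only. Defining the free part as `c + L c` makes it
  -- continuous in every coefficient, so its block bounds extend from dyadic times to all times.
  set W : ℝ → (Fin d → ℤ) → ℂ := fun t => c t + driftInt χ σ K F ρ c t with hW
  have hWc : ∀ k, ContinuousOn (fun t => W t k) (Icc 0 T) := fun k =>
    (hu.cont k).add (continuousOn_driftInt h (hα0.trans_le hαa) haβ hu.adm k)
  have hWb : ∀ j, ∀ t ∈ Icc 0 T, blockNorm χ p j (W t) ≤ blockNorm χ p j u₀.coef + V * n j := by
    intro j
    refine blockNorm_le_of_dyadic hT hWc hp j fun t ht => ?_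
    have ht0 := (dyadicTime_subset hT.le ht).1
    have e : W t = (fun k => heatSymbol σ t k * u₀.coef k) -
        fun k => (Real.sqrt (2 * σ) : ℂ) * z t k := by
      ext k
      simp only [hW, hc, Pi.add_apply, Pi.sub_apply]
      rw [hu.eq t ht k]
      ring
    rw [e]
    refine (blockNorm_sub_le hp j _ _).trans (add_le_add ?_ ?_)
    · refine ((multBound_heatSymbol (mul_nonneg hσ.le ht0)).blockNorm_le hp j _).trans_eq ?_
      rw [one_mul]
    · refine (blockNorm_const_mul p j _ _).le.trans ?_
      rw [hV, mul_assoc]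
      refine mul_le_mul' le_rfl ((blockNorm_le_top j _).trans (mul_le_mul' le_rfl ?_))
      exact le_iSup₂ (f := fun t (_ : t ∈ dyadicTime T) => blockNorm χ ∞ j (z t)) t ht
  set S := ∑' j, weight (-α) j * n j with hS
  set N₀ := besovNorm χ (-α) p q u₀.coef with hN₀
  set w := N₀ + V * S with hw
  have hwt : w ≠ ∞ := ENNReal.add_ne_top.2 ⟨hn₀, ENNReal.mul_ne_top hVt hz⟩
  have hWw : ∀ t ∈ Icc 0 T, besovNorm χ (-α) p ∞ (W t) ≤ w := by
    intro t ht
    refine besovNorm_top_le fun j => ?_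
    refine (mul_le_mul' le_rfl (hWb j t ht)).trans ?_
    rw [mul_add]
    refine add_le_add (weight_mul_blockNorm_le hq0 _ _ _ _) ?_
    rw [mul_left_comm]
    exact mul_le_mul' le_rfl (ENNReal.le_tsum j)
  have hcm : ∀ k, AEMeasurable (fun t => c t k) (volume.restrict (Icc 0 T)) := hu.adm.meas
  have hcA : ∀ t ∈ Icc 0 T, besovNorm χ (-α) p ∞ (c t) ≤ A * w :=
    hA p hp c W hu.adm (fun k => (hWc k).aemeasurable measurableSet_Icc)
      (fun t _ => by simp only [hW, add_sub_cancel_right]) w hwt hWw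
  have hAw : A * w ≠ ∞ := ENNReal.mul_ne_top (by simp) hwt
  -- The right-hand side does not depend on `t`, and its three parts have vanishing tails: the
  -- initial condition by membership in the closure, noise and drift by summability.
  have hblock : ∀ t ∈ Icc 0 T, ∀ j, weight (-α) j * blockNorm χ p j (c t) ≤
      (weight (-α) j * blockNorm χ p j u₀.coef + V * (weight (-α) j * n j)) +
        A * w * ENNReal.ofReal (C * 2 ^ (-(1 / 2 * (j : ℝ)))) := by
    intro t ht j
    have e : c t = W t - driftInt χ σ K F ρ c t := by simp only [hW, add_sub_cancel_right]
    rw [e]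
    refine (mul_le_mul' le_rfl (blockNorm_sub_le hp j _ _)).trans ?_
    rw [mul_add]
    refine add_le_add ?_ ?_
    · refine (mul_le_mul' le_rfl (hWb j t ht)).trans_eq ?_
      rw [mul_add, mul_left_comm]
    · rw [mul_comm (A * w)]
      exact hC p hp c hcm (A * w) hAw hcA t ht j
  constructor
  · refine continuousBesov_of_tailVanish hp hq hu.cont ?_ hblock
    refine TailVanish.add hq (TailVanish.add hq (tailVanish_of_memBesov hα hp hq hm) ?_) ?_
    · exact (tailVanish_of_tsum hq hz).const_mul hq hVt
    · exact (tailVanish_of_tsum hq hGt).const_mul hq hAw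
  · intro t ht
    rw [besovNorm_eq]
    refine (eLpNorm_count_mono (hblock t ht)).trans ?_
    refine (eLpNorm_count_add_le hq _ _).trans ?_
    rw [eLpNorm_count_const_mul hq]
    have h1 : eLpNorm (fun j => weight (-α) j * blockNorm χ p j u₀.coef + V * (weight (-α) j * n j))
        q Measure.count ≤ w := by
      refine (eLpNorm_count_add_le hq _ _).trans (add_le_add le_rfl ?_)
      rw [eLpNorm_count_const_mul hq]
      exact mul_le_mul' le_rfl (eLpNorm_count_le_tsum hq _)
    have h2 := eLpNorm_count_le_tsum hq fun j : ℕ => ENNReal.ofReal (C * 2 ^ (-(1 / 2 * (j : ℝ))))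
    calc _ ≤ w + A * w * G := add_le_add h1 (mul_le_mul' le_rfl h2)
      _ = (1 + G * A) * w := by ring
      _ ≤ (1 + G * A) * ((1 + V) * (N₀ + S)) := by
        refine mul_le_mul' le_rfl ?_
        rw [hw, add_mul, one_mul, mul_add V]
        exact add_le_add le_self_add le_add_self
      _ = _ := by rw [mul_assoc]

theorem besovNorm_lt_top_of_memBesov {u : Dist d} (h : MemBesov χ (-((d : ℝ) / 2)) ∞ ∞ u) :
    besovNorm χ (-((d : ℝ) / 2)) ∞ ∞ u.coef < ∞ := by
  obtain ⟨f, hf⟩ := h 1 one_pos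
  have h1 := besovNorm_add_le (χ := χ) (p := ∞) (q := ∞) le_top le_top (-((d : ℝ) / 2))
    (u.coef - fcoef (f : E d → ℂ)) (fcoef (f : E d → ℂ))
  rw [sub_add_cancel] at h1
  exact h1.trans_lt (ENNReal.add_lt_top.2 ⟨hf.trans ENNReal.one_lt_top,
    besovNorm_fcoef_lt_top f.2.1.continuous⟩)

theorem top_mem_dyadicTime (T : ℝ) : T ∈ dyadicTime T := ⟨0, 1, by simp, by simp⟩

/-- Irregularity is claimed without any regularity of the initial condition; since the noise
vanishes at time zero, that regularity can be read off from the path itself. -/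
theorem MildPath.coef_zero {a : ℝ} {u₀ : Dist d} {z : ℝ → (Fin d → ℤ) → ℂ} {u : ℝ → Dist d}
    (hu : MildPath χ T σ K F ρ a u₀ z u) (hz : z 0 = 0) : (u 0).coef = u₀.coef := by
  ext k
  rw [hu.eq 0 (zero_mem_dyadicTime T) k, hz]
  simp [heatSymbol, driftInt]

/-- A mild solution of critical regularity forces the noise to be of critical regularity. -/
theorem MildPath.tendsto_noise (h : DriftData χ T σ β R κ K F ρ) (hd : 0 < d)
    (hβ : (d : ℝ) / 2 < β) {a : ℝ} {u₀ : Dist d} {z : ℝ → (Fin d → ℤ) → ℂ} {u : ℝ → Dist d}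
    (hu : MildPath χ T σ K F ρ a u₀ z u) (hz : z 0 = 0)
    (hc : ContinuousBesov χ T (-((d : ℝ) / 2)) ∞ ∞ u) :
    Tendsto (fun j => weight (-((d : ℝ) / 2)) j * blockNorm χ 2 j (z T)) atTop (𝓝 0) := by
  have hT := h.time_pos
  have hσ := h.sigma_pos
  have hd2 : (0 : ℝ) < (d : ℝ) / 2 := by positivity
  -- The assumed continuity bounds the path at regularity `-d/2`. Since `d/2 < β` the drift estimate
  -- applies there, and its gain `2^{-j/2}` makes the drift negligible at the critical scale.
  obtain ⟨B, hB⟩ := exists_bound_of_continuous (χ := χ) (u := fun t => (u t).coef) le_top le_top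
    (fun t ht => besovNorm_lt_top_of_memBesov (hc.1 t ht)) hc.2
  obtain ⟨C, hC0, hC⟩ := exists_driftInt_block_bound_of_bounded h hd2 hβ
  have hTm := right_mem_Icc.2 hT.le
  have hdr := hC ∞ le_top (fun t => (u t).coef) hu.adm.meas B (by simp) hB T hTm
  set V := torusMeasure d univ ^ (2 : ℝ≥0∞).toReal⁻¹ with hV
  have hVt : V ≠ ∞ := torusVol_rpow_ne_top d _
  set D := driftInt χ σ K F ρ (fun t => (u t).coef) T with hD
  have t1 := tendsto_blockNorm_of_memBesov hd (hc.1 T hTm)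
  have t2 := tendsto_blockNorm_of_memBesov hd (hc.1 0 (left_mem_Icc.2 hT.le))
  have t3 : Tendsto (fun j : ℕ => V * (ENNReal.ofReal (C * 2 ^ (-(1 / 2 * (j : ℝ)))) * B)) atTop
      (𝓝 0) := by
    have h1 := ENNReal.tendsto_atTop_zero_of_tsum_ne_top
      (tsum_ofReal_geometric_ne_top C (θ := 1 / 2) (by norm_num))
    have h2 := ENNReal.Tendsto.const_mul (a := V)
      (ENNReal.Tendsto.mul_const (b := (B : ℝ≥0∞)) h1 (Or.inr (by simp))) (Or.inr hVt)
    simpa using h2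
  set s : ℂ := (Real.sqrt (2 * σ) : ℂ) with hs
  have hs0 : s ≠ 0 := by
    have : 0 < Real.sqrt (2 * σ) := Real.sqrt_pos.2 (by positivity)
    exact Complex.ofReal_ne_zero.2 this.ne'
  have e : z T = fun k => s⁻¹ * (((fun k => heatSymbol σ T k * (u 0).coef k) - D - (u T).coef) k) := by
    ext k
    have := hu.eq T (top_mem_dyadicTime T) k
    rw [eq_inv_mul_iff_mul_eq₀ hs0]
    simp only [Pi.sub_apply, hu.coef_zero hz]
    rw [this]
    ring
  have hsum := ((t2.add t3).add t1)
  have hfin := ENNReal.Tendsto.const_mul (a := ‖s⁻¹‖ₑ) hsum (Or.inr (by simp))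
  simp only [add_zero, mul_zero] at hfin
  refine tendsto_of_tendsto_of_tendsto_of_le_of_le tendsto_const_nhds hfin (fun _ => zero_le)
    fun j => ?_
  simp only
  rw [e, blockNorm_const_mul, mul_left_comm]
  refine mul_le_mul' le_rfl ?_
  refine (mul_le_mul' le_rfl ((blockNorm_sub_le one_le_two j _ _).trans
    (add_le_add (blockNorm_sub_le one_le_two j _ _) le_rfl))).trans ?_
  rw [mul_add, mul_add]
  refine add_le_add (add_le_add (mul_le_mul' le_rfl ?_) ?_) le_rfl
  · refine ((multBound_heatSymbol (mul_nonneg hσ.le hT.le)).blockNorm_le one_le_two j _).trans_eq ?_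
    rw [one_mul]
  · refine (mul_le_mul' le_rfl (blockNorm_le_top j D)).trans ?_
    rw [mul_left_comm]
    exact mul_le_mul' le_rfl (hdr j)

end MildPath

end FluctuationSPDE

end

noncomputable section

namespace FluctuationSPDE

variable {d : ℕ} {χ : DyadicPartition d}

/-! ### Mild solutions -/

theorem two_pi_pow_ne_zero (d : ℕ) : (((2 * Real.pi) ^ d : ℝ) : ℂ) ≠ 0 :=
  Complex.ofReal_ne_zero.2 (by positivity)

theorem pairing_fourierTest (a : (Fin d → ℤ) → ℂ) (k : Fin d → ℤ) :
    pairing a (fourierTest (-k)) = (((2 * Real.pi) ^ d : ℝ) : ℂ) * a k := by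
  have h : ∀ l, fcoef ((fourierTest (-k) : TestFun d) : E d → ℂ) (-l) = if k = l then 1 else 0 := by
    intro l
    change fcoef (fourierE (-k)) (-l) = _
    rw [fcoef_fourierE]
    simp only [neg_inj]
  rw [pairing, tsum_eq_single k fun l hl => by rw [h, if_neg (Ne.symm hl), mul_zero], h, if_pos rfl,
    mul_one]

theorem NonvanishingDiffusion.exists_densityData {T σ β : ℝ} {K F : E d → E d} {ρ : ℝ → E d → ℝ}
    (h : NonvanishingDiffusion χ T σ β K F ρ) : ∃ L, DensityData T L ρ := by
  have hβ : 0 < β := lt_of_le_of_lt (by positivity) h.beta_gt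
  obtain ⟨L, -, hL⟩ := h.rho_holder.exists_bound hβ
  exact ⟨L, h.rho_holder.continuousOn hβ, h.rho_nonneg,
    fun t ht x => (le_abs_self _).trans (hL t ht x), h.rho_mass⟩

/-- Continuous paths are bounded by their bounds at the dyadic times. -/
theorem ContinuousBesov.le_of_dyadic {T s : ℝ} (hT : 0 < T) {p q : ℝ≥0∞} (hp : 1 ≤ p) (hq : 1 ≤ q)
    {u : ℝ → Dist d} (hu : ContinuousBesov χ T s p q u) {B : ℝ≥0∞}
    (hB : ∀ t ∈ dyadicTime T, besovNorm χ s p q (u t).coef ≤ B) :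
    ∀ t ∈ Icc 0 T, besovNorm χ s p q (u t).coef ≤ B := by
  intro t ht
  have : (𝓝[dyadicTime T] t).NeBot :=
    mem_closure_iff_nhdsWithin_neBot.1 (subset_closure_dyadicTime hT ht)
  have h1 := ((hu.2 t ht).mono_left (nhdsWithin_mono _ (dyadicTime_subset hT.le))).const_add B
  rw [add_zero] at h1
  refine ge_of_tendsto h1 ?_
  filter_upwards [self_mem_nhdsWithin] with r hr
  have h2 := besovNorm_sub_le (χ := χ) hp hq s (u r).coef ((u r).coef - (u t).coef)
  rw [sub_sub_cancel] at h2
  exact h2.trans (add_le_add (hB r hr) le_rfl)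

section Solution

variable {Ω : Type*} [MeasurableSpace Ω] {P : Measure Ω} {T σ β : ℝ} {K F : E d → E d}
  {ρ : ℝ → E d → ℝ} {ξ : NoiseSpace d → Ω → ℝ} {η₀ : Ω → Dist d} {η : ℝ → Ω → Dist d}

theorem IsMildSolution.coef_eq (hη : IsMildSolution χ P T σ β K F ρ ξ η₀ η) {t : ℝ}
    (ht : t ∈ Icc 0 T) (k : Fin d → ℤ) : ∀ᵐ ω ∂P, (η t ω).coef k =
      heatSymbol σ t k * (η₀ ω).coef k - driftInt χ σ K F ρ (fun s => (η s ω).coef) t k -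
        (Real.sqrt (2 * σ) : ℂ) * noiseCoef ξ σ ρ t ω k := by
  filter_upwards [hη.mild (fourierTest (-k)) t ht] with ω hω
  simp only [pairing_fourierTest] at hω
  rw [intervalIntegral.integral_const_mul] at hω
  rw [Dist.coef, hω, noiseCoef, driftInt, mul_sub, mul_sub,
    inv_mul_cancel_left₀ (two_pi_pow_ne_zero d), inv_mul_cancel_left₀ (two_pi_pow_ne_zero d)]
  ring

theorem admPath_of_l2Besov {α a : ℝ} (hαa : α ≤ a) {p q : ℝ≥0∞} (hp : 1 ≤ p) (hq : 1 ≤ q)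
    {u : ℝ → Dist d} (hm : ∀ k, AEMeasurable (fun t => (u t).coef k) (volume.restrict (Icc 0 T)))
    (h : L2Besov χ T (-α) p q u) : AdmPath χ T a 1 fun t => (u t).coef := by
  refine ⟨hm, ?_⟩
  refine ne_top_of_le_ne_top ?_ (lintegral_mono fun s =>
    besovNorm_one_top_le (neg_le_neg hαa) hp (zero_lt_one.trans_le hq).ne' (u s).coef)
  rw [lintegral_const_mul' _ _ (ENNReal.mul_ne_top ENNReal.ofReal_ne_top (torusVol_rpow_ne_top d _))]
  refine ENNReal.mul_ne_top (ENNReal.mul_ne_top ENNReal.ofReal_ne_top (torusVol_rpow_ne_top d _)) ?_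
  have hle : ∀ x : ℝ≥0∞, x ≤ 1 + x ^ (2 : ℝ) := by
    intro x
    rcases le_total x 1 with hx | hx
    · exact le_add_right hx
    · refine le_add_left ?_
      nth_rw 1 [← ENNReal.rpow_one x]
      exact ENNReal.rpow_le_rpow_of_exponent_le hx one_le_two
  refine ne_top_of_le_ne_top ?_ (lintegral_mono fun s => hle _)
  rw [lintegral_add_left measurable_const, lintegral_const, Measure.restrict_apply_univ]
  exact ENNReal.add_ne_top.2 ⟨ENNReal.mul_ne_top (by simp) (by simp), h.2.ne⟩

theorem IsMildSolution.exists_ae_mildPath (hT : 0 < T)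
    (hη : IsMildSolution χ P T σ β K F ρ ξ η₀ η) : ∃ a₀ < β, ∀ a ≥ a₀, ∀ᵐ ω ∂P,
      MildPath χ T σ K F ρ a (η₀ ω) (fun t => noiseCoef ξ σ ρ t ω) fun t => η t ω := by
  obtain ⟨a₀, p, q, ha₀, hp, hq, hreg⟩ := hη.regular
  refine ⟨a₀, ha₀, fun a ha => ?_⟩
  -- The mild equation holds outside a null set depending on the time and the test function;
  -- countably many dyadic times and frequencies leave a single null set.
  have heq := (ae_ball_iff (countable_dyadicTime T)).2 fun t ht =>
    ae_all_iff.2 fun k => hη.coef_eq (dyadicTime_subset hT.le ht) k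
  filter_upwards [hreg, hη.continuous, heq] with ω h1 h2 h3
  have hc : ∀ k, ContinuousOn (fun t => (η t ω).coef k) (Icc 0 T) := fun k =>
    continuousOn_const.mul (h2 (fourierTest (-k)))
  exact ⟨hc, admPath_of_l2Besov ha hp hq (fun k => (hc k).aemeasurable measurableSet_Icc) h1, h3⟩

theorem aemeasurable_coef {u : Ω → Dist d} (hu : ∀ φ, AEMeasurable (fun ω => (u ω).toFun φ) P)
    (k : Fin d → ℤ) : AEMeasurable (fun ω => (u ω).coef k) P := (hu _).const_mul _

theorem IsMildSolution.continuousBesov_and_moments (hd : 0 < d) (hT : 0 < T) (hK : Periodic K)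
    (hK1 : Integrable K (torusMeasure d)) (hA4 : NonvanishingDiffusion χ T σ β K F ρ)
    (hξ : IsWhiteNoise P ξ) (hη : IsMildSolution χ P T σ β K F ρ ξ η₀ η) {r α : ℝ} {p q : ℝ≥0∞}
    (hr : 1 ≤ r) (hα : (d : ℝ) / 2 < α) (hαβ : α < β) (hp : 1 ≤ p) (hq : 1 ≤ q)
    (h₀ : MemLrBesov χ P r (-α) p q η₀) :
    (∀ᵐ ω ∂P, ContinuousBesov χ T (-α) p q fun t => η t ω) ∧
    AEMeasurable (fun ω => ⨆ t ∈ Icc 0 T, besovNorm χ (-α) p q (η t ω).coef ^ r) P ∧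
    ∫⁻ ω, (⨆ t ∈ Icc 0 T, besovNorm χ (-α) p q (η t ω).coef ^ r) ∂P < ∞ := by
  have hr0 : 0 < r := one_pos.trans_le hr
  have hβ : 0 < β := lt_of_le_of_lt (by positivity) hA4.beta_gt
  have hσ := hA4.sigma_pos
  obtain ⟨R, κ, hD⟩ := hA4.exists_driftData hT hβ hK hK1
  obtain ⟨L, hρ⟩ := hA4.exists_densityData
  obtain ⟨a₀, ha₀, hpath⟩ := hη.exists_ae_mildPath hT
  -- The auxiliary exponent must be at least `a₀`, for the path to be admissible, and at least `α`,
  -- for the Picard iterates to lie in the same weak space.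
  obtain ⟨A, hA⟩ := MildPath.exists_bound hD hd hα (le_max_right a₀ α) (max_lt ha₀ hαβ) hp hq
  set S : Ω → ℝ≥0∞ := fun ω => ∑' j, weight (-α) j * noiseSup χ ξ σ ρ T j ω with hS
  set N : Ω → ℝ≥0∞ := fun ω => besovNorm χ (-α) p q (η₀ ω).coef with hN
  have hSm : AEMeasurable S P := AEMeasurable.tsum fun j =>
    (aemeasurable_noiseSup hξ hρ hσ hT j).const_mul _
  have hNm : AEMeasurable N P := aemeasurable_besovNorm hp hq (aemeasurable_coef h₀.1)
  have hSr : ∫⁻ ω, S ω ^ r ∂P < ∞ := lintegral_noise_tsum_lt_top hξ hρ hσ hT hα χ hr0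
  have hfin : ∀ {f : Ω → ℝ≥0∞}, AEMeasurable f P → ∫⁻ ω, f ω ^ r ∂P < ∞ → ∀ᵐ ω ∂P, f ω ≠ ∞ := by
    intro f hf hfr
    filter_upwards [ae_lt_top' (hf.pow_const r) hfr.ne] with ω hω h
    rw [h, ENNReal.top_rpow_of_pos hr0] at hω
    exact lt_irrefl _ hω
  have hmain : ∀ᵐ ω ∂P, (ContinuousBesov χ T (-α) p q fun t => η t ω) ∧
      ∀ t ∈ Icc 0 T, besovNorm χ (-α) p q (η t ω).coef ≤ A * (N ω + S ω) := by
    filter_upwards [hpath _ (le_max_left a₀ α), h₀.2.1, hfin hNm h₀.2.2, hfin hSm hSr]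
      with ω h1 h2 h3 h4
    exact hA _ _ _ h1 h2 h3 h4
  refine ⟨hmain.mono fun ω h => h.1, ?_, ?_⟩
  -- By continuity the supremum over `[0, T]` agrees almost surely with the countable supremum over
  -- dyadic times, which is measurable.
  · have h1 : AEMeasurable (fun ω => ⨆ t ∈ dyadicTime T, besovNorm χ (-α) p q (η t ω).coef ^ r) P :=
      AEMeasurable.biSup _ (countable_dyadicTime T) fun t ht => (aemeasurable_besovNorm hp hq
        (aemeasurable_coef (hη.measurable t (dyadicTime_subset hT.le ht)))).pow_const r
    refine h1.congr (hmain.mono fun ω h => le_antisymm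
      (iSup₂_le fun t ht => le_iSup₂ (f := fun t (_ : t ∈ Icc 0 T) =>
        besovNorm χ (-α) p q (η t ω).coef ^ r) t (dyadicTime_subset hT.le ht))
      (iSup₂_le fun t ht => ?_))
    rw [← ENNReal.le_rpow_inv_iff hr0]
    refine h.1.le_of_dyadic hT hp hq (fun s hs => ?_) t ht
    rw [ENNReal.le_rpow_inv_iff hr0]
    exact le_iSup₂ (f := fun t (_ : t ∈ dyadicTime T) => besovNorm χ (-α) p q (η t ω).coef ^ r) s hs
  · calc _ ≤ ∫⁻ ω, A ^ r * (2 ^ (r - 1) * (N ω ^ r + S ω ^ r)) ∂P := by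
          refine lintegral_mono_ae (hmain.mono fun ω h => iSup₂_le fun t ht => ?_)
          refine (ENNReal.rpow_le_rpow (h.2 t ht) hr0.le).trans ?_
          rw [ENNReal.mul_rpow_of_nonneg _ _ hr0.le]
          exact mul_le_mul' le_rfl (ENNReal.rpow_add_le_mul_rpow_add_rpow _ _ hr)
      _ < ∞ := by
          rw [lintegral_const_mul' _ _ (ENNReal.rpow_ne_top_of_nonneg hr0.le (by simp)),
            lintegral_const_mul' _ _ (ENNReal.rpow_ne_top_of_nonneg (sub_nonneg.2 hr) (by simp)),
            lintegral_add_left' (hNm.pow_const r)]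
          exact ENNReal.mul_lt_top (ENNReal.rpow_lt_top_of_nonneg hr0.le (by simp))
            (ENNReal.mul_lt_top (ENNReal.rpow_lt_top_of_nonneg (sub_nonneg.2 hr) (by simp))
              (ENNReal.add_lt_top.2 ⟨h₀.2.2, hSr⟩))

/-- Continuity at any `-α ≥ -d/2` implies continuity at `-d/2`, so the critical exponent alone
yields one null set for all `α`. -/
theorem IsMildSolution.ae_not_continuousBesov (hd : 0 < d) (hT : 0 < T) (hK : Periodic K)
    (hK1 : Integrable K (torusMeasure d)) (hA4 : NonvanishingDiffusion χ T σ β K F ρ)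
    (hξ : IsWhiteNoise P ξ) (hη : IsMildSolution χ P T σ β K F ρ ξ η₀ η) :
    ∀ᵐ ω ∂P, ∀ α : ℝ, α ≤ (d : ℝ) / 2 → ¬ ContinuousBesov χ T (-α) ∞ ∞ fun t => η t ω := by
  have hβ : 0 < β := lt_of_le_of_lt (by positivity) hA4.beta_gt
  obtain ⟨R, κ, hD⟩ := hA4.exists_driftData hT hβ hK hK1
  obtain ⟨L, hρ⟩ := hA4.exists_densityData
  obtain ⟨a₀, -, hpath⟩ := hη.exists_ae_mildPath hT
  filter_upwards [hpath a₀ le_rfl, noiseCoef_zero_ae (ρ := ρ) hξ hA4.sigma_pos hT,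
    ae_not_tendsto_sum_noiseCoef hd hξ hρ hA4.sigma_pos hT] with ω h1 h2 h3 α hα hc
  exact h3 (tendsto_sum_box_sq hd (h1.tendsto_noise hD hd hA4.beta_gt h2
    (continuousBesov_mono (neg_le_neg hα) le_top hc)))

end Solution

end FluctuationSPDE

end

/-! ### Regularity, moments and optimality for mild solutions -/

open FluctuationSPDE in
theorem proposition3p10 {d : ℕ} (hd : 2 ≤ d) (χ : DyadicPartition d)
    {Ω : Type*} [MeasurableSpace Ω] (P : Measure Ω) [IsProbabilityMeasure P]
    (T σ β : ℝ) (hT : 0 < T) (K F : E d → E d) (ρ : ℝ → E d → ℝ)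
    (hK : Periodic K) (hK1 : Integrable K (torusMeasure d))
    (hA4 : NonvanishingDiffusion χ T σ β K F ρ)
    (ξ : NoiseSpace d → Ω → ℝ) (hξ : IsWhiteNoise P ξ)
    (η₀ : Ω → Dist d) (η : ℝ → Ω → Dist d)
    (hη : IsMildSolution χ P T σ β K F ρ ξ η₀ η) :
    -- regularity and moments in the space of the initial condition
    (∀ (r α : ℝ) (p q : ℝ≥0∞), 2 < r → (d : ℝ) / 2 < α → α < β → 1 ≤ p → 1 ≤ q →
      MemLrBesov χ P r (-α) p q η₀ →
      (∀ᵐ ω ∂P, ContinuousBesov χ T (-α) p q (fun t => η t ω)) ∧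
      AEMeasurable (fun ω => ⨆ t ∈ Icc 0 T, besovNorm χ (-α) p q (η t ω).coef ^ r) P ∧
      ∫⁻ ω, (⨆ t ∈ Icc 0 T, besovNorm χ (-α) p q (η t ω).coef ^ r) ∂P < ∞) ∧
    -- Hölder regularity of every order below `-d/2`
    ((∀ α : ℝ, (d : ℝ) / 2 < α → ∃ r : ℝ, 2 < r ∧ MemLrBesov χ P r (-α) ∞ ∞ η₀) →
      ∀ᵐ ω ∂P, ∀ α : ℝ, (d : ℝ) / 2 < α → ContinuousBesov χ T (-α) ∞ ∞ (fun t => η t ω)) ∧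
    -- optimality of this range
    (∀ᵐ ω ∂P, ∀ α : ℝ, α ≤ (d : ℝ) / 2 → ¬ ContinuousBesov χ T (-α) ∞ ∞ (fun t => η t ω)) := by
  have hd0 : 0 < d := by omega
  have h1 : ∀ (r α : ℝ) (p q : ℝ≥0∞), 2 < r → (d : ℝ) / 2 < α → α < β → 1 ≤ p → 1 ≤ q →
      MemLrBesov χ P r (-α) p q η₀ →
      (∀ᵐ ω ∂P, ContinuousBesov χ T (-α) p q (fun t => η t ω)) ∧
      AEMeasurable (fun ω => ⨆ t ∈ Icc 0 T, besovNorm χ (-α) p q (η t ω).coef ^ r) P ∧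
      ∫⁻ ω, (⨆ t ∈ Icc 0 T, besovNorm χ (-α) p q (η t ω).coef ^ r) ∂P < ∞ :=
    fun r α p q hr hα hαβ hp hq h₀ => hη.continuousBesov_and_moments hd0 hT hK hK1 hA4 hξ
      (by linarith) hα hαβ hp hq h₀
  refine ⟨h1, fun h₀ => ?_, hη.ae_not_continuousBesov hd0 hT hK hK1 hA4 hξ⟩
  have hε : 0 < β - d / 2 := sub_pos.2 hA4.beta_gt
  -- These countably many exponents decrease to `d/2` and stay strictly below `β`, for which `n + 2`
  -- rather than `n + 1` is needed at `n = 0`. Monotonicity in the regularity then covers every `α >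
  -- d/2`, including `α ≥ β`.
  have h2 : ∀ n : ℕ, ∀ᵐ ω ∂P,
      ContinuousBesov χ T (-((d : ℝ) / 2 + (β - d / 2) / (n + 2))) ∞ ∞ fun t => η t ω := by
    intro n
    have hα : (d : ℝ) / 2 < d / 2 + (β - d / 2) / (n + 2) := by
      have : 0 < (β - d / 2) / (n + 2) := by positivity
      linarith
    have hαβ : (d : ℝ) / 2 + (β - d / 2) / (n + 2) < β := by
      have : (β - d / 2) / (n + 2) < β - d / 2 := div_lt_self hε (by linarith [n.cast_nonneg (α := ℝ)])
      linarith
    obtain ⟨r, hr, hm⟩ := h₀ _ hα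
    exact (h1 r _ ∞ ∞ hr hα hαβ le_top le_top hm).1
  filter_upwards [ae_all_iff.2 h2] with ω hω α hα
  obtain ⟨n, hn⟩ := exists_nat_gt ((β - d / 2) / (α - d / 2))
  refine continuousBesov_mono (neg_le_neg ?_) le_top (hω n)
  have hα' : 0 < α - d / 2 := sub_pos.2 hα
  have h3 : (β - d / 2) / (n + 2) ≤ α - d / 2 := by
    rw [div_lt_iff₀ hα'] at hn
    rw [div_le_iff₀ (by positivity)]
    nlinarith
  linarith
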